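/- \textbf{Setting.} Let $\Omega\subset\mathbb R^2$ be a bounded plane domain whose boundary is one simple closed $C^\infty$ curve of length $2\pi$, parametrized counter-clockwise by arc length by $q:\mathbf T=\mathbb R/2\pi\mathbb Z\to\partial\Omega$, with inward unit normal $\nu$. The billiard map $\beta$ sends $(\phi,\eta)$, $|\eta|<1$, to $(\phi',\eta')$, where $q(\phi')$ is the first boundary point on the ray from $q(\phi)$ in the inward unit direction $v$ with tangential component $\eta$, and $\eta'=v\cdot q'(\phi')$. Let $\gamma$ be a bouncing ball orbit of $\Omega$ with end points $q(0),q(b)$, so that $\partial\gamma=\{(0,0),(b,0)\}$ is a period-two orbit of $\beta$. For $k\ge 1$ let $\lambda=k+i\tau(k)$ with $0\le\tau(k)\le T(1+\log k)$ for a constant $T$ (for instance $\tau$ constant, or $\tau(k)=\tau_0\log k$). Let $G_0(\lambda,x,y)=\frac i4H^{(1)}_0(\lambda|x-y|)$ and let $N(\lambda)$ be the operator on $\partial\Omega$ with kernel $N(\lambda,\phi_1,\phi_2)=2\,\partial_{\nu_y}G_0(\lambda,q(\phi_1),y)|_{y=q(\phi_2)}$. Let $\frac12<\delta<1$, let $\chi$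 be a smooth bump function supported in $[-1,1]$ and equal to $1$ on $[-\frac12,\frac12]$, and write $N=N_0+N_1$, where $N_0$ and $N_1$ have the kernels $$\chi(k^{1-\delta}|q(\phi_1)-q(\phi_2)|)\,N(\lambda,\phi_1,\phi_2),\qquad \bigl(1-\chi(k^{1-\delta}|q(\phi_1)-q(\phi_2)|)\bigr)N(\lambda,\phi_1,\phi_2).$$ For $\sigma:\{1,\dots,M\}\to\{0,1\}$ put $N_\sigma=N_{\sigma(1)}\circ\cdots\circ N_{\sigma(M)}$ and $|\sigma|=\#\sigma^{-1}(0)$. Let $\chi_{\partial\gamma}(k)=c(\phi,k^{-1}D_\phi)$, where $c\in C_0^\infty(T^*\mathbf T)$ is supported in the $\varepsilon$-neighbourhood $\{|\eta|\le\varepsilon,\ |\phi|\le\varepsilon\text{ or }|\phi-b|\le\varepsilon\}$ ($\phi$ modulo $2\pi$) of $\partial\gamma$. \textbf{Terminology.} $S^p_\delta(\mathbf T^d)$ is the class of $k$-dependent smooth functions on $\mathbf T^d$ with $|(k^{-1}D)^\alpha a|\le C_\alpha k^{p-\delta|\alpha|}$ for $k\ge1$. A \emph{semiclassical Fourier integral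 kernel of order $p$ with phase $\psi$ associated to a canonical relation $\Lambda$} is a kernel $$F(k,\phi_1,\phi_2)=k^{p+\frac{n+1}2}\int_{\mathbf T^n}e^{i\lambda\psi(\phi_1,\theta,\phi_2)}A(k,\phi_1,\theta,\phi_2)\,d\theta,\qquad A\in S^0_\delta(\mathbf T^{n+2}),$$ such that on some closed set containing the supports of all $A(k,\cdot)$ the function $\psi$ is a smooth nondegenerate phase function (at points with $\partial_\theta\psi=0$ the differentials $d(\partial_{\theta_j}\psi)$ are linearly independent), and every such critical point gives a point $((\phi_1,\partial_{\phi_1}\psi),(\phi_2,-\partial_{\phi_2}\psi))\in\Lambda$. A \emph{semiclassical pseudodifferential operator of order $p$} is an operator $k^{p}a(k,\phi,k^{-1}D_\phi)$ on $\mathbf T$ (mapping $e^{in\phi}$ to $k^pa(k,\phi,n/k)e^{in\phi}$), with $a$ smooth on $T^*\mathbf T$, all derivatives bounded uniformly in $k\ge 1$, and the support in $\eta$ bounded uniformly in $k$. For $k$-dependent kernels, $K\sim K'$ means $\sup_{\phi_1,\phi_2}|K-K'|=O(k^{-R})$ for every $R$. \textbf{Proposition.} For every $M$ there is $\varepsilon>0$,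 depending only on $\Omega,\gamma,M$, such that the following hold for all $\chi_{\partial\gamma}$, $\chi$, $\delta$, $\tau$ as above. (A) Suppose that the straight line containing $\gamma$ meets $\partial\Omega$ only at the two end points of $\gamma$ (as is automatic when $\Omega$ is convex). If $N_\sigma$ is not $N_0^M$, there is a semiclassical Fourier integral kernel $F_\sigma$ of order $-|\sigma|$ associated to the graph of $\beta^{M-|\sigma|}$, with phase the length functional $|q(\phi_1)-q(\theta_1)|+|q(\theta_1)-q(\theta_2)|+\cdots+|q(\theta_n)-q(\phi_2)|$, $n=M-|\sigma|-1$, such that for every integer $R\ge 0$ $$N_\sigma\circ\chi_{\partial\gamma}=F_\sigma+K_R,\qquad |K_R(k,\phi_1,\phi_2)|\le C_Rk^{-R}\quad(k\ge1).$$ (B) There is a semiclassical pseudodifferential operator $N_{0M}$ of order $-M$ with $N_0^M\circ\chi_{\partial\gamma}\sim N_{0M}\circ\chi_{\partial\gamma}$. Moreover $N_0^M\circ\chi_{\partial\gamma}$ itself agrees, in the sense of $\sim$, with a semiclassical pseudodifferential operator of order $-M$. -/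

import Mathlib

noncomputable section

namespace Billiard

/-! Plane domains and the billiard map. The plane is `ℂ`, with real inner product `inner ℝ`. -/

/-- `Ω` is a bounded plane domain whose boundary is one smooth closed curve of length `2π`,
parametrised counter-clockwise by arc length by the `2π`-periodic map `q`.  (`Ω` is then
simply connected, by the Jordan curve theorem.) -/
structure IsSmoothDomain (Ω : Set ℂ) (q : ℝ → ℂ) : Prop where
  isOpen : IsOpen Ω
  isConnected : IsConnected Ω
  isBounded : Bornology.IsBounded Ω
  frontier_eq : frontier Ω = Set.range q
  smooth : ContDiff ℝ (⊤ : ℕ∞) q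
  periodic : Function.Periodic q (2 * Real.pi)
  arclength : ∀ φ, ‖deriv q φ‖ = 1
  injOn : Set.InjOn q (Set.Ico 0 (2 * Real.pi))
  counterclockwise : ∀ φ, ∃ r > 0, ∀ t : ℝ, 0 < t → t < r →
    q φ + (t : ℂ) * (Complex.I * deriv q φ) ∈ Ω

/-- The inward unit normal at `q φ` (for a counter-clockwise arc length parametrisation). -/
def normal (q : ℝ → ℂ) (φ : ℝ) : ℂ := Complex.I * deriv q φ

/-- The inward unit vector at `q φ` with tangential component `η`, for `|η| < 1`. -/
def direction (q : ℝ → ℂ) (z : ℝ × ℝ) : ℂ :=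
  (z.2 : ℂ) * deriv q z.1 + (Real.sqrt (1 - z.2 ^ 2) : ℂ) * normal q z.1

/-- The graph of the billiard map `β` on `B^*∂Ω`: `β (φ, η) = (φ', η')`.  A point `(φ, η)` with
`|η| < 1` determines an inward unit vector `v` at `q φ`; the ray in the direction `v` runs in
`Ω` until it first meets the boundary at `q φ'`, and `η'` is the tangential component of `v`
there.  The variables `φ`, `φ'` are real representatives of points of the circle. -/
def BilliardMap (Ω : Set ℂ) (q : ℝ → ℂ) (z w : ℝ × ℝ) : Prop :=
  |z.2| < 1 ∧
  (∃ t : ℝ, 0 < t ∧ q w.1 = q z.1 + (t : ℂ) * direction q z ∧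
    ∀ s : ℝ, 0 < s → s < t → q z.1 + (s : ℂ) * direction q z ∈ Ω) ∧
  w.2 = inner ℝ (direction q z) (deriv q w.1)

/-- The graph of the iterate `β ^ m`: `β ^ m z = w`. -/
def BilliardIterate (Ω : Set ℂ) (q : ℝ → ℂ) : ℕ → ℝ × ℝ → ℝ × ℝ → Prop
  | 0, z, w => w = z
  | m + 1, z, w => ∃ y, BilliardIterate Ω q m z y ∧ BilliardMap Ω q y w

/-- The canonical relation `{(β ^ m z, z)}` of `β ^ m` (output first). -/
def billiardRelation (Ω : Set ℂ) (q : ℝ → ℂ) (m : ℕ) : Set ((ℝ × ℝ) × (ℝ × ℝ)) :=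
  {p | BilliardIterate Ω q m p.2 p.1}

/-- The segment from `q 0` to `q b` is a bouncing ball orbit: `{(0,0), (b,0)}` is a periodic
orbit of period two of the billiard map. -/
def IsBouncingBall (Ω : Set ℂ) (q : ℝ → ℂ) (b : ℝ) : Prop :=
  BilliardMap Ω q (0, 0) (b, 0) ∧ BilliardMap Ω q (b, 0) (0, 0)

/-- The full straight line through `q 0` and `q b` meets the boundary curve only at these two
points (which is automatic for convex domains). -/
def NoGhost (q : ℝ → ℂ) (b : ℝ) : Prop :=
  ∀ φ t : ℝ, q φ = q 0 + (t : ℂ) * (q b - q 0) → q φ = q 0 ∨ q φ = q b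

/-- The closed `ε`-neighbourhood in phase space of the periodic orbit `{(0,0), (b,0)}`; the
first variable is taken modulo `2π`. -/
def orbitNhd (b ε : ℝ) : Set (ℝ × ℝ) :=
  {z | |z.2| ≤ ε ∧ ∃ n : ℤ, |z.1 - 2 * Real.pi * n| ≤ ε ∨ |z.1 - b - 2 * Real.pi * n| ≤ ε}

/-! The boundary integral operator. -/

/-- The Hankel function `H^{(1)}_ν (z)`, for `ν > -1/2` and `Re z > 0`. -/
def hankel (ν : ℝ) (z : ℂ) : ℂ :=
  (2 / (Real.pi * z)) ^ (1 / 2 : ℂ) *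
    Complex.exp (Complex.I * (z - Real.pi * ν / 2 - Real.pi / 4)) / (Real.Gamma (ν + 1 / 2) : ℂ) *
    ∫ s in Set.Ioi (0 : ℝ), ((Real.exp (-s) * s ^ (ν - 1 / 2) : ℝ) : ℂ) *
      (1 + Complex.I * s / (2 * z)) ^ ((ν - 1 / 2 : ℝ) : ℂ)

/-- The free Green's function of the plane, the kernel of `-(Δ + lam ^ 2)⁻¹`. -/
def freeGreen (lam : ℂ) (x y : ℂ) : ℂ :=
  Complex.I / 4 * hankel 0 (lam * (‖x - y‖ : ℂ))

/-- The kernel `2 ∂_{ν_y} G₀(lam, q φ, y)` at `y = q φ'` of the boundary operator `N(lam)`. -/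
def kernelN (q : ℝ → ℂ) (lam : ℂ) (φ φ' : ℝ) : ℂ :=
  2 * lineDeriv ℝ (fun y : ℂ => freeGreen lam (q φ) y) (q φ') (normal q φ')

/-- A smooth bump function, supported in `[-1,1]` and equal to one on `[-1/2,1/2]`. -/
structure IsBump (χ : ℝ → ℝ) : Prop where
  smooth : ContDiff ℝ (⊤ : ℕ∞) χ
  eq_zero : ∀ x, 1 < |x| → χ x = 0
  eq_one : ∀ x, |x| ≤ 1 / 2 → χ x = 1

/-- The kernels of `N₀` (index `0`, near the diagonal) and `N₁` (index `1`, away from it), with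
`N = N₀ + N₁`, at the semiclassical parameter `k` and the spectral parameter `lam`. -/
def kernelSplit (q : ℝ → ℂ) (χ : ℝ → ℝ) (δ k : ℝ) (lam : ℂ) (i : Fin 2) (φ φ' : ℝ) : ℂ :=
  (if i = 0 then (χ (k ^ (1 - δ) * ‖q φ - q φ'‖) : ℂ)
    else 1 - (χ (k ^ (1 - δ) * ‖q φ - q φ'‖) : ℂ)) * kernelN q lam φ φ'

/-- Composition of kernels on the circle. -/
def compKernel (K K' : ℝ → ℝ → ℂ) (φ₁ φ₂ : ℝ) : ℂ :=
  ∫ θ in (0 : ℝ)..(2 * Real.pi), K φ₁ θ * K' θ φ₂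

/-- The kernel of `N_{σ(1)} ∘ ⋯ ∘ N_{σ(M)} ∘ X`, where `X` has the kernel `K`. -/
def kernelWord (q : ℝ → ℂ) (χ : ℝ → ℝ) (δ k : ℝ) (lam : ℂ) {M : ℕ} (σ : Fin M → Fin 2)
    (K : ℝ → ℝ → ℂ) : ℝ → ℝ → ℂ :=
  (List.ofFn fun j => kernelSplit q χ δ k lam (σ j)).foldr compKernel K

/-- `|σ|`, the number of factors `N₀`. -/
def zeroCount {M : ℕ} (σ : Fin M → Fin 2) : ℕ :=
  (Finset.univ.filter fun j => σ j = 0).card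

/-! Semiclassical kernels on the circle. Functions on a torus are functions of real variables
that are `2π`-periodic in each of them. -/

/-- A `k`-dependent kernel that is uniformly `O(k^{-R})` for `k ≥ 1`. -/
def IsBigOKernel (R : ℕ) (K : ℝ → ℝ → ℝ → ℂ) : Prop :=
  ∃ C : ℝ, ∀ k : ℝ, 1 ≤ k → ∀ φ₁ φ₂ : ℝ, ‖K k φ₁ φ₂‖ ≤ C * k ^ (-(R : ℝ))

/-- Two `k`-dependent kernels agree up to `O(k^{-∞})`. -/
def KernelEquiv (K K' : ℝ → ℝ → ℝ → ℂ) : Prop :=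
  ∀ R : ℕ, IsBigOKernel R fun k φ₁ φ₂ => K k φ₁ φ₂ - K' k φ₁ φ₂

/-- The kernel of the operator `a(φ, k⁻¹ D_φ)` on the circle, `D_φ = -i d/dφ`: it maps
`e^{inφ}` to `a(φ, n/k) e^{inφ}`.  By Poisson summation this is the `2π`-periodisation of
`(k/2π) ∫ e^{ik(φ-θ)η} a(φ, η) dη`. -/
def quantize (k : ℝ) (a : ℝ × ℝ → ℂ) (φ θ : ℝ) : ℂ :=
  (1 / (2 * Real.pi) : ℂ) *
    ∑' n : ℤ, a (φ, n / k) * Complex.exp (Complex.I * n * (φ - θ))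

/-- `K` is the kernel of a semiclassical pseudodifferential operator of order `p`:
`K = k ^ p a(k, φ, k⁻¹ D_φ)` for a symbol `a` on `T^*𝐓`, all of whose derivatives are bounded
uniformly in `k`, and whose support in the fibre variable is bounded uniformly in `k`. -/
def IsPseudodifferential (p : ℝ) (K : ℝ → ℝ → ℝ → ℂ) : Prop :=
  ∃ a : ℝ → ℝ × ℝ → ℂ,
    (∀ k, 1 ≤ k → ContDiff ℝ (⊤ : ℕ∞) (a k)) ∧
    (∀ k, 1 ≤ k → ∀ φ η, a k (φ + 2 * Real.pi, η) = a k (φ, η)) ∧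
    (∃ ρ : ℝ, ∀ k, 1 ≤ k → ∀ φ η, ρ < |η| → a k (φ, η) = 0) ∧
    (∀ j : ℕ, ∃ C : ℝ, ∀ k, 1 ≤ k → ∀ z, ‖iteratedFDeriv ℝ j (a k) z‖ ≤ C) ∧
    ∀ k, 1 ≤ k → ∀ φ θ, K k φ θ = (k ^ p : ℝ) * quantize k (a k) φ θ

/-- `2π`-periodicity in each of the variables `x i`. -/
def TorusPeriodic {d : ℕ} {α : Type*} (f : (Fin d → ℝ) → α) : Prop :=
  ∀ x i, f (Function.update x i (x i + 2 * Real.pi)) = f x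

/-- The symbol class `S^p_δ(𝐓^d)`: `|(k⁻¹ D)^α a| ≤ C_α k^{p - δ |α|}` for `k ≥ 1`. -/
def IsSymbol (δ p : ℝ) {d : ℕ} (a : ℝ → (Fin d → ℝ) → ℂ) : Prop :=
  (∀ k, 1 ≤ k → ContDiff ℝ (⊤ : ℕ∞) (a k) ∧ TorusPeriodic (a k)) ∧
  ∀ j : ℕ, ∃ C : ℝ, ∀ k : ℝ, 1 ≤ k → ∀ x,
    k ^ (-(j : ℝ)) * ‖iteratedFDeriv ℝ j (a k) x‖ ≤ C * k ^ (p - δ * j)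

/-- The point `(φ₁, θ₁, …, θ_n, φ₂)` of `ℝ^{n+2}`. -/
def joinPoint {n : ℕ} (φ₁ : ℝ) (θ : Fin n → ℝ) (φ₂ : ℝ) : Fin (n + 2) → ℝ :=
  Fin.cons (α := fun _ => ℝ) φ₁ (Fin.snoc (α := fun _ => ℝ) θ φ₂)

/-- The partial derivative of `ψ` with respect to the variable with index `i`. -/
def partialDeriv {d : ℕ} (ψ : (Fin d → ℝ) → ℝ) (i : Fin d) (x : Fin d → ℝ) : ℝ :=
  fderiv ℝ ψ x (Pi.single i 1)

/-- The derivative with respect to the `j`th phase variable `θ_j` of a function of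
`(φ₁, θ₁, …, θ_n, φ₂)`. -/
def phaseDeriv {n : ℕ} (ψ : (Fin (n + 2) → ℝ) → ℝ) (j : Fin n) : (Fin (n + 2) → ℝ) → ℝ :=
  partialDeriv ψ j.castSucc.succ

/-- `F` is a semiclassical Fourier integral kernel on the circle of order `p`, with the phase
function `ψ(φ₁, θ, φ₂)`, associated to the canonical relation `Λ`:
`F = k^{p + (n+1)/2} ∫ e^{i lam(k) ψ(φ₁, θ, φ₂)} A(k, φ₁, θ, φ₂) dθ`, `θ ∈ 𝐓^n`,
where `A ∈ S^0_δ`, and where, on a closed set `S` that contains the supports of all `A(k, ·)`,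
`ψ` is a (smooth) nondegenerate phase function, whose critical points
(`∂_θ ψ = 0`) give points `((φ₁, ∂_{φ₁} ψ), (φ₂, -∂_{φ₂} ψ))` of `Λ`. -/
def IsFourierIntegralKernel (δ : ℝ) (lam : ℝ → ℂ) {n : ℕ} (ψ : (Fin (n + 2) → ℝ) → ℝ)
    (Λ : Set ((ℝ × ℝ) × (ℝ × ℝ))) (p : ℝ) (F : ℝ → ℝ → ℝ → ℂ) : Prop :=
  TorusPeriodic ψ ∧
  ∃ (S : Set (Fin (n + 2) → ℝ)) (A : ℝ → (Fin (n + 2) → ℝ) → ℂ),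
    IsClosed S ∧
    (∀ x ∈ S, ContDiffAt ℝ (⊤ : ℕ∞) ψ x) ∧
    (∀ x ∈ S, (∀ j, phaseDeriv ψ j x = 0) →
      LinearIndependent ℝ (fun j : Fin n => fderiv ℝ (phaseDeriv ψ j) x) ∧
      ((x 0, partialDeriv ψ 0 x),
        (x (Fin.last (n + 1)), -partialDeriv ψ (Fin.last (n + 1)) x)) ∈ Λ) ∧
    IsSymbol δ 0 A ∧
    (∀ k, 1 ≤ k → ∀ x, x ∉ S → A k x = 0) ∧
    ∀ k, 1 ≤ k → ∀ φ₁ φ₂, F k φ₁ φ₂ = (k ^ (p + ((n : ℝ) + 1) / 2) : ℝ) *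
      ∫ θ in Set.Icc (0 : Fin n → ℝ) (fun _ => 2 * Real.pi),
        Complex.exp (Complex.I * lam k * ψ (joinPoint φ₁ θ φ₂)) * A k (joinPoint φ₁ θ φ₂)

/-- The length `|q(x₀) - q(x₁)| + ⋯ + |q(x_n) - q(x_{n+1})|` of a polygonal path with `n + 1`
links and vertices on the boundary. -/
def pathLength (q : ℝ → ℂ) (n : ℕ) (x : Fin (n + 2) → ℝ) : ℝ :=
  ∑ j : Fin (n + 1), ‖q (x j.castSucc) - q (x j.succ)‖

/-- A smooth symbol on `T^*𝐓` supported in the `ε`-neighbourhood of the orbit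
`{(0,0), (b,0)}`; its quantisation is the microlocal cutoff `χ_{∂γ}(k)`. -/
structure IsOrbitCutoff (b ε : ℝ) (c : ℝ × ℝ → ℂ) : Prop where
  smooth : ContDiff ℝ (⊤ : ℕ∞) c
  periodic : ∀ φ η, c (φ + 2 * Real.pi, η) = c (φ, η)
  support : ∀ z, c z ≠ 0 → z ∈ orbitNhd b ε

end Billiard

end

noncomputable section

namespace Billiard

open scoped ContDiff Topology Real
open MeasureTheory Set Filter
open Complex (I exp norm_real ofReal_zero exp_add real_smul ofRealCLM ofReal_mul normSq ofReal_one
  continuous_ofReal norm_I contDiff_exp norm_exp mul_conj norm_of_nonneg norm_ofNat)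
open Real (pi_pos two_pi_pos rpow_add pi_gt_three norm_eq_abs rpow_one rpow_pos_of_pos rpow_neg
  rpow_le_rpow_of_exponent_le rpow_natCast smoothTransition Gamma)
open Finset (mul_sum sum_congr sum_nonneg single_le_sum sum_le_sum sum_mul sum_eq_single)
open Function (Periodic comp_def)
open ContinuousLinearMap (fst snd proj)
open Nat (even_add_one even_or_odd)
open intervalIntegral (integral_of_le norm_integral_le_of_norm_le_const)
open intervalIntegral renaming integral_const_mul → int_const_mul, integral_add → int_add,
  integral_finsetSum → int_sum, integral_mul_const → int_mul_const, integral_congr → int_congr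

local notation "vcons" => Fin.cons (α := fun _ => ℝ)
local notation "vsnoc" => Fin.snoc (α := fun _ => ℝ)
local notation "ℝ₁" => Ici (1 : ℝ)
local notation "𝐃" => iteratedFDeriv ℝ
local notation "Smooth" => ContDiff ℝ ∞
local notation "𝕋" n:max => Icc (0 : Fin n → ℝ) fun _ => 2 * π

/-! ### Families of smooth functions with uniformly bounded derivatives -/

section Families

variable {ι κ : Type*} {E E' F G : Type*} [NormedAddCommGroup E] [NormedSpace ℝ E]
  [NormedAddCommGroup E'] [NormedSpace ℝ E']
  [NormedAddCommGroup F] [NormedSpace ℝ F] [NormedAddCommGroup G] [NormedSpace ℝ G]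

/-- A family of smooth functions, all of whose derivatives are bounded uniformly by a constant
multiple of the weight. -/
structure UB (w : ι → ℝ) (f : ι → E → F) : Prop where
  nonneg : ∀ i, 0 ≤ w i
  smooth : ∀ i, Smooth (f i)
  bound : ∀ j : ℕ, ∃ C, 0 ≤ C ∧ ∀ i x, ‖𝐃 j (f i) x‖ ≤ C * w i

/-- A family of smooth functions, all of whose derivatives of positive order are uniformly
bounded. -/
structure UB₁ (f : ι → E → F) : Prop where
  smooth : ∀ i, Smooth (f i)
  bound : ∀ j : ℕ, 1 ≤ j → ∃ C, 0 ≤ C ∧ ∀ i x, ‖𝐃 j (f i) x‖ ≤ C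

lemma UB.of_bound {w : ι → ℝ} {f : ι → E → F} (hw : ∀ i, 0 ≤ w i) (hf : ∀ i, Smooth (f i))
    (h : ∀ j : ℕ, ∃ C, ∀ i x, ‖𝐃 j (f i) x‖ ≤ C * w i) : UB w f :=
  ⟨hw, hf, fun j => (h j).imp' (fun C => max C 0) fun C hC => ⟨le_max_right _ _, fun i x =>
    (hC i x).trans (mul_le_mul_of_nonneg_right (le_max_left _ _) (hw i))⟩⟩

lemma UB.norm_le {w : ι → ℝ} {f : ι → E → F} (h : UB w f) :
    ∃ C, 0 ≤ C ∧ ∀ i x, ‖f i x‖ ≤ C * w i := by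
  obtain ⟨C, hC, h⟩ := h.bound 0
  exact ⟨C, hC, fun i x => by simpa using h i x⟩

/-- A common bound for the derivatives of order at most `n`. -/
lemma UB.bound_le {w : ι → ℝ} {f : ι → E → F} (h : UB w f) (n : ℕ) :
    ∃ C, 0 ≤ C ∧ ∀ j ≤ n, ∀ i x, ‖𝐃 j (f i) x‖ ≤ C * w i := by
  choose C hC hb using h.bound
  refine ⟨∑ j ∈ Finset.range (n + 1), C j, sum_nonneg fun j _ => hC j,
    fun j hj i x => (hb j i x).trans ?_⟩
  exact mul_le_mul_of_nonneg_right (single_le_sum (f := C) (fun j _ => hC j)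
    (Finset.mem_range.2 (by omega))) (h.nonneg i)

lemma UB₁.bound_pow {f : ι → E → F} (h : UB₁ f) (n : ℕ) :
    ∃ D, 1 ≤ D ∧ ∀ j, 1 ≤ j → j ≤ n → ∀ i x, ‖𝐃 j (f i) x‖ ≤ D ^ j := by
  have : ∀ j, ∃ C, 0 ≤ C ∧ (1 ≤ j → ∀ i x, ‖𝐃 j (f i) x‖ ≤ C) := fun j => by
    by_cases hj : 1 ≤ j
    · obtain ⟨C, h0, h⟩ := h.bound j hj
      exact ⟨C, h0, fun _ => h⟩
    · exact ⟨0, le_rfl, fun h => absurd h hj⟩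
  choose C hC hb using this
  have hs : 0 ≤ ∑ j ∈ Finset.range (n + 1), C j := sum_nonneg fun j _ => hC j
  refine ⟨1 + ∑ j ∈ Finset.range (n + 1), C j, by linarith,
    fun j hj hn i x => (hb j hj i x).trans ?_⟩
  have h1 : C j ≤ ∑ j ∈ Finset.range (n + 1), C j :=
    single_le_sum (f := C) (fun j _ => hC j) (Finset.mem_range.2 (by omega))
  calc C j ≤ (1 + ∑ j ∈ Finset.range (n + 1), C j) ^ 1 := by linarith
    _ ≤ _ := pow_le_pow_right₀ (by linarith) hj

lemma UB.mono {w w' : ι → ℝ} {f : ι → E → F} (h : UB w f) {C : ℝ} (hC : 0 ≤ C)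
    (hw' : ∀ i, 0 ≤ w' i) (hw : ∀ i, w i ≤ C * w' i) : UB w' f :=
  .of_bound hw' h.smooth fun j => by
    obtain ⟨D, hD, h⟩ := h.bound j
    exact ⟨D * C, fun i x => (h i x).trans
      ((mul_le_mul_of_nonneg_left (hw i) hD).trans_eq (mul_assoc _ _ _).symm)⟩

lemma UB.reindex {w : ι → ℝ} {f : ι → E → F} (h : UB w f) (g : κ → ι) :
    UB (fun i => w (g i)) (fun i => f (g i)) :=
  ⟨fun i => h.nonneg _, fun i => h.smooth _, fun j =>
    (h.bound j).imp fun C hC => ⟨hC.1, fun i => hC.2 _⟩⟩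

lemma UB.ub₁ {f : ι → E → F} (h : UB (fun _ => 1) f) : UB₁ f := ⟨h.smooth, fun j _ => by
    obtain ⟨C, h0, h⟩ := h.bound j
    exact ⟨C, h0, fun i x => by simpa using h i x⟩⟩

lemma UB.const (c : ι → F) {C : ℝ} (hC : ∀ i, ‖c i‖ ≤ C) : UB (fun _ => 1) (fun i (_ : E) => c i) :=
  .of_bound (fun _ => zero_le_one) (fun i => contDiff_const) fun j => by
    refine ⟨max C 0, fun i x => ?_⟩
    rcases Nat.eq_zero_or_pos j with rfl | hj
    · simpa using Or.inl (hC i)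
    · rw [iteratedFDeriv_const_of_ne (by omega)]; simp

lemma UB.add {w : ι → ℝ} {f g : ι → E → F} (hf : UB w f) (hg : UB w g) :
    UB w (fun i x => f i x + g i x) :=
  .of_bound hf.nonneg (fun i => (hf.smooth i).add (hg.smooth i)) fun j => by
    obtain ⟨C, _, hC⟩ := hf.bound j
    obtain ⟨D, _, hD⟩ := hg.bound j
    refine ⟨C + D, fun i x => ?_⟩
    rw [fun_iteratedFDeriv_add_apply ((hf.smooth i).contDiffAt.of_le (by exact_mod_cast le_top))
      ((hg.smooth i).contDiffAt.of_le (by exact_mod_cast le_top)), add_mul]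
    exact (norm_add_le _ _).trans (add_le_add (hC i x) (hD i x))

lemma UB₁.add {f g : ι → E → F} (hf : UB₁ f) (hg : UB₁ g) : UB₁ (fun i x => f i x + g i x) :=
  ⟨fun i => (hf.smooth i).add (hg.smooth i), fun j hj => by
    obtain ⟨C, h0, hC⟩ := hf.bound j hj
    obtain ⟨D, h1, hD⟩ := hg.bound j hj
    refine ⟨C + D, add_nonneg h0 h1, fun i x => ?_⟩
    rw [fun_iteratedFDeriv_add_apply ((hf.smooth i).contDiffAt.of_le (by exact_mod_cast le_top))
      ((hg.smooth i).contDiffAt.of_le (by exact_mod_cast le_top))]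
    exact (norm_add_le _ _).trans (add_le_add (hC i x) (hD i x))⟩

lemma UB.clm {w : ι → ℝ} {f : ι → E → F} (hf : UB w f) (L : F →L[ℝ] G) :
    UB w (fun i x => L (f i x)) :=
  .of_bound hf.nonneg (fun i => L.contDiff.comp (hf.smooth i)) fun j => by
    obtain ⟨C, _, hC⟩ := hf.bound j
    refine ⟨‖L‖ * C, fun i x => ?_⟩
    refine (L.norm_iteratedFDeriv_comp_left (f := f i) ((hf.smooth i).contDiffAt (x := x))
      (n := j) (by exact_mod_cast le_top)).trans ?_
    rw [mul_assoc]
    exact mul_le_mul_of_nonneg_left (hC i x) (norm_nonneg _)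

lemma UB.neg {w : ι → ℝ} {f : ι → E → F} (hf : UB w f) : UB w (fun i x => -f i x) :=
  hf.clm (-ContinuousLinearMap.id ℝ F)

lemma UB.sub {w : ι → ℝ} {f g : ι → E → F} (hf : UB w f) (hg : UB w g) :
    UB w (fun i x => f i x - g i x) := by
  simpa only [sub_eq_add_neg] using hf.add hg.neg

lemma UB.bilin {w w' : ι → ℝ} {f : ι → E → F} {g : ι → E → E'} (B : F →L[ℝ] E' →L[ℝ] G)
    (hf : UB w f) (hg : UB w' g) : UB (fun i => w i * w' i) (fun i x => B (f i x) (g i x)) :=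
  .of_bound (fun i => mul_nonneg (hf.nonneg i) (hg.nonneg i))
    (fun i => B.isBoundedBilinearMap.contDiff.comp ((hf.smooth i).prodMk (hg.smooth i)))
    fun j => by
    obtain ⟨C, h0, hC⟩ := hf.bound_le j
    obtain ⟨D, h1, hD⟩ := hg.bound_le j
    refine ⟨‖B‖ * ∑ m ∈ Finset.range (j + 1), (j.choose m : ℝ) * C * D, fun i x => ?_⟩
    refine (B.norm_iteratedFDeriv_le_of_bilinear (hf.smooth i) (hg.smooth i) x (n := j)
      (by exact_mod_cast le_top)).trans ?_
    rw [mul_assoc, sum_mul]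
    refine mul_le_mul_of_nonneg_left (sum_le_sum fun m hm => ?_) (norm_nonneg B)
    have hm' : m ≤ j := by have := Finset.mem_range.1 hm; omega
    calc _ ≤ (j.choose m : ℝ) * (C * w i) * (D * w' i) := by
          gcongr
          · exact mul_nonneg (by positivity) (mul_nonneg h0 (hf.nonneg i))
          · exact hC m hm' i x
          · exact hD _ (Nat.sub_le _ _) i x
      _ = _ := by ring

lemma UB.mul {A : Type*} [NormedRing A] [NormedAlgebra ℝ A] {w w' : ι → ℝ} {f g : ι → E → A}
    (hf : UB w f) (hg : UB w' g) : UB (fun i => w i * w' i) (fun i x => f i x * g i x) :=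
  hf.bilin (ContinuousLinearMap.mul ℝ A) hg

lemma UB.mul_bdd {A : Type*} [NormedRing A] [NormedAlgebra ℝ A] {w : ι → ℝ} {f g : ι → E → A}
    (hf : UB w f) (hg : UB (fun _ => 1) g) : UB w (fun i x => f i x * g i x) := by
  simpa using hf.mul hg

lemma UB.const_mul {A : Type*} [NormedRing A] [NormedAlgebra ℝ A] {w : ι → ℝ} {f : ι → E → A}
    (hf : UB w f) (c : ι → A) : UB (fun i => ‖c i‖ * w i) (fun i x => c i * f i x) := by
  have h : UB (fun i => ‖c i‖) (fun i (_ : E) => c i) :=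
    .of_bound (fun i => norm_nonneg _) (fun i => contDiff_const) fun j => by
      refine ⟨1, fun i x => ?_⟩
      rcases Nat.eq_zero_or_pos j with rfl | hj
      · simp
      · rw [iteratedFDeriv_const_of_ne (by omega)]; simp
  exact h.mul hf

lemma UB₁.clm {f : ι → E → F} (hf : UB₁ f) (L : F →L[ℝ] G) : UB₁ (fun i x => L (f i x)) :=
  ⟨fun i => L.contDiff.comp (hf.smooth i), fun j hj => by
    obtain ⟨C, h0, hC⟩ := hf.bound j hj
    refine ⟨‖L‖ * C, by positivity, fun i x => ?_⟩
    refine (L.norm_iteratedFDeriv_comp_left (f := f i) ((hf.smooth i).contDiffAt (x := x))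
      (n := j) (by exact_mod_cast le_top)).trans ?_
    exact mul_le_mul_of_nonneg_left (hC i x) (norm_nonneg _)⟩

lemma UB₁.prodMk {f : ι → E → F} {g : ι → E → G} (hf : UB₁ f) (hg : UB₁ g) :
    UB₁ (fun i x => (f i x, g i x)) := by
  have h1 := hf.clm (ContinuousLinearMap.inl ℝ F G)
  have h2 := hg.clm (ContinuousLinearMap.inr ℝ F G)
  simpa using h1.add h2

/-- A bounded family of continuous affine maps. -/
lemma UB₁.affine (L : ι → E →L[ℝ] F) (c : ι → F) {C : ℝ} (hC : ∀ i, ‖L i‖ ≤ C) :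
    UB₁ (fun i x => L i x + c i) := by
  refine ⟨fun i => (L i).contDiff.add contDiff_const, fun j hj => ?_⟩
  refine ⟨max C 0, le_max_right _ _, fun i x => ?_⟩
  have h1 : fderiv ℝ (fun x => L i x + c i) = fun _ => L i := by
    ext1 y
    exact ((L i).hasFDerivAt.add_const (c i)).fderiv
  obtain ⟨m, rfl⟩ : ∃ m, j = m + 1 := ⟨j - 1, by omega⟩
  rw [← norm_iteratedFDeriv_fderiv, h1]
  rcases Nat.eq_zero_or_pos m with rfl | hm
  · simpa using Or.inl (hC i)
  · rw [iteratedFDeriv_const_of_ne (by omega)]; simp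

lemma UB₁.linear (L : E →L[ℝ] F) : UB₁ (fun (_ : ι) x => L x) := by
  simpa using UB₁.affine (ι := ι) (fun _ => L) (fun _ => 0) (fun _ => le_rfl)

/-- Composition of a uniformly bounded family with a family with bounded derivatives. -/
lemma UB.comp {w : ι → ℝ} {g : ι → F → G} {f : ι → E → F} (hg : UB w g) (hf : UB₁ f) :
    UB w (fun i x => g i (f i x)) :=
  .of_bound hg.nonneg (fun i => (hg.smooth i).comp (hf.smooth i)) fun j => by
    obtain ⟨C, h0, hC⟩ := hg.bound_le j
    obtain ⟨D, h1, hD⟩ := hf.bound_pow j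
    refine ⟨j.factorial * C * D ^ j, fun i x => ?_⟩
    refine (norm_iteratedFDeriv_comp_le (hg.smooth i) (hf.smooth i) (n := j)
      (by exact_mod_cast le_top) x (C := C * w i) (D := D) (fun m hm => hC m hm i _)
      (fun m h1 h2 => hD m h1 h2 i x)).trans_eq (by ring)

lemma UB₁.comp {g : ι → F → G} {f : ι → E → F} (hg : UB₁ g) (hf : UB₁ f) :
    UB₁ (fun i x => g i (f i x)) := by
  refine ⟨fun i => (hg.smooth i).comp (hf.smooth i), fun j hj => ?_⟩
  obtain ⟨C, h0, hC⟩ := hg.bound_pow j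
  obtain ⟨D, h1, hD⟩ := hf.bound_pow j
  refine ⟨j.factorial * C ^ j * D ^ j, by positivity, fun i x => ?_⟩
  let y := g i (f i x)
  have hs : Smooth (fun z => g i z - y) := (hg.smooth i).sub contDiff_const
  have key : ∀ m, 1 ≤ m → 𝐃 m (fun z => g i z - y) = 𝐃 m (g i) := fun m hm => by
    ext1 z
    have := fun_iteratedFDeriv_sub_apply (i := m) (x := z)
      ((hg.smooth i).contDiffAt.of_le (by exact_mod_cast le_top))
      (contDiff_const (c := y)).contDiffAt (𝕜 := ℝ)
    rw [this, iteratedFDeriv_const_of_ne (by omega)]; simp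
  have h2 : 𝐃 j (fun x => g i (f i x)) x = 𝐃 j ((fun z => g i z - y) ∘ f i) x := by
    have := fun_iteratedFDeriv_sub_apply (i := j) (x := x)
      (((hg.smooth i).comp (hf.smooth i)).contDiffAt.of_le (by exact_mod_cast le_top))
      (contDiff_const (c := y)).contDiffAt (𝕜 := ℝ)
    rw [iteratedFDeriv_const_of_ne (by omega)] at this
    simpa [comp_def] using this.symm
  rw [h2]
  refine norm_iteratedFDeriv_comp_le hs (hf.smooth i) (n := j)
      (by exact_mod_cast le_top) x (fun m hm => ?_) (fun m h1 h2 => hD m h1 h2 i x)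
  rcases Nat.eq_zero_or_pos m with rfl | hm0
  · simp only [norm_iteratedFDeriv_zero]
    simp only [y, sub_self, norm_zero]; positivity
  · rw [key m hm0]
    exact (hC m hm0 hm i _).trans (pow_le_pow_right₀ h0 hm)

/-- Composition of a fixed smooth function with a uniformly bounded family. -/
lemma UB.comp_smooth [ProperSpace F] {f : ι → E → F} (hf : UB (fun _ => 1) f) {g : F → G}
    (hg : Smooth g) : UB (fun _ => 1) (fun i x => g (f i x)) :=
  .of_bound (fun _ => zero_le_one) (fun i => hg.comp (hf.smooth i)) fun j => by
    obtain ⟨R, hR0, hR⟩ := hf.norm_le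
    have hb : ∀ m : ℕ, ∃ C, 0 ≤ C ∧ ∀ y ∈ Metric.closedBall (0 : F) R, ‖𝐃 m g y‖ ≤ C := fun m => by
      obtain ⟨C, hC⟩ := (isCompact_closedBall (0 : F) R).exists_bound_of_continuousOn
        ((hg.continuous_iteratedFDeriv (m := m) (by exact_mod_cast le_top)).continuousOn)
      exact ⟨max C 0, le_max_right _ _, fun y hy => (hC y hy).trans (le_max_left _ _)⟩
    choose C h0 hC using hb
    obtain ⟨D, h1, hD⟩ := hf.ub₁.bound_pow j
    refine ⟨j.factorial * (∑ m ∈ Finset.range (j + 1), C m) * D ^ j, fun i x => ?_⟩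
    rw [mul_one]
    refine norm_iteratedFDeriv_comp_le hg (hf.smooth i) (n := j)
      (by exact_mod_cast le_top) x (fun m hm => ?_) (fun m h1 h2 => hD m h1 h2 i x)
    refine (hC m (f i x) ?_).trans (single_le_sum (f := C) (fun j _ => h0 j)
      (Finset.mem_range.2 (by omega)))
    simpa using hR i x

lemma UB.fderiv {w : ι → ℝ} {f : ι → E → F} (hf : UB w f) : UB w (fun i x => fderiv ℝ (f i) x) :=
  .of_bound hf.nonneg (fun i => (hf.smooth i).fderiv_right (by norm_cast)) fun j => by
    obtain ⟨C, _, hC⟩ := hf.bound (j + 1)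
    exact ⟨C, fun i x => by rw [norm_iteratedFDeriv_fderiv]; exact hC i x⟩

lemma UB₁.fderiv {f : ι → E → F} (hf : UB₁ f) : UB (fun _ => 1) (fun i x => fderiv ℝ (f i) x) :=
  .of_bound (fun _ => zero_le_one) (fun i => (hf.smooth i).fderiv_right (by norm_cast)) fun j => by
    obtain ⟨C, _, hC⟩ := hf.bound (j + 1) (by omega)
    exact ⟨C, fun i x => by rw [norm_iteratedFDeriv_fderiv, mul_one]; exact hC i x⟩

lemma UB.fderiv_apply {w : ι → ℝ} {f : ι → E → F} (hf : UB w f) (v : E) :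
    UB w (fun i x => _root_.fderiv ℝ (f i) x v) :=
  hf.fderiv.clm (ContinuousLinearMap.apply ℝ F v)

lemma UB₁.fderiv_apply {f : ι → E → F} (hf : UB₁ f) (v : E) :
    UB (fun _ => 1) (fun i x => _root_.fderiv ℝ (f i) x v) :=
  hf.fderiv.clm (ContinuousLinearMap.apply ℝ F v)

/-- Finite sums of varying length with summable weights. -/
lemma UB.sum {w : ι → ℝ} {v : ℕ → ℝ} (hv : Summable v) (hv0 : ∀ j, 0 ≤ v j)
    {f : ι × ℕ → E → F} (hw : ∀ i, 0 ≤ w i)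
    (hf : UB (fun p : ι × ℕ => w p.1 * v p.2) f) (n : ι → ℕ) :
    UB w (fun i x => ∑ j ∈ Finset.range (n i), f (i, j) x) :=
  .of_bound hw (fun i => ContDiff.sum fun j _ => hf.smooth _) fun m => by
    obtain ⟨C, h0, hC⟩ := hf.bound m
    refine ⟨C * ∑' j, v j, fun i x => ?_⟩
    rw [iteratedFDeriv_fun_sum_apply fun j _ =>
      ((hf.smooth (i, j)).contDiffAt.of_le (by exact_mod_cast le_top))]
    refine (norm_sum_le_of_le _ fun j _ => hC (i, j) x).trans ?_
    calc ∑ j ∈ Finset.range (n i), C * (w i * v j)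
        = C * w i * ∑ j ∈ Finset.range (n i), v j := by
          rw [mul_sum]; exact sum_congr rfl fun j _ => by ring
      _ ≤ C * w i * ∑' j, v j := mul_le_mul_of_nonneg_left
          (hv.sum_le_tsum _ fun j _ => hv0 j) (mul_nonneg h0 (hw i))
      _ = _ := by ring

end Families

local notation "UB₀" => UB (fun _ => 1)
variable {ι : Type*} {E F : Type} [NormedAddCommGroup E] [NormedSpace ℝ E]
  [NormedAddCommGroup F] [NormedSpace ℝ F]

/-! ### Integrals depending smoothly on parameters -/

section Parametric

lemma contDiffOn_partial_fderiv
    {U : Set ℝ} (hU : IsOpen U) {f : E × ℝ → F} (hf : ContDiffOn ℝ ∞ f (univ ×ˢ U)) :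
    ContDiffOn ℝ ∞ (fun p : E × ℝ => fderiv ℝ (fun x => f (x, p.2)) p.1) (univ ×ˢ U) := by
  have h1 := hf.fderiv_of_isOpen (isOpen_univ.prod hU) (m := ∞) (by norm_cast)
  have h2 : ContDiffOn ℝ ∞ (fun p => (fderiv ℝ f p).comp (ContinuousLinearMap.inl ℝ E ℝ))
      (univ ×ˢ U) := h1.clm_comp contDiffOn_const
  refine h2.congr fun p hp => ?_
  have h3 : HasFDerivAt f (fderiv ℝ f p) (p.1, p.2) :=
    ((hf.contDiffAt ((isOpen_univ.prod hU).mem_nhds hp)).differentiableAt (by simp)).hasFDerivAt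
  exact (h3.comp p.1 (hasFDerivAt_prodMk_left p.1 p.2)).fderiv

lemma aestronglyMeasurable_of_contDiffOn
    {U : Set ℝ} (hU : IsOpen U) {f : E × ℝ → F} (hf : ContDiffOn ℝ ∞ f (univ ×ˢ U))
    {μ : Measure ℝ} (hμ : ∀ᵐ s ∂μ, s ∈ U) (x : E) :
    AEStronglyMeasurable (fun s => f (x, s)) μ := by
  have h : ContinuousOn (fun s => f (x, s)) U :=
    hf.continuousOn.comp (by fun_prop) fun s hs => ⟨trivial, hs⟩
  rw [← Measure.restrict_eq_self_of_ae_mem hμ]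
  exact h.aestronglyMeasurable hU.measurableSet

/-- Differentiation under the integral sign, to all orders. -/
lemma contDiff_integral_nat (n : ℕ)
    {U : Set ℝ} (hU : IsOpen U) {f : E × ℝ → F} (hf : ContDiffOn ℝ ∞ f (univ ×ˢ U))
    {μ : Measure ℝ} (hμ : ∀ᵐ s ∂μ, s ∈ U) {m : ℕ → ℝ → ℝ} (hm : ∀ j, Integrable (m j) μ)
    (hb : ∀ j, ∀ᵐ s ∂μ, ∀ x, ‖𝐃 j (fun x => f (x, s)) x‖ ≤ m j s) :
    ContDiff ℝ n (fun x => ∫ s, f (x, s) ∂μ) ∧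
      ∀ j ≤ n, ∀ x, ‖𝐃 j (fun x => ∫ s, f (x, s) ∂μ) x‖ ≤ ∫ s, m j s ∂μ := by
  induction n generalizing F f m with
  | zero =>
    have hb0 : ∀ᵐ s ∂μ, ∀ x, ‖f (x, s)‖ ≤ m 0 s := by simpa using hb 0
    constructor
    · rw [Nat.cast_zero, contDiff_zero]
      refine continuous_of_dominated (bound := m 0)
        (fun x => aestronglyMeasurable_of_contDiffOn hU hf hμ x)
        (fun x => hb0.mono fun s hs => hs x) (hm 0) (hμ.mono fun s hs => ?_)
      rw [← continuousOn_univ]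
      exact hf.continuousOn.comp (by fun_prop) fun x _ => ⟨trivial, hs⟩
    · intro j hj x
      obtain rfl : j = 0 := by omega
      rw [norm_iteratedFDeriv_zero]
      exact norm_integral_le_of_norm_le (hm 0) (hb0.mono fun s hs => hs x)
  | succ n ih =>
    have hb0 : ∀ᵐ s ∂μ, ∀ x, ‖f (x, s)‖ ≤ m 0 s := by simpa using hb 0
    have hf' := contDiffOn_partial_fderiv hU hf
    have hb1 : ∀ᵐ s ∂μ, ∀ x, ‖fderiv ℝ (fun x => f (x, s)) x‖ ≤ m 1 s :=
      (hb 1).mono fun s hs x => by simpa [norm_iteratedFDeriv_one] using hs x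
    have hd : ∀ x, HasFDerivAt (fun x => ∫ s, f (x, s) ∂μ)
        (∫ s, fderiv ℝ (fun x => f (x, s)) x ∂μ) x := fun x => by
      refine hasFDerivAt_integral_of_dominated_of_fderiv_le (bound := m 1) (s := univ) univ_mem
        (Eventually.of_forall fun x => aestronglyMeasurable_of_contDiffOn hU hf hμ x)
        ((hm 0).mono' (aestronglyMeasurable_of_contDiffOn hU hf hμ x) (hb0.mono fun s hs => hs x))
        (aestronglyMeasurable_of_contDiffOn hU hf' hμ x)
        (hb1.mono fun s hs x _ => hs x) (hm 1) (hμ.mono fun s hs x _ => ?_)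
      have h3 : DifferentiableAt ℝ f (x, s) :=
        (hf.contDiffAt ((isOpen_univ.prod hU).mem_nhds ⟨trivial, hs⟩)).differentiableAt (by simp)
      exact (h3.comp x (hasFDerivAt_prodMk_left x s).differentiableAt).hasFDerivAt
    have hfd : fderiv ℝ (fun x => ∫ s, f (x, s) ∂μ) =
        fun x => ∫ s, fderiv ℝ (fun x => f (x, s)) x ∂μ := funext fun x => (hd x).fderiv
    have hb' : ∀ j, ∀ᵐ s ∂μ, ∀ x, ‖𝐃 j
        (fun x => fderiv ℝ (fun x => f (x, s)) x) x‖ ≤ m (j + 1) s := fun j =>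
      (hb (j + 1)).mono fun s hs x => by rw [norm_iteratedFDeriv_fderiv]; exact hs x
    obtain ⟨h1, h2⟩ := ih hf' (m := fun j => m (j + 1)) (fun j => hm _) hb'
    constructor
    · rw [Nat.cast_add, Nat.cast_one, contDiff_succ_iff_fderiv]
      refine ⟨fun x => (hd x).differentiableAt, by simp, ?_⟩
      rw [hfd]; exact h1
    · intro j hj x
      rcases j with _ | j
      · rw [norm_iteratedFDeriv_zero]
        exact norm_integral_le_of_norm_le (hm 0) (hb0.mono fun s hs => hs x)
      · rw [← norm_iteratedFDeriv_fderiv, hfd]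
        exact h2 j (by omega) x

/-- Integration of a family with respect to a parameter. -/
lemma UB.integral {w : ι → ℝ} {f : ι → E × ℝ → F} {U : Set ℝ} (hU : IsOpen U)
    (hf : ∀ i, ContDiffOn ℝ ∞ (f i) (univ ×ˢ U)) {μ : ι → Measure ℝ}
    (hμ : ∀ i, ∀ᵐ s ∂(μ i), s ∈ U) {m : ι → ℝ → ℝ} (hm : ∀ i, Integrable (m i) (μ i))
    (hw : ∀ i, ∫ s, m i s ∂(μ i) ≤ w i) (hw0 : ∀ i, 0 ≤ w i)
    (hb : ∀ j, ∃ C, 0 ≤ C ∧ ∀ i, ∀ᵐ s ∂(μ i), ∀ x, ‖𝐃 j (fun x => f i (x, s)) x‖ ≤ C * m i s) :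
    UB w (fun i x => ∫ s, f i (x, s) ∂(μ i)) := by
  choose C h0 hC using hb
  have key := fun n i => contDiff_integral_nat n hU (hf i) (hμ i)
    (m := fun j s => C j * m i s) (fun j => (hm i).const_mul _) (fun j => hC j i)
  refine .of_bound hw0 (fun i => contDiff_infty.2 fun n => (key n i).1) fun j =>
    ⟨C j, fun i x => ((key j i).2 j le_rfl x).trans ?_⟩
  simp only [MeasureTheory.integral_const_mul]
  exact mul_le_mul_of_nonneg_left (hw i) (h0 j)

lemma UB₁.prodMk_const (c : ι → ℝ) : UB₁ (fun (i : ι) (x : E) => (x, c i)) := by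
  have := UB₁.affine (ι := ι) (fun _ => ContinuousLinearMap.inl ℝ E ℝ)
    (fun i => ((0 : E), c i)) (fun _ => le_rfl)
  simpa using this

lemma norm_iteratedFDeriv_prodMk_const_le
    (j : ℕ) : ∃ C, 0 ≤ C ∧ ∀ f : E × ℝ → F, Smooth f → ∀ (s : ℝ) (x : E),
      ‖𝐃 j (fun x => f (x, s)) x‖ ≤ C * ‖𝐃 j f (x, s)‖ := by
  refine ⟨∏ _ : Fin j, ‖ContinuousLinearMap.inl ℝ E ℝ‖, by positivity, fun f hf s x => ?_⟩
  have h1 : Smooth (fun z => f (z + ((0 : E), s))) := hf.comp (by fun_prop)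
  have h2 : (fun x => f (x, s)) = (fun z => f (z + ((0 : E), s))) ∘
      (ContinuousLinearMap.inl ℝ E ℝ) := by ext; simp
  rw [h2, ContinuousLinearMap.iteratedFDeriv_comp_right _ h1 _ (by exact_mod_cast le_top)]
  refine (ContinuousMultilinearMap.norm_compContinuousLinearMap_le _ _).trans_eq ?_
  rw [iteratedFDeriv_comp_add_right, mul_comm]
  simp

/-- Integration over a bounded interval of a family that is uniformly bounded on it. -/
lemma UB.intervalIntegral_of {w : ι → ℝ}
    (hw0 : ∀ i, 0 ≤ w i) {f : ι → E × ℝ → F} (hf : ∀ i, Smooth (f i)) {a b : ℝ}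
    (hab : a ≤ b) (hb : ∀ j, ∃ C, 0 ≤ C ∧ ∀ i, ∀ s ∈ Ioc a b, ∀ x,
      ‖𝐃 j (fun x => f i (x, s)) x‖ ≤ C * w i) :
    UB w (fun i x => ∫ s in a..b, f i (x, s)) := by
  simp only [integral_of_le hab]
  have h := UB.integral (w := fun i => (b - a) * w i) isOpen_univ
    (fun i => (hf i).contDiffOn) (μ := fun _ => volume.restrict (Ioc a b))
    (fun i => by simp) (m := fun i _ => w i) (fun i => integrable_const _)
    (fun i => by simp [hab]) (fun i => mul_nonneg (by linarith) (hw0 i))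
    (fun j => by
      obtain ⟨C, h0, hC⟩ := hb j
      refine ⟨C, h0, fun i => ?_⟩
      exact ae_restrict_of_forall_mem measurableSet_Ioc fun s hs x => hC i s hs x)
  exact h.mono (C := b - a) (by linarith) hw0 fun i => le_rfl

/-- The difference quotient of a smooth function in a fixed direction. -/
def diffQuot (g : E → F) (e : E) (p : E × ℝ) : F :=
  ∫ t in (0 : ℝ)..1, fderiv ℝ g (p.1 + (t * p.2) • e) e

lemma smul_diffQuot [CompleteSpace F] {g : E → F} (hg : Smooth g) (e x : E) (u : ℝ) :
    u • diffQuot g e (x, u) = g (x + u • e) - g x := by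
  have h : ∀ t ∈ uIcc (0 : ℝ) 1, HasDerivAt (fun t : ℝ => g (x + (t * u) • e))
      (u • fderiv ℝ g (x + (t * u) • e) e) t := fun t _ => by
    have h1 : HasDerivAt (fun t : ℝ => x + (t * u) • e) (u • e) t := by
      simpa using (((hasDerivAt_id t).mul_const u).smul_const e).const_add x
    have := ((hg.differentiable (by simp)) (x + (t * u) • e)).hasFDerivAt.comp_hasDerivAt t h1
    simpa [comp_def] using this
  have hc : Continuous fun t : ℝ => fderiv ℝ g (x + (t * u) • e) e :=
    ((hg.continuous_fderiv (by simp)).comp (by fun_prop)).clm_apply continuous_const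
  have := intervalIntegral.integral_eq_sub_of_hasDerivAt h
    ((hc.const_smul u).intervalIntegrable _ _)
  rw [diffQuot, ← intervalIntegral.integral_smul, this]
  simp

lemma UB₁.diffQuot {g : ι → E → F} (hg : UB₁ g) (e : E) : UB₀ (fun i => diffQuot (g i) e) := by
  have hL : ∀ t : ℝ, Smooth (fun p : (E × ℝ) × ℝ => p.1.1 + (p.2 * p.1.2) • e) :=
    fun t => by fun_prop
  refine UB.intervalIntegral_of (f := fun i (p : (E × ℝ) × ℝ) =>
    _root_.fderiv ℝ (g i) (p.1.1 + (p.2 * p.1.2) • e) e) (fun _ => zero_le_one)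
    (fun i => ?_) zero_le_one fun j => ?_
  · exact (((hg.fderiv_apply e).smooth i).comp (hL 0))
  · let A : Icc (0 : ℝ) 1 → (E × ℝ) →L[ℝ] E := fun t =>
      fst ℝ E ℝ + (t : ℝ) • (snd ℝ E ℝ).smulRight e
    have hA : ∀ t, ‖A t‖ ≤ ‖fst ℝ E ℝ‖ + ‖(snd ℝ E ℝ).smulRight e‖ := fun t => by
      refine (norm_add_le _ _).trans (by
        gcongr
        rw [norm_smul]
        refine mul_le_of_le_one_left (norm_nonneg _) ?_
        rw [Real.norm_of_nonneg t.2.1]; exact t.2.2)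
    have h1 := UB₁.affine (ι := ι × Icc (0 : ℝ) 1) (fun p => A p.2) (fun _ => 0) (fun p => hA p.2)
    have h2 := ((hg.fderiv_apply e).reindex (fun p : ι × Icc (0 : ℝ) 1 => p.1)).comp h1
    obtain ⟨C, h0, hC⟩ := h2.bound j
    refine ⟨C, h0, fun i s hs x => ?_⟩
    have := hC (i, ⟨s, hs.1.le, hs.2⟩) x
    simpa [A, mul_smul] using this

end Parametric

/-! ### Exponentials -/

section Exponential

lemma norm_iteratedFDeriv_cexp_le {g : ι → E → ℂ} (hg : UB₁ g) {L : ι → ℝ}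
    (hL : ∀ i, 1 ≤ L i) (j : ℕ) : ∃ C, 0 ≤ C ∧ ∀ i x, ‖𝐃 j (fun x => exp (L i * g i x)) x‖ ≤
        C * L i ^ j * Real.exp (L i * (g i x).re) := by
  obtain ⟨D, hD1, hD⟩ := hg.bound_pow j
  have hexp : Smooth exp := contDiff_exp
  let c := ∑ m ∈ Finset.range (j + 1), ‖𝐃 m exp 0‖
  refine ⟨j.factorial * c * D ^ j, by positivity, fun i x => ?_⟩
  have hL0 : 0 < L i := zero_lt_one.trans_le (hL i)
  let h : E → ℂ := fun y => L i * g i y - L i * g i x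
  have hgs : Smooth (fun y => (L i : ℂ) * g i y) := contDiff_const.mul (hg.smooth i)
  have hs : Smooth h := hgs.sub contDiff_const
  have h1 : (fun x => exp (L i * g i x)) = fun y => exp (L i * g i x) • (exp ∘ h) y := by
    ext1 y
    simp only [h, Function.comp, smul_eq_mul, ← exp_add]
    congr 1; ring
  have hD' : ∀ m, 1 ≤ m → m ≤ j → ‖𝐃 m h x‖ ≤ (D * L i) ^ m := fun m h1 h2 => by
    have e1 : 𝐃 m h x = (L i : ℝ) • 𝐃 m (g i) x := by
      have e2 : h = fun y => (L i • g i) y - L i * g i x := by ext1 y; simp [h]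
      rw [e2, fun_iteratedFDeriv_sub_apply (f := L i • g i) (((hg.smooth i).const_smul
        (L i)).contDiffAt.of_le (by exact_mod_cast le_top)) contDiff_const.contDiffAt,
        iteratedFDeriv_const_of_ne (by omega), iteratedFDeriv_const_smul_apply
        ((hg.smooth i).contDiffAt.of_le (by exact_mod_cast le_top))]
      simp
    rw [e1, norm_smul, Real.norm_of_nonneg hL0.le, mul_pow, mul_comm]
    exact mul_le_mul (hD m h1 h2 i x)
      (by simpa using pow_le_pow_right₀ (hL i) h1) hL0.le (by positivity)
  rw [h1, iteratedFDeriv_const_smul_apply' ((hexp.comp hs).contDiffAt.of_le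
    (by exact_mod_cast le_top)), norm_smul, norm_exp]
  have h2 := norm_iteratedFDeriv_comp_le hexp hs (n := j) (by exact_mod_cast le_top) x
    (C := c) (D := D * L i) (fun m hm => by
      have : h x = 0 := sub_self _
      rw [this]
      exact single_le_sum (f := fun m => ‖𝐃 m exp 0‖)
        (fun _ _ => norm_nonneg _) (Finset.mem_range.2 (by omega))) hD'
  have h3 : ((L i : ℂ) * g i x).re = L i * (g i x).re := by simp
  rw [h3, mul_comm]
  refine (mul_le_mul_of_nonneg_right h2 (Real.exp_pos _).le).trans_eq ?_
  rw [mul_pow]; ring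

/-- Derivatives of a product of an exponential and an amplitude. -/
lemma UB.cexp_mul {g : ι → E → ℂ} (hg : UB₁ g) {L : ι → ℝ} (hL : ∀ i, 1 ≤ L i)
    {w : ι → ℝ} {B : ι → E → ℂ} (hB : UB w B) {κ : ι → ℝ}
    (hκ : ∀ i x, B i x ≠ 0 → L i * (g i x).re ≤ κ i) (j : ℕ) :
    ∃ C, 0 ≤ C ∧ ∀ i x, ‖𝐃 j (fun x => exp (L i * g i x) * B i x) x‖ ≤
      C * (L i ^ j * (Real.exp (κ i) * w i)) := by
  choose C h0 hC using norm_iteratedFDeriv_cexp_le hg hL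
  obtain ⟨D, h1, hD⟩ := hB.bound_le j
  refine ⟨∑ m ∈ Finset.range (j + 1), (j.choose m : ℝ) * C m * D,
    sum_nonneg fun m _ => mul_nonneg (mul_nonneg (by positivity) (h0 m)) h1,
    fun i x => ?_⟩
  have hL0 : 0 < L i := zero_lt_one.trans_le (hL i)
  have hes : Smooth (fun x => exp (L i * g i x)) :=
    contDiff_exp.comp (contDiff_const.mul (hg.smooth i))
  refine (norm_iteratedFDeriv_mul_le hes (hB.smooth i) x (n := j)
    (by exact_mod_cast le_top)).trans ?_
  rw [sum_mul]
  refine sum_le_sum fun m hm => ?_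
  have hm' : m ≤ j := by have := Finset.mem_range.1 hm; omega
  by_cases hx : x ∈ tsupport (B i)
  · have hcl : IsClosed {x | L i * (g i x).re ≤ κ i} :=
      isClosed_le (continuous_const.mul (Complex.continuous_re.comp (hg.smooth i).continuous))
        continuous_const
    have hx' : L i * (g i x).re ≤ κ i := closure_minimal (fun y hy => hκ i y hy) hcl hx
    calc _ ≤ (j.choose m : ℝ) * (C m * L i ^ j * Real.exp (κ i)) * (D * w i) := by
          have h2 := h0 m
          refine mul_le_mul (mul_le_mul_of_nonneg_left ((hC m i x).trans ?_) (by positivity))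
            (hD _ (Nat.sub_le _ _) i x) (norm_nonneg _) (by positivity)
          exact mul_le_mul (mul_le_mul_of_nonneg_left (pow_le_pow_right₀ (hL i) hm') h2)
            (Real.exp_le_exp.2 hx') (Real.exp_pos _).le (by positivity)
      _ = _ := by ring
  · have hz : 𝐃 (j - m) (B i) x = 0 := by
      by_contra hne
      exact hx (tsupport_iteratedFDeriv_subset (𝕜 := ℝ) (j - m) (subset_closure hne))
    rw [hz, norm_zero, mul_zero]
    have := hB.nonneg i
    have := h0 m
    positivity

lemma UB.cexp_mul_one {g : ι → E → ℂ} (hg : UB₁ g) {w : ι → ℝ} {B : ι → E → ℂ} (hB : UB w B)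
    (hκ : ∀ i x, B i x ≠ 0 → (g i x).re ≤ 0) :
    UB w (fun i x => exp (g i x) * B i x) := by
  refine ⟨hB.nonneg, fun i => (contDiff_exp.comp (hg.smooth i)).mul (hB.smooth i), fun j => ?_⟩
  simpa using UB.cexp_mul hg (L := fun _ => 1) (fun _ => le_rfl) hB (κ := fun _ => 0)
    (by simpa using hκ) j

end Exponential

/-! ### Nonstationary phase -/

section Nonstationary

lemma eventually_fderiv_eq_zero {f : E × ℝ → ℂ} {x : E} {a : ℝ}
    (h : ∀ x, ∀ᶠ v in 𝓝 a, f (x, v) = 0) (hf : Differentiable ℝ f) :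
    ∀ᶠ v in 𝓝 a, fderiv ℝ f (x, v) (0, 1) = 0 := by
  filter_upwards [(h x).eventually_nhds] with v hv
  have h1 : HasDerivAt (fun v => f (x, v)) (fderiv ℝ f (x, v) (0, 1)) v :=
    (hf (x, v)).hasFDerivAt.comp_hasDerivAt v ((hasDerivAt_const v x).prodMk (hasDerivAt_id v))
  have h2 : HasDerivAt (fun v => f (x, v)) 0 v :=
    (hasDerivAt_const v (0 : ℂ)).congr_of_eventuallyEq hv
  exact h1.unique h2

/-- One integration by parts. -/
lemma integral_cexp_by_parts {F H B : E × ℝ → ℂ} (hF : Smooth F) (hH : Smooth H) (hB : Smooth B)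
    (hHB : ∀ p, B p = H p * fderiv ℝ F p (0, 1) * B p) {a b : ℝ}
    (ha : ∀ x, ∀ᶠ v in 𝓝 a, B (x, v) = 0) (hb : ∀ x, ∀ᶠ v in 𝓝 b, B (x, v) = 0)
    {Λ : ℝ} (hΛ : Λ ≠ 0) (x : E) :
    ∫ v in a..b, exp (Λ * (I * F (x, v))) * B (x, v) =
      (Λ : ℂ)⁻¹ * ∫ v in a..b, exp (Λ * (I * F (x, v))) *
        (I * fderiv ℝ (fun p => H p * B p) (x, v) (0, 1)) := by
  have hp : ∀ v : ℝ, HasDerivAt (fun v : ℝ => (x, v)) ((0 : E), (1 : ℝ)) v := fun v =>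
    (hasDerivAt_const v x).prodMk (hasDerivAt_id v)
  have hHBs : Smooth (fun p => H p * B p) := hH.mul hB
  have h1 : ∀ v : ℝ, HasDerivAt (fun v : ℝ => H (x, v) * B (x, v))
      (fderiv ℝ (fun p => H p * B p) (x, v) (0, 1)) v := fun v =>
    ((hHBs.differentiable (by simp)) (x, v)).hasFDerivAt.comp_hasDerivAt v (hp v)
  have h2 : ∀ v : ℝ, HasDerivAt (fun v : ℝ => F (x, v)) (fderiv ℝ F (x, v) (0, 1)) v := fun v =>
    ((hF.differentiable (by simp)) (x, v)).hasFDerivAt.comp_hasDerivAt v (hp v)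
  have h3 : ∀ v : ℝ, HasDerivAt (fun v : ℝ => exp (Λ * (I * F (x, v)))) (exp (Λ * (I * F (x, v))) *
        (Λ * (I * fderiv ℝ F (x, v) (0, 1)))) v := fun v =>
    (((h2 v).const_mul I).const_mul (Λ : ℂ)).cexp
  have c0 : Continuous fun v : ℝ => (x, v) := by fun_prop
  have c1 : Continuous fun v : ℝ => fderiv ℝ (fun p => H p * B p) (x, v) (0, 1) :=
    ((hHBs.continuous_fderiv (by simp)).comp c0).clm_apply continuous_const
  have c2 : Continuous fun v : ℝ => fderiv ℝ F (x, v) (0, 1) :=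
    ((hF.continuous_fderiv (by simp)).comp c0).clm_apply continuous_const
  have c3 : Continuous fun v : ℝ => F (x, v) := hF.continuous.comp c0
  have key := intervalIntegral.integral_mul_deriv_eq_deriv_mul (a := a) (b := b)
    (fun v _ => h3 v) (fun v _ => h1 v)
    (Continuous.intervalIntegrable (by fun_prop) a b) (c1.intervalIntegrable a b)
  rw [(ha x).self_of_nhds, (hb x).self_of_nhds, mul_zero, mul_zero, mul_zero, mul_zero,
    sub_zero, zero_sub] at key
  have e1 : ∀ v : ℝ, exp (Λ * (I * F (x, v))) * B (x, v) =
      (Λ : ℂ)⁻¹ * (-I * (exp (Λ * (I * F (x, v))) *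
        (Λ * (I * fderiv ℝ F (x, v) (0, 1))) * (H (x, v) * B (x, v)))) := fun v => by
    have hΛ' : (Λ : ℂ) ≠ 0 := by exact_mod_cast hΛ
    conv_lhs => rw [hHB (x, v)]
    have hinv := inv_mul_cancel₀ hΛ'
    linear_combination (exp (Λ * (I * F (x, v))) * H (x, v) *
      fderiv ℝ F (x, v) (0, 1) * B (x, v) * ((Λ : ℂ)⁻¹ * Λ)) * Complex.I_sq -
      (exp (Λ * (I * F (x, v))) * H (x, v) *
      fderiv ℝ F (x, v) (0, 1) * B (x, v)) * hinv
  simp_rw [e1]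
  rw [int_const_mul, int_const_mul]
  congr 1
  have e2 := congrArg (fun z => I * z) key
  simp only [mul_neg] at e2
  rw [neg_mul, ← e2, ← int_const_mul]
  congr 1; ext v; ring

/-- Nonstationary phase with parameters: integrals with rapidly oscillating exponentials are
rapidly decreasing, together with all their derivatives. -/
theorem UB.nonstationary {F H B : ι → E × ℝ → ℂ} {w Λ : ι → ℝ} (hF : UB₁ F)
    (hΛ : ∀ i, 1 ≤ Λ i) (hB : UB w B) (hH : UB₀ H)
    (hHB : ∀ i p, B i p = H i p * _root_.fderiv ℝ (F i) p (0, 1) * B i p)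
    (him : ∀ i p, B i p ≠ 0 → 0 ≤ (F i p).im) {a b : ℝ} (hab : a ≤ b)
    (ha : ∀ i x, ∀ᶠ v in 𝓝 a, B i (x, v) = 0) (hb : ∀ i x, ∀ᶠ v in 𝓝 b, B i (x, v) = 0)
    (N : ℕ) :
    UB (fun i => w i * ((Λ i)⁻¹) ^ N) (fun i x =>
      ∫ v in a..b, exp (Λ i * (I * F i (x, v))) * B i (x, v)) := by
  have hΛ0 : ∀ i, 0 < Λ i := fun i => zero_lt_one.trans_le (hΛ i)
  have hdF := hF.fderiv_apply ((0, 1) : E × ℝ)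
  have iter : ∀ n : ℕ, ∃ B' : ι → E × ℝ → ℂ, UB w B' ∧
      (∀ i p, B' i p = H i p * _root_.fderiv ℝ (F i) p (0, 1) * B' i p) ∧
      (∀ i, tsupport (B' i) ⊆ tsupport (B i)) ∧
      (∀ i x, ∀ᶠ v in 𝓝 a, B' i (x, v) = 0) ∧ (∀ i x, ∀ᶠ v in 𝓝 b, B' i (x, v) = 0) ∧
      ∀ i x, ∫ v in a..b, exp (Λ i * (I * F i (x, v))) * B i (x, v) = ((Λ i : ℂ)⁻¹) ^ n *
          ∫ v in a..b, exp (Λ i * (I * F i (x, v))) * B' i (x, v) := by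
    intro n
    induction n with
    | zero => exact ⟨B, hB, hHB, fun i => Subset.rfl, ha, hb, fun i x => by simp⟩
    | succ n ih =>
      obtain ⟨B', h1, h2, h3, h4, h5, h6⟩ := ih
      have hHB' : UB w (fun i p => H i p * B' i p) := by simpa using hH.mul h1
      have hts : ∀ i, tsupport (fun p => _root_.fderiv ℝ (fun p => H i p * B' i p) p (0, 1)) ⊆
          tsupport (B' i) := fun i => by
        refine closure_minimal (fun p hp => ?_) (isClosed_tsupport _)
        have : p ∈ tsupport (_root_.fderiv ℝ (fun p => H i p * B' i p)) := by
          refine subset_closure fun h0 => hp ?_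
          simp only; rw [h0]; rfl
        have := tsupport_fderiv_subset ℝ this
        exact closure_mono (show Function.support (fun p => H i p * B' i p) ⊆
          Function.support (B' i) from fun z hz hz' => hz (by simp only [hz', mul_zero])) this
      refine ⟨fun i p => I * _root_.fderiv ℝ (fun p => H i p * B' i p) p (0, 1),
        ?_, ?_, ?_, ?_, ?_, ?_⟩
      · simpa using (hHB'.fderiv_apply ((0, 1) : E × ℝ)).const_mul (fun _ => I)
      · intro i p
        have hz : ∀ p, B' i p * (1 - H i p * _root_.fderiv ℝ (F i) p (0, 1)) = 0 := fun p => by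
          linear_combination h2 i p
        by_cases hp : p ∈ tsupport (B' i)
        · have hc : IsClosed {p | 1 - H i p * _root_.fderiv ℝ (F i) p (0, 1) = 0} :=
            isClosed_eq (continuous_const.sub ((hH.smooth i).continuous.mul
              (hdF.smooth i).continuous)) continuous_const
          have : 1 - H i p * _root_.fderiv ℝ (F i) p (0, 1) = 0 :=
            closure_minimal (fun p hp => (mul_eq_zero.1 (hz p)).resolve_left hp) hc hp
          linear_combination (I * _root_.fderiv ℝ (fun p => H i p * B' i p) p (0, 1)) * this
        · have : _root_.fderiv ℝ (fun p => H i p * B' i p) p (0, 1) = 0 := by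
            by_contra h
            exact hp (hts i (subset_closure h))
          beta_reduce; rw [this]; ring
      · intro i
        refine Subset.trans ?_ (h3 i)
        refine Subset.trans (closure_mono fun p hp => ?_) (hts i)
        exact fun h => hp (by simp only [h, mul_zero])
      · intro i x
        refine (eventually_fderiv_eq_zero (f := fun p => H i p * B' i p)
          (fun x => (h4 i x).mono fun v hv => by simp [hv])
          ((hHB'.smooth i).differentiable (by simp))).mono fun v hv => by beta_reduce; rw [hv, mul_zero]
      · intro i x
        refine (eventually_fderiv_eq_zero (f := fun p => H i p * B' i p)
          (fun x => (h5 i x).mono fun v hv => by simp [hv])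
          ((hHB'.smooth i).differentiable (by simp))).mono fun v hv => by beta_reduce; rw [hv, mul_zero]
      · intro i x
        rw [h6 i x, integral_cexp_by_parts (hF.smooth i) (hH.smooth i) (h1.smooth i) (h2 i)
          (h4 i) (h5 i) (hΛ0 i).ne' x, ← mul_assoc, pow_succ]
  have main : ∀ n : ℕ, ∃ I' : ι → E → ℂ, (∀ i, Smooth (I' i)) ∧
      (∀ i x, ∫ v in a..b, exp (Λ i * (I * F i (x, v))) * B i (x, v) = ((Λ i : ℂ)⁻¹) ^ n * I' i x) ∧
      ∀ j, ∃ C, 0 ≤ C ∧ ∀ i x, ‖𝐃 j (I' i) x‖ ≤ C * (w i * Λ i ^ j) := by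
    intro n
    obtain ⟨B', h1, -, h3, -, -, h6⟩ := iter n
    have hg : UB₁ (fun i p => I * F i p) := hF.clm (ContinuousLinearMap.mul ℝ ℂ I)
    have hb' := UB.cexp_mul hg hΛ h1 (κ := fun _ => 0) fun i p hp => by
      have hcl : IsClosed {p | 0 ≤ (F i p).im} :=
        isClosed_le continuous_const (Complex.continuous_im.comp (hF.smooth i).continuous)
      have := closure_minimal (fun y hy => him i y hy) hcl (h3 i (subset_closure hp))
      have h7 : 0 ≤ (F i p).im := this
      have := mul_nonneg (hΛ0 i).le h7
      simpa using this
    have hsm : ∀ i, Smooth (fun p : E × ℝ => exp (Λ i * (I * F i p)) * B' i p) := fun i =>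
      (contDiff_exp.comp (contDiff_const.mul (hg.smooth i))).mul (h1.smooth i)
    have hint : ∀ j, ∃ C, 0 ≤ C ∧ ∀ i, ∀ s ∈ Ioc a b, ∀ x : E, ‖𝐃 j
        (fun x => exp (Λ i * (I * F i (x, s))) * B' i (x, s)) x‖ ≤
        C * (w i * Λ i ^ j) := fun j => by
      obtain ⟨C, h0, hC⟩ := hb' j
      obtain ⟨D, h1, hD⟩ := norm_iteratedFDeriv_prodMk_const_le (E := E) (F := ℂ) j
      refine ⟨D * C, by positivity, fun i s _ x => (hD _ (hsm i) s x).trans ?_⟩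
      rw [mul_assoc]
      refine mul_le_mul_of_nonneg_left ((hC i _).trans_eq ?_) h1
      rw [Real.exp_zero]; ring
    refine ⟨_, fun i => ?_, h6, fun j => ?_⟩
    · have hi := UB.integral (ι := Unit) (w := fun _ => ∫ s in Ioc a b, w i)
        (f := fun _ p => exp (Λ i * (I * F i p)) * B' i p)
        isOpen_univ (fun _ => (hsm i).contDiffOn) (μ := fun _ => volume.restrict (Ioc a b))
        (by simp) (m := fun _ _ => w i) (fun _ => integrable_const _) (fun _ => le_rfl)
        (fun _ => integral_nonneg fun _ => h1.nonneg i) (fun j => by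
          obtain ⟨C, h0, hC⟩ := hint j
          refine ⟨C * Λ i ^ j, mul_nonneg h0 (by have := hΛ0 i; positivity), fun _ => ?_⟩
          exact ae_restrict_of_forall_mem measurableSet_Ioc fun s hs x => (hC i s hs x).trans_eq (by ring))
      simpa only [integral_of_le hab] using hi.smooth ()
    · obtain ⟨C, h0, hC⟩ := hint j
      refine ⟨C * (b - a), mul_nonneg h0 (by linarith), fun i x => ?_⟩
      choose m hm using hint
      simp only [integral_of_le hab]
      refine ((contDiff_integral_nat (E := E) j isOpen_univ (hsm i).contDiffOn
        (μ := volume.restrict (Ioc a b)) (by simp)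
        (m := fun j' _ => if j' = j then C * (w i * Λ i ^ j) else m j' * (w i * Λ i ^ j'))
        (fun j => integrable_const _) (fun j' => ?_)).2 j le_rfl x).trans_eq ?_
      · refine ae_restrict_of_forall_mem measurableSet_Ioc fun s hs x => ?_
        split_ifs with h
        · subst h; exact hC i s hs x
        · exact (hm j').2 i s hs x
      · simp [hab]; ring
  refine .of_bound (fun i => mul_nonneg (hB.nonneg i) (by have := hΛ0 i; positivity))
    (fun i => ?_) fun j => ?_
  · obtain ⟨I', h1, h2, -⟩ := main 0
    have : (fun x => ∫ v in a..b, exp (Λ i * (I * F i (x, v))) * B i (x, v)) =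
        I' i := funext fun x => by simpa using h2 i x
    rw [this]; exact h1 i
  · obtain ⟨I', h1, h2, h3⟩ := main (N + j)
    obtain ⟨C, -, hC⟩ := h3 j
    refine ⟨C, fun i x => ?_⟩
    have : (fun x => ∫ v in a..b, exp (Λ i * (I * F i (x, v))) * B i (x, v)) =
        fun x => ((Λ i : ℂ)⁻¹) ^ (N + j) • I' i x := funext fun x => by simpa using h2 i x
    rw [this, iteratedFDeriv_const_smul_apply' ((h1 i).contDiffAt.of_le
      (by exact_mod_cast le_top)), norm_smul]
    have h0 := hΛ0 i
    have e : ‖((Λ i : ℂ)⁻¹) ^ (N + j)‖ = ((Λ i)⁻¹) ^ (N + j) := by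
      rw [norm_pow, norm_inv, norm_of_nonneg h0.le]
    rw [e]
    refine (mul_le_mul_of_nonneg_left (hC i x) (by positivity)).trans_eq ?_
    have h1 : (Λ i)⁻¹ ^ j * Λ i ^ j = 1 := by rw [← mul_pow, inv_mul_cancel₀ h0.ne', one_pow]
    rw [pow_add]
    linear_combination (C * w i * (Λ i)⁻¹ ^ N) * h1

end Nonstationary

/-! ### Smooth cutoffs -/

/-- A smooth function that equals `x⁻¹` for `x ≥ c`, and vanishes for `x ≤ c / 4`. -/
def realInv (c x : ℝ) : ℝ := smoothTransition ((4 * x / c - 1) / 3) / x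

lemma contDiff_realInv {c : ℝ} (hc : 0 < c) : Smooth (realInv c) := by
  rw [contDiff_iff_contDiffAt]
  intro x
  by_cases hx : x = 0
  · have : realInv c =ᶠ[𝓝 x] fun _ => 0 := by
      have : Iio (c / 4) ∈ 𝓝 x := Iio_mem_nhds (by rw [hx]; positivity)
      filter_upwards [this] with y hy
      rw [realInv, smoothTransition.zero_of_nonpos, zero_div]
      have : 4 * y / c ≤ 1 := (div_le_one hc).2 (by have := mem_Iio.1 hy; linarith)
      linarith
    exact contDiffAt_const.congr_of_eventuallyEq this
  · refine ContDiffAt.div ?_ contDiffAt_id hx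
    exact (smoothTransition.contDiff.comp (by fun_prop)).contDiffAt

lemma realInv_of_le {c x : ℝ} (hc : 0 < c) (hx : c ≤ x) : realInv c x = x⁻¹ := by
  rw [realInv, smoothTransition.one_of_one_le, one_div]
  have : 1 ≤ x / c := (one_le_div hc).2 hx
  rw [mul_div_assoc]; linarith

/-- A smooth function that equals `z⁻¹` for `|z| ≥ c`. -/
def complexInv (c : ℝ) (z : ℂ) : ℂ := (realInv (c ^ 2) (normSq z) : ℂ) * (starRingEnd ℂ) z

lemma contDiff_complexInv {c : ℝ} (hc : 0 < c) : Smooth (complexInv c) := by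
  have h : Smooth (normSq : ℂ → ℝ) := by
    have : (normSq : ℂ → ℝ) = fun z => z.re * z.re + z.im * z.im := by
      ext z; exact Complex.normSq_apply z
    rw [this]
    exact (Complex.reCLM.contDiff.mul Complex.reCLM.contDiff).add
      (Complex.imCLM.contDiff.mul Complex.imCLM.contDiff)
  exact (ofRealCLM.contDiff.comp ((contDiff_realInv (by positivity)).comp h)).mul
    Complex.conjCLE.contDiff

lemma complexInv_mul {c : ℝ} (hc : 0 < c) {z : ℂ} (hz : c ≤ ‖z‖) : complexInv c z * z = 1 := by
  have h1 : c ^ 2 ≤ normSq z := by rw [Complex.normSq_eq_norm_sq]; exact pow_le_pow_left₀ hc.le hz 2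
  have h2 : normSq z ≠ 0 := ((pow_pos hc 2).trans_le h1).ne'
  rw [complexInv, realInv_of_le (by positivity) h1, mul_assoc, mul_comm _ z, mul_conj,
    ← ofReal_mul, inv_mul_cancel₀ h2, ofReal_one]

/-- A positive smooth function that equals the square root for `t ≥ c ^ 2`. -/
def realSqrt (c t : ℝ) : ℝ :=
  Real.sqrt (c ^ 2 / 4 + (t - c ^ 2 / 4) * smoothTransition ((4 * t / c ^ 2 - 1) / 3))

lemma realSqrt_arg_ge {c : ℝ} (hc : 0 < c) (t : ℝ) : c ^ 2 / 4 ≤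
    c ^ 2 / 4 + (t - c ^ 2 / 4) * smoothTransition ((4 * t / c ^ 2 - 1) / 3) := by
  have hc2 : 0 < c ^ 2 := by positivity
  rcases le_total t (c ^ 2 / 4) with h | h
  · rw [smoothTransition.zero_of_nonpos, mul_zero, add_zero]
    have : 4 * t / c ^ 2 ≤ 1 := (div_le_one hc2).2 (by linarith)
    linarith
  · have := mul_nonneg (sub_nonneg.2 h) (smoothTransition.nonneg ((4 * t / c ^ 2 - 1) / 3))
    linarith

lemma contDiff_realSqrt {c : ℝ} (hc : 0 < c) : Smooth (realSqrt c) := by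
  have h : Smooth (fun t : ℝ => c ^ 2 / 4 +
      (t - c ^ 2 / 4) * smoothTransition ((4 * t / c ^ 2 - 1) / 3)) :=
    contDiff_const.add ((contDiff_id.sub contDiff_const).mul
      (smoothTransition.contDiff.comp (by fun_prop)))
  refine h.sqrt fun t => ?_
  have := realSqrt_arg_ge hc t
  have : 0 < c ^ 2 / 4 := by positivity
  linarith [realSqrt_arg_ge hc t]

lemma le_realSqrt {c : ℝ} (hc : 0 < c) (t : ℝ) : c / 2 ≤ realSqrt c t := by
  refine Real.le_sqrt_of_sq_le ?_
  have := realSqrt_arg_ge hc t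
  nlinarith

lemma realSqrt_sq {c x : ℝ} (hc : 0 < c) (hx : c ≤ x) : realSqrt c (x ^ 2) = x := by
  have h1 : 1 ≤ x ^ 2 / c ^ 2 := (one_le_div (by positivity)).2 (pow_le_pow_left₀ hc.le hx 2)
  rw [realSqrt, smoothTransition.one_of_one_le, mul_one, add_sub_cancel,
    Real.sqrt_sq (hc.le.trans hx)]
  rw [mul_div_assoc]; linarith

/-- A smooth bump function equal to one for `|x| ≤ c`, and supported in `|x| ≤ 2 * c`. -/
def bump (c x : ℝ) : ℝ := smoothTransition ((4 - x ^ 2 / c ^ 2) / 3)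

lemma contDiff_bump (c : ℝ) : Smooth (bump c) := smoothTransition.contDiff.comp (by fun_prop)

lemma bump_eq_one {c x : ℝ} (hc : 0 < c) (hx : |x| ≤ c) : bump c x = 1 := by
  refine smoothTransition.one_of_one_le ?_
  have : x ^ 2 / c ^ 2 ≤ 1 := (div_le_one (by positivity)).2 (sq_le_sq' (by
    linarith [neg_abs_le x]) ((le_abs_self x).trans hx))
  linarith

lemma bump_eq_zero {c x : ℝ} (hc : 0 < c) (hx : 2 * c ≤ |x|) : bump c x = 0 := by
  refine smoothTransition.zero_of_nonpos ?_
  have h1 : (2 * c) ^ 2 ≤ x ^ 2 := by rw [← sq_abs x]; exact pow_le_pow_left₀ (by positivity) hx 2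
  have : 4 ≤ x ^ 2 / c ^ 2 := (le_div_iff₀ (by positivity)).2 (by linarith)
  linarith

lemma bump_mem (c x : ℝ) : bump c x ∈ Icc (0 : ℝ) 1 :=
  ⟨smoothTransition.nonneg _, smoothTransition.le_one _⟩

/-- Derivatives of a smooth function with compact support are bounded. -/
lemma UB.of_hasCompactSupport {E F : Type*} [NormedAddCommGroup E] [NormedSpace ℝ E]
    [NormedAddCommGroup F] [NormedSpace ℝ F] {f : E → F} (hf : Smooth f)
    (hc : HasCompactSupport f) : UB₀ (fun (_ : ι) => f) :=
  .of_bound (fun _ => zero_le_one) (fun _ => hf) fun j => by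
    obtain ⟨C, hC⟩ := (hc.iteratedFDeriv (𝕜 := ℝ) j).exists_bound_of_continuous
      (hf.continuous_iteratedFDeriv (m := j) (by exact_mod_cast le_top))
    exact ⟨C, fun _ x => by simpa using hC x⟩

lemma UB.bump {c : ℝ} (hc : 0 < c) : UB₀ (fun (_ : ι) => Billiard.bump c) := by
  refine UB.of_hasCompactSupport (contDiff_bump c) ?_
  refine HasCompactSupport.of_support_subset_isCompact (isCompact_Icc (a := -(2 * c))
    (b := 2 * c)) fun x hx => ?_
  by_contra h
  refine hx (bump_eq_zero hc ?_)
  rw [mem_Icc, ← abs_le, not_le] at h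
  exact h.le

/-- Derivatives of a smooth periodic function are bounded. -/
lemma UB.of_periodic {f : ℝ → F} (hf : Smooth f) {T : ℝ} (hT : 0 < T) (hp : Periodic f T) :
    UB₀ (fun (_ : ι) => f) :=
  .of_bound (fun _ => zero_le_one) (fun _ => hf) fun j => by
    have hper : Periodic (𝐃 j f) T := fun x => by
      have : (fun z => f (z + T)) = f := funext hp
      rw [← iteratedFDeriv_comp_add_right j T x, this]
    obtain ⟨C, hC⟩ := (isCompact_Icc (a := (0 : ℝ)) (b := T)).exists_bound_of_continuousOn
      (hf.continuous_iteratedFDeriv (m := j) (by exact_mod_cast le_top)).continuousOn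
    refine ⟨C, fun _ x => ?_⟩
    obtain ⟨y, hy, hxy⟩ := hper.exists_mem_Ico₀ hT x
    rw [hxy, mul_one]
    exact hC y (Ico_subset_Icc_self hy)

/-! ### The Hankel function -/

/-- The Laplace transform of `w ^ (m - 1/2) (1 + i w / (2 μ)) ^ (-1/2)`. -/
def laplaceP (μ : ℂ) (m : ℕ) (x : ℝ) : ℂ :=
  ∫ w in Ioi (0 : ℝ), ((Real.exp (-(x * w)) * w ^ ((m : ℝ) - 1 / 2) : ℝ) : ℂ) *
    (1 + I * w / (2 * μ)) ^ ((-(1 / 2) : ℝ) : ℂ)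

lemma one_le_re_one_add {μ : ℂ} (hμ : 0 ≤ μ.im) {w : ℝ} (hw : 0 ≤ w) :
    1 ≤ (1 + I * w / (2 * μ)).re := by
  have h : (1 + I * w / (2 * μ)).re = 1 + w * μ.im / (2 * normSq μ) := by
    by_cases h0 : μ = 0
    · simp [h0]
    have h1 : I * w / (2 * μ) = (w / (2 * normSq μ) : ℝ) * (I * (starRingEnd ℂ) μ) := by
      have h2 : (normSq μ : ℂ) ≠ 0 := by exact_mod_cast (Complex.normSq_pos.2 h0).ne'
      push_cast
      rw [div_mul_eq_mul_div, div_eq_div_iff (by simp [h0]) (by simp [h0])]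
      have := mul_conj μ
      linear_combination (-2 * I * w) * this
    rw [h1, Complex.add_re, Complex.re_ofReal_mul]
    simp
    ring
  rw [h]
  have : 0 ≤ w * μ.im / (2 * normSq μ) :=
    div_nonneg (mul_nonneg hw hμ) (mul_nonneg zero_le_two (Complex.normSq_nonneg _))
  linarith

lemma norm_cpow_le_one {μ : ℂ} (hμ : 0 ≤ μ.im) {w : ℝ} (hw : 0 ≤ w) :
    ‖(1 + I * w / (2 * μ)) ^ ((-(1 / 2) : ℝ) : ℂ)‖ ≤ 1 := by
  have h1 := one_le_re_one_add hμ hw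
  have h2 : 1 ≤ ‖1 + I * w / (2 * μ)‖ := h1.trans (Complex.re_le_norm _)
  rw [Complex.norm_cpow_real]
  exact Real.rpow_le_one_of_one_le_of_nonpos h2 (by norm_num)

lemma continuousOn_cpow {μ : ℂ} (hμ : 0 ≤ μ.im) : ContinuousOn (fun w : ℝ =>
    (1 + I * w / (2 * μ)) ^ ((-(1 / 2) : ℝ) : ℂ)) (Ioi 0) := by
  refine ContinuousOn.cpow (by fun_prop) continuousOn_const fun w hw => ?_
  left
  have := one_le_re_one_add hμ (le_of_lt (mem_Ioi.1 hw))
  linarith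

lemma integrableOn_exp_mul_rpow {x : ℝ} (hx : 0 < x) {s : ℝ} (hs : -1 < s) :
    IntegrableOn (fun w : ℝ => Real.exp (-(x * w)) * w ^ s) (Ioi 0) := by
  have := integrableOn_rpow_mul_exp_neg_mul_rpow (p := 1) hs zero_lt_one hx
  refine this.congr_fun (fun w _ => ?_) measurableSet_Ioi
  simp [mul_comm]

lemma integral_exp_mul_rpow {x : ℝ} (hx : 0 < x) {s : ℝ} (hs : 0 < s) :
    ∫ w in Ioi (0 : ℝ), Real.exp (-(x * w)) * w ^ (s - 1) = Gamma s * x ^ (-s) := by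
  have := Real.integral_rpow_mul_exp_neg_mul_Ioi hs hx
  rw [one_div, Real.inv_rpow hx.le, ← rpow_neg hx.le] at this
  rw [mul_comm, ← this]
  simp_rw [mul_comm]

lemma aestronglyMeasurable_laplaceP {μ : ℂ} (hμ : 0 ≤ μ.im) (m : ℕ) (x : ℝ) :
    AEStronglyMeasurable (fun w : ℝ => ((Real.exp (-(x * w)) * w ^ ((m : ℝ) - 1 / 2) : ℝ) : ℂ) *
      (1 + I * w / (2 * μ)) ^ ((-(1 / 2) : ℝ) : ℂ)) (volume.restrict (Ioi 0)) := by
  refine ContinuousOn.aestronglyMeasurable ?_ measurableSet_Ioi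
  refine ContinuousOn.mul ?_ (continuousOn_cpow hμ)
  refine continuous_ofReal.comp_continuousOn (ContinuousOn.mul (by fun_prop) ?_)
  exact continuousOn_id.rpow_const fun w hw => Or.inl (ne_of_gt hw)

lemma norm_laplace_integrand_le {μ : ℂ} (hμ : 0 ≤ μ.im) (m : ℕ) (x : ℝ) {w : ℝ} (hw : 0 < w) :
    ‖((Real.exp (-(x * w)) * w ^ ((m : ℝ) - 1 / 2) : ℝ) : ℂ) *
      (1 + I * w / (2 * μ)) ^ ((-(1 / 2) : ℝ) : ℂ)‖ ≤
      Real.exp (-(x * w)) * w ^ ((m : ℝ) - 1 / 2) := by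
  rw [norm_mul, norm_of_nonneg (by positivity)]
  exact mul_le_of_le_one_right (by positivity) (norm_cpow_le_one hμ hw.le)

lemma norm_laplaceP_le {μ : ℂ} (hμ : 0 ≤ μ.im) (m : ℕ) {x : ℝ} (hx : 0 < x) :
    ‖laplaceP μ m x‖ ≤ Gamma (m + 1 / 2) * x ^ (-((m : ℝ) + 1 / 2)) := by
  have hm : (0 : ℝ) < m + 1 / 2 := by positivity
  have hs : (m : ℝ) - 1 / 2 = (m + 1 / 2) - 1 := by ring
  rw [← integral_exp_mul_rpow hx hm, ← hs]
  refine norm_integral_le_of_norm_le (integrableOn_exp_mul_rpow hx (by linarith)) ?_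
  exact ae_restrict_of_forall_mem measurableSet_Ioi fun w hw => norm_laplace_integrand_le hμ m x hw

lemma hasDerivAt_laplaceP {μ : ℂ} (hμ : 0 ≤ μ.im) (m : ℕ) {x : ℝ} (hx : 0 < x) :
    HasDerivAt (laplaceP μ m) (-laplaceP μ (m + 1) x) x := by
  have hm : (0 : ℝ) < m + 1 / 2 := by positivity
  have hball : Ioi (x / 2) ∈ 𝓝 x := Ioi_mem_nhds (by linarith)
  have key := hasDerivAt_integral_of_dominated_loc_of_deriv_le (μ := volume.restrict (Ioi (0 : ℝ)))
    (F := fun x w => ((Real.exp (-(x * w)) * w ^ ((m : ℝ) - 1 / 2) : ℝ) : ℂ) *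
      (1 + I * w / (2 * μ)) ^ ((-(1 / 2) : ℝ) : ℂ))
    (F' := fun x w => -(((Real.exp (-(x * w)) * w ^ (((m + 1 : ℕ) : ℝ) - 1 / 2) : ℝ) : ℂ) *
      (1 + I * w / (2 * μ)) ^ ((-(1 / 2) : ℝ) : ℂ)))
    (bound := fun w => Real.exp (-(x / 2 * w)) * w ^ (((m + 1 : ℕ) : ℝ) - 1 / 2))
    (x₀ := x) hball
    (Eventually.of_forall fun x => aestronglyMeasurable_laplaceP hμ m x) ?_
    (aestronglyMeasurable_laplaceP hμ (m + 1) x).neg ?_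
    (integrableOn_exp_mul_rpow (by linarith) (by push_cast; linarith)) ?_
  · have h2 := key.2
    rw [integral_neg] at h2
    exact h2
  · refine Integrable.mono' (integrableOn_exp_mul_rpow hx (s := (m : ℝ) - 1 / 2) (by linarith))
      (aestronglyMeasurable_laplaceP hμ m x) ?_
    exact ae_restrict_of_forall_mem measurableSet_Ioi fun w hw => norm_laplace_integrand_le hμ m x hw
  · refine ae_restrict_of_forall_mem measurableSet_Ioi fun w hw y hy => ?_
    rw [norm_neg]
    refine (norm_laplace_integrand_le hμ (m + 1) y hw).trans ?_
    have hw0 : 0 < w := hw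
    have : x / 2 * w ≤ y * w := mul_le_mul_of_nonneg_right (le_of_lt hy) hw0.le
    gcongr
  · refine ae_restrict_of_forall_mem measurableSet_Ioi fun w hw y _ => ?_
    have hw0 : 0 < w := hw
    have h1 : HasDerivAt (fun y : ℝ => Real.exp (-(y * w)) * w ^ ((m : ℝ) - 1 / 2))
        (Real.exp (-(y * w)) * -w * w ^ ((m : ℝ) - 1 / 2)) y := by
      simpa using ((((hasDerivAt_id y).mul_const w).neg).exp).mul_const (w ^ ((m : ℝ) - 1 / 2))
    have h2 := (h1.ofReal_comp).mul_const ((1 + I * w / (2 * μ)) ^ ((-(1 / 2) : ℝ) : ℂ))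
    refine h2.congr_deriv ?_
    have : ((m + 1 : ℕ) : ℝ) - 1 / 2 = 1 + ((m : ℝ) - 1 / 2) := by push_cast; ring
    rw [this, rpow_add hw0, rpow_one]
    push_cast
    ring

/-- Smooth functions with compact support in `(0, ∞)`. -/
structure IsPosCutoff (c : ℝ → ℝ) : Prop where
  smooth : Smooth c
  compact : HasCompactSupport c
  zero : ∃ ε > 0, ∀ x ≤ ε, c x = 0

lemma IsPosCutoff.deriv {c : ℝ → ℝ} (hc : IsPosCutoff c) : IsPosCutoff (deriv c) := by
  refine ⟨hc.smooth.iterate_deriv 1, hc.compact.deriv, ?_⟩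
  obtain ⟨ε, h0, h⟩ := hc.zero
  refine ⟨ε / 2, by positivity, fun x hx => ?_⟩
  have : c =ᶠ[𝓝 x] fun _ => 0 := by
    filter_upwards [Iio_mem_nhds (show x < ε by linarith)] with y hy using h y (le_of_lt hy)
  rw [this.deriv_eq, deriv_const]

/-- The function `P_m`, rescaled and localised. -/
def laplaceScaled (μ : ℂ) (Λ : ℝ) (m : ℕ) (c : ℝ → ℝ) (y : ℝ) : ℂ :=
  ((Λ ^ ((m : ℝ) + 1 / 2) : ℝ) : ℂ) * (laplaceP μ m (Λ * y) * c y)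

lemma hasDerivAt_laplaceScaled {μ : ℂ} {Λ : ℝ} (hμ : 0 ≤ μ.im) (hΛ : 0 < Λ) (m : ℕ)
    {c : ℝ → ℝ} (hc : IsPosCutoff c) (y : ℝ) :
    HasDerivAt (laplaceScaled μ Λ m c)
      (-laplaceScaled μ Λ (m + 1) c y + laplaceScaled μ Λ m (deriv c) y) y := by
  obtain ⟨ε, hε, h0⟩ := hc.zero
  rcases lt_or_ge y ε with hy | hy
  · have h1 : c =ᶠ[𝓝 y] fun _ => 0 := by
      filter_upwards [Iio_mem_nhds hy] with z hz using h0 z (le_of_lt hz)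
    have h2 : c y = 0 := h0 y hy.le
    have h3 : deriv c y = 0 := by rw [h1.deriv_eq, deriv_const]
    rw [laplaceScaled, laplaceScaled, h2, h3]
    simp only [ofReal_zero, mul_zero, neg_zero, add_zero]
    refine (hasDerivAt_const y (0 : ℂ)).congr_of_eventuallyEq ?_
    filter_upwards [h1] with z hz
    rw [laplaceScaled, hz]; simp
  · have hy0 : 0 < y := hε.trans_le hy
    have h1 : HasDerivAt (fun y : ℝ => laplaceP μ m (Λ * y))
        (Λ • -laplaceP μ (m + 1) (Λ * y)) y := by
      have := HasDerivAt.scomp y (hasDerivAt_laplaceP hμ m (mul_pos hΛ hy0))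
        ((hasDerivAt_id y).const_mul Λ)
      simpa [comp_def] using this
    have h2 : HasDerivAt (fun y : ℝ => (c y : ℂ)) ((deriv c y : ℝ) : ℂ) y :=
      ((hc.smooth.differentiable (by simp)) y).hasDerivAt.ofReal_comp
    refine ((h1.mul h2).const_mul ((Λ ^ ((m : ℝ) + 1 / 2) : ℝ) : ℂ)).congr_deriv ?_
    have h4 : ((m + 1 : ℕ) : ℝ) + 1 / 2 = ((m : ℝ) + 1 / 2) + 1 := by push_cast; ring
    rw [laplaceScaled, laplaceScaled, h4, Real.rpow_add_one hΛ.ne', real_smul, ofReal_mul]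
    ring

lemma laplaceScaled_aux (n : ℕ) (m : ℕ) {c : ℝ → ℝ} (hc : IsPosCutoff c) :
    ∃ C, ∀ (μ : ℂ) (Λ : ℝ), 0 ≤ μ.im → 0 < Λ → ContDiff ℝ n (laplaceScaled μ Λ m c) ∧
      ∀ y, ‖iteratedDeriv n (laplaceScaled μ Λ m c) y‖ ≤ C := by
  induction n generalizing m c with
  | zero =>
    obtain ⟨ε, hε, h0⟩ := hc.zero
    obtain ⟨D, hD⟩ := hc.compact.exists_bound_of_continuous hc.smooth.continuous
    refine ⟨Gamma (m + 1 / 2) * ε ^ (-((m : ℝ) + 1 / 2)) * D, fun μ Λ hμ hΛ => ⟨?_, fun y => ?_⟩⟩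
    · rw [Nat.cast_zero, contDiff_zero, continuous_iff_continuousAt]
      exact fun y => (hasDerivAt_laplaceScaled hμ hΛ m hc y).continuousAt
    · have hD0 : 0 ≤ D := (norm_nonneg _).trans (hD 0)
      have hG : 0 < Gamma (m + 1 / 2) := Real.Gamma_pos_of_pos (by positivity)
      rw [iteratedDeriv_zero, laplaceScaled]
      rcases le_or_gt y ε with hy | hy
      · rw [h0 y hy]; simp only [ofReal_zero, mul_zero, norm_zero]; positivity
      · have hy0 : 0 < y := hε.trans hy
        rw [norm_mul, norm_mul, norm_real, norm_real, Real.norm_of_nonneg (by positivity)]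
        have h1 := norm_laplaceP_le hμ m (mul_pos hΛ hy0)
        rw [Real.mul_rpow hΛ.le hy0.le] at h1
        have h2 : Λ ^ ((m : ℝ) + 1 / 2) * Λ ^ (-((m : ℝ) + 1 / 2)) = 1 := by
          rw [← rpow_add hΛ, add_neg_cancel, Real.rpow_zero]
        have h3 : y ^ (-((m : ℝ) + 1 / 2)) ≤ ε ^ (-((m : ℝ) + 1 / 2)) :=
          Real.rpow_le_rpow_of_nonpos hε hy.le (by have : (0:ℝ) ≤ m := m.cast_nonneg; linarith)
        calc _ ≤ Λ ^ ((m : ℝ) + 1 / 2) * (Gamma (m + 1 / 2) *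
              (Λ ^ (-((m : ℝ) + 1 / 2)) * y ^ (-((m : ℝ) + 1 / 2))) * D) := by
              gcongr
              exact hD y
          _ = Gamma (m + 1 / 2) * y ^ (-((m : ℝ) + 1 / 2)) * D := by
              linear_combination (Gamma (m + 1 / 2) * y ^ (-((m : ℝ) + 1 / 2)) * D) * h2
          _ ≤ _ := by gcongr
  | succ n ih =>
    obtain ⟨C, hC⟩ := ih (m + 1) hc
    obtain ⟨D, hD⟩ := ih m hc.deriv
    refine ⟨C + D, fun μ Λ hμ hΛ => ?_⟩
    obtain ⟨h1, h2⟩ := hC μ Λ hμ hΛ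
    obtain ⟨h3, h4⟩ := hD μ Λ hμ hΛ
    have hd : deriv (laplaceScaled μ Λ m c) = fun y =>
        -laplaceScaled μ Λ (m + 1) c y + laplaceScaled μ Λ m (deriv c) y :=
      funext fun y => (hasDerivAt_laplaceScaled hμ hΛ m hc y).deriv
    constructor
    · rw [Nat.cast_add, Nat.cast_one, contDiff_succ_iff_deriv]
      refine ⟨fun y => (hasDerivAt_laplaceScaled hμ hΛ m hc y).differentiableAt, by simp, ?_⟩
      rw [hd]
      exact h1.neg.add h3
    · intro y
      rw [iteratedDeriv_succ', hd, iteratedDeriv_fun_add h1.neg.contDiffAt h3.contDiffAt,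
        iteratedDeriv_fun_neg]
      refine (norm_add_le _ _).trans (add_le_add ?_ (h4 y))
      rw [norm_neg]; exact h2 y

/-- The rescaled functions are smooth, uniformly in the scale and in `μ`. -/
lemma UB.laplaceScaled {κ : Type*} {μ : κ → ℂ} {Λ : κ → ℝ} (hμ : ∀ i, 0 ≤ (μ i).im)
    (hΛ : ∀ i, 0 < Λ i) (m : ℕ) {c : ℝ → ℝ} (hc : IsPosCutoff c) :
    UB₀ (fun i => laplaceScaled (μ i) (Λ i) m c) :=
  .of_bound (fun _ => zero_le_one) (fun i => contDiff_infty.2 fun n =>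
      ((laplaceScaled_aux n m hc).choose_spec _ _ (hμ i) (hΛ i)).1) fun j => by
    obtain ⟨C, hC⟩ := laplaceScaled_aux j m hc
    refine ⟨C, fun i x => ?_⟩
    rw [norm_iteratedFDeriv_eq_norm_iteratedDeriv, mul_one]
    exact (hC _ _ (hμ i) (hΛ i)).2 x

/-- The constant in the formula for the Hankel function. -/
def hankelConst (μ : ℂ) : ℂ := (2 / (π * μ)) ^ (1 / 2 : ℂ) * exp (-(I * (π / 4))) /
    (Gamma (1 / 2) : ℂ)

lemma hankel_zero {μ : ℂ} (hμ : μ ≠ 0) {x : ℝ} (hx : 0 < x) :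
    hankel 0 (μ * x) = hankelConst μ * (exp (I * μ * x) * laplaceP μ 0 x) := by
  have hx' : (x : ℂ) ≠ 0 := by exact_mod_cast hx.ne'
  have h1 : (2 / (π * (μ * x)) : ℂ) ^ (1 / 2 : ℂ) =
      (2 / (π * μ)) ^ (1 / 2 : ℂ) * ((x ^ (-(1 / 2) : ℝ) : ℝ) : ℂ) := by
    have e : (2 / (π * (μ * x)) : ℂ) = ((x⁻¹ : ℝ) : ℂ) * (2 / (π * μ)) := by
      push_cast
      have : (π : ℂ) ≠ 0 := by exact_mod_cast Real.pi_ne_zero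
      field_simp
    have h2 : (2 / (π * μ) : ℂ) ≠ 0 := by simp [hμ, Real.pi_ne_zero]
    have h3 : ((x⁻¹ : ℝ) : ℂ) ≠ 0 := by simpa using hx.ne'
    rw [e, Complex.cpow_def_of_ne_zero (mul_ne_zero h3 h2),
      Complex.log_ofReal_mul (inv_pos.2 hx) h2, add_mul, exp_add,
      ← Complex.cpow_def_of_ne_zero h2, mul_comm]
    congr 1
    rw [Real.rpow_def_of_pos hx, Real.log_inv]
    push_cast
    congr 1; ring
  have h2 : ∫ s in Ioi (0 : ℝ), ((Real.exp (-s) * s ^ ((0 : ℝ) - 1 / 2) : ℝ) : ℂ) *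
      (1 + I * s / (2 * (μ * x))) ^ (((0 : ℝ) - 1 / 2 : ℝ) : ℂ) =
      ((x ^ (1 / 2 : ℝ) : ℝ) : ℂ) * laplaceP μ 0 x := by
    have := integral_comp_mul_left_Ioi (fun s : ℝ =>
      ((Real.exp (-s) * s ^ ((0 : ℝ) - 1 / 2) : ℝ) : ℂ) *
      (1 + I * s / (2 * (μ * x))) ^ (((0 : ℝ) - 1 / 2 : ℝ) : ℂ)) 0 hx
    rw [mul_zero, real_smul] at this
    have h3 : laplaceP μ 0 x = ((x ^ (1 / 2 : ℝ) : ℝ) : ℂ) * ∫ w in Ioi (0 : ℝ),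
        ((Real.exp (-(x * w)) * (x * w) ^ ((0 : ℝ) - 1 / 2) : ℝ) : ℂ) *
      (1 + I * (x * w : ℝ) / (2 * (μ * x))) ^ (((0 : ℝ) - 1 / 2 : ℝ) : ℂ) := by
      rw [laplaceP, ← integral_const_mul]
      refine setIntegral_congr_fun measurableSet_Ioi fun w hw => ?_
      have hw0 : 0 < w := hw
      have e1 : I * (x * w : ℝ) / (2 * (μ * x)) = I * w / (2 * μ) := by push_cast; field_simp
      have e2 : x ^ (1 / 2 : ℝ) * (x * w) ^ ((0 : ℝ) - 1 / 2) = w ^ ((0 : ℝ) - 1 / 2) := by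
        rw [Real.mul_rpow hx.le hw0.le, ← mul_assoc, ← rpow_add hx]
        norm_num
      simp only [e1]
      rw [← mul_assoc, ← ofReal_mul, mul_left_comm, e2]
      simp
    have e : ((x ^ (1 / 2 : ℝ) : ℝ) : ℂ) * ((x ^ (1 / 2 : ℝ) : ℝ) : ℂ) * ((x⁻¹ : ℝ) : ℂ) = 1 := by
      rw [← ofReal_mul, ← rpow_add hx, ← ofReal_mul]
      norm_num [hx.ne']
    rw [h3, this, ← mul_assoc (((x ^ (1 / 2 : ℝ) : ℝ) : ℂ)), ← mul_assoc _ ((x⁻¹ : ℝ) : ℂ), e, one_mul]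
  rw [hankel, hankelConst, h1, h2]
  simp only [zero_add, ofReal_zero, mul_zero, zero_div, sub_zero]
  rw [show I * (μ * x - π / 4) = I * μ * x + -(I * (π / 4)) by ring, exp_add]
  have h3 : ((x ^ (-(1 / 2) : ℝ) : ℝ) : ℂ) * ((x ^ (1 / 2 : ℝ) : ℝ) : ℂ) = 1 := by
    rw [← ofReal_mul, ← rpow_add hx]; norm_num
  linear_combination ((2 / (π * μ)) ^ (1 / 2 : ℂ) * exp (I * μ * x) * exp (-(I * (π / 4))) /
    (Gamma (1 / 2) : ℂ) * laplaceP μ 0 x) * h3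

/-- The amplitude of the derivative of the Hankel function. -/
def hankelAmp (μ : ℂ) (x : ℝ) : ℂ := hankelConst μ * (I * μ * laplaceP μ 0 x - laplaceP μ 1 x)

lemma hasDerivAt_hankel {μ : ℂ} (hμ : μ ≠ 0) (him : 0 ≤ μ.im) {x : ℝ} (hx : 0 < x) :
    HasDerivAt (fun x : ℝ => hankel 0 (μ * x)) (exp (I * μ * x) * hankelAmp μ x) x := by
  have h1 : HasDerivAt (fun x : ℝ => exp (I * μ * x)) (exp (I * μ * x) * (I * μ)) x := by
    have := ((hasDerivAt_id x).ofReal_comp.const_mul (I * μ)).cexp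
    simpa using this
  have h2 := (h1.mul (hasDerivAt_laplaceP him 0 hx)).const_mul (hankelConst μ)
  refine (h2.congr_deriv ?_).congr_of_eventuallyEq ?_
  · rw [hankelAmp, zero_add]; ring
  · filter_upwards [Ioi_mem_nhds hx] with y hy using hankel_zero hμ hy

lemma norm_hankelConst_le : ∃ C, 0 ≤ C ∧ ∀ μ : ℂ, 1 ≤ ‖μ‖ → ‖hankelConst μ‖ ≤ C := by
  refine ⟨1 / Gamma (1 / 2), by
    have := Real.Gamma_pos_of_pos (s := 1 / 2) (by norm_num)
    positivity, fun μ hμ => ?_⟩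
  have hG := Real.Gamma_pos_of_pos (s := 1 / 2) (by norm_num)
  rw [hankelConst, norm_div, norm_mul, norm_of_nonneg hG.le]
  gcongr
  have e : -(I * (π / 4)) = ((-(π / 4) : ℝ) : ℂ) * I := by push_cast; ring
  rw [e, Complex.norm_exp_ofReal_mul_I, mul_one,
    show (1 / 2 : ℂ) = ((1 / 2 : ℝ) : ℂ) by push_cast; rfl, Complex.norm_cpow_real]
  refine Real.rpow_le_one (norm_nonneg _) ?_ (by norm_num)
  rw [norm_div, norm_mul, norm_of_nonneg pi_pos.le]
  simp only [norm_ofNat]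
  rw [div_le_one (by have := pi_pos; positivity)]
  nlinarith [pi_gt_three]

/-- Uniform symbol bounds for the amplitude. -/
lemma UB.hankelAmp {κ : Type*} {μ : κ → ℂ} {Λ : κ → ℝ} (hμ : ∀ i, 0 ≤ (μ i).im)
    (hμ1 : ∀ i, 1 ≤ ‖μ i‖) {R : ℝ} (hR : ∀ i, ‖μ i‖ ≤ R)
    (hΛ : ∀ i, 0 < Λ i) {c : ℝ → ℝ} (hc : IsPosCutoff c) :
    UB (fun i => Λ i ^ (-(1 / 2) : ℝ) + Λ i ^ (-(3 / 2) : ℝ))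
      (fun i y => hankelAmp (μ i) (Λ i * y) * c y) := by
  obtain ⟨C, hC0, hC⟩ := norm_hankelConst_le
  have h0 := (UB.laplaceScaled hμ hΛ 0 hc).const_mul fun i =>
    hankelConst (μ i) * I * μ i * ((Λ i ^ (-(1 / 2) : ℝ) : ℝ) : ℂ)
  have h1 := (UB.laplaceScaled hμ hΛ 1 hc).const_mul fun i =>
    -hankelConst (μ i) * ((Λ i ^ (-(3 / 2) : ℝ) : ℝ) : ℂ)
  have hp : ∀ i (s : ℝ), 0 < Λ i ^ s := fun i s => rpow_pos_of_pos (hΛ i) s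
  have hw : ∀ i, 0 ≤ Λ i ^ (-(1 / 2) : ℝ) + Λ i ^ (-(3 / 2) : ℝ) := fun i =>
    add_nonneg (hp i _).le (hp i _).le
  have hR0 : ∀ i, 0 ≤ R := fun i => (norm_nonneg _).trans (hR i)
  rcases isEmpty_or_nonempty κ with hk | ⟨⟨i₀⟩⟩
  · exact ⟨fun i => hk.elim i, fun i => hk.elim i, fun j => ⟨0, le_rfl, fun i => hk.elim i⟩⟩
  have h0' := h0.mono (C := C * R) (mul_nonneg hC0 (hR0 i₀)) hw fun i => by
    simp only [norm_mul, norm_I, mul_one, norm_of_nonneg (hp i _).le]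
    have := (hp i (-(3 / 2))).le
    calc _ ≤ C * R * Λ i ^ (-(1 / 2) : ℝ) :=
          mul_le_mul_of_nonneg_right (mul_le_mul (hC _ (hμ1 i)) (hR i) (norm_nonneg _) hC0)
            (hp i _).le
      _ ≤ _ := mul_le_mul_of_nonneg_left (le_add_of_nonneg_right this) (mul_nonneg hC0 (hR0 i))
  have h1' := h1.mono (C := C) hC0 hw fun i => by
    simp only [norm_mul, norm_neg, mul_one, norm_of_nonneg (hp i _).le]
    have := (hp i (-(1 / 2))).le
    calc _ ≤ C * Λ i ^ (-(3 / 2) : ℝ) :=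
          mul_le_mul_of_nonneg_right (hC _ (hμ1 i)) (hp i _).le
      _ ≤ _ := mul_le_mul_of_nonneg_left (le_add_of_nonneg_left this) hC0
  have e : (fun i y => Billiard.hankelAmp (μ i) (Λ i * y) * c y) = fun i y =>
      hankelConst (μ i) * I * μ i * ((Λ i ^ (-(1 / 2) : ℝ) : ℝ) : ℂ) *
        Billiard.laplaceScaled (μ i) (Λ i) 0 c y +
      -hankelConst (μ i) * ((Λ i ^ (-(3 / 2) : ℝ) : ℝ) : ℂ) *
        Billiard.laplaceScaled (μ i) (Λ i) 1 c y := by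
    ext i y
    have a0 : ((Λ i ^ (-(1 / 2) : ℝ) : ℝ) : ℂ) * ((Λ i ^ (((0 : ℕ) : ℝ) + 1 / 2) : ℝ) : ℂ) = 1 := by
      rw [← ofReal_mul, ← rpow_add (hΛ i)]; norm_num
    have a1 : ((Λ i ^ (-(3 / 2) : ℝ) : ℝ) : ℂ) * ((Λ i ^ (((1 : ℕ) : ℝ) + 1 / 2) : ℝ) : ℂ) = 1 := by
      rw [← ofReal_mul, ← rpow_add (hΛ i)]; norm_num
    rw [Billiard.hankelAmp, Billiard.laplaceScaled, Billiard.laplaceScaled]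
    linear_combination (-(hankelConst (μ i) * I * μ i * laplaceP (μ i) 0 (Λ i * y) * c y)) *
      a0 + hankelConst (μ i) * laplaceP (μ i) 1 (Λ i * y) * c y * a1
  rw [e]
  exact h0'.add h1'

lemma hasDerivAt_norm {f : ℝ → ℂ} {f' : ℂ} {t : ℝ} (hf : HasDerivAt f f' t) (h : f t ≠ 0) :
    HasDerivAt (fun t => ‖f t‖) (inner ℝ (f t) f' / ‖f t‖) t := by
  have h1 := (hf.norm_sq).sqrt (by simpa using h)
  simp only [Real.sqrt_sq (norm_nonneg _)] at h1
  refine h1.congr_deriv ?_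
  rw [mul_div_mul_left _ _ (two_ne_zero' ℝ)]

/-- An explicit formula for the kernel of `N`, with `lam = k * μ`. -/
lemma kernelN_eq {q : ℝ → ℂ} {k : ℝ} (hk : 0 < k) {μ : ℂ} (hμ : μ ≠ 0) (him : 0 ≤ μ.im)
    {φ θ : ℝ} (h : q φ ≠ q θ) :
    kernelN q (k * μ) φ θ = I / 2 * k *
      (exp (I * μ * (k * ‖q φ - q θ‖ : ℝ)) * hankelAmp μ (k * ‖q φ - q θ‖)) *
      ((inner ℝ (q θ - q φ) (normal q θ) / ‖q φ - q θ‖ : ℝ) : ℂ) := by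
  have h0 : q φ - q θ ≠ 0 := sub_ne_zero.2 h
  have h1 : HasDerivAt (fun t : ℝ => q φ - (q θ + t • normal q θ)) (-normal q θ) 0 := by
    simpa using (((hasDerivAt_id (0 : ℝ)).smul_const (normal q θ)).const_add (q θ)).const_sub (q φ)
  have h2 : HasDerivAt (fun t : ℝ => k * ‖q φ - (q θ + t • normal q θ)‖)
      (k * (inner ℝ (q θ - q φ) (normal q θ) / ‖q φ - q θ‖)) 0 := by
    have := (hasDerivAt_norm h1 (by simpa using h0)).const_mul k
    refine this.congr_deriv ?_
    simp only [zero_smul, add_zero]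
    rw [inner_neg_right, ← inner_neg_left, neg_sub]
  have hr : 0 < k * ‖q φ - q θ‖ := mul_pos hk (norm_pos_iff.2 h0)
  have h3 := HasDerivAt.scomp (0 : ℝ) (h := fun t : ℝ => k * ‖q φ - (q θ + t • normal q θ)‖)
    (g₁ := fun x : ℝ => hankel 0 (μ * x)) (by simpa using hasDerivAt_hankel hμ him hr) h2
  have h4 := h3.const_mul (I / 4)
  have h5 := HasDerivAt.congr_of_eventuallyEq (f₁ := fun t : ℝ =>
      freeGreen (k * μ) (q φ) (q θ + t • normal q θ)) h4 <| Eventually.of_forall fun t => by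
    simp only [freeGreen, Function.comp]
    congr 2; push_cast; ring
  have h6 : lineDeriv ℝ (fun y : ℂ => freeGreen (k * μ) (q φ) y) (q θ) (normal q θ) = _ := h5.deriv
  rw [kernelN, h6, real_smul]
  push_cast
  ring

/-! ### Oscillatory integrals on the half line -/

lemma exists_isPosCutoff {a b : ℝ} (ha : 0 < a) (hab : a < b) :
    ∃ c : ℝ → ℝ, IsPosCutoff c ∧ ∀ x ∈ Icc a b, c x = 1 := by
  let c : ContDiffBump ((a + b) / 2) := ⟨(b - a) / 2, b / 2, by linarith, by linarith⟩
  refine ⟨c, ⟨c.contDiff, c.hasCompactSupport, a / 2, by positivity, fun x hx => ?_⟩,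
    fun x hx => ?_⟩
  · refine c.zero_of_le_dist ?_
    rw [Real.dist_eq, abs_sub_comm]
    refine le_trans ?_ (le_abs_self _)
    change b / 2 ≤ _; linarith
  · refine c.one_of_mem_closedBall ?_
    rw [Metric.mem_closedBall, Real.dist_eq]
    change _ ≤ (b - a) / 2
    rw [abs_le]; constructor <;> linarith [hx.1, hx.2]

section HalfLine

/-- A family of functions on `(0, ∞)` with uniform symbol bounds, of order `R` at infinity and
of order `-3/2` at zero. -/
def SymbolFamily (R : ℕ) (f : ι → ℝ → ℂ) : Prop := ∀ c : ℝ → ℝ, IsPosCutoff c →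
    UB (fun p : ι × Ioi (0 : ℝ) => (p.2 : ℝ) ^ R + (p.2 : ℝ) ^ (-(3 / 2) : ℝ))
      (fun p y => f p.1 (p.2 * y) * c y)

lemma SymbolFamily.contDiffOn {R : ℕ} {f : ι → ℝ → ℂ} (hf : SymbolFamily R f) (i : ι) :
    ContDiffOn ℝ ∞ (f i) (Ioi 0) := by
  intro y hy
  have hy0 : 0 < y := hy
  obtain ⟨c, hc, hc1⟩ := exists_isPosCutoff (a := y / 2) (b := 2 * y) (by positivity) (by linarith)
  have h := ((hf c hc).smooth (i, ⟨1, mem_Ioi.2 one_pos⟩)).contDiffAt (x := y)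
  refine ContDiffAt.contDiffWithinAt (h.congr_of_eventuallyEq ?_)
  filter_upwards [Icc_mem_nhds (show y / 2 < y by linarith) (show y < 2 * y by linarith)] with z hz
  simp [hc1 z hz]

/-- The derivative of `u Θ(x, u)` with respect to `u`. -/
def radialDeriv (Θ : E × ℝ → ℂ) (p : E × ℝ) : ℂ := Θ p + p.2 * fderiv ℝ Θ p (0, 1)

/-- The data of an oscillatory integral on the half line: `k` is the large parameter, the phase
is `s Θ(x, s / k)`, and the amplitude is `s f(s ρ(x, s / k)) B(x, s / k)`. -/
structure HalfLineData (R : ℕ) (k : ι → ℝ) (Θ : ι → E × ℝ → ℂ) (ρ : ι → E × ℝ → ℝ)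
    (f : ι → ℝ → ℂ) (B : ι → E × ℝ → ℂ) : Prop where
  one_le : ∀ i, 1 ≤ k i
  phase : UB₀ Θ
  radius : UB₀ ρ
  radius_mem : ∀ i p, ρ i p ∈ Icc (1 / 4 : ℝ) 2
  symbol : SymbolFamily R f
  amp : UB₀ B
  support : ∀ i x u, 1 ≤ u → B i (x, u) = 0
  im_nonneg : ∀ i x u, 0 < u → B i (x, u) ≠ 0 → 0 ≤ (Θ i (x, u)).im
  nonstationary : ∃ c > 0, ∀ i x u, 0 < u → B i (x, u) ≠ 0 → c ≤ ‖radialDeriv (Θ i) (x, u)‖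

/-- The integrand of an oscillatory integral on the half line. -/
def halfLineIntegrand (k : ℝ) (Θ : E × ℝ → ℂ) (ρ : E × ℝ → ℝ) (f : ℝ → ℂ) (B : E × ℝ → ℂ)
    (x : E) (s : ℝ) : ℂ :=
  exp (I * s * Θ (x, s / k)) * (s * f (s * ρ (x, s / k))) * B (x, s / k)

variable {R : ℕ} {k : ι → ℝ} {Θ : ι → E × ℝ → ℂ} {ρ : ι → E × ℝ → ℝ}
    {f : ι → ℝ → ℂ} {B : ι → E × ℝ → ℂ}

local notation "HLD" => HalfLineData R k Θ ρ f B
local notation:max "𝓗" i:max => halfLineIntegrand (k i) (Θ i) (ρ i) (f i) (B i)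

lemma HalfLineData.contDiffOn (h : HLD) (i : ι) : ContDiffOn ℝ ∞ (fun p : E × ℝ => 𝓗 i p.1 p.2)
      (univ ×ˢ Ioi 0) := by
  have hp : Smooth (fun p : E × ℝ => (p.1, p.2 / k i)) := by fun_prop
  have h1 := (h.phase.smooth i).comp hp
  have h2 := (h.radius.smooth i).comp hp
  have h3 := (h.amp.smooth i).comp hp
  have h4 : Smooth (fun p : E × ℝ => (p.2 : ℂ)) := ofRealCLM.contDiff.comp contDiff_snd
  have h5 : ContDiffOn ℝ ∞ (fun p : E × ℝ => f i (p.2 * ρ i (p.1, p.2 / k i))) (univ ×ˢ Ioi 0) := by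
    refine (h.symbol.contDiffOn i).comp (contDiff_snd.mul h2).contDiffOn fun p hp => ?_
    have := (h.radius_mem i (p.1, p.2 / k i)).1
    exact mul_pos (mem_Ioi.1 hp.2) (lt_of_lt_of_le (by norm_num) this)
  exact ((contDiff_exp.comp ((contDiff_const.mul h4).mul h1)).contDiffOn.mul
    (h4.contDiffOn.mul h5)).mul h3.contDiffOn

/-- A smooth function, one for `s ≤ 1` and zero for `s ≥ 2`. -/
def lowCutoff (s : ℝ) : ℝ := smoothTransition (2 - s)

lemma contDiff_lowCutoff : Smooth lowCutoff := smoothTransition.contDiff.comp (by fun_prop)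

lemma lowCutoff_eq_one {s : ℝ} (hs : s ≤ 1) : lowCutoff s = 1 :=
  smoothTransition.one_of_one_le (by linarith)

lemma lowCutoff_eq_zero {s : ℝ} (hs : 2 ≤ s) : lowCutoff s = 0 :=
  smoothTransition.zero_of_nonpos (by linarith)

lemma lowCutoff_mem (s : ℝ) : lowCutoff s ∈ Icc (0 : ℝ) 1 :=
  ⟨smoothTransition.nonneg _, smoothTransition.le_one _⟩

lemma integrableOn_low_weight (R : ℕ) :
    IntegrableOn (fun s : ℝ => s * (s ^ R + s ^ (-(3 / 2) : ℝ))) (Ioc 0 2) := by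
  have h1 : IntervalIntegrable (fun s : ℝ => s ^ (-(1 / 2) : ℝ)) volume 0 2 :=
    intervalIntegral.intervalIntegrable_rpow' (by norm_num)
  have h2 : IntervalIntegrable (fun s : ℝ => s ^ (R + 1)) volume 0 2 :=
    (continuous_pow (R + 1)).intervalIntegrable _ _
  have h3 := (h2.add h1)
  rw [intervalIntegrable_iff_integrableOn_Ioc_of_le (by norm_num)] at h3
  refine h3.congr_fun (fun s hs => ?_) measurableSet_Ioc
  have hs0 : 0 < s := hs.1
  simp only
  rw [mul_add, ← pow_succ', show (-(1 / 2) : ℝ) = 1 + -(3 / 2) by norm_num, rpow_add hs0, rpow_one]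

lemma HalfLineData.low_bound (h : HLD) (j : ℕ) : ∃ C, 0 ≤ C ∧ ∀ i, ∀ s ∈ Ioc (0 : ℝ) 2, ∀ x,
      ‖𝐃 j (fun x => 𝓗 i x s * (lowCutoff s : ℂ)) x‖ ≤ C * (s * (s ^ R + s ^ (-(3 / 2) : ℝ))) := by
  let κ := ι × Ioc (0 : ℝ) 2
  have hin : UB₁ (fun (p : κ) (x : E) => (x, (p.2 : ℝ) / k p.1)) :=
    UB₁.prodMk_const fun p : κ => (p.2 : ℝ) / k p.1
  have hΘ := (h.phase.reindex (fun p : κ => p.1)).comp hin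
  have hρ := (h.radius.reindex (fun p : κ => p.1)).comp hin
  have hB := (h.amp.reindex (fun p : κ => p.1)).comp hin
  obtain ⟨c, hc, hc1⟩ := exists_isPosCutoff (a := 1 / 4) (b := 2) (by norm_num) (by norm_num)
  have hf := ((h.symbol c hc).reindex (fun p : κ =>
    (p.1, (⟨p.2, p.2.2.1⟩ : Ioi (0 : ℝ))))).comp hρ.ub₁
  have hs : ∀ p : κ, ‖(I * ((p.2 : ℝ) : ℂ))‖ ≤ 2 := fun p => by
    have := p.2.2
    simp only [norm_mul, norm_I, one_mul, norm_of_nonneg this.1.le]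
    exact this.2
  have hg : UB₁ (fun (p : κ) (x : E) => I * ((p.2 : ℝ) : ℂ) * Θ p.1 (x, (p.2 : ℝ) / k p.1)) :=
    ((hΘ.const_mul fun p : κ => I * ((p.2 : ℝ) : ℂ)).mono (C := 2) zero_le_two
      (fun _ => zero_le_one) fun p => by simpa using hs p).ub₁
  have h1 := UB.cexp_mul_one hg (hf.mul_bdd hB) fun p x hx => by
    have h0 := h.im_nonneg p.1 x ((p.2 : ℝ) / k p.1)
      (div_pos p.2.2.1 (by linarith [h.one_le p.1])) (right_ne_zero_of_mul hx)
    have := mul_nonneg p.2.2.1.le h0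
    rw [mul_assoc, Complex.I_mul_re, Complex.im_ofReal_mul]
    linarith
  have h2 := h1.const_mul fun p : κ => ((p.2 : ℝ) : ℂ) * (lowCutoff p.2 : ℂ)
  obtain ⟨C, h0, hC⟩ := h2.bound j
  refine ⟨C, h0, fun i s hs x => ?_⟩
  have key := hC (i, ⟨s, hs⟩) x
  have e : (fun x => 𝓗 i x s * (lowCutoff s : ℂ)) =
      fun x => ((s : ℝ) : ℂ) * (lowCutoff s : ℂ) * (exp (I * (s : ℂ) *
        Θ i (x, s / k i)) * (f i (s * ρ i (x, s / k i)) * c (ρ i (x, s / k i)) *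
        B i (x, s / k i))) := by
    ext x
    rw [halfLineIntegrand, hc1 _ (h.radius_mem i _)]
    push_cast; ring
  rw [e]
  refine key.trans (mul_le_mul_of_nonneg_left ?_ h0)
  have hw : 0 ≤ s ^ R + s ^ (-(3 / 2) : ℝ) := by have := hs.1; positivity
  have hb := lowCutoff_mem s
  rw [norm_mul, norm_real, norm_real, Real.norm_of_nonneg hs.1.le, Real.norm_of_nonneg hb.1]
  have := mul_le_of_le_one_right hs.1.le hb.2
  exact mul_le_mul_of_nonneg_right this hw

lemma HalfLineData.low (h : HLD) : UB₀ (fun i x => ∫ s in Ioc (0 : ℝ) 2,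
      𝓗 i x s * (lowCutoff s : ℂ)) := by
  have hb : Smooth (fun p : E × ℝ => (lowCutoff p.2 : ℂ)) :=
    ofRealCLM.contDiff.comp (contDiff_lowCutoff.comp contDiff_snd)
  have hnn : 0 ≤ ∫ s in Ioc (0 : ℝ) 2, s * (s ^ R + s ^ (-(3 / 2) : ℝ)) :=
    setIntegral_nonneg measurableSet_Ioc fun s hs => by have := hs.1; positivity
  have h1 := UB.integral (f := fun i (p : E × ℝ) => 𝓗 i p.1 p.2 * (lowCutoff p.2 : ℂ))
    (w := fun _ => ∫ s in Ioc (0 : ℝ) 2, s * (s ^ R + s ^ (-(3 / 2) : ℝ)))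
    isOpen_Ioi (fun i => (h.contDiffOn i).mul hb.contDiffOn)
    (μ := fun _ => volume.restrict (Ioc (0 : ℝ) 2))
    (fun i => by exact ae_restrict_of_forall_mem measurableSet_Ioc fun s hs => hs.1)
    (m := fun _ s => s * (s ^ R + s ^ (-(3 / 2) : ℝ)))
    (fun i => integrableOn_low_weight R) (fun i => le_rfl) (fun i => hnn) fun j => by
    obtain ⟨C, h0, hC⟩ := h.low_bound j
    refine ⟨C, h0, fun i => ?_⟩
    exact ae_restrict_of_forall_mem measurableSet_Ioc fun s hs x => hC i s hs x
  exact h1.mono hnn (fun _ => zero_le_one) fun i => (mul_one _).ge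

/-- The dyadic cutoff, supported in `1 ≤ v ≤ 4`. -/
def dyadicCutoff (v : ℝ) : ℝ := lowCutoff (v / 2) - lowCutoff v

lemma dyadicCutoff_eq_zero {v : ℝ} (hv : v ≤ 1 ∨ 4 ≤ v) : dyadicCutoff v = 0 := by
  rcases hv with hv | hv
  · rw [dyadicCutoff, lowCutoff_eq_one hv, lowCutoff_eq_one (by linarith), sub_self]
  · rw [dyadicCutoff, lowCutoff_eq_zero (by linarith), lowCutoff_eq_zero (by linarith), sub_self]

lemma sum_dyadicCutoff (n : ℕ) (s : ℝ) :
    ∑ j ∈ Finset.range n, dyadicCutoff (s / 2 ^ j) = lowCutoff (s / 2 ^ n) - lowCutoff s := by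
  have := Finset.sum_range_sub (fun j => lowCutoff (s / 2 ^ j)) n
  simp only [pow_zero, div_one] at this
  rw [← this]
  refine sum_congr rfl fun j _ => ?_
  rw [dyadicCutoff, pow_succ, div_div]

lemma contDiff_dyadicCutoff : Smooth dyadicCutoff :=
  (contDiff_lowCutoff.comp (contDiff_id.div_const 2)).sub contDiff_lowCutoff

lemma UB.dyadicCutoff : UB₀ (fun (_ : ι) => Billiard.dyadicCutoff) := by
  refine UB.of_hasCompactSupport contDiff_dyadicCutoff ?_
  refine HasCompactSupport.of_support_subset_isCompact (isCompact_Icc (a := (1 : ℝ))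
    (b := 4)) fun x hx => ?_
  by_contra h
  rw [mem_Icc, not_and_or, not_le, not_le] at h
  exact hx (dyadicCutoff_eq_zero (h.imp le_of_lt le_of_lt))

/-- A smooth bounded function that is the identity on `[-5, 5]`. -/
def truncId (v : ℝ) : ℝ := v * bump 5 v

lemma truncId_eq {v : ℝ} (hv : |v| ≤ 5) : truncId v = v := by
  rw [truncId, bump_eq_one (by norm_num) hv, mul_one]

lemma UB.truncId : UB₀ (fun (_ : ι) => Billiard.truncId) := by
  refine UB.of_hasCompactSupport (contDiff_id.mul (contDiff_bump 5)) ?_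
  refine HasCompactSupport.of_support_subset_isCompact (isCompact_Icc (a := -(2 * 5 : ℝ))
    (b := 2 * 5)) fun x hx => ?_
  by_contra h
  refine hx ?_
  rw [mem_Icc, ← abs_le, not_le] at h
  change x * Billiard.bump 5 x = 0
  rw [bump_eq_zero (by norm_num : (0 : ℝ) < 5) h.le, mul_zero]

lemma UB.ite {w : ι → ℝ} (hw : ∀ i, 0 ≤ w i) {P : ι → Prop} [DecidablePred P] {g : ι → E → F}
    (h : UB (fun i : {i // P i} => w i) (fun i => g i)) :
    UB w (fun i x => if P i then g i x else 0) :=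
  .of_bound hw (fun i => by
      by_cases hi : P i
      · simpa [hi] using h.smooth ⟨i, hi⟩
      · simpa [hi] using contDiff_const) fun j => by
    obtain ⟨C, h0, hC⟩ := h.bound j
    refine ⟨C, fun i x => ?_⟩
    by_cases hi : P i
    · simpa [hi] using hC ⟨i, hi⟩ x
    · simpa [hi] using mul_nonneg h0 (hw i)

lemma HalfLineData.dyadic (h : HLD) : UB (fun p : ι × ℕ => 1 * (1 / 2 : ℝ) ^ p.2) (fun p x =>
      if (2 : ℝ) ^ p.2 ≤ k p.1 then (2 : ℂ) ^ p.2 * (2 : ℂ) ^ p.2 * ∫ v in (1 / 2 : ℝ)..5,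
        exp (((2 : ℝ) ^ p.2 : ℝ) * (I * (v * Θ p.1 (x, 2 ^ p.2 / k p.1 * v)))) *
        ((v * dyadicCutoff v : ℝ) * f p.1 (2 ^ p.2 * (v * ρ p.1 (x, 2 ^ p.2 / k p.1 * v))) *
          B p.1 (x, 2 ^ p.2 / k p.1 * v)) else 0) := by
  obtain ⟨c, hc, hns⟩ := h.nonstationary
  let κ := {p : ι × ℕ // (2 : ℝ) ^ p.2 ≤ k p.1}
  let Λ : κ → ℝ := fun p => 2 ^ p.1.2
  let t : κ → ℝ := fun p => Λ p / k p.1.1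
  have hk0 : ∀ p : κ, 0 < k p.1.1 := fun p => zero_lt_one.trans_le (h.one_le _)
  have hΛ : ∀ p, 1 ≤ Λ p := fun p => one_le_pow₀ one_le_two
  have ht0' : ∀ p, 0 < t p := fun p => div_pos (zero_lt_one.trans_le (hΛ p)) (hk0 p)
  have ht0 : ∀ p, 0 ≤ t p := fun p => (ht0' p).le
  have ht1 : ∀ p, t p ≤ 1 := fun p => (div_le_one (hk0 p)).2 p.2
  have hin : UB₁ (fun (p : κ) (z : E × ℝ) => (z.1, t p * z.2)) := by
    have := UB₁.affine (ι := κ) (E := E × ℝ) (F := E × ℝ) (fun p =>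
      (fst ℝ E ℝ).prod (t p • snd ℝ E ℝ)) (fun _ => 0)
      (C := 1) fun p => by
        refine ContinuousLinearMap.opNorm_le_bound _ zero_le_one fun z => ?_
        rw [one_mul]
        refine max_le (le_max_left _ _) ?_
        refine le_trans ?_ (le_max_right _ _)
        change ‖t p * z.2‖ ≤ ‖z.2‖
        rw [norm_mul, Real.norm_of_nonneg (ht0 p)]
        exact mul_le_of_le_one_left (norm_nonneg _) (ht1 p)
    simpa using this
  have hsnd : UB₁ (fun (_ : κ) (z : E × ℝ) => z.2) := UB₁.linear (snd ℝ E ℝ)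
  have hζ := (UB.truncId (ι := κ)).comp hsnd
  have hθ := (UB.dyadicCutoff (ι := κ)).comp hsnd
  have hΘ := (h.phase.reindex (fun p : κ => p.1.1)).comp hin
  have hρ := (h.radius.reindex (fun p : κ => p.1.1)).comp hin
  have hB := (h.amp.reindex (fun p : κ => p.1.1)).comp hin
  have hF := (hζ.clm ofRealCLM).mul_bdd hΘ
  have hζρ := hζ.mul_bdd hρ
  obtain ⟨c2, hc2, hc21⟩ := exists_isPosCutoff (a := 1 / 4) (b := 8) (by norm_num) (by norm_num)
  have hf := ((h.symbol c2 hc2).reindex (fun p : κ =>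
    (p.1.1, (⟨Λ p, by exact zero_lt_one.trans_le (hΛ p)⟩ : Ioi (0 : ℝ))))).comp hζρ.ub₁
  let A : κ → E × ℝ → ℂ := fun p z => f p.1.1 (Λ p * (truncId z.2 * ρ p.1.1 (z.1, t p * z.2))) *
    c2 (truncId z.2 * ρ p.1.1 (z.1, t p * z.2)) * B p.1.1 (z.1, t p * z.2) *
    ofRealCLM (truncId z.2 * dyadicCutoff z.2)
  have hA : UB _ A := ((hf.mul_bdd hB).mul_bdd ((hζ.mul_bdd hθ).clm ofRealCLM))
  have hH := (hF.fderiv_apply ((0, 1) : E × ℝ)).comp_smooth (contDiff_complexInv hc)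
  have hthsupp : ∀ v : ℝ, dyadicCutoff v ≠ 0 → 1 < v ∧ v < 4 := fun v hv => by
    by_contra hcon
    rw [not_and_or, not_lt, not_lt] at hcon
    exact hv (dyadicCutoff_eq_zero hcon)
  have hder : ∀ (p : κ) (z : E × ℝ), |z.2| < 5 → fderiv ℝ (fun z : E × ℝ =>
      ofRealCLM (truncId z.2) * Θ p.1.1 (z.1, t p * z.2)) z (0, 1) =
      radialDeriv (Θ p.1.1) (z.1, t p * z.2) := fun p z hz => by
    have e1 : HasDerivAt (fun v : ℝ => (v : ℂ) * Θ p.1.1 (z.1, t p * v))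
        (1 * Θ p.1.1 (z.1, t p * z.2) +
          z.2 * fderiv ℝ (Θ p.1.1) (z.1, t p * z.2) (0, t p)) z.2 := by
      refine (hasDerivAt_id z.2).ofReal_comp.mul ?_
      refine ((h.phase.smooth p.1.1).differentiable (by simp) _).hasFDerivAt.comp_hasDerivAt z.2 ?_
      refine (hasDerivAt_const z.2 z.1).prodMk ?_
      simpa using (hasDerivAt_id z.2).const_mul (t p)
    have e2 := ((hF.smooth p).differentiable (by simp) z).hasFDerivAt.comp_hasDerivAt z.2
      ((hasDerivAt_const z.2 z.1).prodMk (hasDerivAt_id z.2))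
    have e3 := e2.congr_of_eventuallyEq (f₁ := fun v : ℝ => (v : ℂ) * Θ p.1.1 (z.1, t p * v)) <| by
      have : Ioo (-5 : ℝ) 5 ∈ 𝓝 z.2 := Ioo_mem_nhds (abs_lt.1 hz).1 (abs_lt.1 hz).2
      filter_upwards [this] with v hv
      simp [truncId_eq (abs_le.2 ⟨hv.1.le, hv.2.le⟩)]
    have e4 := e3.unique e1
    refine e4.trans ?_
    rw [radialDeriv, one_mul]
    have : ((0 : E), t p) = t p • ((0 : E), (1 : ℝ)) := by simp
    rw [this, map_smul, real_smul]
    push_cast; ring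
  have hAne : ∀ p z, A p z ≠ 0 → (1 < z.2 ∧ z.2 < 4) ∧ B p.1.1 (z.1, t p * z.2) ≠ 0 := fun p z hz => by
    refine ⟨hthsupp _ fun h0 => right_ne_zero_of_mul hz (by simp [h0]),
      right_ne_zero_of_mul (left_ne_zero_of_mul hz)⟩
  have hbd : ∀ p x v₀, v₀ < 1 ∨ 4 < v₀ → ∀ᶠ v in 𝓝 v₀, A p (x, v) = 0 := fun p x v₀ hv => by
    have : ∀ᶠ v in 𝓝 v₀, dyadicCutoff v = 0 := by
      rcases hv with hv | hv
      · filter_upwards [Iio_mem_nhds hv] with v hv using dyadicCutoff_eq_zero (Or.inl (le_of_lt hv))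
      · filter_upwards [Ioi_mem_nhds hv] with v hv using dyadicCutoff_eq_zero (Or.inr (le_of_lt hv))
    exact this.mono fun v hv => by simp [A, hv]
  have main := UB.nonstationary hF.ub₁ hΛ hA hH (fun p z => by
      by_cases hz : A p z = 0
      · simp only [hz, mul_zero]
      · obtain ⟨h1, h2⟩ := hAne p z hz
        have h3 := hder p z (abs_lt.2 ⟨by linarith [h1.1], by linarith [h1.2]⟩)
        rw [complexInv_mul hc, one_mul]
        rw [h3]
        exact hns _ _ _ (mul_pos (ht0' p) (by linarith [h1.1])) h2)
    (fun p z hz => by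
      obtain ⟨h1, h2⟩ := hAne p z hz
      have h4 := h.im_nonneg p.1.1 z.1 _ (mul_pos (ht0' p) (by linarith [h1.1])) h2
      rw [truncId_eq (abs_le.2 ⟨by linarith [h1.1], by linarith [h1.2]⟩)]
      simpa using mul_nonneg (by linarith [h1.1] : (0 : ℝ) ≤ z.2) h4)
    (a := 1 / 2) (b := 5) (by norm_num)
    (fun p x => hbd p x _ (Or.inl (by norm_num))) (fun p x => hbd p x _ (Or.inr (by norm_num)))
    (R + 3)
  have main2 := (main.const_mul fun p : κ => (2 : ℂ) ^ p.1.2 * (2 : ℂ) ^ p.1.2).mono (C := 2)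
    (w' := fun p : κ => 1 * (1 / 2 : ℝ) ^ p.1.2) zero_le_two (fun p => by positivity) fun p => by
      have hL := hΛ p
      have hL0 : 0 < Λ p := zero_lt_one.trans_le hL
      have e1 : ‖(2 : ℂ) ^ p.1.2 * (2 : ℂ) ^ p.1.2‖ = Λ p ^ 2 := by simp [Λ, sq]
      have e2 : Λ p ^ (-(3 / 2) : ℝ) ≤ Λ p ^ R :=
        (Real.rpow_le_one_of_one_le_of_nonpos hL (by norm_num)).trans (one_le_pow₀ hL)
      have e3 : (1 / 2 : ℝ) ^ p.1.2 = (Λ p)⁻¹ := by simp [Λ]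
      simp only [one_mul]
      rw [e1, e3]
      calc Λ p ^ 2 * ((Λ p ^ R + Λ p ^ (-(3 / 2) : ℝ)) * (Λ p)⁻¹ ^ (R + 3))
          ≤ Λ p ^ 2 * ((Λ p ^ R + Λ p ^ R) * (Λ p)⁻¹ ^ (R + 3)) := by gcongr
        _ = 2 * (Λ p)⁻¹ := by
          rw [inv_pow, pow_add]
          field_simp
          ring
  refine UB.ite (P := fun p : ι × ℕ => (2 : ℝ) ^ p.2 ≤ k p.1) (fun p => by positivity) ?_
  refine cast ?_ main2
  congr 1
  ext p x
  congr 1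
  refine int_congr fun v hv => ?_
  rw [uIcc_of_le (by norm_num)] at hv
  have hv5 : truncId v = v := truncId_eq (abs_le.2 ⟨by linarith [hv.1], hv.2⟩)
  simp only [A]
  rw [hv5]
  have hρm := h.radius_mem p.1.1 (x, t p * v)
  by_cases hd : dyadicCutoff v = 0
  · simp [hd]
  · have hd' := hthsupp v hd
    rw [hc21 _ ⟨by nlinarith [hρm.1], by nlinarith [hρm.2, hρm.1]⟩]
    simp only [Λ, t]
    simp only [Complex.ofRealCLM_apply, ofReal_one, mul_one]
    ring

lemma halfLineIntegrand_eq_zero (h : HLD) (i : ι) (x : E) {s : ℝ} (hs : k i ≤ s) : 𝓗 i x s = 0 := by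
  have hk : 0 < k i := zero_lt_one.trans_le (h.one_le i)
  rw [halfLineIntegrand, h.support i x _ ((one_le_div hk).2 hs), mul_zero]

/-- A dyadic piece of the integral. -/
lemma HalfLineData.piece_eq (h : HLD) (i : ι) (j : ℕ) (x : E) : ∫ s in Ioi (0 : ℝ), 𝓗 i x s *
      (dyadicCutoff (s / 2 ^ j) : ℂ) =
      if (2 : ℝ) ^ j ≤ k i then (2 : ℂ) ^ j * (2 : ℂ) ^ j * ∫ v in (1 / 2 : ℝ)..5,
        exp (((2 : ℝ) ^ j : ℝ) * (I * (v * Θ i (x, 2 ^ j / k i * v)))) *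
        ((v * dyadicCutoff v : ℝ) * f i (2 ^ j * (v * ρ i (x, 2 ^ j / k i * v))) *
          B i (x, 2 ^ j / k i * v)) else 0 := by
  have hk : 0 < k i := zero_lt_one.trans_le (h.one_le i)
  have h2 : (0 : ℝ) < 2 ^ j := by positivity
  split_ifs with hj
  · have e1 := integral_comp_mul_left_Ioi (fun s : ℝ =>
      𝓗 i x s * (dyadicCutoff (s / 2 ^ j) : ℂ)) 0 h2
    rw [mul_zero] at e1
    have e2 : ∫ s in Ioi (0 : ℝ), 𝓗 i x s *
      (dyadicCutoff (s / 2 ^ j) : ℂ) = (2 : ℂ) ^ j * ∫ v in Ioi (0 : ℝ), 𝓗 i x (2 ^ j * v) *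
          (dyadicCutoff (2 ^ j * v / 2 ^ j) : ℂ) := by
      rw [e1, real_smul, ← mul_assoc]
      push_cast
      rw [mul_inv_cancel₀ (pow_ne_zero _ two_ne_zero), one_mul]
    rw [e2, mul_assoc]
    congr 1
    rw [integral_of_le (by norm_num), ← integral_const_mul]
    rw [setIntegral_eq_of_subset_of_forall_sdiff_eq_zero measurableSet_Ioi
      (s := Ioc (1 / 2 : ℝ) 5) (fun v hv => lt_trans (by norm_num) hv.1)]
    · refine setIntegral_congr_fun measurableSet_Ioc fun v hv => ?_
      have e3 : 2 ^ j * v / k i = 2 ^ j / k i * v := by ring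
      have e4 : 2 ^ j * v / 2 ^ j = v := mul_div_cancel_left₀ v h2.ne'
      simp only [halfLineIntegrand, e3, e4]
      have e5 : I * ((2 ^ j * v : ℝ) : ℂ) * Θ i (x, 2 ^ j / k i * v) =
        ((2 : ℝ) ^ j : ℝ) * (I * (v * Θ i (x, 2 ^ j / k i * v))) := by push_cast; ring
      rw [e5, mul_assoc]
      push_cast
      ring_nf
    · intro v hv
      have : dyadicCutoff (2 ^ j * v / 2 ^ j) = 0 := by
        rw [mul_div_cancel_left₀ v h2.ne']
        refine dyadicCutoff_eq_zero ?_
        by_contra hcon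
        rw [not_or, not_le, not_le] at hcon
        exact hv.2 ⟨by linarith [hcon.1], by linarith [hcon.2]⟩
      rw [this, ofReal_zero, mul_zero]
  · rw [not_le] at hj
    refine setIntegral_eq_zero_of_forall_eq_zero fun s hs => ?_
    rcases le_or_gt s (2 ^ j) with hs' | hs'
    · rw [dyadicCutoff_eq_zero (Or.inl ((div_le_one h2).2 hs')), ofReal_zero, mul_zero]
    · rw [halfLineIntegrand_eq_zero h i x (hj.trans hs').le, zero_mul]

lemma HalfLineData.continuousOn_mul (h : HLD) (i : ι) (x : E) {c : ℝ → ℝ} (hc : Continuous c) :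
    ContinuousOn (fun s => 𝓗 i x s * (c s : ℂ)) (Ioi 0) :=
  ((h.contDiffOn i).continuousOn.comp (f := fun s : ℝ => (x, s)) (by fun_prop)
    fun s hs => ⟨trivial, hs⟩).mul (continuous_ofReal.comp hc).continuousOn

lemma HalfLineData.integrableOn_low (h : HLD) (i : ι) (x : E) : IntegrableOn (fun s => 𝓗 i x s *
      (lowCutoff s : ℂ)) (Ioi 0) := by
  obtain ⟨C, -, hC⟩ := h.low_bound 0
  have hcont := h.continuousOn_mul i x contDiff_lowCutoff.continuous
  have h1 : IntegrableOn (fun s => 𝓗 i x s * (lowCutoff s : ℂ)) (Ioc 0 2) := by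
    refine Integrable.mono' ((integrableOn_low_weight R).const_mul C)
      ((hcont.mono fun s hs => hs.1).aestronglyMeasurable measurableSet_Ioc) ?_
    exact ae_restrict_of_forall_mem measurableSet_Ioc fun s hs => by simpa using hC i s hs x
  rw [← Ioc_union_Ioi_eq_Ioi (zero_le_two (α := ℝ))]
  refine h1.union (integrableOn_zero.congr_fun (fun s hs => ?_) measurableSet_Ioi)
  rw [lowCutoff_eq_zero (le_of_lt hs), ofReal_zero, mul_zero]

lemma HalfLineData.integrableOn_piece (h : HLD) (i : ι) (j : ℕ) (x : E) :
    IntegrableOn (fun s => 𝓗 i x s * (dyadicCutoff (s / 2 ^ j) : ℂ)) (Ioi 0) := by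
  have h2 : (0 : ℝ) < 2 ^ j := by positivity
  have hcont := h.continuousOn_mul i x (contDiff_dyadicCutoff.continuous.comp
    (continuous_id.div_const (2 ^ j)))
  have h1 : IntegrableOn (fun s => 𝓗 i x s *
      (dyadicCutoff (s / 2 ^ j) : ℂ)) (Icc (2 ^ j) (2 ^ j * 4)) :=
    (hcont.mono fun s hs => h2.trans_le hs.1).integrableOn_Icc
  refine (h1.of_forall_sdiff_eq_zero measurableSet_Ioi fun s hs => ?_)
  rw [dyadicCutoff_eq_zero, ofReal_zero, mul_zero]
  by_contra hcon
  rw [not_or, not_le, not_le, one_lt_div h2, div_lt_iff₀ h2] at hcon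
  exact hs.2 ⟨hcon.1.le, by linarith [hcon.2]⟩

lemma halfLineIntegrand_split (h : HLD) (i : ι) (x : E) (s : ℝ) : 𝓗 i x s =
      𝓗 i x s * (lowCutoff s : ℂ) +
      ∑ j ∈ Finset.range ⌈k i⌉₊, 𝓗 i x s *
      (dyadicCutoff (s / 2 ^ j) : ℂ) := by
  rcases le_or_gt (k i) s with hs | hs
  · simp [halfLineIntegrand_eq_zero h i x hs]
  · rw [← mul_sum, ← Complex.ofReal_sum, sum_dyadicCutoff, ← mul_add, ← Complex.ofReal_add]
    have h2 : k i ≤ 2 ^ ⌈k i⌉₊ := (Nat.le_ceil _).trans (by exact_mod_cast (Nat.lt_two_pow_self).le)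
    rw [lowCutoff_eq_one (s := s / 2 ^ ⌈k i⌉₊) ((div_le_one (by positivity)).2 (hs.le.trans h2))]
    simp

lemma HalfLineData.integrableOn (h : HLD) (i : ι) (x : E) : IntegrableOn (𝓗 i x) (Ioi 0) := by
  have : 𝓗 i x = _ := funext fun s => halfLineIntegrand_split h i x s
  rw [this]
  exact (h.integrableOn_low i x).add (integrable_finsetSum _ fun j _ => h.integrableOn_piece i j x)

/-- Oscillatory integrals on the half line with nonstationary phase are bounded, together with
all derivatives. -/
theorem HalfLineData.ub (h : HLD) : UB₀ (fun i x => ∫ s in Ioi (0 : ℝ), 𝓗 i x s) := by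
  have h1 := UB.sum (w := fun _ : ι => 1) (summable_geometric_of_lt_one (r := (1 / 2 : ℝ))
    (by norm_num) (by norm_num)) (fun j => by positivity) (fun _ => zero_le_one) h.dyadic
    (fun i => ⌈k i⌉₊)
  refine cast ?_ (h.low.add h1)
  congr 1
  ext i x
  rw [setIntegral_congr_fun measurableSet_Ioi fun s _ => halfLineIntegrand_split h i x s,
    integral_add (h.integrableOn_low i x) (integrable_finsetSum _ fun j _ =>
      h.integrableOn_piece i j x), integral_finsetSum _ fun j _ => h.integrableOn_piece i j x]
  congr 1
  · refine (setIntegral_eq_of_subset_of_forall_sdiff_eq_zero measurableSet_Ioi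
      (fun s hs => hs.1) fun s hs => ?_).symm
    rw [lowCutoff_eq_zero, ofReal_zero, mul_zero]
    by_contra hcon
    exact hs.2 ⟨hs.1, (not_le.1 hcon).le⟩
  · exact sum_congr rfl fun j _ => (h.piece_eq i j x).symm

end HalfLine

variable {Ω : Set ℂ} {q : ℝ → ℂ} {b : ℝ}
local notation "Dom" => IsSmoothDomain Ω q
local notation "Bounce" => IsBouncingBall Ω q b

/-! ### The boundary curve near the diagonal -/

section Curve

lemma IsSmoothDomain.ub (h : Dom) : UB₀ (fun (_ : ι) => q) :=
  UB.of_periodic h.smooth two_pi_pos h.periodic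

lemma IsSmoothDomain.contDiff_deriv (h : Dom) : Smooth (deriv q) := h.smooth.iterate_deriv 1

lemma IsSmoothDomain.deriv_periodic (h : Dom) : Periodic (deriv q) (2 * π) := fun φ => by
  rw [← deriv_comp_add_const]
  congr 1
  exact funext h.periodic

lemma IsSmoothDomain.ub_deriv (h : Dom) : UB₀ (fun (_ : ι) => deriv q) :=
  UB.of_periodic h.contDiff_deriv two_pi_pos h.deriv_periodic

lemma IsSmoothDomain.hasDerivAt (h : Dom) (φ : ℝ) :
    HasDerivAt q (deriv q φ) φ := (h.smooth.differentiable (by simp) φ).hasDerivAt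

/-- Points with the same image differ by a multiple of the period. -/
lemma IsSmoothDomain.eq_of_eq (h : Dom) {φ θ : ℝ} (hq : q φ = q θ) :
    ∃ n : ℤ, φ - θ = n * (2 * π) := by
  have hT := two_pi_pos
  have hper : ∀ x, q (toIcoMod hT 0 x) = q x := fun x => by rw [toIcoMod, h.periodic.sub_zsmul_eq]
  have hm : ∀ x, toIcoMod hT 0 x ∈ Ico 0 (2 * π) := fun x => by simpa using toIcoMod_mem_Ico hT 0 x
  have := h.injOn (hm φ) (hm θ) (by rw [hper, hper, hq])
  rw [toIcoMod, toIcoMod] at this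
  refine ⟨toIcoDiv hT 0 φ - toIcoDiv hT 0 θ, ?_⟩
  push_cast
  simp only [zsmul_eq_mul] at this
  linarith

/-- Points of the curve that are close in the plane are close along the curve. -/
lemma IsSmoothDomain.exists_chord (h : Dom) {u₁ : ℝ} (hu : 0 < u₁) :
    ∃ r > 0, ∀ φ u, |u| ≤ π → ‖q φ - q (φ - u)‖ ≤ r → |u| ≤ u₁ := by
  have hq := h.smooth.continuous
  let K : Set (ℝ × ℝ) := Icc 0 (2 * π) ×ˢ (Icc (-π) π ∩ {u | u₁ ≤ |u|})
  have hK : IsCompact K := isCompact_Icc.prod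
    (isCompact_Icc.inter_right (isClosed_le continuous_const continuous_abs))
  have hc : Continuous fun p : ℝ × ℝ => ‖q p.1 - q (p.1 - p.2)‖ := by fun_prop
  have key : ∃ r > 0, ∀ p ∈ K, r < ‖q p.1 - q (p.1 - p.2)‖ := by
    rcases K.eq_empty_or_nonempty with hE | hne
    · exact ⟨1, one_pos, by simp [hE]⟩
    obtain ⟨p, hp, hmin⟩ := hK.exists_isMinOn hne hc.continuousOn
    have hpos : 0 < ‖q p.1 - q (p.1 - p.2)‖ := by
      rw [norm_pos_iff, sub_ne_zero]
      intro heq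
      obtain ⟨n, hn⟩ := h.eq_of_eq heq
      have h2 : p.2 = n * (2 * π) := by linarith
      have h3 := abs_le.2 hp.2.1
      have hpi := pi_pos
      have h4 : u₁ ≤ |p.2| := hp.2.2
      rw [h2, abs_mul, abs_of_pos two_pi_pos] at h3 h4
      have h5 : |(n : ℝ)| < 1 := by
        by_contra hcon
        nlinarith
      have h6 : n = 0 := by
        have : |n| < 1 := by exact_mod_cast h5
        exact Int.abs_lt_one_iff.1 this
      rw [h6] at h4
      simp at h4
      linarith
    refine ⟨_ / 2, half_pos hpos, fun p' hp' => ?_⟩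
    have : ‖q p.1 - q (p.1 - p.2)‖ ≤ ‖q p'.1 - q (p'.1 - p'.2)‖ := hmin hp'
    linarith
  obtain ⟨r, hr, hK⟩ := key
  refine ⟨r, hr, fun φ u hu1 hle => ?_⟩
  by_contra hcon
  have hT := two_pi_pos
  have hφ : q (toIcoMod hT 0 φ) = q φ := by rw [toIcoMod, h.periodic.sub_zsmul_eq]
  have hφ2 : q (toIcoMod hT 0 φ - u) = q (φ - u) := by
    rw [toIcoMod, sub_right_comm, h.periodic.sub_zsmul_eq]
  have hm := toIcoMod_mem_Ico hT 0 φ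
  rw [zero_add] at hm
  have := hK (toIcoMod hT 0 φ, u) ⟨⟨hm.1, hm.2.le⟩, abs_le.1 hu1, (not_le.1 hcon).le⟩
  simp only [hφ, hφ2] at this
  linarith

/-- The quotient `(q (φ - σ w) - q φ) / w`. -/
def sideQuot (q : ℝ → ℂ) (σ : ℝ) : ℝ × ℝ → ℂ := diffQuot q (-σ)

lemma smul_sideQuot (h : Dom) (σ φ w : ℝ) : w • sideQuot q σ (φ, w) = q (φ - σ * w) - q φ := by
  rw [sideQuot, smul_diffQuot h.smooth]
  simp only [smul_eq_mul]
  congr 2; ring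

lemma UB.sideQuot (h : Dom) (σ : ℝ) : UB₀ (fun (_ : ι) => sideQuot q σ) := h.ub.ub₁.diffQuot (-σ)

lemma sideQuot_zero (q : ℝ → ℂ) (σ φ : ℝ) : sideQuot q σ (φ, 0) = -(σ : ℂ) * deriv q φ := by
  simp [sideQuot, diffQuot, fderiv_eq_smul_deriv]

lemma norm_sideQuot_le (h : Dom) {σ : ℝ} (hσ : |σ| = 1) (p : ℝ × ℝ) : ‖sideQuot q σ p‖ ≤ 1 := by
  have := norm_integral_le_of_norm_le_const (a := 0) (b := 1) (C := 1)
    (f := fun t : ℝ => fderiv ℝ q (p.1 + (t * p.2) • (-σ)) (-σ)) fun t _ => by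
      rw [fderiv_eq_smul_deriv, norm_smul, h.arclength, mul_one, norm_neg, norm_eq_abs, hσ]
  rw [sideQuot, diffQuot]
  exact this.trans (by simp)

/-- The quotient `‖q (φ - σ w) - q φ‖ / w`, for small `w`. -/
def sideRadius (q : ℝ → ℂ) (σ : ℝ) (p : ℝ × ℝ) : ℝ := realSqrt (1 / 2) (‖sideQuot q σ p‖ ^ 2)

lemma UB.sideRadius (h : Dom) (σ : ℝ) : UB₀ (fun (_ : ι) => sideRadius q σ) :=
  (UB.sideQuot h σ).comp_smooth (g := fun z : ℂ => realSqrt (1 / 2) (‖z‖ ^ 2))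
    ((contDiff_realSqrt (by norm_num)).comp (contDiff_norm_sq ℝ))

lemma sideRadius_mem (h : Dom) {σ : ℝ} (hσ : |σ| = 1) (p : ℝ × ℝ) :
    sideRadius q σ p ∈ Icc (1 / 4 : ℝ) 2 := by
  constructor
  · have := le_realSqrt (c := 1 / 2) (by norm_num) (‖sideQuot q σ p‖ ^ 2)
    rw [sideRadius]; linarith
  · have h1 := norm_sideQuot_le h hσ p
    have h0 := norm_nonneg (sideQuot q σ p)
    rw [sideRadius, realSqrt, Real.sqrt_le_left (by norm_num)]
    have h2 := smoothTransition.nonneg ((4 * ‖sideQuot q σ p‖ ^ 2 / (1 / 2) ^ 2 - 1) / 3)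
    have h3 := smoothTransition.le_one ((4 * ‖sideQuot q σ p‖ ^ 2 / (1 / 2) ^ 2 - 1) / 3)
    nlinarith [mul_le_mul_of_nonneg_right (pow_le_one₀ h0 h1 (n := 2)) h2]

/-- The normal component of `sideQuot`. -/
def sideNormal (q : ℝ → ℂ) (σ : ℝ) (p : ℝ × ℝ) : ℝ :=
  inner ℝ (sideQuot q σ p) (normal q (p.1 - σ * p.2))

lemma UB₁.sideShift (σ : ℝ) : UB₁ (fun (_ : ι) (p : ℝ × ℝ) => p.1 - σ * p.2) := by
  have := UB₁.linear (ι := ι) (fst ℝ ℝ ℝ - σ • snd ℝ ℝ ℝ)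
  simpa using this

lemma UB.normal (h : Dom) : UB₀ (fun (_ : ι) => normal q) :=
  h.ub_deriv.clm (ContinuousLinearMap.mul ℝ ℂ I)

lemma UB.sideNormal (h : Dom) (σ : ℝ) : UB₀ (fun (_ : ι) => sideNormal q σ) := by
  have := (UB.sideQuot (ι := ι) h σ).bilin (innerSL ℝ) ((UB.normal h).comp (UB₁.sideShift σ))
  refine UB.mono (w := fun _ => 1 * 1) (C := 1) ?_ zero_le_one (fun _ => zero_le_one) (fun _ => by simp)
  exact this

lemma inner_mul_I_self (z : ℂ) : inner ℝ z (I * z) = 0 := by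
  rw [Complex.inner]
  simp
  ring

/-- The quotient of `sideNormal` by `w`. -/
def sideCurv (q : ℝ → ℂ) (σ : ℝ) (p : ℝ × ℝ) : ℝ := diffQuot (sideNormal q σ) (0, 1) ((p.1, 0), p.2)

lemma UB.sideCurv (h : Dom) (σ : ℝ) : UB₀ (fun (_ : ι) => sideCurv q σ) := by
  have h1 : UB₁ (fun (_ : ι) (p : ℝ × ℝ) => ((p.1, (0 : ℝ)), p.2)) := by
    have := UB₁.linear (ι := ι) (E := ℝ × ℝ) (((fst ℝ ℝ ℝ).prod
      (0 : ℝ × ℝ →L[ℝ] ℝ)).prod (snd ℝ ℝ ℝ))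
    simpa using this
  exact ((UB.sideNormal h σ).ub₁.diffQuot (0, 1)).comp h1

lemma mul_sideCurv (h : Dom) (σ φ w : ℝ) : w * sideCurv q σ (φ, w) = sideNormal q σ (φ, w) := by
  have h1 := smul_diffQuot ((UB.sideNormal (ι := Unit) h σ).smooth ()) ((0, 1) : ℝ × ℝ) (φ, 0) w
  have h2 : sideNormal q σ (φ, 0) = 0 := by
    have : -(σ : ℂ) * deriv q φ = (-σ) • deriv q φ := by rw [real_smul]; push_cast; ring
    rw [sideNormal, sideQuot_zero, this, inner_smul_left, Billiard.normal, mul_zero, sub_zero,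
      inner_mul_I_self, mul_zero]
  simp only [smul_eq_mul, Prod.smul_mk, mul_zero, mul_one, Prod.mk_add_mk, add_zero, zero_add,
    h2, sub_zero] at h1
  exact h1

/-- A scale on which the curve is nearly straight. -/
structure IsStraightScale (q : ℝ → ℂ) (u₁ : ℝ) : Prop where
  pos : 0 < u₁
  le : u₁ ≤ 1
  norm : ∀ σ, |σ| = 1 → ∀ φ w, 0 ≤ w → w ≤ u₁ → sideRadius q σ (φ, w) = ‖sideQuot q σ (φ, w)‖
  deriv : ∀ σ, |σ| = 1 → ∀ φ w, 0 ≤ w → w ≤ u₁ →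
    7 / 8 ≤ sideRadius q σ (φ, w) + w * fderiv ℝ (sideRadius q σ) (φ, w) (0, 1)

lemma UB.norm_sub_le {f : ℝ × ℝ → F}
    (hf : UB₀ (fun (_ : Unit) => f)) : ∃ C, 0 ≤ C ∧ (∀ φ w, 0 ≤ w →
      ‖f (φ, w) - f (φ, 0)‖ ≤ C * w) ∧ ∀ p, ‖_root_.fderiv ℝ f p (0, 1)‖ ≤ C := by
  obtain ⟨C, h0, hC⟩ := (hf.fderiv_apply ((0, 1) : ℝ × ℝ)).norm_le
  refine ⟨C, h0, fun φ w hw => ?_, fun p => by simpa using hC () p⟩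
  have h1 : ∀ t ∈ Icc (0 : ℝ) w, HasDerivWithinAt (fun t => f (φ, t))
      (_root_.fderiv ℝ f (φ, t) (0, 1)) (Icc 0 w) t := fun t _ =>
    (((hf.smooth ()).differentiable (by simp) (φ, t)).hasFDerivAt.comp_hasDerivAt t
      ((hasDerivAt_const t φ).prodMk (hasDerivAt_id t))).hasDerivWithinAt
  have h2 := norm_image_sub_le_of_norm_deriv_le_segment' h1 (C := C)
    (fun t _ => by simpa using hC () (φ, t)) w ⟨hw, le_rfl⟩
  simpa using h2

lemma IsSmoothDomain.exists_straightScale (h : Dom) :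
    ∃ u₁, IsStraightScale q u₁ := by
  have key : ∀ σ : ℝ, |σ| = 1 → ∃ u > 0, u ≤ 1 ∧ (∀ φ w, 0 ≤ w → w ≤ u →
      sideRadius q σ (φ, w) = ‖sideQuot q σ (φ, w)‖) ∧ ∀ φ w, 0 ≤ w → w ≤ u →
      7 / 8 ≤ sideRadius q σ (φ, w) + w * fderiv ℝ (sideRadius q σ) (φ, w) (0, 1) := by
    intro σ hσ
    obtain ⟨C, h0, hC, -⟩ := UB.norm_sub_le (UB.sideQuot (ι := Unit) h σ)
    obtain ⟨D, h1, -, hD⟩ := UB.norm_sub_le (UB.sideRadius (ι := Unit) h σ)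
    have hn : ∀ φ, ‖sideQuot q σ (φ, 0)‖ = 1 := fun φ => by
      rw [sideQuot_zero, norm_mul, norm_neg, norm_real, norm_eq_abs, hσ,
        h.arclength, mul_one]
    have hlow : ∀ φ w, 0 ≤ w → 1 - C * w ≤ ‖sideQuot q σ (φ, w)‖ := fun φ w hw => by
      have := norm_sub_norm_le (sideQuot q σ (φ, 0)) (sideQuot q σ (φ, w))
      rw [hn, norm_sub_rev] at this
      linarith [hC φ w hw]
    have hCD : 0 < 16 * (C + D + 1) := by positivity
    refine ⟨1 / (16 * (C + D + 1)), by positivity, ?_, ?_, ?_⟩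
    · rw [div_le_one hCD]; linarith
    all_goals
      intro φ w hw hwu
      rw [le_div_iff₀ hCD] at hwu
      have h2 := hlow φ w hw
      have h3 : C * w ≤ 1 / 16 := by nlinarith
      have h4 : D * w ≤ 1 / 16 := by nlinarith
      have h5 : sideRadius q σ (φ, w) = ‖sideQuot q σ (φ, w)‖ :=
        realSqrt_sq (by norm_num) (by linarith)
    · exact h5
    · have h6 := abs_le.1 (by simpa using hD (φ, w) :
        |fderiv ℝ (sideRadius q σ) (φ, w) (0, 1)| ≤ D)
      have h7 : -(w * D) ≤ w * fderiv ℝ (sideRadius q σ) (φ, w) (0, 1) := by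
        have := mul_le_mul_of_nonneg_left h6.1 hw
        linarith
      rw [h5] at *
      linarith
  obtain ⟨u, h1, h2, h3, h4⟩ := key 1 (by simp)
  obtain ⟨v, g1, g2, g3, g4⟩ := key (-1) (by simp)
  have hcase : ∀ σ : ℝ, |σ| = 1 → σ = 1 ∨ σ = -1 := fun σ hσ => eq_or_eq_neg_of_abs_eq hσ
  refine ⟨min u v, lt_min h1 g1, min_le_of_left_le h2, fun σ hσ φ w hw hwu => ?_,
    fun σ hσ φ w hw hwu => ?_⟩
  · rcases hcase σ hσ with rfl | rfl
    · exact h3 φ w hw (hwu.trans (min_le_left _ _))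
    · exact g3 φ w hw (hwu.trans (min_le_right _ _))
  · rcases hcase σ hσ with rfl | rfl
    · exact h4 φ w hw (hwu.trans (min_le_left _ _))
    · exact g4 φ w hw (hwu.trans (min_le_right _ _))

end Curve

/-! ### The kernel near the diagonal -/

section Near

lemma UB.congr {w : ι → ℝ} {f g : ι → E → F}
    (h : UB w f) (hfg : ∀ i x, f i x = g i x) : UB w g := by
  have : f = g := funext fun i => funext (hfg i)
  exact this ▸ h

/-- A smooth cutoff to small chords. -/
def chordCut (r₁ : ℝ) (z : ℂ) : ℝ := bump r₁ ‖z‖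

lemma contDiff_chordCut (r₁ : ℝ) : Smooth (chordCut r₁) := by
  have := contDiff_norm_sq (n := ∞) ℝ (E := ℂ)
  exact smoothTransition.contDiff.comp ((contDiff_const.sub (this.div_const _)).div_const _)

/-- The parameter `μ` in `lam = k μ`. -/
def specParam (a : ℝ) : ℂ := 1 + I * a

@[simp] lemma specParam_re (a : ℝ) : (specParam a).re = 1 := by simp [specParam]
@[simp] lemma specParam_im (a : ℝ) : (specParam a).im = a := by simp [specParam]

lemma specParam_ne_zero (a : ℝ) : specParam a ≠ 0 := fun h => by
  have := congrArg Complex.re h; simp at this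

lemma one_le_norm_specParam (a : ℝ) : 1 ≤ ‖specParam a‖ := by
  have := Complex.abs_re_le_norm (specParam a)
  simpa using this

lemma norm_specParam_le {a T : ℝ} (h : a ∈ Icc 0 T) : ‖specParam a‖ ≤ 1 + T :=
  (norm_add_le _ _).trans (by simpa [abs_of_nonneg h.1] using h.2)

lemma UB.specParam {a : ι → ℝ} {T : ℝ} (h : ∀ i, a i ∈ Icc 0 T) :
    UB₀ (fun i (_ : E) => specParam (a i)) :=
  UB.const _ fun i => norm_specParam_le (h i)

/-- A scale `r₁` in the plane such that the curve is nearly straight on chords of length `2 r₁`. -/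
structure NearScale (q : ℝ → ℂ) (u₁ r₁ : ℝ) : Prop where
  straight : IsStraightScale q u₁
  pos : 0 < r₁
  chord : ∀ φ u, |u| ≤ π → ‖q φ - q (φ - u)‖ ≤ 2 * r₁ → |u| ≤ u₁ / 2

lemma IsSmoothDomain.exists_nearScale (h : Dom) :
    ∃ u₁, ∃ r > 0, ∀ r₁, 0 < r₁ → r₁ ≤ r → NearScale q u₁ r₁ := by
  obtain ⟨u₁, hu⟩ := h.exists_straightScale
  obtain ⟨r, hr, hc⟩ := h.exists_chord (half_pos hu.pos)
  exact ⟨u₁, r / 2, half_pos hr, fun r₁ h1 h2 => ⟨hu, h1, fun φ u h3 h4 => hc φ u h3 (by linarith)⟩⟩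

/-- The data of an oscillatory integral with the kernel `N` near the diagonal. -/
structure NearData (q : ℝ → ℂ) (u₁ r₁ : ℝ) (R : ℕ) (k a : ι → ℝ) (X : ι → ℝ → ℂ)
    (G b : ι → (ℝ × E) × ℝ → ℂ) : Prop where
  scale : NearScale q u₁ r₁
  one_le : ∀ i, 1 ≤ k i
  bdd : ∃ T, ∀ i, a i ∈ Icc 0 T
  symbol : SymbolFamily R (fun i x => hankelAmp (specParam (a i)) x * X i x)
  phase : UB₀ G
  amp : UB₀ b
  re_le : ∀ i φ y u, |u| ≤ π → ‖q φ - q (φ - u)‖ ≤ 2 * r₁ → b i ((φ, y), u) ≠ 0 →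
    |(radialDeriv (G i) ((φ, y), u)).re| ≤ 1 / 2
  im_nonneg : ∀ i φ y u, |u| ≤ π → ‖q φ - q (φ - u)‖ ≤ 2 * r₁ → b i ((φ, y), u) ≠ 0 →
    0 ≤ a i * ‖q φ - q (φ - u)‖ + u * (G i ((φ, y), u)).im

/-- The integrand of an oscillatory integral with the kernel `N` near the diagonal. -/
def nearIntegrand (q : ℝ → ℂ) (r₁ k a : ℝ) (X : ℝ → ℂ) (G b : (ℝ × E) × ℝ → ℂ) (x : ℝ × E)
    (u : ℝ) : ℂ :=
  kernelN q (k * specParam a) x.1 (x.1 - u) * X (k * ‖q x.1 - q (x.1 - u)‖) *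
    bump r₁ ‖q x.1 - q (x.1 - u)‖ * (exp (I * k * u * G (x, u)) * b (x, u))

/-- The phase of the integrand on one side of the diagonal. -/
def sidePhase (q : ℝ → ℂ) (a : ℝ) (G : (ℝ × E) × ℝ → ℂ) (σ : ℝ) (p : (ℝ × E) × ℝ) : ℂ :=
  specParam a * (sideRadius q σ (p.1.1, p.2) : ℂ) + σ * G (p.1, σ * p.2)

/-- The amplitude of the integrand on one side of the diagonal. -/
def sideAmp (q : ℝ → ℂ) (u₁ r₁ : ℝ) (b : (ℝ × E) × ℝ → ℂ) (σ : ℝ) (p : (ℝ × E) × ℝ) : ℂ :=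
  I / 2 * ((sideCurv q σ (p.1.1, p.2) * realInv (1 / 4) (sideRadius q σ (p.1.1, p.2)) *
    (bump (u₁ / 2) p.2 * chordCut r₁ (q (p.1.1 - σ * p.2) - q p.1.1)) : ℝ) : ℂ) *
    b (p.1, σ * p.2)

lemma UB.ofReal {w : ι → ℝ} {f : ι → E → ℝ} (hf : UB w f) :
    UB w (fun i x => (f i x : ℂ)) := hf.clm ofRealCLM

lemma UB₁.fstfst_snd : UB₁ (fun (_ : ι) (p : (ℝ × E) × ℝ) => (p.1.1, p.2)) :=
  UB₁.linear (((fst ℝ ℝ E).comp (fst ℝ (ℝ × E) ℝ)).prod (snd ℝ (ℝ × E) ℝ))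

lemma UB₁.snd_mul (σ : ℝ) : UB₁ (fun (_ : ι) (p : (ℝ × E) × ℝ) => (p.1, σ * p.2)) :=
  UB₁.linear ((fst ℝ (ℝ × E) ℝ).prod (σ • snd ℝ (ℝ × E) ℝ))

lemma UB₁.fstfst : UB₁ (fun (_ : ι) (p : (ℝ × E) × ℝ) => p.1.1) :=
  UB₁.linear ((fst ℝ ℝ E).comp (fst ℝ (ℝ × E) ℝ))

lemma UB₁.snd : UB₁ (fun (_ : ι) (p : (ℝ × E) × ℝ) => p.2) :=
  UB₁.linear (ContinuousLinearMap.snd ℝ (ℝ × E) ℝ)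

lemma radialDeriv_eq_of_hasDerivAt {Θ : E × ℝ → ℂ} (hΘ : Smooth Θ) {x : E} {u : ℝ} {d : ℂ}
    (h : HasDerivAt (fun u : ℝ => u * Θ (x, u)) d u) : radialDeriv Θ (x, u) = d := by
  have h1 : HasDerivAt (fun u : ℝ => Θ (x, u)) (fderiv ℝ Θ (x, u) (0, 1)) u :=
    ((hΘ.differentiable (by simp) (x, u)).hasFDerivAt.comp_hasDerivAt u
      ((hasDerivAt_const u x).prodMk (hasDerivAt_id u)))
  have h2 := ((hasDerivAt_id u).ofReal_comp).mul h1
  refine Eq.trans ?_ (h2.unique h)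
  simp [radialDeriv]

lemma hasDerivAt_mul_self {Θ : E × ℝ → ℂ} (hΘ : Smooth Θ) (x : E) (u : ℝ) :
    HasDerivAt (fun u : ℝ => u * Θ (x, u)) (radialDeriv Θ (x, u)) u := by
  have h1 : HasDerivAt (fun u : ℝ => Θ (x, u)) (fderiv ℝ Θ (x, u) (0, 1)) u :=
    ((hΘ.differentiable (by simp) (x, u)).hasFDerivAt.comp_hasDerivAt u
      ((hasDerivAt_const u x).prodMk (hasDerivAt_id u)))
  have h2 := ((hasDerivAt_id u).ofReal_comp).mul h1
  refine h2.congr_deriv ?_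
  simp [radialDeriv]

variable {u₁ r₁ : ℝ} {R : ℕ} {k a : ι → ℝ} {X : ι → ℝ → ℂ} {G b : ι → (ℝ × E) × ℝ → ℂ}

local notation "NData" => NearData q u₁ r₁ R k a X G b
local notation:max "𝓚" i:max => nearIntegrand q r₁ (k i) (a i) (X i) (G i) (b i)

lemma sidePhase_ub (hΩ : Dom) (h : NData) (σ : ℝ) : UB₀ (fun i => sidePhase q (a i) (G i) σ) := by
  obtain ⟨T, hT⟩ := h.bdd
  have h2 := ((UB.sideRadius (ι := ι) hΩ σ).comp (UB₁.fstfst_snd (E := E))).ofReal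
  have h3 : UB₀ (fun (i : ι) (_ : (ℝ × E) × ℝ) => (σ : ℂ)) :=
    UB.const _ (C := ‖(σ : ℂ)‖) fun i => le_rfl
  exact ((UB.specParam hT).mul_bdd h2).add (h3.mul_bdd (h.phase.comp (UB₁.snd_mul σ)))

lemma sideAmp_ub (hΩ : Dom) (h : NData) (σ : ℝ) : UB₀ (fun i => sideAmp q u₁ r₁ (b i) σ) := by
  have h1 := (UB.sideCurv (ι := ι) hΩ σ).comp (UB₁.fstfst_snd (E := E))
  have h2 := ((UB.sideRadius (ι := ι) hΩ σ).comp (UB₁.fstfst_snd (E := E))).comp_smooth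
    (contDiff_realInv (c := 1 / 4) (by norm_num))
  have h3 := (UB.bump (ι := ι) (half_pos h.scale.straight.pos)).comp (UB₁.snd (E := E))
  have h4 : UB₁ (fun (_ : ι) (p : (ℝ × E) × ℝ) => p.1.1 - σ * p.2) :=
    (UB₁.sideShift σ).comp UB₁.fstfst_snd
  have h5 := ((hΩ.ub.comp h4).sub (hΩ.ub.comp (UB₁.fstfst (ι := ι) (E := E)))).comp_smooth
    (contDiff_chordCut r₁)
  have h6 := ((h1.mul_bdd h2).mul_bdd (h3.mul_bdd h5)).ofReal
  have h7 : UB₀ (fun (i : ι) (_ : (ℝ × E) × ℝ) => I / 2) :=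
    UB.const _ (C := ‖I / 2‖) fun i => le_rfl
  exact (h7.mul_bdd h6).mul_bdd (h.amp.comp (UB₁.snd_mul σ))

lemma sideAmp_ne_zero (h : NearScale q u₁ r₁) {b : (ℝ × E) × ℝ → ℂ} {σ : ℝ} (hσ : |σ| = 1)
    {x : ℝ × E} {w : ℝ} (hw : 0 < w) (hb : sideAmp q u₁ r₁ b σ (x, w) ≠ 0) :
    w ≤ u₁ ∧ |σ * w| ≤ π ∧ ‖q x.1 - q (x.1 - σ * w)‖ ≤ 2 * r₁ ∧ b (x, σ * w) ≠ 0 := by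
  simp only [sideAmp, ne_eq, mul_eq_zero, Complex.ofReal_eq_zero, not_or] at hb
  obtain ⟨⟨-, -, h1, h2⟩, h3⟩ := hb
  have hw1 : w ≤ u₁ := by
    by_contra hcon
    refine h1 (bump_eq_zero (half_pos h.straight.pos) ?_)
    rw [abs_of_pos hw]; linarith [not_le.1 hcon]
  refine ⟨hw1, ?_, ?_, h3⟩
  · rw [abs_mul, hσ, one_mul, abs_of_pos hw]
    linarith [h.straight.le, pi_gt_three]
  · by_contra hcon
    refine h2 (bump_eq_zero h.pos ?_)
    rw [abs_norm, norm_sub_rev]; exact (not_le.1 hcon).le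

lemma norm_chord_eq (hΩ : Dom) {σ : ℝ} (hσ : |σ| = 1) (h : IsStraightScale q u₁)
    {φ w : ℝ} (hw : 0 ≤ w) (hw1 : w ≤ u₁) :
    ‖q φ - q (φ - σ * w)‖ = w * sideRadius q σ (φ, w) := by
  rw [h.norm σ hσ φ w hw hw1, norm_sub_rev, ← smul_sideQuot hΩ, norm_smul, Real.norm_of_nonneg hw]

lemma NearData.side (hΩ : Dom) (h : NData) {σ : ℝ} (hσ : |σ| = 1) :
    HalfLineData R k (fun i => sidePhase q (a i) (G i) σ) (fun _ p => sideRadius q σ (p.1.1, p.2))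
      (fun i x => hankelAmp (specParam (a i)) x * X i x)
      (fun i => sideAmp q u₁ r₁ (b i) σ) := by
  refine ⟨h.one_le, sidePhase_ub hΩ h σ, (UB.sideRadius hΩ σ).comp UB₁.fstfst_snd,
    fun i p => sideRadius_mem hΩ hσ _, h.symbol, sideAmp_ub hΩ h σ, ?_, ?_, 3 / 8, by norm_num, ?_⟩
  · intro i x u hu
    by_contra hcon
    have h1 := (sideAmp_ne_zero h.scale hσ (by linarith) hcon).1
    have h2 := h.scale.straight.le
    have h3 : u = u₁ := by linarith
    have h4 : bump (u₁ / 2) u = 0 := bump_eq_zero (half_pos h.scale.straight.pos)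
      ((le_abs_self u).trans' (by linarith))
    exact hcon (by simp [sideAmp, h4])
  · rintro i ⟨φ, y⟩ w hw hb
    obtain ⟨h1, h2, h3, h4⟩ := sideAmp_ne_zero h.scale hσ hw hb
    have h5 := h.im_nonneg i φ y _ h2 h3 h4
    rw [norm_chord_eq hΩ hσ h.scale.straight hw.le h1] at h5
    have h6 : (sidePhase q (a i) (G i) σ ((φ, y), w)).im =
        a i * sideRadius q σ (φ, w) + σ * (G i ((φ, y), σ * w)).im := by
      simp [sidePhase]
    rw [h6]
    refine nonneg_of_mul_nonneg_right (a := w) ?_ hw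
    linarith
  · rintro i ⟨φ, y⟩ w hw hb
    obtain ⟨h1, h2, h3, h4⟩ := sideAmp_ne_zero h.scale hσ hw hb
    have h5 := abs_le.1 (h.re_le i φ y _ h2 h3 h4)
    have h6 := h.scale.straight.deriv σ hσ φ w hw.le h1
    have e1 : HasDerivAt (fun w : ℝ => sideRadius q σ (φ, w))
        (fderiv ℝ (sideRadius q σ) (φ, w) (0, 1)) w :=
      ((((UB.sideRadius (ι := Unit) hΩ σ).smooth ()).differentiable (by simp)
        (φ, w)).hasFDerivAt.comp_hasDerivAt w ((hasDerivAt_const w φ).prodMk (hasDerivAt_id w)))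
    have e2 := ((hasDerivAt_id w).mul e1).ofReal_comp.const_mul (specParam (a i))
    have e3 := (hasDerivAt_mul_self (h.phase.smooth i) (φ, y) (σ * w)).scomp w
      ((hasDerivAt_id w).const_mul σ)
    have e4 := radialDeriv_eq_of_hasDerivAt ((sidePhase_ub hΩ h σ).smooth i) (x := (φ, y)) (u := w)
      ((e2.add e3).congr_of_eventuallyEq (f₁ := fun u : ℝ =>
        u * sidePhase q (a i) (G i) σ ((φ, y), u)) (Eventually.of_forall fun u => by
          simp [sidePhase, comp_def]; ring))
    rw [e4]
    refine le_trans ?_ (Complex.abs_re_le_norm _)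
    refine le_trans ?_ (le_abs_self _)
    have h7 : |σ * (radialDeriv (G i) ((φ, y), σ * w)).re| ≤ 1 / 2 := by
      rw [abs_mul, hσ, one_mul]; exact abs_le.2 h5
    have h8 := (abs_le.1 h7).1
    simp
    linarith

lemma halfLine_eq_near (hΩ : Dom) (h : NData) {σ : ℝ}
    (hσ : |σ| = 1) (i : ι) (x : ℝ × E) {w : ℝ} (hw : 0 < w) :
    halfLineIntegrand (k i) (sidePhase q (a i) (G i) σ) (fun p => sideRadius q σ (p.1.1, p.2))
      (fun x => hankelAmp (specParam (a i)) x * X i x) (sideAmp q u₁ r₁ (b i) σ) x (k i * w) =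
    𝓚 i x (σ * w) * bump (u₁ / 2) w := by
  have hk : 0 < k i := one_pos.trans_le (h.one_le i)
  by_cases hw1 : w ≤ u₁
  swap
  · have h4 : bump (u₁ / 2) w = 0 := bump_eq_zero (half_pos h.scale.straight.pos)
      ((le_abs_self w).trans' (by linarith))
    simp [halfLineIntegrand, sideAmp, h4, mul_div_cancel_left₀ w hk.ne']
  have h1 := norm_chord_eq hΩ hσ h.scale.straight hw.le hw1 (φ := x.1)
  have h2 := (sideRadius_mem hΩ hσ (x.1, w)).1
  have h3 : q x.1 ≠ q (x.1 - σ * w) := fun heq => by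
    rw [heq, sub_self, norm_zero] at h1
    have : 0 < w * sideRadius q σ (x.1, w) := by positivity
    linarith
  obtain ⟨T, hT⟩ := h.bdd
  have h4 : inner ℝ (q (x.1 - σ * w) - q x.1) (normal q (x.1 - σ * w)) =
      w * (w * sideCurv q σ (x.1, w)) := by
    rw [mul_sideCurv hΩ, ← smul_sideQuot hΩ, inner_smul_left, sideNormal]
    simp
  rw [nearIntegrand, kernelN_eq hk (specParam_ne_zero _) (by simpa using (hT i).1) h3, h4,
    halfLineIntegrand, sidePhase, sideAmp, mul_div_cancel_left₀ w hk.ne',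
    realInv_of_le (by norm_num) h2, chordCut, norm_sub_rev (q (x.1 - σ * w)), h1]
  have h5 : exp (I * ((k i * w : ℝ) : ℂ) * (specParam (a i) *
      (sideRadius q σ (x.1, w) : ℂ) + σ * G i (x, σ * w))) =
      exp (I * specParam (a i) * (k i * (w * sideRadius q σ (x.1, w)) : ℝ)) *
      exp (I * k i * ((σ * w : ℝ) : ℂ) * G i (x, σ * w)) := by
    rw [← exp_add]; congr 1; push_cast; ring
  rw [h5, mul_assoc (k i) w]
  have h6 : (sideRadius q σ (x.1, w) : ℂ) ≠ 0 := by
    exact_mod_cast (show sideRadius q σ (x.1, w) ≠ 0 by linarith)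
  have h7 : (w : ℂ) ≠ 0 := by exact_mod_cast hw.ne'
  push_cast
  field_simp

lemma bump_mul_near (h : NData) {σ : ℝ} (hσ : |σ| = 1) (i : ι)
    (x : ℝ × E) {w : ℝ} (hw : 0 < w) (hw1 : w ≤ π) :
    𝓚 i x (σ * w) * bump (u₁ / 2) w = 𝓚 i x (σ * w) := by
  by_cases hn : ‖q x.1 - q (x.1 - σ * w)‖ ≤ 2 * r₁
  · have h1 : |σ * w| = w := by rw [abs_mul, hσ, one_mul, abs_of_pos hw]
    have h2 := h.scale.chord x.1 (σ * w) (by rw [h1]; exact hw1) hn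
    rw [bump_eq_one (half_pos h.scale.straight.pos) (by rw [abs_of_pos hw]; rwa [h1] at h2), ofReal_one,
      mul_one]
  · have : bump r₁ ‖q x.1 - q (x.1 - σ * w)‖ = 0 := bump_eq_zero h.scale.pos (by
      rw [abs_norm]; exact (not_le.1 hn).le)
    simp [nearIntegrand, this]

lemma NearData.integral_side (hΩ : Dom) (h : NData) {σ : ℝ} (hσ : |σ| = 1) (i : ι) (x : ℝ × E) :
    IntervalIntegrable (fun w => 𝓚 i x (σ * w)) volume 0 π ∧
    k i * ∫ w in (0 : ℝ)..π, 𝓚 i x (σ * w) =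
      ∫ s in Ioi (0 : ℝ), halfLineIntegrand (k i) (sidePhase q (a i) (G i) σ)
        (fun p => sideRadius q σ (p.1.1, p.2)) (fun x => hankelAmp (specParam (a i)) x * X i x)
        (sideAmp q u₁ r₁ (b i) σ) x s := by
  have hk : 0 < k i := one_pos.trans_le (h.one_le i)
  have hI := (h.side hΩ hσ).integrableOn i x
  have h0 := (integrableOn_Ioi_comp_mul_left_iff _ 0 hk).2 (by simpa using hI)
  have h1 : IntegrableOn (fun w => 𝓚 i x (σ * w) * bump (u₁ / 2) w) (Ioi 0) :=
    h0.congr_fun (fun w hw => halfLine_eq_near hΩ h hσ i x hw) measurableSet_Ioi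
  have h2 : EqOn (fun w => 𝓚 i x (σ * w) * bump (u₁ / 2) w) (fun w => 𝓚 i x (σ * w))
      (Ioc 0 π) := fun w hw => bump_mul_near h hσ i x hw.1 hw.2
  constructor
  · rw [intervalIntegrable_iff_integrableOn_Ioc_of_le pi_pos.le]
    exact (h1.mono_set Ioc_subset_Ioi_self).congr_fun h2 measurableSet_Ioc
  · rw [integral_of_le pi_pos.le, ← setIntegral_congr_fun measurableSet_Ioc h2,
      ← setIntegral_eq_of_subset_of_forall_sdiff_eq_zero measurableSet_Ioi Ioc_subset_Ioi_self
        (s := Ioc 0 π), ← setIntegral_congr_fun measurableSet_Ioi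
        (fun w hw => halfLine_eq_near hΩ h hσ i x hw)]
    · have := integral_comp_mul_left_Ioi (halfLineIntegrand (k i) (sidePhase q (a i) (G i) σ)
        (fun p => sideRadius q σ (p.1.1, p.2)) (fun x => hankelAmp (specParam (a i)) x * X i x)
        (sideAmp q u₁ r₁ (b i) σ) x) 0 hk
      rw [this, mul_zero, real_smul, ← mul_assoc, Complex.ofReal_inv, mul_inv_cancel₀
        (by exact_mod_cast hk.ne'), one_mul]
    · intro w hw
      have hw1 : π < w := by
        by_contra hcon
        exact hw.2 ⟨hw.1, not_lt.1 hcon⟩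
      have h4 : bump (u₁ / 2) w = 0 := bump_eq_zero (half_pos h.scale.straight.pos)
        ((le_abs_self w).trans' (by linarith [h.scale.straight.le, pi_gt_three]))
      simp [h4]

lemma NearData.intervalIntegrable (hΩ : Dom) (h : NData) (i : ι) (x : ℝ × E) :
    IntervalIntegrable (𝓚 i x) volume (-π) π := by
  have h1 := (h.integral_side hΩ (σ := 1) (by simp) i x).1
  have h2 := (h.integral_side hΩ (σ := -1) (by simp) i x).1
  simp only [one_mul, neg_mul] at h1 h2
  refine IntervalIntegrable.trans (b := 0) ?_ h1
  have := h2.comp_mul_left (c := -1)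
  simpa [div_neg] using this.symm

/-- Oscillatory integrals with the kernel `N` near the diagonal are symbols. -/
theorem NearData.ub (hΩ : Dom) (h : NData) : UB₀ (fun i x => k i * ∫ u in (-π)..π, 𝓚 i x u) := by
  have e1 := h.integral_side hΩ (σ := 1) (by simp)
  have e2 := h.integral_side hΩ (σ := -1) (by simp)
  have h1 := (h.side hΩ (σ := 1) (by simp)).ub
  have h2 := (h.side hΩ (σ := -1) (by simp)).ub
  refine (h1.add h2).congr fun i x => ?_
  have h3 := h.intervalIntegrable hΩ i x
  have hpi := pi_pos
  have hsplit := intervalIntegral.integral_add_adjacent_intervals (a := -π) (b := 0) (c := π)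
    (h3.mono_set (by rw [uIcc_of_le (by linarith), uIcc_of_le (by linarith)]
                     exact Icc_subset_Icc_right hpi.le))
    (h3.mono_set (by rw [uIcc_of_le (by linarith), uIcc_of_le (by linarith)]
                     exact Icc_subset_Icc_left (by linarith)))
  have hneg := intervalIntegral.integral_comp_neg (a := 0) (b := π) (𝓚 i x)
  rw [neg_zero] at hneg
  rw [← (e1 i x).2, ← (e2 i x).2, ← hsplit, ← hneg]
  simp only [one_mul, neg_mul]
  ring

end Near

/-! ### Symbol families with the cutoff `χ` -/

section Families

lemma IsBump.hasCompactSupport {χ : ℝ → ℝ} (h : IsBump χ) : HasCompactSupport χ := by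
  refine HasCompactSupport.of_support_subset_isCompact (isCompact_Icc (a := -1) (b := 1))
    fun x hx => ?_
  by_contra hcon
  rw [mem_Icc, ← abs_le, not_le] at hcon
  exact hx (h.eq_zero x hcon)

lemma IsBump.exists_bound {χ : ℝ → ℝ} (h : IsBump χ) : ∃ C, 1 ≤ C ∧ ∀ x, |χ x| ≤ C := by
  obtain ⟨C, hC⟩ := h.smooth.continuous.bounded_above_of_compact_support h.hasCompactSupport
  exact ⟨max C 1, le_max_right _ _, fun x => (hC x).trans (le_max_left _ _)⟩

lemma IsPosCutoff.exists_bound {c : ℝ → ℝ} (hc : IsPosCutoff c) :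
    ∃ ε B : ℝ, 0 < ε ∧ ε < B ∧ ∀ x, c x ≠ 0 → ε ≤ x ∧ x ≤ B := by
  obtain ⟨ε, hε, h0⟩ := hc.zero
  obtain ⟨B, hB⟩ := hc.compact.isCompact.bddAbove
  refine ⟨ε, max B (ε + 1), hε, by linarith [le_max_right B (ε + 1)], fun x hx => ⟨?_, ?_⟩⟩
  · by_contra hcon
    exact hx (h0 x (not_le.1 hcon).le)
  · exact (hB (subset_tsupport _ hx)).trans (le_max_left _ _)

lemma IsPosCutoff.ub {c : ℝ → ℝ} (hc : IsPosCutoff c) : UB₀ (fun (_ : ι) => c) :=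
  UB.of_hasCompactSupport hc.smooth hc.compact

lemma IsBump.ub_scaled {χ c : ℝ → ℝ} (h : IsBump χ) (hc : IsPosCutoff c) {t : ι → ℝ}
    (ht : ∀ i, 0 < t i) : UB₀ (fun i y => χ (t i * y) * c y) := by
  classical
  obtain ⟨ε, B, hε, -, hcs⟩ := hc.exists_bound
  have h1 : UB₁ (fun (i : {i // t i < 2 / ε}) (y : ℝ) => t i * y) := by
    have := UB₁.affine (fun i : {i // t i < 2 / ε} => t i • ContinuousLinearMap.id ℝ ℝ)
      (fun _ => 0) (C := 2 / ε) fun i => by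
        rw [norm_smul, Real.norm_of_nonneg (ht i).le]
        exact (mul_le_of_le_one_right (ht i).le ContinuousLinearMap.norm_id_le).trans i.2.le
    simpa using this
  have h2 : UB₀ (fun (i : {i // t i < 2 / ε}) (y : ℝ) => χ (t i * y) * c y) :=
    ((UB.of_hasCompactSupport h.smooth h.hasCompactSupport).comp h1).mul_bdd hc.ub
  refine (UB.ite (w := fun _ : ι => 1) (fun _ => zero_le_one) (P := fun i => t i < 2 / ε)
    (g := fun i y => χ (t i * y) * c y) h2).congr fun i y => ?_
  split_ifs with hi
  · rfl
  · by_cases hy : c y = 0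
    · simp [hy]
    rw [h.eq_zero, zero_mul]
    have h3 := (hcs y hy).1
    rw [not_lt, div_le_iff₀ hε] at hi
    rw [abs_of_pos (mul_pos (ht i) (hε.trans_le h3))]
    nlinarith [ht i]

lemma IsPosCutoff.exists_eq_one {c : ℝ → ℝ} (hc : IsPosCutoff c) :
    ∃ c', IsPosCutoff c' ∧ ∀ x, c' x * c x = c x := by
  obtain ⟨ε, B, hε, hB, h⟩ := hc.exists_bound
  obtain ⟨c', h1, h2⟩ := exists_isPosCutoff hε hB
  refine ⟨c', h1, fun x => ?_⟩
  by_cases hx : c x = 0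
  · simp [hx]
  · rw [h2 x (h x hx), one_mul]

lemma symbolFamily_hankel {a : ι → ℝ} {T : ℝ} (ha : ∀ i, a i ∈ Icc 0 T) :
    SymbolFamily 0 (fun i x => hankelAmp (specParam (a i)) x) := by
  intro c hc
  have h := UB.hankelAmp (κ := ι × Ioi (0 : ℝ)) (μ := fun p => specParam (a p.1))
    (Λ := fun p => p.2) (fun p => by simpa using (ha p.1).1)
    (fun p => one_le_norm_specParam _) (fun p => norm_specParam_le (ha p.1)) (fun p => p.2.2) hc
  refine h.mono zero_le_two (fun p => ?_) fun p => ?_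
  · have : (0 : ℝ) < p.2 := p.2.2
    positivity
  · have hp : (0 : ℝ) < p.2 := p.2.2
    have h3 : (0 : ℝ) ≤ (p.2 : ℝ) ^ (-(3 / 2) : ℝ) := by positivity
    have h1 : (p.2 : ℝ) ^ (-(1 / 2) : ℝ) ≤ 1 + (p.2 : ℝ) ^ (-(3 / 2) : ℝ) := by
      rcases le_total 1 (p.2 : ℝ) with h1 | h1
      · linarith [Real.rpow_le_one_of_one_le_of_nonpos h1 (z := -(1 / 2)) (by norm_num)]
      · linarith [Real.rpow_le_rpow_of_exponent_ge hp h1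
          (show (-(3 / 2) : ℝ) ≤ -(1 / 2) by norm_num)]
    rw [pow_zero]
    linarith

lemma SymbolFamily.mul_bump {R : ℕ} {f : ι → ℝ → ℂ} (hf : SymbolFamily R f) {χ : ℝ → ℝ}
    (h : IsBump χ) {t : ι → ℝ} (ht : ∀ i, 0 < t i) :
    SymbolFamily R (fun i x => f i x * (χ (t i * x) : ℂ)) := by
  intro c hc
  obtain ⟨c', hc', h1⟩ := hc.exists_eq_one
  have h2 := (h.ub_scaled hc (t := fun p : ι × Ioi (0 : ℝ) => t p.1 * p.2)
    (fun p => mul_pos (ht _) p.2.2)).ofReal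
  refine ((hf c' hc').mul_bdd h2).congr fun p y => ?_
  have h3 : (c' y : ℂ) * c y = c y := by exact_mod_cast h1 y
  beta_reduce
  rw [← mul_assoc (t p.1)]
  push_cast
  linear_combination (f p.1 (p.2 * y) * χ (t p.1 * p.2 * y)) * h3

lemma SymbolFamily.mul_one_sub_bump {f : ι → ℝ → ℂ} (hf : SymbolFamily 0 f) {χ : ℝ → ℝ}
    (h : IsBump χ) {k : ι → ℝ} (hk : ∀ i, 1 ≤ k i) {δ : ℝ} (hδ : 1 / 2 < δ) (R : ℕ) :
    SymbolFamily (2 * R) (fun i x => f i x * ((k i : ℂ) ^ R * (1 - (χ (k i ^ (-δ) * x) : ℂ)))) := by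
  classical
  intro c hc
  have hk0 : ∀ i, 0 < k i := fun i => one_pos.trans_le (hk i)
  obtain ⟨c', hc', h1⟩ := hc.exists_eq_one
  obtain ⟨ε, B, hε, hεB, hcs⟩ := hc.exists_bound
  have hB : 0 < B := hε.trans hεB
  have h2 := (h.ub_scaled hc (t := fun p : ι × Ioi (0 : ℝ) => k p.1 ^ (-δ) * p.2)
    (fun p => mul_pos (rpow_pos_of_pos (hk0 _) _) p.2.2)).ofReal
  have h3 := (UB.ofReal (hc.ub (ι := ι × Ioi (0 : ℝ)))).sub h2
  have h4 := ((hf c' hc').mul_bdd h3).const_mul (fun p => (k p.1 : ℂ) ^ R)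
  let P : ι × Ioi (0 : ℝ) → Prop := fun p => 1 / (2 * B) ≤ k p.1 ^ (-δ) * p.2
  have h5 := h4.reindex (fun p : {p // P p} => (p : ι × Ioi (0 : ℝ)))
  have hw : ∀ p : ι × Ioi (0 : ℝ), 0 ≤ (p.2 : ℝ) ^ (2 * R) + (p.2 : ℝ) ^ (-(3 / 2) : ℝ) :=
    fun p => by
      have : (0 : ℝ) < p.2 := p.2.2
      positivity
  set c₀ : ℝ := 1 / (2 * B) with hc₀
  have hc₀0 : 0 < c₀ := by positivity
  refine (UB.ite (P := P) hw (g := fun p y => (k p.1 : ℂ) ^ R *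
    (f p.1 (p.2 * y) * c' y * ((c y : ℂ) - ((χ (k p.1 ^ (-δ) * p.2 * y) * c y : ℝ) : ℂ))))
    (h5.mono (C := (1 + c₀ ^ (-(3 / 2) : ℝ)) * (1 / c₀) ^ (2 * R))
    (by positivity) (fun p => hw p) fun p => ?_)).congr fun p y => ?_
  · obtain ⟨⟨i, Λ, hΛ⟩, hp⟩ := p
    simp only [mem_Ioi] at hΛ
    simp only [pow_zero, norm_pow, norm_of_nonneg (hk0 i).le]
    have hp' : c₀ ≤ k i ^ (-δ) * Λ := hp
    have hkd := rpow_pos_of_pos (hk0 i) δ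
    rw [rpow_neg (hk0 i).le] at hp'
    have h6 : c₀ * k i ^ δ ≤ Λ := by
      have := mul_le_mul_of_nonneg_left hp' hkd.le
      rw [mul_inv_cancel_left₀ hkd.ne'] at this
      linarith
    have h7 : c₀ ≤ Λ := by
      have := Real.one_le_rpow (hk i) (by linarith : 0 ≤ δ)
      nlinarith
    have h8 : k i ≤ (1 / c₀ * Λ) ^ 2 := by
      have e1 : k i ^ δ ≤ 1 / c₀ * Λ := by
        rw [one_div, ← div_eq_inv_mul, le_div_iff₀ hc₀0]; linarith
      calc k i = k i ^ (1 : ℝ) := (rpow_one _).symm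
        _ ≤ k i ^ (δ * 2) := rpow_le_rpow_of_exponent_le (hk i) (by linarith)
        _ = (k i ^ δ) ^ 2 := by rw [Real.rpow_mul (hk0 i).le]; norm_num
        _ ≤ _ := pow_le_pow_left₀ hkd.le e1 2
    have h9 : k i ^ R ≤ (1 / c₀) ^ (2 * R) * Λ ^ (2 * R) := by
      rw [← mul_pow, pow_mul]; exact pow_le_pow_left₀ (hk0 i).le h8 R
    have h10 : 1 + Λ ^ (-(3 / 2) : ℝ) ≤ 1 + c₀ ^ (-(3 / 2) : ℝ) := by
      have := Real.rpow_le_rpow_of_nonpos hc₀0 h7 (show (-(3 / 2) : ℝ) ≤ 0 by norm_num)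
      linarith
    calc k i ^ R * (1 + Λ ^ (-(3 / 2) : ℝ))
        ≤ ((1 / c₀) ^ (2 * R) * Λ ^ (2 * R)) * (1 + c₀ ^ (-(3 / 2) : ℝ)) := by gcongr
      _ = (1 + c₀ ^ (-(3 / 2) : ℝ)) * (1 / c₀) ^ (2 * R) * Λ ^ (2 * R) := by ring
      _ ≤ _ := by
        gcongr
        have : (0 : ℝ) ≤ Λ ^ (-(3 / 2) : ℝ) := by positivity
        linarith
  · have h3 : (c' y : ℂ) * c y = c y := by exact_mod_cast h1 y
    split_ifs with hp
    · beta_reduce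
      rw [← mul_assoc (k p.1 ^ (-δ))]
      push_cast
      linear_combination (f p.1 (p.2 * y) * (k p.1 : ℂ) ^ R * (1 - χ (k p.1 ^ (-δ) * p.2 * y))) * h3
    · by_cases hy : c y = 0
      · simp [hy]
      have h6 := hcs y hy
      have h7 : 0 < k p.1 ^ (-δ) * (p.2 : ℝ) := mul_pos (rpow_pos_of_pos (hk0 _) _) p.2.2
      beta_reduce
      rw [h.eq_one]
      · simp
      rw [← mul_assoc, abs_of_pos (mul_pos h7 (hε.trans_le h6.1))]
      have h8 : k p.1 ^ (-δ) * (p.2 : ℝ) < c₀ := not_le.1 hp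
      calc _ ≤ c₀ * B := mul_le_mul h8.le h6.2 (hε.le.trans h6.1) hc₀0.le
        _ = 1 / 2 := by rw [hc₀]; field_simp

end Families

/-! ### Elementary bounds for the kernel -/

/-- The analytic data. -/
structure Setting (Ω : Set ℂ) (q : ℝ → ℂ) (χ : ℝ → ℝ) (δ : ℝ) (τ : ℝ → ℝ) (T : ℝ)
    (lam : ℝ → ℂ) : Prop where
  domain : IsSmoothDomain Ω q
  bump : IsBump χ
  half_lt : 1 / 2 < δ
  lt_one : δ < 1
  tau : ∀ k, 1 ≤ k → 0 ≤ τ k ∧ τ k ≤ T * (1 + Real.log k)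
  lam_eq : ∀ k, lam k = (k : ℂ) + I * (τ k : ℂ)

variable {χ : ℝ → ℝ} {δ : ℝ} {τ : ℝ → ℝ} {T : ℝ} {lam : ℝ → ℂ} {k : ℝ}

local notation "Stg" => Setting Ω q χ δ τ T lam
local notation:max "𝒩" k:max => kernelSplit q χ δ k (lam k)
local notation:max "𝒲" k:max => kernelWord q χ δ k (lam k)

lemma Setting.T_nonneg (H : Stg) : 0 ≤ T := by
  have := H.tau 1 le_rfl
  simp at this
  linarith

lemma Setting.reduced_mem (H : Stg) (hk : 1 ≤ k) : τ k / k ∈ Icc 0 T := by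
  have hk0 : 0 < k := by linarith
  obtain ⟨h1, h2⟩ := H.tau k hk
  refine ⟨by positivity, (div_le_iff₀ hk0).2 (h2.trans ?_)⟩
  have := Real.log_le_sub_one_of_pos hk0
  exact mul_le_mul_of_nonneg_left (by linarith) H.T_nonneg

lemma Setting.ub_specParam (H : Stg) : UB₀ (fun (k : ℝ₁) (_ : E) => specParam (τ k / k)) :=
  UB.specParam fun k => H.reduced_mem k.2

lemma Setting.lam_eq_mul (H : Stg) (hk : 1 ≤ k) : lam k = k * specParam (τ k / k) := by
  have hk0 : (k : ℂ) ≠ 0 := by exact_mod_cast (by linarith : k ≠ 0)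
  rw [H.lam_eq, specParam]
  push_cast
  field_simp

lemma IsSmoothDomain.norm_chord_le (h : Dom) (φ u : ℝ) : ‖q φ - q (φ - u)‖ ≤ |u| := by
  have h1 := smul_sideQuot h 1 φ u
  rw [one_mul] at h1
  rw [norm_sub_rev, ← h1, norm_smul]
  exact mul_le_of_le_one_right (norm_nonneg _) (norm_sideQuot_le h (by simp) _)

lemma IsSmoothDomain.exists_le_chord (h : Dom) :
    ∃ c > 0, ∀ φ u, |u| ≤ π → c * |u| ≤ ‖q φ - q (φ - u)‖ := by
  obtain ⟨u₁, hu⟩ := h.exists_straightScale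
  obtain ⟨r, hr, hc⟩ := h.exists_chord hu.pos
  have hpi := pi_pos
  refine ⟨min (1 / 4) (r / π), by positivity, fun φ u hu1 => ?_⟩
  by_cases hcase : |u| ≤ u₁
  · refine (mul_le_mul_of_nonneg_right (min_le_left _ _) (abs_nonneg u)).trans ?_
    obtain ⟨σ, hσ, hσu⟩ : ∃ σ : ℝ, |σ| = 1 ∧ u = σ * |u| := by
      rcases le_total 0 u with h0 | h0
      · exact ⟨1, by simp, by rw [abs_of_nonneg h0, one_mul]⟩
      · exact ⟨-1, by simp, by rw [abs_of_nonpos h0]; ring⟩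
    have h1 := norm_chord_eq h hσ hu (abs_nonneg u) hcase (φ := φ)
    rw [← hσu] at h1
    rw [h1, mul_comm]
    exact mul_le_mul_of_nonneg_left (sideRadius_mem h hσ _).1 (abs_nonneg u)
  · have h1 : r < ‖q φ - q (φ - u)‖ := by
      by_contra hcon
      exact hcase (hc φ u hu1 (not_lt.1 hcon))
    refine (mul_le_mul (min_le_right _ _) hu1 (abs_nonneg u) (by positivity)).trans ?_
    rw [div_mul_cancel₀ _ hpi.ne']
    exact h1.le

lemma IsSmoothDomain.chord_ne (h : Dom) {φ u : ℝ} (hu : u ≠ 0)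
    (hu1 : |u| ≤ π) : q φ ≠ q (φ - u) := by
  obtain ⟨c, hc, h1⟩ := h.exists_le_chord
  intro heq
  have h2 := h1 φ u hu1
  rw [heq, sub_self, norm_zero] at h2
  have := abs_pos.2 hu
  nlinarith [mul_pos hc this]

lemma IsSmoothDomain.exists_inner_le (h : Dom) :
    ∃ C, 0 ≤ C ∧ ∀ φ u, |inner ℝ (q (φ - u) - q φ) (normal q (φ - u))| ≤ C * |u| ^ 2 := by
  obtain ⟨C, h0, hC⟩ := (UB.sideCurv (ι := Unit) h 1).norm_le
  refine ⟨C, h0, fun φ u => ?_⟩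
  have h1 := smul_sideQuot h 1 φ u
  have h2 := mul_sideCurv h 1 φ u
  rw [one_mul] at h1
  rw [← h1, inner_smul_left]
  rw [sideNormal] at h2
  simp only [one_mul] at h2
  rw [← h2]
  have h3 := hC () (φ, u)
  simp only [mul_one, norm_eq_abs] at h3
  simp only [conj_trivial, abs_mul]
  nlinarith [abs_nonneg u, mul_nonneg (abs_nonneg u) (abs_nonneg u)]

lemma Setting.exists_hankelAmp_le (H : Stg) : ∃ C, 0 ≤ C ∧ ∀ k, 1 ≤ k → ∀ x, 0 < x →
      ‖hankelAmp (specParam (τ k / k)) x‖ ≤ C * (1 + x ^ (-(3 / 2) : ℝ)) := by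
  obtain ⟨c, hc, h1⟩ := exists_isPosCutoff (a := 1 / 2) (b := 1) (by norm_num) (by norm_num)
  obtain ⟨C, h0, hC⟩ := (symbolFamily_hankel (a := fun k : ℝ₁ => τ k / k) (T := T)
    (fun k => H.reduced_mem k.2) c hc).norm_le
  refine ⟨C, h0, fun k hk x hx => ?_⟩
  have := hC (⟨k, hk⟩, ⟨x, hx⟩) 1
  simpa [h1 1 (by norm_num)] using this

lemma Setting.continuousOn_hankelAmp (H : Stg) (hk : 1 ≤ k) :
    ContinuousOn (hankelAmp (specParam (τ k / k))) (Ioi 0) :=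
  ((symbolFamily_hankel (a := fun k : ℝ₁ => τ k / k) (T := T)
    (fun k => H.reduced_mem k.2)).contDiffOn ⟨k, hk⟩).continuousOn

lemma Setting.kernelN_eq (H : Stg) (hk : 1 ≤ k) {φ θ : ℝ} (h : q φ ≠ q θ) :
    kernelN q (lam k) φ θ = I / 2 * k * (exp (I * specParam (τ k / k) * (k * ‖q φ - q θ‖ : ℝ)) *
        hankelAmp (specParam (τ k / k)) (k * ‖q φ - q θ‖)) *
      ((inner ℝ (q θ - q φ) (normal q θ) / ‖q φ - q θ‖ : ℝ) : ℂ) := by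
  rw [H.lam_eq_mul hk]
  exact Billiard.kernelN_eq (by linarith) (specParam_ne_zero _)
    (by simpa using (H.reduced_mem hk).1) h

lemma Setting.exists_kernel_le (H : Stg) : ∃ C, 0 ≤ C ∧ ∀ k, 1 ≤ k → ∀ i φ u, u ≠ 0 → |u| ≤ π →
      ‖𝒩 k i φ (φ - u)‖ ≤ C * k * |u| ^ (-(1 / 2) : ℝ) := by
  obtain ⟨A, hA0, hA⟩ := H.exists_hankelAmp_le
  obtain ⟨B, hB0, hB⟩ := H.domain.exists_inner_le
  obtain ⟨c, hc, hcu⟩ := H.domain.exists_le_chord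
  obtain ⟨D, hD1, hD⟩ := H.bump.exists_bound
  refine ⟨(1 + D) * (A * (4 + c ^ (-(3 / 2) : ℝ)) * (B / c)) * 2, by positivity,
    fun k hk i φ u hu hu1 => ?_⟩
  have hk0 : 0 < k := by linarith
  have hup := abs_pos.2 hu
  set r := ‖q φ - q (φ - u)‖
  have hr : c * |u| ≤ r := hcu φ u hu1
  have hr0 : 0 < r := (mul_pos hc hup).trans_le hr
  have h1 : ‖(if i = 0 then (χ (k ^ (1 - δ) * r) : ℂ) else 1 - (χ (k ^ (1 - δ) * r) : ℂ))‖ ≤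
      1 + D := by
    split_ifs
    · rw [norm_real]; exact (hD _).trans (by linarith)
    · refine (norm_sub_le _ _).trans ?_
      rw [norm_one, norm_real]; gcongr; exact hD _
  have h2 : ‖exp (I * specParam (τ k / k) * (k * r : ℝ))‖ ≤ 1 := by
    rw [norm_exp, Real.exp_le_one_iff]
    have := (H.reduced_mem hk).1
    simp [specParam, -Complex.ofReal_div]
    have h5 : 0 ≤ k * r := by positivity
    nlinarith
  have h3 : ‖((inner ℝ (q (φ - u) - q φ) (normal q (φ - u)) / r : ℝ) : ℂ)‖ ≤ B / c * |u| := by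
    rw [norm_real, norm_eq_abs, abs_div, abs_of_pos hr0, div_le_iff₀ hr0]
    refine (hB φ u).trans ?_
    calc B * |u| ^ 2 = B / c * |u| * (c * |u|) := by field_simp
      _ ≤ _ := by gcongr
  have h4 : |u| * (1 + (k * r) ^ (-(3 / 2) : ℝ)) ≤
      (4 + c ^ (-(3 / 2) : ℝ)) * 2 * |u| ^ (-(1 / 2) : ℝ) := by
    have e1 : (k * r) ^ (-(3 / 2) : ℝ) ≤ (c * |u|) ^ (-(3 / 2) : ℝ) :=
      Real.rpow_le_rpow_of_nonpos (by positivity) (by nlinarith) (by norm_num)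
    have e2 : |u| * (c * |u|) ^ (-(3 / 2) : ℝ) = c ^ (-(3 / 2) : ℝ) * |u| ^ (-(1 / 2) : ℝ) := by
      rw [Real.mul_rpow hc.le hup.le, show (-(1 / 2) : ℝ) = 1 + -(3 / 2) by norm_num,
        rpow_add hup, rpow_one]
      ring
    have e3 : |u| ≤ 8 * |u| ^ (-(1 / 2) : ℝ) := by
      have e4 : |u| = |u| ^ (3 / 2 : ℝ) * |u| ^ (-(1 / 2) : ℝ) := by rw [← rpow_add hup]; norm_num
      have e5 : |u| ^ (3 / 2 : ℝ) ≤ 8 := by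
        calc |u| ^ (3 / 2 : ℝ) ≤ 4 ^ (3 / 2 : ℝ) :=
              Real.rpow_le_rpow hup.le (hu1.trans Real.pi_le_four) (by norm_num)
          _ = 8 := by
              rw [show (4 : ℝ) = 2 ^ (2 : ℝ) by norm_num, ← Real.rpow_mul (by norm_num)]
              norm_num
      nth_rewrite 1 [e4]
      gcongr
    have e6 : 0 ≤ c ^ (-(3 / 2) : ℝ) * |u| ^ (-(1 / 2) : ℝ) := by positivity
    have e7 := mul_le_mul_of_nonneg_left e1 hup.le
    nlinarith
  rw [kernelSplit, H.kernelN_eq hk (H.domain.chord_ne hu hu1)]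
  simp only [norm_mul, norm_div, norm_I, norm_ofNat, norm_of_nonneg hk0.le] at *
  have h5 := hA k hk (k * r) (by positivity)
  calc _ ≤ (1 + D) * (1 / 2 * k * (1 * (A * (1 + (k * r) ^ (-(3 / 2) : ℝ)))) *
        (B / c * |u|)) := by gcongr
    _ = (1 + D) * (1 / 2 * k * A * (B / c)) * (|u| * (1 + (k * r) ^ (-(3 / 2) : ℝ))) := by ring
    _ ≤ (1 + D) * (1 / 2 * k * A * (B / c)) *
        ((4 + c ^ (-(3 / 2) : ℝ)) * 2 * |u| ^ (-(1 / 2) : ℝ)) := by gcongr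
    _ = (1 + D) * (A * (4 + c ^ (-(3 / 2) : ℝ)) * (B / c)) * k * |u| ^ (-(1 / 2) : ℝ) := by ring
    _ ≤ _ := by
      have : 0 ≤ (1 + D) * (A * (4 + c ^ (-(3 / 2) : ℝ)) * (B / c)) * k *
        |u| ^ (-(1 / 2) : ℝ) := by positivity
      nlinarith

lemma Setting.continuousOn_kernel (H : Stg) (hk : 1 ≤ k) (i : Fin 2) :
    ContinuousOn (fun p : ℝ × ℝ => 𝒩 k i p.1 (p.1 - p.2)) {p | p.2 ≠ 0 ∧ |p.2| ≤ π} := by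
  have hk0 : 0 < k := by linarith
  have hq := H.domain.smooth.continuous
  have hr : Continuous fun p : ℝ × ℝ => ‖q p.1 - q (p.1 - p.2)‖ := by fun_prop
  have hn : Continuous (normal q) := continuous_const.mul H.domain.contDiff_deriv.continuous
  have hpos : ∀ p ∈ {p : ℝ × ℝ | p.2 ≠ 0 ∧ |p.2| ≤ π}, 0 < ‖q p.1 - q (p.1 - p.2)‖ :=
    fun p hp => norm_pos_iff.2 (sub_ne_zero.2 (H.domain.chord_ne hp.1 hp.2))
  have h1 : ContinuousOn (fun p : ℝ × ℝ => kernelN q (lam k) p.1 (p.1 - p.2))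
      {p | p.2 ≠ 0 ∧ |p.2| ≤ π} := by
    refine ContinuousOn.congr ?_ fun p hp => H.kernelN_eq hk (H.domain.chord_ne hp.1 hp.2)
    refine ContinuousOn.mul (ContinuousOn.mul continuousOn_const (ContinuousOn.mul ?_ ?_)) ?_
    · exact Continuous.continuousOn (by fun_prop)
    · exact (H.continuousOn_hankelAmp hk).comp (by fun_prop) fun p hp => mul_pos hk0 (hpos p hp)
    · refine continuous_ofReal.comp_continuousOn (ContinuousOn.div ?_ hr.continuousOn
        fun p hp => (hpos p hp).ne')
      exact Continuous.continuousOn (by fun_prop)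
  refine ContinuousOn.mul (Continuous.continuousOn ?_) h1
  have hχ := H.bump.smooth.continuous
  by_cases hi : i = 0
  · simp only [hi, if_true]; fun_prop
  · simp only [hi, if_false]; fun_prop

lemma IsSmoothDomain.normal_periodic (h : Dom) : Periodic (normal q) (2 * π) := fun φ => by
  rw [normal, normal, h.deriv_periodic]

lemma kernelSplit_add_two_pi (h : Dom) (k : ℝ) (l : ℂ) (i : Fin 2) (φ : ℝ) :
    Periodic (kernelSplit q χ δ k l i φ) (2 * π) := fun θ => by
  simp only [kernelSplit, kernelN, h.periodic θ, h.normal_periodic θ]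

lemma kernelSplit_add_two_pi_left (h : Dom) (k : ℝ) (l : ℂ) (i : Fin 2) (φ θ : ℝ) :
    kernelSplit q χ δ k l i (φ + 2 * π) θ = kernelSplit q χ δ k l i φ θ := by
  simp only [kernelSplit, kernelN, h.periodic φ]

lemma intervalIntegrable_abs_rpow :
    IntervalIntegrable (fun u : ℝ => |u| ^ (-(1 / 2) : ℝ)) volume (-π) π := by
  have hpi := pi_pos
  have h1 : IntervalIntegrable (fun u : ℝ => |u| ^ (-(1 / 2) : ℝ)) volume 0 π := by
    refine (intervalIntegral.intervalIntegrable_rpow' (a := 0) (b := π)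
      (r := -(1 / 2)) (by norm_num)).congr fun x hx => ?_
    rw [uIoc_of_le hpi.le] at hx
    simp only [abs_of_pos hx.1]
  have h2 := h1.comp_mul_left (c := -1)
  simp only [neg_mul, one_mul, abs_neg, div_neg, div_one, neg_zero] at h2
  exact h2.symm.trans h1

lemma Setting.intervalIntegrable_kernel (H : Stg) (hk : 1 ≤ k) (i : Fin 2) (φ : ℝ) :
    IntervalIntegrable (fun u => 𝒩 k i φ (φ - u)) volume (-π) π := by
  obtain ⟨C, h0, hC⟩ := H.exists_kernel_le
  have hpi := pi_pos
  have hle : -π ≤ π := by linarith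
  have h1 := (intervalIntegrable_abs_rpow.const_mul (C * k))
  rw [intervalIntegrable_iff_integrableOn_Ioc_of_le hle] at h1 ⊢
  have hae : ∀ᵐ u : ℝ ∂volume, u ≠ 0 := by simp [ae_iff]
  have hset : (Ioc (-π) π ∩ {0}ᶜ : Set ℝ) =ᵐ[volume] Ioc (-π) π := by
    filter_upwards [hae] with u hu
    simp only [eq_iff_iff]
    constructor
    · exact fun h => h.1
    · exact fun h => ⟨h, hu⟩
  have hm : AEStronglyMeasurable (fun u => 𝒩 k i φ (φ - u)) (volume.restrict (Ioc (-π) π)) := by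
    rw [← Measure.restrict_congr_set hset]
    refine ContinuousOn.aestronglyMeasurable ?_
      (measurableSet_Ioc.inter (measurableSet_singleton 0).compl)
    exact (H.continuousOn_kernel hk i).comp (f := fun u : ℝ => (φ, u)) (by fun_prop)
      fun u hu => ⟨hu.2, abs_le.2 ⟨hu.1.1.le, hu.1.2⟩⟩
  refine Integrable.mono' h1 hm ?_
  filter_upwards [ae_restrict_mem measurableSet_Ioc, ae_restrict_of_ae hae] with u hu hu0
  exact hC k hk i φ u hu0 (abs_le.2 ⟨hu.1.le, hu.2⟩)

/-- Kernels that are continuous and periodic in the left variable. -/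
structure LeftRegular (K : ℝ → ℝ → ℂ) : Prop where
  continuous : ∀ φ₂, Continuous fun φ => K φ φ₂
  periodic : ∀ φ₂, Periodic (fun φ => K φ φ₂) (2 * π)

lemma LeftRegular.add {K L : ℝ → ℝ → ℂ} (hK : LeftRegular K) (hL : LeftRegular L) :
    LeftRegular fun φ₁ φ₂ => K φ₁ φ₂ + L φ₁ φ₂ :=
  ⟨fun φ => (hK.continuous φ).add (hL.continuous φ), fun φ => (hK.periodic φ).add (hL.periodic φ)⟩

lemma LeftRegular.sub {K L : ℝ → ℝ → ℂ} (hK : LeftRegular K) (hL : LeftRegular L) :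
    LeftRegular fun φ₁ φ₂ => K φ₁ φ₂ - L φ₁ φ₂ :=
  ⟨fun φ => (hK.continuous φ).sub (hL.continuous φ), fun φ => (hK.periodic φ).sub (hL.periodic φ)⟩

/-- An integral over a period, centred. -/
lemma integral_period_eq {f : ℝ → ℂ} (hf : Periodic f (2 * π)) (φ : ℝ) :
    ∫ θ in (0 : ℝ)..(2 * π), f θ = ∫ u in (-π)..π, f (φ - u) := by
  have h1 := hf.intervalIntegral_add_eq 0 (φ - π)
  rw [zero_add] at h1
  rw [h1, intervalIntegral.integral_comp_sub_left, sub_neg_eq_add]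
  congr 1; ring

lemma compKernel_eq (h : Dom) {k : ℝ} {l : ℂ} {i : Fin 2} {K : ℝ → ℝ → ℂ}
    (hK : LeftRegular K) (φ φ₂ : ℝ) :
    compKernel (kernelSplit q χ δ k l i) K φ φ₂ =
      ∫ u in (-π)..π, kernelSplit q χ δ k l i φ (φ - u) * K (φ - u) φ₂ :=
  integral_period_eq ((kernelSplit_add_two_pi h k l i φ).mul (hK.periodic φ₂)) φ

lemma Setting.intervalIntegrable_mul (H : Stg) (hk : 1 ≤ k)
    (i : Fin 2) (φ : ℝ) {g : ℝ → ℂ} (hg : Continuous g) :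
    IntervalIntegrable (fun u => 𝒩 k i φ (φ - u) * g u) volume (-π) π :=
  (H.intervalIntegrable_kernel hk i φ).mul_continuousOn hg.continuousOn

lemma Setting.compKernel_add (H : Stg) (hk : 1 ≤ k) {i : Fin 2}
    {K L : ℝ → ℝ → ℂ} (hK : LeftRegular K) (hL : LeftRegular L) (φ φ₂ : ℝ) :
    compKernel (𝒩 k i) (fun φ₁ φ₂ => K φ₁ φ₂ + L φ₁ φ₂) φ φ₂ = compKernel (𝒩 k i) K φ φ₂ +
        compKernel (𝒩 k i) L φ φ₂ := by
  rw [compKernel_eq H.domain hK, compKernel_eq H.domain hL, compKernel_eq H.domain (hK.add hL),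
    ← int_add]
  · simp only [mul_add]
  · exact H.intervalIntegrable_mul hk i φ ((hK.continuous φ₂).comp (continuous_sub_left φ))
  · exact H.intervalIntegrable_mul hk i φ ((hL.continuous φ₂).comp (continuous_sub_left φ))

lemma Setting.leftRegular_comp (H : Stg) (hk : 1 ≤ k) (i : Fin 2)
    {K : ℝ → ℝ → ℂ} (hK : LeftRegular K) :
    LeftRegular (compKernel (𝒩 k i) K) := by
  refine ⟨fun φ₂ => ?_, fun φ₂ φ => ?_⟩
  · simp only [compKernel_eq H.domain hK]
    obtain ⟨C, h0, hC⟩ := H.exists_kernel_le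
    have hc := hK.continuous φ₂
    obtain ⟨B, hB⟩ : ∃ B, ∀ φ, ‖K φ φ₂‖ ≤ B := by
      have := (hK.periodic φ₂).compact_of_continuous two_pi_pos.ne' hc
      obtain ⟨B, hB⟩ := this.isBounded.exists_norm_le
      exact ⟨B, fun φ => hB _ (mem_range_self φ)⟩
    have hpi := pi_pos
    have hae : ∀ᵐ u : ℝ ∂volume, u ≠ 0 := by simp [ae_iff]
    refine intervalIntegral.continuous_of_dominated_interval
      (bound := fun u => C * k * |u| ^ (-(1 / 2) : ℝ) * B) ?_ ?_ ?_ ?_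
    · intro φ
      have h1 := H.intervalIntegrable_mul hk i φ (hc.comp (continuous_sub_left φ))
      exact (intervalIntegrable_iff.1 h1).aestronglyMeasurable
    · intro φ
      filter_upwards [hae] with u hu hu1
      rw [uIoc_of_le (by linarith)] at hu1
      rw [norm_mul]
      have h2 := hC k hk i φ u hu (abs_le.2 ⟨hu1.1.le, hu1.2⟩)
      exact mul_le_mul h2 (hB _) (norm_nonneg _) ((norm_nonneg _).trans h2)
    · exact (intervalIntegrable_abs_rpow.const_mul (C * k)).mul_const B
    · filter_upwards [hae] with u hu hu1
      rw [uIoc_of_le (by linarith)] at hu1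
      refine Continuous.mul ?_ (by fun_prop)
      exact (H.continuousOn_kernel hk i).comp_continuous (f := fun φ : ℝ => (φ, u)) (by fun_prop)
        fun φ => ⟨hu, abs_le.2 ⟨hu1.1.le, hu1.2⟩⟩
  · simp only [compKernel, kernelSplit_add_two_pi_left H.domain]

lemma Setting.exists_norm_compKernel_le (H : Stg) :
    ∃ C, 0 ≤ C ∧ ∀ k, 1 ≤ k → ∀ (i : Fin 2) (K : ℝ → ℝ → ℂ), LeftRegular K →
      ∀ (φ₂ B : ℝ), (∀ φ, ‖K φ φ₂‖ ≤ B) → ∀ φ,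
      ‖compKernel (𝒩 k i) K φ φ₂‖ ≤ C * k * B := by
  obtain ⟨C, h0, hC⟩ := H.exists_kernel_le
  have hpi := pi_pos
  have hae : ∀ᵐ u : ℝ ∂volume, u ≠ 0 := by simp [ae_iff]
  refine ⟨C * ∫ u in (-π)..π, |u| ^ (-(1 / 2) : ℝ), mul_nonneg h0
    (intervalIntegral.integral_nonneg (by linarith) fun u _ => by positivity),
    fun k hk i K hK φ₂ B hB φ => ?_⟩
  rw [compKernel_eq H.domain hK]
  refine (intervalIntegral.norm_integral_le_of_norm_le (g := fun u =>
    (C * k * |u| ^ (-(1 / 2) : ℝ)) * B) (by linarith) ?_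
    ((intervalIntegrable_abs_rpow.const_mul (C * k)).mul_const B)).trans_eq ?_
  · filter_upwards [hae] with u hu hu1
    rw [norm_mul]
    have h2 := hC k hk i φ u hu (abs_le.2 ⟨hu1.1.le, hu1.2⟩)
    exact mul_le_mul h2 (hB _) (norm_nonneg _) ((norm_nonneg _).trans h2)
  · rw [int_mul_const, int_const_mul]
    ring

/-! ### Pseudodifferential kernels -/

lemma quantize_eq_sum {k ρ : ℝ} (hk : 0 < k) {a : ℝ × ℝ → ℂ} (ha : ∀ φ η, a (φ, η) ≠ 0 → |η| ≤ ρ)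
    (φ θ : ℝ) : quantize k a φ θ = (1 / (2 * π) : ℂ) *
      ∑ n ∈ Finset.Icc (-⌈ρ * k⌉) ⌈ρ * k⌉, a (φ, n / k) * exp (I * n * (φ - θ)) := by
  rw [quantize, tsum_eq_sum]
  intro n hn
  have : a (φ, n / k) = 0 := by
    by_contra hcon
    have h1 := ha _ _ hcon
    rw [abs_div, abs_of_pos hk, div_le_iff₀ hk] at h1
    have h2 := h1.trans (Int.le_ceil _)
    rw [Finset.mem_Icc, ← abs_le] at hn
    exact hn (by exact_mod_cast h2)
  rw [this, zero_mul]

lemma card_Icc_ceil_le {k ρ : ℝ} (hk : 1 ≤ k) (hρ : 0 ≤ ρ) :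
    ((Finset.Icc (-⌈ρ * k⌉) ⌈ρ * k⌉).card : ℝ) ≤ (2 * ρ + 3) * k := by
  rw [Int.card_Icc]
  have h3 : (0 : ℤ) ≤ ⌈ρ * k⌉ := Int.ceil_nonneg (by positivity)
  have h4 : ((⌈ρ * k⌉ + 1 - -⌈ρ * k⌉).toNat : ℝ) = 2 * ⌈ρ * k⌉ + 1 := by
    have : ((⌈ρ * k⌉ + 1 - -⌈ρ * k⌉).toNat : ℤ) = 2 * ⌈ρ * k⌉ + 1 := by omega
    exact_mod_cast this
  rw [h4]
  have h5 := (Int.ceil_lt_add_one (ρ * k)).le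
  nlinarith

lemma norm_quantize_le {k ρ B : ℝ} (hk : 1 ≤ k) (hρ : 0 ≤ ρ) {a : ℝ × ℝ → ℂ}
    (ha : ∀ φ η, a (φ, η) ≠ 0 → |η| ≤ ρ) {φ : ℝ} (hB : ∀ η, ‖a (φ, η)‖ ≤ B) (θ : ℝ) :
    ‖quantize k a φ θ‖ ≤ (2 * ρ + 3) * k * B := by
  have hB0 : 0 ≤ B := (norm_nonneg _).trans (hB 0)
  rw [quantize_eq_sum (by linarith) ha, norm_mul]
  have h1 : ‖∑ n ∈ Finset.Icc (-⌈ρ * k⌉) ⌈ρ * k⌉, a (φ, n / k) * exp (I * n * (φ - θ))‖ ≤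
      ∑ n ∈ Finset.Icc (-⌈ρ * k⌉) ⌈ρ * k⌉, B := by
    refine (norm_sum_le _ _).trans (sum_le_sum fun n _ => ?_)
    have : ‖exp (I * n * (φ - θ))‖ = 1 := by rw [norm_exp]; simp
    rw [norm_mul, this, mul_one]
    exact hB _
  have h2 : ‖(1 / (2 * π) : ℂ)‖ ≤ 1 := by
    have hpi := pi_gt_three
    rw [norm_div, norm_one, norm_mul, norm_ofNat, norm_of_nonneg (by linarith), div_le_one (by linarith)]
    linarith
  refine (mul_le_mul h2 h1 (norm_nonneg _) zero_le_one).trans ?_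
  rw [one_mul, Finset.sum_const, nsmul_eq_mul]
  exact mul_le_mul_of_nonneg_right (card_Icc_ceil_le hk hρ) hB0

lemma leftRegular_quantize {k ρ : ℝ} (hk : 0 < k) {a : ℝ × ℝ → ℂ}
    (ha : ∀ φ η, a (φ, η) ≠ 0 → |η| ≤ ρ) (hc : Continuous a)
    (hp : ∀ φ η, a (φ + 2 * π, η) = a (φ, η)) : LeftRegular (quantize k a) := by
  refine ⟨fun θ => ?_, fun θ φ => ?_⟩
  · simp only [quantize_eq_sum hk ha]
    fun_prop
  · simp only [quantize, hp]
    congr 2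
    ext n
    congr 1
    have : I * n * ((φ + 2 * π : ℝ) - θ) = I * n * (φ - θ) + n * (2 * π * I) := by push_cast; ring
    rw [this, exp_add, Complex.exp_int_mul_two_pi_mul_I, mul_one]

/-- A family of symbols with `|η| ≤ ρ` and `q φ ∈ V` on its support. -/
structure PsiSymbol (q : ℝ → ℂ) (ρ : ℝ) (V : Set ℂ) (b : ℝ → ℝ × ℝ → ℂ) : Prop where
  ub : UB₀ (fun (k : ℝ₁) => b k)
  periodic : ∀ k, 1 ≤ k → ∀ φ η, b k (φ + 2 * π, η) = b k (φ, η)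
  support : ∀ k, 1 ≤ k → ∀ φ η, b k (φ, η) ≠ 0 → |η| ≤ ρ ∧ q φ ∈ V

lemma PsiSymbol.continuous {ρ : ℝ} {V : Set ℂ} {b : ℝ → ℝ × ℝ → ℂ} (h : PsiSymbol q ρ V b) {k : ℝ}
    (hk : 1 ≤ k) : Continuous (b k) := (h.ub.smooth ⟨k, hk⟩).continuous

lemma PsiSymbol.leftRegular {ρ : ℝ} {V : Set ℂ} {b : ℝ → ℝ × ℝ → ℂ} (h : PsiSymbol q ρ V b) {k : ℝ}
    (hk : 1 ≤ k) : LeftRegular (quantize k (b k)) :=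
  leftRegular_quantize (by linarith) (fun φ η hb => (h.support k hk φ η hb).1) (h.continuous hk)
    (h.periodic k hk)

/-- The kernel is, for large `k`, pseudodifferential of order `-m`. -/
def PsiForm (q : ℝ → ℂ) (ρ : ℝ) (V : Set ℂ) (m : ℕ) (X : ℝ → ℝ → ℝ → ℂ) : Prop :=
  ∃ b, PsiSymbol q ρ V b ∧ ∃ k₀, ∀ k, 1 ≤ k → k₀ ≤ k → ∀ φ₁ φ₂,
    X k φ₁ φ₂ = ((k : ℂ) ^ m)⁻¹ * quantize k (b k) φ₁ φ₂

lemma PsiSymbol.isPseudodifferential {ρ : ℝ} {V : Set ℂ} {b : ℝ → ℝ × ℝ → ℂ}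
    (h : PsiSymbol q ρ V b) (m : ℕ) :
    IsPseudodifferential (-(m : ℝ)) fun k φ₁ φ₂ => ((k : ℂ) ^ m)⁻¹ * quantize k (b k) φ₁ φ₂ := by
  refine ⟨b, fun k hk => h.ub.smooth ⟨k, hk⟩, h.periodic, ⟨ρ, fun k hk φ η hη => ?_⟩, fun j => ?_,
    fun k hk φ θ => ?_⟩
  · by_contra hcon
    exact hη.not_ge (h.support k hk φ η hcon).1
  · obtain ⟨C, -, hC⟩ := h.ub.bound j
    exact ⟨C, fun k hk z => by simpa using hC ⟨k, hk⟩ z⟩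
  · rw [rpow_neg (by linarith), rpow_natCast]
    push_cast
    rfl

lemma exists_one_le_rpow_mul {δ : ℝ} (hδ : δ < 1) {ε : ℝ} (hε : 0 < ε) :
    ∃ k₀ : ℝ, ∀ k, k₀ ≤ k → 1 ≤ k ^ (1 - δ) * ε := by
  have h := (tendsto_rpow_atTop (y := 1 - δ) (by linarith)).eventually_ge_atTop (1 / ε)
  obtain ⟨k₀, hk⟩ := h.exists_forall_of_atTop
  exact ⟨k₀, fun k h => by have := hk k h; rwa [div_le_iff₀ hε] at this⟩

lemma Setting.symbol_zero (H : Stg) :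
    SymbolFamily 0 (fun (k : ℝ₁) x => hankelAmp (specParam (τ k / k)) x *
      (χ ((k : ℝ) ^ (-δ) * x) : ℂ)) :=
  (symbolFamily_hankel fun k => H.reduced_mem k.2).mul_bump H.bump fun k =>
    rpow_pos_of_pos (one_pos.trans_le k.2) _

lemma rpow_mul_chord {k : ℝ} (hk : 1 ≤ k) (δ r : ℝ) : k ^ (-δ) * (k * r) = k ^ (1 - δ) * r := by
  rw [← mul_assoc, sub_eq_neg_add, rpow_add (by linarith), rpow_one]

/-- For large `k`, the kernel of `N₀` is supported near the diagonal. -/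
lemma Setting.kernelSplit_zero_mul_bump (H : Stg) {k ε : ℝ}
    (hε : 0 < ε) (hkε : 1 ≤ k ^ (1 - δ) * ε) (φ θ : ℝ) :
    𝒩 k 0 φ θ * (Billiard.bump ε ‖q φ - q θ‖ : ℂ) = 𝒩 k 0 φ θ ∧
    (𝒩 k 0 φ θ ≠ 0 → ‖q φ - q θ‖ ≤ ε) := by
  have h : 𝒩 k 0 φ θ ≠ 0 → ‖q φ - q θ‖ ≤ ε := fun h => by
    by_contra hcon
    rw [not_le] at hcon
    have hk : 0 < k ^ (1 - δ) := by
      by_contra h1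
      nlinarith
    refine h ?_
    rw [kernelSplit, if_pos rfl, H.bump.eq_zero, ofReal_zero, zero_mul]
    rw [abs_of_pos (mul_pos hk (hε.trans hcon))]
    nlinarith
  refine ⟨?_, h⟩
  by_cases h0 : 𝒩 k 0 φ θ = 0
  · rw [h0, zero_mul]
  · rw [bump_eq_one hε (by rw [abs_norm]; exact h h0), ofReal_one, mul_one]

/-- `V'` contains a neighbourhood of `V` of positive radius. -/
def Thickens (V V' : Set ℂ) : Prop := ∃ ε > 0, ∀ z ∈ V, ∀ w, ‖w - z‖ ≤ ε → w ∈ V'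

lemma PsiSymbol.nearData (H : Stg) {ρ : ℝ} (hρ : ρ ≤ 1 / 2) {V : Set ℂ}
    {b : ℝ → ℝ × ℝ → ℂ} (hb : PsiSymbol q ρ V b) {u₁ r₁ : ℝ} (hs : NearScale q u₁ r₁) {R : ℕ}
    {X : ℝ₁ → ℝ → ℂ} (hX : SymbolFamily R fun (k : ℝ₁) x =>
      hankelAmp (specParam (τ k / k)) x * X k x) :
    NearData q u₁ r₁ R (fun k : ℝ₁ => (k : ℝ)) (fun k => τ k / k) X
      (fun _ p => ((-truncId p.1.2 : ℝ) : ℂ)) (fun k p => b k (p.1.1 - p.2, p.1.2)) := by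
  have hfs : UB₁ (fun (_ : ℝ₁) (p : (ℝ × ℝ) × ℝ) => p.1.2) :=
    UB₁.linear ((snd ℝ ℝ ℝ).comp (fst ℝ (ℝ × ℝ) ℝ))
  have hG : UB₀ (fun (_ : ℝ₁) (p : (ℝ × ℝ) × ℝ) =>
      ((-truncId p.1.2 : ℝ) : ℂ)) := ((UB.truncId.comp hfs).neg).ofReal
  refine ⟨hs, fun k => k.2, ⟨T, fun k => H.reduced_mem k.2⟩, hX, hG, ?_, ?_, ?_⟩
  · refine hb.ub.comp (UB₁.prodMk ?_ hfs)
    have := (UB₁.sideShift (ι := ℝ₁) 1).comp UB₁.fstfst_snd (E := (ℝ × ℝ) × ℝ)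
    simpa using this
  · intro k φ η u hu hr hb0
    have h1 := (hb.support k k.2 _ _ hb0).1
    have h2 : radialDeriv (fun p : (ℝ × ℝ) × ℝ => ((-truncId p.1.2 : ℝ) : ℂ)) ((φ, η), u) =
        ((-η : ℝ) : ℂ) := by
      refine radialDeriv_eq_of_hasDerivAt (hG.smooth k) ?_
      simp only [truncId_eq (h1.trans (hρ.trans (by norm_num)))]
      simpa using ((hasDerivAt_id u).ofReal_comp).mul_const ((-η : ℝ) : ℂ)
    rw [h2, Complex.ofReal_re, abs_neg]
    exact h1.trans hρ
  · intro k φ η u hu hr hb0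
    have h1 := (H.reduced_mem k.2).1
    rw [Complex.ofReal_im, mul_zero, add_zero]
    positivity

/-- Composition with `N₀` lowers the order of a pseudodifferential kernel. -/
theorem PsiForm.comp_zero (H : Stg) {ρ : ℝ} (hρ : ρ ≤ 1 / 2) {V V' : Set ℂ}
    (hV : Thickens V V') {m : ℕ} {X : ℝ → ℝ → ℝ → ℂ} (h : PsiForm q ρ V m X) :
    PsiForm q ρ V' (m + 1) (fun k => compKernel (𝒩 k 0) (X k)) := by
  classical
  obtain ⟨b, hb, k₀, hX⟩ := h
  obtain ⟨ε, hε, hV⟩ := hV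
  obtain ⟨u₁, r, hr, hs⟩ := H.domain.exists_nearScale
  have hr₁ : 0 < min r ε := lt_min hr hε
  have hD := hb.nearData H hρ (hs _ hr₁ (min_le_left _ _)) H.symbol_zero
  obtain ⟨k₁, hk₁⟩ := exists_one_le_rpow_mul H.lt_one hr₁
  have hnear : ∀ k (hk : 1 ≤ k), k₁ ≤ k → ∀ φ η u, nearIntegrand q (min r ε) k (τ k / k)
      (fun x => (χ (k ^ (-δ) * x) : ℂ)) (fun p => ((-truncId p.1.2 : ℝ) : ℂ))
      (fun p : (ℝ × ℝ) × ℝ => b k (p.1.1 - p.2, p.1.2)) (φ, η) u =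
      𝒩 k 0 φ (φ - u) * (b k (φ - u, η) * exp (I * (k * -η) * u)) := fun k hk hk1 φ η u => by
    rw [← (H.kernelSplit_zero_mul_bump hr₁ (hk₁ k hk1) φ (φ - u)).1, kernelSplit, nearIntegrand,
      rpow_mul_chord hk, H.lam_eq_mul hk, if_pos rfl]
    by_cases hb0 : b k (φ - u, η) = 0
    · simp [hb0]
    dsimp only
    rw [truncId_eq ((hb.support k hk _ _ hb0).1.trans (hρ.trans (by norm_num)))]
    have : I * k * u * ((-η : ℝ) : ℂ) = I * (k * -η) * u := by push_cast; ring
    rw [this]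
    ring
  let b' : ℝ → ℝ × ℝ → ℂ := fun k z => if k₁ ≤ k then k * ∫ u in (-π)..π,
    nearIntegrand q (min r ε) k (τ k / k)
      (fun x => (χ (k ^ (-δ) * x) : ℂ)) (fun p => ((-truncId p.1.2 : ℝ) : ℂ))
      (fun p : (ℝ × ℝ) × ℝ => b k (p.1.1 - p.2, p.1.2)) z u else 0
  refine ⟨b', ⟨?_, ?_, ?_⟩, max k₀ k₁, ?_⟩
  · exact UB.ite (fun _ => zero_le_one) (P := fun k : ℝ₁ => k₁ ≤ k)
      (g := fun k z => k * ∫ u in (-π)..π, nearIntegrand q (min r ε) k (τ k / k)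
        (fun x => (χ ((k : ℝ) ^ (-δ) * x) : ℂ)) (fun p => ((-truncId p.1.2 : ℝ) : ℂ))
        (fun p : (ℝ × ℝ) × ℝ => b k (p.1.1 - p.2, p.1.2)) z u)
      ((hD.ub H.domain).reindex fun k : {k : ℝ₁ // k₁ ≤ k} => (k : ℝ₁))
  · intro k hk φ η
    by_cases hk1 : k₁ ≤ k
    · simp only [b', if_pos hk1, hnear k hk hk1]
      congr 2
      ext u
      rw [kernelSplit_add_two_pi_left H.domain, add_sub_right_comm,
        kernelSplit_add_two_pi H.domain, hb.periodic k hk]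
    · simp only [b', if_neg hk1]
  · intro k hk φ η hne
    by_cases hk1 : k₁ ≤ k
    swap
    · exact absurd (by simp only [b', if_neg hk1]) hne
    obtain ⟨u, hu⟩ : ∃ u, 𝒩 k 0 φ (φ - u) ≠ 0 ∧ b k (φ - u, η) ≠ 0 := by
      by_contra! hcon
      refine hne ?_
      simp only [b', if_pos hk1, hnear k hk hk1]
      rw [int_congr (g := fun _ => 0)]
      · simp
      intro u _
      by_cases h0 : 𝒩 k 0 φ (φ - u) = 0
      · simp [h0]
      · simp [hcon u h0]
    obtain ⟨h1, h2⟩ := hb.support k hk _ _ hu.2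
    refine ⟨h1, hV _ h2 _ ?_⟩
    exact ((H.kernelSplit_zero_mul_bump hr₁ (hk₁ k hk1) φ (φ - u)).2 hu.1).trans (min_le_right _ _)
  · intro k hk hk0 φ₁ φ₂
    have hk1 : k₁ ≤ k := (le_max_right _ _).trans hk0
    have hkpos : 0 < k := by linarith
    have hkc : (k : ℂ) ≠ 0 := by exact_mod_cast hkpos.ne'
    have hX' : X k = fun φ₁ φ₂ => ((k : ℂ) ^ m)⁻¹ * quantize k (b k) φ₁ φ₂ :=
      funext fun φ₁ => funext fun φ₂ => hX k hk ((le_max_left _ _).trans hk0) φ₁ φ₂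
    have hbs : ∀ φ η, b k (φ, η) ≠ 0 → |η| ≤ ρ := fun φ η h => (hb.support k hk φ η h).1
    have hbs' : ∀ φ η, b' k (φ, η) ≠ 0 → |η| ≤ ρ := fun φ η h => by
      by_contra hcon
      refine h ?_
      simp only [b', if_pos hk1, hnear k hk hk1]
      have : ∀ u, b k (φ - u, η) = 0 := fun u => by
        by_contra h0
        exact hcon (hbs _ _ h0)
      simp [this]
    have e1 : compKernel (𝒩 k 0) (X k) φ₁ φ₂ =
        ((k : ℂ) ^ m)⁻¹ * compKernel (𝒩 k 0) (quantize k (b k)) φ₁ φ₂ := by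
      rw [hX', compKernel, compKernel, ← int_const_mul]
      congr 1; ext θ; ring
    beta_reduce
    rw [e1, compKernel_eq H.domain (hb.leftRegular hk), quantize_eq_sum hkpos hbs', pow_succ,
      mul_inv, mul_assoc]
    congr 1
    simp only [quantize_eq_sum hkpos hbs]
    have e2 : ∀ u, 𝒩 k 0 φ₁ (φ₁ - u) * ((1 / (2 * π) : ℂ) *
        ∑ n ∈ Finset.Icc (-⌈ρ * k⌉) ⌈ρ * k⌉, b k (φ₁ - u, n / k) *
          exp (I * n * ((φ₁ - u : ℝ) - φ₂))) =
        ∑ n ∈ Finset.Icc (-⌈ρ * k⌉) ⌈ρ * k⌉, (1 / (2 * π) : ℂ) * exp (I * n * (φ₁ - φ₂)) *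
          (𝒩 k 0 φ₁ (φ₁ - u) *
            (b k (φ₁ - u, n / k) * exp (I * (k * -(n / k : ℝ)) * u))) := fun u => by
      rw [mul_sum, mul_sum]
      refine sum_congr rfl fun n _ => ?_
      have : I * n * ((φ₁ - u : ℝ) - φ₂) = I * n * (φ₁ - φ₂) + I * (k * -(n / k : ℝ)) * u := by
        push_cast; field_simp; ring
      rw [this, exp_add]
      ring
    simp only [e2]
    rw [int_sum]
    · rw [mul_sum, mul_sum]
      refine sum_congr rfl fun n _ => ?_
      rw [int_const_mul]
      simp only [b', if_pos hk1, hnear k hk hk1]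
      field_simp
    · intro n _
      refine IntervalIntegrable.const_mul (H.intervalIntegrable_mul hk 0 φ₁ ?_) _
      have := hb.continuous hk
      fun_prop

/-! ### Fourier series -/

/-- The Fourier coefficient of a `2π`-periodic function. -/
def circleCoeff (g : ℝ → ℂ) (l : ℤ) : ℂ :=
  (1 / (2 * π) : ℂ) * ∫ t in (0 : ℝ)..(2 * π), g t * exp (-(I * l * t))

lemma norm_circleCoeff_le {g : ℝ → ℂ} {B : ℝ} (hB : ∀ t, ‖g t‖ ≤ B) (l : ℤ) :
    ‖circleCoeff g l‖ ≤ B := by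
  have hpi := two_pi_pos
  rw [circleCoeff, norm_mul]
  have h := norm_integral_le_of_norm_le_const (a := 0) (b := 2 * π) (C := B)
    (f := fun t : ℝ => g t * exp (-(I * l * t))) fun t _ => by
      rw [norm_mul, norm_exp]
      simpa using hB t
  rw [sub_zero, abs_of_pos hpi] at h
  have h2 : ‖(1 / (2 * π) : ℂ)‖ = (2 * π)⁻¹ := by
    rw [norm_div, norm_one, one_div, norm_mul, norm_ofNat, norm_of_nonneg pi_pos.le]
  rw [h2, inv_mul_le_iff₀ hpi]
  linarith

lemma circleCoeff_deriv {g : ℝ → ℂ} (hg : Smooth g) (hp : Periodic g (2 * π))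
    (l : ℤ) : circleCoeff (deriv g) l = I * l * circleCoeff g l := by
  have hd : ∀ t : ℝ, HasDerivAt g (deriv g t) t := fun t =>
    (hg.differentiable (by simp) t).hasDerivAt
  have he : ∀ t : ℝ, HasDerivAt (fun t : ℝ => exp (-(I * l * t)))
      (-(I * l) * exp (-(I * l * t))) t := fun t => by
    have h1 : HasDerivAt (fun t : ℝ => -(I * l * t)) (-(I * l)) t := by
      simpa using (((hasDerivAt_id t).ofReal_comp).const_mul (I * l)).fun_neg
    simpa [mul_comm] using h1.cexp
  have hcd : Continuous (deriv g) := hg.continuous_deriv (by simp)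
  have hpart := intervalIntegral.integral_mul_deriv_eq_deriv_mul (a := 0) (b := 2 * π)
    (u := fun t : ℝ => exp (-(I * l * t))) (v := g)
    (u' := fun t : ℝ => -(I * l) * exp (-(I * l * t))) (v' := deriv g)
    (fun t _ => he t) (fun t _ => hd t) (Continuous.intervalIntegrable (by fun_prop) _ _)
    (hcd.intervalIntegrable _ _)
  have hend : g (2 * π) = g 0 := by simpa using hp 0
  have hexp : exp (-(I * l * ((2 * π : ℝ) : ℂ))) = 1 := by
    have := Complex.exp_int_mul_two_pi_mul_I (-l)
    rw [← this]; congr 1; push_cast; ring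
  simp only [hend, hexp, ofReal_zero, mul_zero, neg_zero, Complex.exp_zero, sub_self,
    zero_sub] at hpart
  rw [circleCoeff, circleCoeff]
  simp only [mul_comm (deriv g _), mul_comm (g _)]
  have h : -∫ t in (0 : ℝ)..(2 * π), -(I * l) * exp (-(I * l * t)) * g t =
      I * l * ∫ t in (0 : ℝ)..(2 * π), exp (-(I * l * t)) * g t := by
    rw [← intervalIntegral.integral_neg, ← int_const_mul]
    congr 1
    ext t
    ring
  rw [hpart, h]
  ring

lemma iterate_deriv_periodic {g : ℝ → ℂ} (hp : Periodic g (2 * π)) (N : ℕ) :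
    Periodic (deriv^[N] g) (2 * π) := by
  induction N with
  | zero => exact hp
  | succ N ih =>
    rw [Function.iterate_succ_apply']
    intro t
    rw [← deriv_comp_add_const]
    congr 1
    exact funext ih

lemma circleCoeff_iterate_deriv {g : ℝ → ℂ} (hg : Smooth g)
    (hp : Periodic g (2 * π)) (l : ℤ) (N : ℕ) :
    circleCoeff (deriv^[N] g) l = (I * l) ^ N * circleCoeff g l := by
  induction N with
  | zero => simp
  | succ N ih =>
    rw [Function.iterate_succ_apply', circleCoeff_deriv (hg.iterate_deriv N)
      (iterate_deriv_periodic hp N), ih, pow_succ]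
    ring

lemma pow_mul_norm_circleCoeff_le {g : ℝ → ℂ} (hg : Smooth g)
    (hp : Periodic g (2 * π)) (l : ℤ) {N : ℕ} {B : ℝ}
    (hB : ∀ t, ‖𝐃 N g t‖ ≤ B) : |(l : ℝ)| ^ N * ‖circleCoeff g l‖ ≤ B := by
  have h1 := norm_circleCoeff_le (g := deriv^[N] g) (B := B) (fun t => by
    rw [← iteratedDeriv_eq_iterate, ← norm_iteratedFDeriv_eq_norm_iteratedDeriv]; exact hB t) l
  rw [circleCoeff_iterate_deriv hg hp, norm_mul, norm_pow, norm_mul, norm_I, one_mul,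
    Complex.norm_intCast] at h1
  exact h1

lemma summable_one_div_one_add_sq : Summable fun l : ℤ => 2 / (1 + (l : ℝ) ^ 2) := by
  refine Summable.of_norm_bounded_eventually
    ((Real.summable_one_div_int_pow (p := 2)).2 (by norm_num) |>.mul_left 2) ?_
  filter_upwards [(Set.finite_singleton (0 : ℤ)).compl_mem_cofinite] with l hl
  have hl0 : (l : ℝ) ≠ 0 := by exact_mod_cast hl
  rw [Real.norm_of_nonneg (by positivity), mul_one_div]
  exact div_le_div_of_nonneg_left zero_le_two (by positivity) (by linarith)

lemma norm_le_of_pow_mul {l : ℤ} (hl : l ≠ 0) {N : ℕ} {x B : ℝ} (hx : 0 ≤ x)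
    (h : |(l : ℝ)| ^ (N + 2) * x ≤ B) : |(l : ℝ)| ^ N * x ≤ B * (2 / (1 + (l : ℝ) ^ 2)) := by
  have h1 : (1 : ℝ) ≤ |(l : ℝ)| := by exact_mod_cast Int.one_le_abs hl
  have h2 : (l : ℝ) ^ 2 = |(l : ℝ)| ^ 2 := (sq_abs _).symm
  rw [h2, mul_div_assoc', le_div_iff₀ (by positivity)]
  have h3 : 0 ≤ |(l : ℝ)| ^ N * x := by positivity
  calc _ ≤ |(l : ℝ)| ^ N * x * (|(l : ℝ)| ^ 2 + |(l : ℝ)| ^ 2) := by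
        gcongr; nlinarith
    _ = 2 * (|(l : ℝ)| ^ (N + 2) * x) := by ring
    _ ≤ _ := by linarith

lemma summable_norm_circleCoeff {g : ℝ → ℂ} (hg : Smooth g)
    (hp : Periodic g (2 * π)) : Summable fun l => ‖circleCoeff g l‖ := by
  obtain ⟨B, -, hB⟩ := (UB.of_periodic (ι := Unit) hg two_pi_pos hp).bound 2
  refine Summable.of_norm_bounded_eventually (summable_one_div_one_add_sq.mul_left B) ?_
  filter_upwards [(Set.finite_singleton (0 : ℤ)).compl_mem_cofinite] with l hl
  have h := norm_le_of_pow_mul (N := 0) hl (norm_nonneg _)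
    (pow_mul_norm_circleCoeff_le hg hp l fun t => by simpa using hB () t)
  simpa using h

lemma hasSum_circleCoeff {g : ℝ → ℂ} (hg : Smooth g) (hp : Periodic g (2 * π)) (φ : ℝ) :
    HasSum (fun l : ℤ => circleCoeff g l * exp (I * l * φ)) (g φ) := by
  have : Fact (0 < 2 * π) := ⟨two_pi_pos⟩
  let f : C(AddCircle (2 * π), ℂ) := ⟨hp.lift, continuous_coinduced_dom.2 (by exact hg.continuous)⟩
  have hf : ∀ l, fourierCoeff f l = circleCoeff g l := fun l => by
    rw [fourierCoeff_eq_intervalIntegral f l 0, circleCoeff, zero_add, real_smul]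
    congr 1
    · push_cast; ring
    · congr 1
      ext t
      rw [fourier_coe_apply, smul_eq_mul, mul_comm]
      congr 1
      have : ((2 * π : ℝ) : ℂ) ≠ 0 := by exact_mod_cast two_pi_pos.ne'
      congr 1
      push_cast at this ⊢
      field_simp
  have h := has_pointwise_sum_fourier_series_of_summable (f := f) (by
    refine Summable.of_norm ?_
    simp only [hf]
    exact summable_norm_circleCoeff hg hp) (φ : AddCircle (2 * π))
  have h0 : f (φ : AddCircle (2 * π)) = g φ := rfl
  rw [h0] at h
  refine h.congr_fun fun l => ?_
  rw [hf, fourier_coe_apply, smul_eq_mul]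
  congr 2
  have : ((2 * π : ℝ) : ℂ) ≠ 0 := by exact_mod_cast two_pi_pos.ne'
  push_cast at this ⊢
  field_simp

/-- The Fourier series of a function truncated smoothly at frequencies `≲ k`. -/
lemma norm_sub_truncated_le {ζ : ℝ → ℂ} (hζ : ∀ x, ‖ζ x‖ ≤ 1) (hζ1 : ∀ x, |x| ≤ 1 / 4 → ζ x = 1)
    (hζ0 : ∀ x, 1 / 2 < |x| → ζ x = 0) (R : ℕ) {B : ℝ} :
    ∃ C, ∀ k : ℝ, 1 ≤ k → ∀ n : ℤ, |n / k| ≤ 1 / 8 → ∀ g : ℝ → ℂ, Smooth g →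
      Periodic g (2 * π) → (∀ t, ‖𝐃 (R + 2) g t‖ ≤ B) → ∀ φ : ℝ,
      ‖g φ - ∑ m ∈ Finset.Icc (-⌈1 / 2 * k⌉) ⌈1 / 2 * k⌉, ζ (m / k) *
        (circleCoeff g (m - n) * exp (I * (m - n : ℤ) * φ))‖ ≤
      C * (k ^ R)⁻¹ := by
  set S := ∑' l : ℤ, 2 / (1 + (l : ℝ) ^ 2)
  refine ⟨2 * 8 ^ R * B * S, fun k hk n hn g hg hp hB φ => ?_⟩
  have hk0 : 0 < k := by linarith
  have hB0 : 0 ≤ B := (norm_nonneg _).trans (hB 0)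
  have h1 : HasSum (fun m : ℤ => ζ (m / k) * (circleCoeff g (m - n) * exp (I * (m - n : ℤ) * φ)))
      (∑ m ∈ Finset.Icc (-⌈1 / 2 * k⌉) ⌈1 / 2 * k⌉, ζ (m / k) *
        (circleCoeff g (m - n) * exp (I * (m - n : ℤ) * φ))) := by
    refine hasSum_sum_of_ne_finset_zero fun m hm => ?_
    rw [hζ0, zero_mul]
    rw [Finset.mem_Icc, ← abs_le, not_le] at hm
    rw [abs_div, abs_of_pos hk0, lt_div_iff₀ hk0]
    exact (Int.le_ceil _).trans_lt (by exact_mod_cast hm)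
  have h2 : HasSum (fun m : ℤ => circleCoeff g (m - n) * exp (I * (m - n : ℤ) * φ)) (g φ) :=
    (Equiv.subRight n).hasSum_iff (f := fun l : ℤ =>
      circleCoeff g l * exp (I * l * φ)) |>.2 (hasSum_circleCoeff hg hp φ)
  have h3 := h2.sub h1
  have hS : HasSum (fun m : ℤ => 2 * 8 ^ R * B * (k ^ R)⁻¹ * (2 / (1 + ((m - n : ℤ) : ℝ) ^ 2)))
      (2 * 8 ^ R * B * (k ^ R)⁻¹ * S) :=
    ((Equiv.subRight n).hasSum_iff (f := fun l : ℤ => 2 / (1 + (l : ℝ) ^ 2)) |>.2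
      summable_one_div_one_add_sq.hasSum).mul_left _
  rw [← h3.tsum_eq]
  refine (tsum_of_norm_bounded hS fun m => ?_).trans_eq (by ring)
  have h4 : circleCoeff g (m - n) * exp (I * (m - n : ℤ) * φ) -
      ζ (m / k) * (circleCoeff g (m - n) * exp (I * (m - n : ℤ) * φ)) =
      (1 - ζ (m / k)) * (circleCoeff g (m - n) * exp (I * (m - n : ℤ) * φ)) := by
    ring
  have h5 : ‖exp (I * (m - n : ℤ) * φ)‖ = 1 := by rw [norm_exp]; simp
  rw [h4, norm_mul, norm_mul, h5, mul_one]
  by_cases hm : |m / k| ≤ 1 / 4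
  · rw [hζ1 _ hm, sub_self, norm_zero, zero_mul]
    positivity
  have h6 : ‖1 - ζ (m / k)‖ ≤ 2 := (norm_sub_le _ _).trans (by rw [norm_one]; linarith [hζ (m / k)])
  have h7 : k / 8 ≤ |((m - n : ℤ) : ℝ)| := by
    rw [not_le, abs_div, abs_of_pos hk0, lt_div_iff₀ hk0] at hm
    rw [abs_div, abs_of_pos hk0, div_le_iff₀ hk0] at hn
    have := abs_sub_abs_le_abs_sub (m : ℝ) n
    push_cast
    linarith
  have hl : m - n ≠ 0 := fun h => by
    rw [h] at h7
    simp at h7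
    linarith
  have h8 := norm_le_of_pow_mul hl (norm_nonneg _) (pow_mul_norm_circleCoeff_le hg hp (m - n) hB)
  have h9 : (k / 8) ^ R * ‖circleCoeff g (m - n)‖ ≤ B * (2 / (1 + ((m - n : ℤ) : ℝ) ^ 2)) :=
    (mul_le_mul_of_nonneg_right (pow_le_pow_left₀ (by positivity) h7 R) (norm_nonneg _)).trans h8
  have h10 : ‖circleCoeff g (m - n)‖ ≤
      8 ^ R * (k ^ R)⁻¹ * (B * (2 / (1 + ((m - n : ℤ) : ℝ) ^ 2))) := by
    rw [div_pow] at h9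
    calc _ = 8 ^ R * (k ^ R)⁻¹ * (k ^ R / 8 ^ R * ‖circleCoeff g (m - n)‖) := by field_simp
      _ ≤ _ := by gcongr
  calc _ ≤ 2 * (8 ^ R * (k ^ R)⁻¹ * (B * (2 / (1 + ((m - n : ℤ) : ℝ) ^ 2)))) := by gcongr
    _ = _ := by ring

/-! ### Words in `N₀` and `N₁` -/

lemma kernelWord_succ {M : ℕ} (k : ℝ) (l : ℂ) (σ : Fin (M + 1) → Fin 2) (K : ℝ → ℝ → ℂ) :
    kernelWord q χ δ k l σ K = compKernel (kernelSplit q χ δ k l (σ 0))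
      (kernelWord q χ δ k l (fun j => σ j.succ) K) := by
  simp [kernelWord, List.ofFn_succ]

lemma kernelWord_nil (k : ℝ) (l : ℂ) (σ : Fin 0 → Fin 2) (K : ℝ → ℝ → ℂ) :
    kernelWord q χ δ k l σ K = K := by
  simp [kernelWord]

lemma Setting.leftRegular_word (H : Stg) (hk : 1 ≤ k) {M : ℕ}
    (σ : Fin M → Fin 2) {K : ℝ → ℝ → ℂ} (hK : LeftRegular K) :
    LeftRegular (𝒲 k σ K) := by
  induction M with
  | zero => rwa [kernelWord_nil]
  | succ M ih =>
    rw [kernelWord_succ]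
    exact H.leftRegular_comp hk _ (ih _)

lemma Setting.kernelWord_add (H : Stg) (hk : 1 ≤ k) {M : ℕ}
    (σ : Fin M → Fin 2) {K L : ℝ → ℝ → ℂ} (hK : LeftRegular K) (hL : LeftRegular L) (φ φ₂ : ℝ) :
    𝒲 k σ (fun φ₁ φ₂ => K φ₁ φ₂ + L φ₁ φ₂) φ φ₂ = 𝒲 k σ K φ φ₂ + 𝒲 k σ L φ φ₂ := by
  induction M generalizing φ φ₂ with
  | zero => simp only [kernelWord_nil]
  | succ M ih =>
    simp only [kernelWord_succ]
    rw [← H.compKernel_add hk (H.leftRegular_word hk _ hK) (H.leftRegular_word hk _ hL)]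
    congr 1
    exact funext fun φ => funext fun φ₂ => ih _ φ φ₂

lemma Setting.exists_norm_kernelWord_le (H : Stg) (M : ℕ) :
    ∃ C, 0 ≤ C ∧ ∀ k, 1 ≤ k → ∀ (σ : Fin M → Fin 2) (K : ℝ → ℝ → ℂ), LeftRegular K →
      ∀ (φ₂ B : ℝ), (∀ φ, ‖K φ φ₂‖ ≤ B) → ∀ φ,
      ‖𝒲 k σ K φ φ₂‖ ≤ C * k ^ M * B := by
  obtain ⟨C, h0, hC⟩ := H.exists_norm_compKernel_le
  refine ⟨C ^ M, by positivity, fun k hk σ K hK φ₂ B hB => ?_⟩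
  induction M with
  | zero => simpa [kernelWord_nil] using hB
  | succ M ih =>
    intro φ
    rw [kernelWord_succ]
    refine (hC k hk _ _ (H.leftRegular_word hk _ hK) φ₂ _ (ih _) φ).trans_eq (by ring)

/-- It suffices to bound a kernel for large `k`, if it is polynomially bounded. -/
lemma isBigOKernel_of_large {K : ℝ → ℝ → ℝ → ℂ} {C D k₀ : ℝ} {p R : ℕ}
    (h1 : ∀ k, 1 ≤ k → ∀ φ₁ φ₂, ‖K k φ₁ φ₂‖ ≤ C * k ^ p)
    (h2 : ∀ k, 1 ≤ k → k₀ ≤ k → ∀ φ₁ φ₂, ‖K k φ₁ φ₂‖ ≤ D * (k ^ R)⁻¹) : IsBigOKernel R K := by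
  have hC : 0 ≤ C := by
    have := (norm_nonneg _).trans (h1 1 le_rfl 0 0)
    simpa using this
  refine ⟨max D (C * (max k₀ 1) ^ (p + R)), fun k hk φ₁ φ₂ => ?_⟩
  have hk0 : 0 < k := by linarith
  rw [rpow_neg hk0.le, rpow_natCast]
  rcases le_total k₀ k with h | h
  · exact (h2 k hk h φ₁ φ₂).trans (by gcongr; exact le_max_left _ _)
  · refine (h1 k hk φ₁ φ₂).trans ?_
    calc C * k ^ p = C * k ^ (p + R) * (k ^ R)⁻¹ := by rw [pow_add]; field_simp
      _ ≤ C * (max k₀ 1) ^ (p + R) * (k ^ R)⁻¹ := by gcongr; exact h.trans (le_max_left _ _)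
      _ ≤ _ := by gcongr; exact le_max_right _ _

/-- Fubini's theorem for an integrable function times a bounded continuous one. -/
lemma integral_mul_integral_swap {X : Type*} [MeasurableSpace X] [TopologicalSpace X]
    [BorelSpace X] [SecondCountableTopology X] {μ : Measure X} [IsFiniteMeasure μ] {a b : ℝ}
    {f : ℝ → ℂ} (hf : IntervalIntegrable f volume a b) {F : ℝ × X → ℂ} (hF : Continuous F) {B : ℝ}
    (hB : ∀ p, ‖F p‖ ≤ B) :
    ∫ u in a..b, f u * ∫ t, F (u, t) ∂μ = ∫ t, (∫ u in a..b, f u * F (u, t)) ∂μ := by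
  rw [intervalIntegrable_iff] at hf
  have h1 : Integrable (fun p : ℝ × X => f p.1 * 1) ((volume.restrict (uIoc a b)).prod μ) :=
    Integrable.mul_prod (g := fun _ : X => (1 : ℂ)) hf (integrable_const 1)
  have h2 : Integrable (fun p : ℝ × X => f p.1 * F p) ((volume.restrict (uIoc a b)).prod μ) := by
    simp only [mul_one] at h1
    exact h1.mul_bdd (c := B) hF.aestronglyMeasurable (Eventually.of_forall hB)
  simp only [intervalIntegral.intervalIntegral_eq_integral_uIoc]
  rw [integral_smul, ← integral_integral_swap h2]
  congr 2
  ext u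
  rw [← integral_const_mul]

lemma continuous_quantize {k ρ : ℝ} (hk : 0 < k) {a : ℝ × ℝ → ℂ}
    (ha : ∀ φ η, a (φ, η) ≠ 0 → |η| ≤ ρ) (hc : Continuous a) :
    Continuous fun p : ℝ × ℝ => quantize k a p.1 p.2 := by
  simp only [quantize_eq_sum hk ha]
  fun_prop

lemma Setting.compKernel_assoc (H : Stg) (hk : 1 ≤ k) {i : Fin 2}
    {K L : ℝ → ℝ → ℂ} (hK : LeftRegular K) (hKc : Continuous fun p : ℝ × ℝ => K p.1 p.2)
    {B D : ℝ} (hB : ∀ φ θ, ‖K φ θ‖ ≤ B) (hLc : ∀ φ, Continuous fun θ => L θ φ)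
    (hD : ∀ φ θ, ‖L φ θ‖ ≤ D) :
    compKernel (𝒩 k i) (compKernel K L) = compKernel (compKernel (𝒩 k i) K) L := by
  ext φ φ₂
  have hKL : LeftRegular (compKernel K L) := by
    refine ⟨fun φ₂ => ?_, fun φ₂ φ => ?_⟩
    · refine intervalIntegral.continuous_parametric_intervalIntegral_of_continuous' ?_ _ _
      exact hKc.mul ((hLc φ₂).comp continuous_snd)
    · simp only [compKernel, (hK.periodic _) φ]
  have hpi := two_pi_pos
  rw [compKernel_eq H.domain hKL]
  have h := integral_mul_integral_swap (μ := volume.restrict (Ioc 0 (2 * π)))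
    (H.intervalIntegrable_kernel hk i φ) (F := fun p : ℝ × ℝ => K (φ - p.1) p.2 * L p.2 φ₂)
    ((hKc.comp ((continuous_const.sub continuous_fst).prodMk continuous_snd)).mul ((hLc φ₂).comp continuous_snd)) (B := B * D) fun p => by
      rw [norm_mul]
      exact mul_le_mul (hB _ _) (hD _ _) (norm_nonneg _) ((norm_nonneg _).trans (hB 0 0))
  simp only [compKernel, integral_of_le hpi.le] at h ⊢
  rw [h]
  refine integral_congr_ae (Eventually.of_forall fun t => ?_)
  have h2 := compKernel_eq (χ := χ) (δ := δ) (k := k) (l := lam k) (i := i) H.domain hK φ t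
  simp only [compKernel, integral_of_le hpi.le] at h2
  beta_reduce
  rw [h2, ← int_mul_const]
  congr 1
  ext u
  ring

/-- The composition of a Fourier multiplier and a pseudodifferential operator. -/
lemma compKernel_multiplier {k ρ ρ' : ℝ} (hk : 0 < k) {ζ : ℝ → ℂ} (hζ : ∀ η, ζ η ≠ 0 → |η| ≤ ρ')
    {c : ℝ × ℝ → ℂ} (hc : Continuous c) (hcs : ∀ φ η, c (φ, η) ≠ 0 → |η| ≤ ρ) (φ θ : ℝ) :
    compKernel (quantize k fun z => ζ z.2) (quantize k c) φ θ =
      (1 / (2 * π) : ℂ) * ∑ n ∈ Finset.Icc (-⌈ρ * k⌉) ⌈ρ * k⌉,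
        (∑ m ∈ Finset.Icc (-⌈ρ' * k⌉) ⌈ρ' * k⌉, ζ (m / k) *
          (circleCoeff (fun t => c (t, n / k)) (m - n) * exp (I * (m - n : ℤ) * φ))) *
          exp (I * n * (φ - θ)) := by
  rw [compKernel]
  simp only [quantize_eq_sum hk hcs, quantize_eq_sum hk (a := fun z => ζ z.2) (ρ := ρ')
    (fun φ η h => hζ η h)]
  have h1 : ∀ t : ℝ, (1 / (2 * π) : ℂ) * (∑ m ∈ Finset.Icc (-⌈ρ' * k⌉) ⌈ρ' * k⌉,
      ζ (m / k) * exp (I * m * (φ - t))) * ((1 / (2 * π) : ℂ) *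
      ∑ n ∈ Finset.Icc (-⌈ρ * k⌉) ⌈ρ * k⌉, c (t, n / k) * exp (I * n * (t - θ))) =
      ∑ n ∈ Finset.Icc (-⌈ρ * k⌉) ⌈ρ * k⌉, ∑ m ∈ Finset.Icc (-⌈ρ' * k⌉) ⌈ρ' * k⌉,
        ((1 / (2 * π) : ℂ) * ζ (m / k) * exp (I * (m - n : ℤ) * φ) *
          exp (I * n * (φ - θ)) * (1 / (2 * π) : ℂ)) *
          (c (t, n / k) * exp (-(I * (m - n : ℤ) * t))) := fun t => by
    rw [mul_mul_mul_comm, Finset.sum_mul_sum, Finset.sum_comm, mul_sum]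
    refine sum_congr rfl fun n _ => ?_
    rw [mul_sum]
    refine sum_congr rfl fun m _ => ?_
    have : exp (I * m * (φ - t)) * exp (I * n * (t - θ)) =
        exp (I * (m - n : ℤ) * φ) * exp (I * n * (φ - θ)) * exp (-(I * (m - n : ℤ) * t)) := by
      rw [← exp_add, ← exp_add, ← exp_add]
      congr 1; push_cast; ring
    linear_combination (1 / (2 * π) : ℂ) * (1 / (2 * π) : ℂ) * ζ (m / k) * c (t, n / k) * this
  simp only [h1]
  have hi : ∀ (n m : ℤ), IntervalIntegrable (fun t : ℝ =>
      ((1 / (2 * π) : ℂ) * ζ (m / k) * exp (I * (m - n : ℤ) * φ) *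
          exp (I * n * (φ - θ)) * (1 / (2 * π) : ℂ)) *
          (c (t, n / k) * exp (-(I * (m - n : ℤ) * t)))) volume 0
          (2 * π) := fun n m => Continuous.intervalIntegrable (by fun_prop) _ _
  rw [int_sum fun n _ => Continuous.intervalIntegrable (by fun_prop) _ _, mul_sum]
  refine sum_congr rfl fun n _ => ?_
  rw [int_sum fun m _ => hi n m, sum_mul, mul_sum]
  refine sum_congr rfl fun m _ => ?_
  rw [int_const_mul, circleCoeff]
  ring

/-! ### Powers of `N₀` -/

lemma Thickens.univ : Thickens Set.univ Set.univ := ⟨1, one_pos, fun _ _ _ _ => mem_univ _⟩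

lemma PsiSymbol.psiForm {ρ : ℝ} {V : Set ℂ} {b : ℝ → ℝ × ℝ → ℂ} (h : PsiSymbol q ρ V b) :
    PsiForm q ρ V 0 fun k => quantize k (b k) :=
  ⟨b, h, 0, fun k _ _ φ₁ φ₂ => by simp⟩

lemma PsiSymbol.mono {ρ : ℝ} {V V' : Set ℂ} {b : ℝ → ℝ × ℝ → ℂ} (h : PsiSymbol q ρ V b)
    (hV : V ⊆ V') : PsiSymbol q ρ V' b :=
  ⟨h.ub, h.periodic, fun k hk φ η hb => (h.support k hk φ η hb).imp_right fun h => hV h⟩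

lemma PsiForm.word_zero (H : Stg) {ρ : ℝ} (hρ : ρ ≤ 1 / 2)
    {X : ℝ → ℝ → ℝ → ℂ} (h : PsiForm q ρ univ 0 X) (M : ℕ) :
    PsiForm q ρ univ M fun k => 𝒲 k (fun _ : Fin M => 0) (X k) := by
  induction M with
  | zero => simpa only [kernelWord_nil] using h
  | succ M ih => simpa only [kernelWord_succ] using ih.comp_zero H hρ Thickens.univ

lemma PsiSymbol.exists_norm_le {ρ : ℝ} {V : Set ℂ} {b : ℝ → ℝ × ℝ → ℂ} (h : PsiSymbol q ρ V b)
    (hρ : 0 ≤ ρ) : ∃ C, 0 ≤ C ∧ ∀ k, 1 ≤ k → ∀ φ θ, ‖quantize k (b k) φ θ‖ ≤ C * k := by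
  obtain ⟨B, hB0, hB⟩ := h.ub.norm_le
  refine ⟨(2 * ρ + 3) * B, by positivity, fun k hk φ θ => ?_⟩
  refine (norm_quantize_le hk hρ (fun φ η hb => (h.support k hk φ η hb).1) (B := B)
    (fun η => by simpa using hB ⟨k, hk⟩ (φ, η)) θ).trans_eq (by ring)

lemma PsiSymbol.multiplier (q : ℝ → ℂ) : PsiSymbol q (1 / 2) univ
    (fun _ z => (bump (1 / 4) z.2 : ℂ)) := by
  refine ⟨?_, fun _ _ _ _ => rfl, fun k _ φ η h => ⟨?_, mem_univ _⟩⟩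
  · have h1 : UB₁ (fun (_ : ℝ₁) (p : ℝ × ℝ) => p.2) := UB₁.linear (snd ℝ ℝ ℝ)
    exact ((UB.bump (by norm_num)).comp h1).ofReal
  · by_contra hcon
    refine h ?_
    dsimp only
    rw [bump_eq_zero (by norm_num) (by linarith), ofReal_zero]

/-- The multiplier acts as the identity on low frequencies, up to a negligible error. -/
lemma PsiSymbol.multiplier_comp {ρ : ℝ} (hρ0 : 0 ≤ ρ) (hρ : ρ ≤ 1 / 8) {V : Set ℂ} {c : ℝ × ℝ → ℂ}
    (hc : PsiSymbol q ρ V fun _ => c) (R : ℕ) :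
    ∃ C, 0 ≤ C ∧ ∀ k, 1 ≤ k → ∀ φ θ, ‖quantize k c φ θ -
      compKernel (quantize k fun z => (bump (1 / 4) z.2 : ℂ)) (quantize k c) φ θ‖ ≤
      C * (k ^ R)⁻¹ := by
  have hslice : UB (fun _ : ℝ => 1) (fun (η : ℝ) (t : ℝ) => c (t, η)) :=
    (hc.ub.reindex (fun _ : ℝ => ⟨1, mem_Ici.2 le_rfl⟩)).comp (UB₁.prodMk_const fun η => η)
  obtain ⟨B, -, hB⟩ := hslice.bound (R + 1 + 2)
  obtain ⟨C, hC⟩ := norm_sub_truncated_le (ζ := fun x => (bump (1 / 4) x : ℂ)) (fun x => by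
      rw [norm_of_nonneg (bump_mem _ _).1]; exact (bump_mem _ _).2)
    (fun x hx => by rw [bump_eq_one (by norm_num) hx, ofReal_one])
    (fun x hx => by rw [bump_eq_zero (by norm_num) (by linarith), ofReal_zero])
    (R + 1) (B := B)
  refine ⟨(2 * ρ + 3) * max C 0, by positivity, fun k hk φ θ => ?_⟩
  have hk0 : 0 < k := by linarith
  have hcs : ∀ φ η, c (φ, η) ≠ 0 → |η| ≤ ρ := fun φ η h => (hc.support 1 le_rfl φ η h).1
  rw [compKernel_multiplier hk0 (ρ' := 1 / 2) (ρ := ρ)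
    (fun η h => ((multiplier q).support 1 le_rfl 0 η h).1)
    (hc.continuous le_rfl) hcs, quantize_eq_sum hk0 hcs, ← mul_sub, ← Finset.sum_sub_distrib]
  simp only [← sub_mul]
  rw [norm_mul]
  have h2 : ‖(1 / (2 * π) : ℂ)‖ ≤ 1 := by
    have hpi := pi_gt_three
    rw [norm_div, norm_one, norm_mul, norm_ofNat, norm_of_nonneg (by linarith), div_le_one (by linarith)]
    linarith
  refine (mul_le_of_le_one_left (norm_nonneg _) h2).trans ?_
  have h3 : ∀ n ∈ Finset.Icc (-⌈ρ * k⌉) ⌈ρ * k⌉, ‖(c (φ, n / k) -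
      ∑ m ∈ Finset.Icc (-⌈1 / 2 * k⌉) ⌈1 / 2 * k⌉, (bump (1 / 4) (m / k) : ℂ) *
        (circleCoeff (fun t => c (t, n / k)) (m - n) * exp (I * (m - n : ℤ) * φ))) *
      exp (I * n * (φ - θ))‖ ≤ max C 0 * (k ^ (R + 1))⁻¹ := by
    intro n _
    have he : ‖exp (I * n * (φ - θ))‖ = 1 := by rw [norm_exp]; simp
    rw [norm_mul, he, mul_one]
    by_cases hn : |n / k| ≤ 1 / 8
    · refine (hC k hk n hn (fun t => c (t, n / k)) (hslice.smooth _)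
        (fun t => hc.periodic 1 le_rfl t _) (fun t => ?_) φ).trans ?_
      · simpa using hB (n / k) t
      · gcongr; exact le_max_left _ _
    · have h0 : ∀ t, c (t, n / k) = 0 := fun t => by
        by_contra h
        exact hn ((hcs _ _ h).trans hρ)
      simp only [h0, circleCoeff, zero_mul, intervalIntegral.integral_zero, mul_zero,
        Finset.sum_const_zero, sub_zero, norm_zero]
      positivity
  refine (norm_sum_le _ _).trans ((sum_le_sum h3).trans ?_)
  rw [Finset.sum_const, Int.card_Icc, nsmul_eq_mul]
  have h3 : (0 : ℤ) ≤ ⌈ρ * k⌉ := Int.ceil_nonneg (by positivity)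
  have h4 : ((⌈ρ * k⌉ + 1 - -⌈ρ * k⌉).toNat : ℝ) = 2 * ⌈ρ * k⌉ + 1 := by
    have : ((⌈ρ * k⌉ + 1 - -⌈ρ * k⌉).toNat : ℤ) = 2 * ⌈ρ * k⌉ + 1 := by omega
    exact_mod_cast this
  rw [h4]
  have h5 := (Int.ceil_lt_add_one (ρ * k)).le
  calc _ ≤ ((2 * ρ + 3) * k) * (max C 0 * (k ^ (R + 1))⁻¹) := by gcongr; nlinarith
    _ = _ := by rw [pow_succ]; field_simp

lemma PsiForm.eventually_continuous {ρ : ℝ} {V : Set ℂ} {m : ℕ} {X : ℝ → ℝ → ℝ → ℂ}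
    (h : PsiForm q ρ V m X) : ∃ k₀, ∀ k, 1 ≤ k → k₀ ≤ k →
      Continuous (fun p : ℝ × ℝ => X k p.1 p.2) ∧ ∃ B, ∀ φ θ, ‖X k φ θ‖ ≤ B := by
  obtain ⟨b, hb, k₀, hX⟩ := h
  refine ⟨k₀, fun k hk hk0 => ⟨?_, ?_⟩⟩
  · simp only [hX k hk hk0]
    exact continuous_const.mul (continuous_quantize (by linarith)
      (fun φ η h => (hb.support k hk φ η h).1) (hb.continuous hk))
  · obtain ⟨C, hC0, hC⟩ := (hb.ub.norm_le)
    refine ⟨‖((k : ℂ) ^ m)⁻¹‖ * ((2 * max ρ 0 + 3) * k * C), fun φ θ => ?_⟩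
    rw [hX k hk hk0, norm_mul]
    gcongr
    exact norm_quantize_le hk (le_max_right _ _) (fun φ η h =>
      ((hb.support k hk φ η h).1).trans (le_max_left _ _))
      (fun η => by simpa using hC ⟨k, hk⟩ (φ, η)) θ

/-- `N₀ ^ M` commutes with composition on the right. -/
lemma PsiForm.word_comp (H : Stg) {ρ ρ' : ℝ} (hρ : ρ ≤ 1 / 2)
    {X : ℝ → ℝ → ℝ → ℂ} (hX : PsiForm q ρ univ 0 X) (hXr : ∀ k, 1 ≤ k → LeftRegular (X k))
    {V : Set ℂ} {c : ℝ → ℝ × ℝ → ℂ} (hρ' : 0 ≤ ρ') (hc : PsiSymbol q ρ' V c) (M : ℕ) :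
    ∃ k₀, ∀ k, 1 ≤ k → k₀ ≤ k → 𝒲 k (fun _ : Fin M => 0) (compKernel (X k) (quantize k (c k))) =
        compKernel (𝒲 k (fun _ : Fin M => 0) (X k)) (quantize k (c k)) := by
  obtain ⟨D, -, hD⟩ := hc.exists_norm_le hρ'
  induction M with
  | zero => exact ⟨0, fun k _ _ => by simp only [kernelWord_nil]⟩
  | succ M ih =>
    obtain ⟨k₀, h0⟩ := ih
    obtain ⟨k₁, h1⟩ := (hX.word_zero H hρ M).eventually_continuous
    refine ⟨max k₀ k₁, fun k hk hk0 => ?_⟩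
    obtain ⟨h2, B, h3⟩ := h1 k hk ((le_max_right _ _).trans hk0)
    rw [kernelWord_succ, kernelWord_succ, h0 k hk ((le_max_left _ _).trans hk0)]
    exact H.compKernel_assoc hk (H.leftRegular_word hk _ (hXr k hk)) h2 h3
      (fun φ => (hc.leftRegular hk).continuous φ) (hD k hk)

theorem Setting.powers_of_zero (H : Stg) {ρ : ℝ} (hρ0 : 0 ≤ ρ)
    (hρ : ρ ≤ 1 / 8) {V : Set ℂ} {c : ℝ × ℝ → ℂ} (hc : PsiSymbol q ρ V fun _ => c) (M : ℕ) :
    (∃ P : ℝ → ℝ → ℝ → ℂ, IsPseudodifferential (-(M : ℝ)) P ∧ KernelEquiv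
          (fun k => 𝒲 k (fun _ : Fin M => 0) (quantize k c))
          (fun k => compKernel (P k) (quantize k c))) ∧
      (∃ P : ℝ → ℝ → ℝ → ℂ, IsPseudodifferential (-(M : ℝ)) P ∧ KernelEquiv
          (fun k => 𝒲 k (fun _ : Fin M => 0) (quantize k c)) P) := by
  replace hc := hc.mono (subset_univ V)
  obtain ⟨C, hC0, hC⟩ := H.exists_norm_kernelWord_le M
  obtain ⟨D, hD0, hD⟩ := hc.exists_norm_le hρ0
  have hword : ∀ k, 1 ≤ k → ∀ φ₁ φ₂, ‖𝒲 k (fun _ : Fin M => 0) (quantize k c) φ₁ φ₂‖ ≤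
      C * D * k ^ (M + 1) := fun k hk φ₁ φ₂ =>
    (hC k hk _ _ (hc.leftRegular hk) φ₂ (D * k) (fun φ => hD k hk φ φ₂) φ₁).trans_eq (by ring)
  have hP : ∀ (b : ℝ → ℝ × ℝ → ℂ) (B : ℝ), (∀ k : ℝ, 1 ≤ k → ∀ φ θ, ‖quantize k (b k) φ θ‖ ≤ B * k) →
      ∀ k : ℝ, 1 ≤ k → ∀ φ₁ φ₂, ‖((k : ℂ) ^ M)⁻¹ * quantize k (b k) φ₁ φ₂‖ ≤ B * k :=
    fun b B hB k hk φ₁ φ₂ => by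
      rw [norm_mul, norm_inv, norm_pow, norm_of_nonneg (by linarith)]
      exact (mul_le_of_le_one_left (norm_nonneg _) (inv_le_one_of_one_le₀ (one_le_pow₀ hk))).trans
        (hB k hk φ₁ φ₂)
  have hkM : ∀ k : ℝ, 1 ≤ k → k ≤ k ^ (M + 1) := fun k hk => le_self_pow₀ hk (by omega)
  constructor
  · have hm := PsiSymbol.multiplier q
    obtain ⟨b, hb, k₀, hk₀⟩ := hm.psiForm.word_zero H le_rfl M
    obtain ⟨k₁, hk₁⟩ := hm.psiForm.word_comp H le_rfl (fun k hk => hm.leftRegular hk) hρ0 hc M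
    obtain ⟨B, hB0, hB⟩ := hb.exists_norm_le (by norm_num)
    refine ⟨_, hb.isPseudodifferential M, fun R => ?_⟩
    obtain ⟨E, hE0, hE⟩ := PsiSymbol.multiplier_comp hρ0 hρ hc (R + M)
    refine isBigOKernel_of_large (C := C * D + 2 * π * B * D) (p := M + 2) (D := C * E)
      (k₀ := max k₀ k₁) (fun k hk φ₁ φ₂ => ?_) (fun k hk hk0 φ₁ φ₂ => ?_)
    · have hk0 : 0 ≤ k := by linarith
      have h1 : ‖compKernel (fun φ₁ φ₂ => ((k : ℂ) ^ M)⁻¹ * quantize k (b k) φ₁ φ₂)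
          (quantize k c) φ₁ φ₂‖ ≤ (B * k) * (D * k) * |2 * π - 0| :=
        norm_integral_le_of_norm_le_const fun θ _ => by
          rw [norm_mul]
          exact mul_le_mul (hP b B hB k hk _ _) (hD k hk _ _) (norm_nonneg _) (by positivity)
      rw [sub_zero, abs_of_pos two_pi_pos] at h1
      have h2 : k ^ (M + 1) ≤ k ^ (M + 2) := pow_le_pow_right₀ hk (by omega)
      have h3 : k * k ≤ k ^ (M + 2) := by rw [← sq]; exact pow_le_pow_right₀ hk (by omega)
      refine (norm_sub_le _ _).trans ((add_le_add (hword k hk φ₁ φ₂) h1).trans ?_)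
      calc _ = C * D * k ^ (M + 1) + 2 * π * B * D * (k * k) := by ring
        _ ≤ C * D * k ^ (M + 2) + 2 * π * B * D * k ^ (M + 2) := by
          have := pi_pos
          gcongr
        _ = _ := by ring
    · have hk1 : 0 < k := by linarith
      have hX : 𝒲 k (fun _ : Fin M => 0) (quantize k fun z => (Billiard.bump (1 / 4) z.2 : ℂ)) =
          fun φ₁ φ₂ => ((k : ℂ) ^ M)⁻¹ * quantize k (b k) φ₁ φ₂ :=
        funext fun φ => funext fun θ => hk₀ k hk ((le_max_left _ _).trans hk0) φ θ
      have hcomp := hk₁ k hk ((le_max_right _ _).trans hk0)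
      rw [hX] at hcomp
      beta_reduce
      rw [← hcomp]
      have hr1 := hc.leftRegular hk
      obtain ⟨F, -, hF⟩ := hm.exists_norm_le (by norm_num)
      have hr2 : LeftRegular (compKernel (quantize k fun z => (Billiard.bump (1 / 4) z.2 : ℂ))
          (quantize k c)) := by
        refine ⟨fun φ₂ => ?_, fun φ₂ φ => ?_⟩
        · refine intervalIntegral.continuous_parametric_intervalIntegral_of_continuous' ?_ _ _
          exact (continuous_quantize hk1 (fun φ η h => (hm.support k hk φ η h).1)
            (hm.continuous hk)).mul ((hr1.continuous φ₂).comp continuous_snd)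
        · simp only [compKernel]
          congr 1
          ext θ
          rw [show quantize k (fun z => (Billiard.bump (1 / 4) z.2 : ℂ)) (φ + 2 * π) θ =
            quantize k (fun z => (Billiard.bump (1 / 4) z.2 : ℂ)) φ θ from
            (hm.leftRegular hk).periodic θ φ]
      have hadd := H.kernelWord_add hk (fun _ : Fin M => 0) (hr1.sub hr2) hr2 φ₁ φ₂
      simp only [sub_add_cancel] at hadd
      have hsub : 𝒲 k (fun _ : Fin M => 0) (quantize k c) φ₁ φ₂ - 𝒲 k (fun _ : Fin M => 0)
            (compKernel (quantize k fun z => (Billiard.bump (1 / 4) z.2 : ℂ)) (quantize k c)) φ₁ φ₂ =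
          𝒲 k (fun _ : Fin M => 0) (fun φ₁ φ₂ => quantize k c φ₁ φ₂ -
            compKernel (quantize k fun z => (Billiard.bump (1 / 4) z.2 : ℂ)) (quantize k c) φ₁ φ₂)
            φ₁ φ₂ := by
        rw [sub_eq_iff_eq_add]
        exact hadd
      rw [hsub]
      refine (hC k hk _ _ (hr1.sub hr2) φ₂ _ (fun φ => hE k hk φ φ₂) φ₁).trans_eq ?_
      rw [pow_add]; field_simp
  · obtain ⟨b, hb, k₀, hk₀⟩ := hc.psiForm.word_zero H (hρ.trans (by norm_num)) M
    obtain ⟨B, hB0, hB⟩ := hb.exists_norm_le hρ0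
    refine ⟨_, hb.isPseudodifferential M, fun R => ?_⟩
    refine isBigOKernel_of_large (C := C * D + B) (p := M + 1) (D := 0) (k₀ := k₀)
      (fun k hk φ₁ φ₂ => ?_) (fun k hk hk0 φ₁ φ₂ => ?_)
    · refine (norm_sub_le _ _).trans ((add_le_add (hword k hk φ₁ φ₂)
        (hP b B hB k hk φ₁ φ₂)).trans ?_)
      rw [add_mul]
      gcongr
      exact hkM k hk
    · beta_reduce
      rw [← hk₀ k hk hk0, sub_self, norm_zero, zero_mul]

/-! ### Geometry near the bouncing ball orbit -/

/-- The parameters of the end points of the orbit, in alternation. -/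
def pt (b : ℝ) (p : ℕ) : ℝ := if Even p then 0 else b

lemma pt_add_two (b : ℝ) (p : ℕ) : pt b (p + 2) = pt b p := by simp [pt, Nat.even_add]

/-- The boundary point with parameter `x` is close to the end point with index `p`. -/
def Near (q : ℝ → ℂ) (b e : ℝ) (p : ℕ) (x : ℝ) : Prop := ‖q x - q (pt b p)‖ ≤ e

lemma Near.mono {e e' : ℝ} {p : ℕ} {x : ℝ} (h : Near q b e p x) (he : e ≤ e') : Near q b e' p x :=
  le_trans h he

lemma near_add_two {e : ℝ} {p : ℕ} {x : ℝ} : Near q b e (p + 2) x ↔ Near q b e p x := by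
  rw [Near, Near, pt_add_two]

/-- The derivative of `‖q x - q y‖` with respect to `x`. -/
def distDeriv (q : ℝ → ℂ) (x y : ℝ) : ℝ := inner ℝ (q x - q y) (deriv q x) / ‖q x - q y‖

lemma direction_zero (q : ℝ → ℂ) (x : ℝ) : direction q (x, 0) = normal q x := by simp [direction]

lemma pt_cases (b : ℝ) (p : ℕ) :
    (pt b p = 0 ∧ pt b (p + 1) = b) ∨ (pt b p = b ∧ pt b (p + 1) = 0) := by
  by_cases hp : Even p <;> simp [pt, even_add_one, hp]

lemma IsBouncingBall.exists_segment (hb : Bounce) (p : ℕ) :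
    ∃ t : ℝ, 0 < t ∧ q (pt b (p + 1)) = q (pt b p) + (t : ℂ) * normal q (pt b p) ∧
      ∀ s : ℝ, 0 < s → s < t → q (pt b p) + (s : ℂ) * normal q (pt b p) ∈ Ω := by
  rcases pt_cases b p with ⟨h1, h2⟩ | ⟨h1, h2⟩
  · rw [h1, h2, ← direction_zero]
    exact hb.1.2.1
  · rw [h1, h2, ← direction_zero]
    exact hb.2.2.1

/-- The length of the orbit. -/
def orbitLength (q : ℝ → ℂ) (b : ℝ) : ℝ := ‖q b - q 0‖

local notation "ℓ" => orbitLength q b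

lemma norm_pt_sub (p : ℕ) : ‖q (pt b (p + 1)) - q (pt b p)‖ = ℓ := by
  rcases pt_cases b p with ⟨h1, h2⟩ | ⟨h1, h2⟩
  · rw [h1, h2, orbitLength]
  · rw [h1, h2, orbitLength, norm_sub_rev]

lemma IsSmoothDomain.norm_normal (h : Dom) (x : ℝ) : ‖normal q x‖ = 1 := by
  rw [normal, norm_mul, norm_I, one_mul, h.arclength]

lemma pt_sub_eq (h : Dom) (hb : Bounce) (p : ℕ) :
    q (pt b (p + 1)) - q (pt b p) = (ℓ : ℂ) * normal q (pt b p) := by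
  obtain ⟨t, ht, h1, -⟩ := hb.exists_segment p
  have h2 := norm_pt_sub (q := q) (b := b) p
  rw [h1, add_sub_cancel_left, norm_mul, h.norm_normal, mul_one, norm_of_nonneg ht.le] at h2
  rw [← h2, h1, add_sub_cancel_left]

lemma orbitLength_pos (h : Dom) (hb : Bounce) : 0 < ℓ := by
  obtain ⟨t, ht, h1, -⟩ := hb.exists_segment 0
  rw [← norm_pt_sub 0, h1, add_sub_cancel_left, norm_mul, h.norm_normal, mul_one,
    norm_of_nonneg ht.le]
  exact ht

lemma orbit_mem (h : Dom) (hb : Bounce) (p : ℕ) {s : ℝ} (hs : 0 < s) (hs1 : s < 1) :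
    q (pt b p) + (s : ℂ) * (q (pt b (p + 1)) - q (pt b p)) ∈ Ω := by
  obtain ⟨t, ht, h1, h2⟩ := hb.exists_segment p
  have := h2 (s * t) (by positivity) (by nlinarith)
  rw [h1, add_sub_cancel_left, ← mul_assoc]
  exact_mod_cast this

lemma normal_pt_succ (h : Dom) (hb : Bounce) (p : ℕ) :
    normal q (pt b (p + 1)) = -normal q (pt b p) := by
  have h1 := pt_sub_eq h hb p
  have h2 := pt_sub_eq h hb (p + 1)
  rw [show p + 1 + 1 = p + 2 from rfl, pt_add_two, ← neg_sub, h1, ← mul_neg] at h2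
  have h3 : (ℓ : ℂ) ≠ 0 := by exact_mod_cast (orbitLength_pos h hb).ne'
  exact (mul_left_cancel₀ h3 h2).symm

lemma deriv_pt_succ (h : Dom) (hb : Bounce) (p : ℕ) :
    deriv q (pt b (p + 1)) = -deriv q (pt b p) := by
  have h1 := normal_pt_succ h hb p
  rw [normal, normal, ← mul_neg] at h1
  exact mul_left_cancel₀ Complex.I_ne_zero h1

lemma inner_pt_sub (h : Dom) (hb : Bounce) (p : ℕ) :
    inner ℝ (q (pt b p) - q (pt b (p + 1))) (deriv q (pt b p)) = 0 := by
  rw [← neg_sub, pt_sub_eq h hb, inner_neg_left, ← real_smul, inner_smul_left, normal,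
    real_inner_comm, inner_mul_I_self]
  simp

/-- Every parameter has a representative within `π` of a given one. -/
lemma IsSmoothDomain.exists_rep (h : Dom) (θ x : ℝ) :
    ∃ u, |u| ≤ π ∧ q θ = q (x - u) ∧ deriv q θ = deriv q (x - u) := by
  have hT := two_pi_pos
  have h1 := toIocMod_mem_Ioc hT (-π) (x - θ)
  refine ⟨toIocMod hT (-π) (x - θ), abs_le.2 ⟨h1.1.le, by linarith [h1.2]⟩, ?_, ?_⟩
  all_goals
    have h2 : x - toIocMod hT (-π) (x - θ) =
        θ + toIocDiv hT (-π) (x - θ) • (2 * π) := by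
      rw [toIocMod]; ring
    rw [h2]
  · exact (h.periodic.zsmul _ θ).symm
  · exact (h.deriv_periodic.zsmul _ θ).symm

lemma IsSmoothDomain.exists_near_deriv (h : Dom) {η : ℝ} (hη : 0 < η) :
    ∃ e > 0, ∀ x φ, ‖q φ - q x‖ ≤ e → ‖deriv q φ - deriv q x‖ ≤ η := by
  have huc : UniformContinuous (deriv q) := by
    obtain ⟨C, h0, hC⟩ := (h.ub_deriv (ι := Unit)).bound 1
    have : LipschitzWith ⟨C, h0⟩ (deriv q) := lipschitzWith_of_nnnorm_fderiv_le
      (h.contDiff_deriv.differentiable (by simp)) fun x => by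
        have := hC () x
        rw [norm_iteratedFDeriv_one, mul_one] at this
        exact this
    exact this.uniformContinuous
  obtain ⟨u, hu, hd⟩ := Metric.uniformContinuous_iff.1 huc η hη
  obtain ⟨r, hr, hc⟩ := h.exists_chord (half_pos hu)
  refine ⟨r, hr, fun x φ hle => ?_⟩
  obtain ⟨v, hv, h1, h2⟩ := h.exists_rep φ x
  rw [h1, norm_sub_rev] at hle
  have h3 := hc x v hv hle
  rw [h2, ← dist_eq_norm]
  refine (hd ?_).le
  rw [Real.dist_eq, sub_sub_cancel_left, abs_neg]
  linarith

lemma abs_inner_sub_le {z z' w w' : ℂ} {A : ℝ} (hw : ‖w‖ = 1) (hz' : ‖z'‖ ≤ A) :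
    |inner ℝ z w - inner ℝ z' w'| ≤ ‖z - z'‖ + A * ‖w - w'‖ := by
  have h1 : inner ℝ z w - inner ℝ z' w' = inner ℝ (z - z') w + inner ℝ z' (w - w') := by
    rw [inner_sub_left, inner_sub_right]; ring
  rw [h1]
  refine (abs_add_le _ _).trans (add_le_add ?_ ?_)
  · refine (abs_real_inner_le_norm _ _).trans ?_
    rw [hw, mul_one]
  · exact (abs_real_inner_le_norm _ _).trans (mul_le_mul_of_nonneg_right hz' (norm_nonneg _))

lemma Near.norm_sub_le {e : ℝ} {p : ℕ} {x y : ℝ} (hx : Near q b e p x) (hy : Near q b e (p + 1) y) :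
    ‖(q x - q y) - (q (pt b p) - q (pt b (p + 1)))‖ ≤ 2 * e := by
  rw [sub_sub_sub_comm]
  refine (_root_.norm_sub_le _ _).trans ?_
  rw [Near] at hx hy
  linarith

lemma Near.le_norm {e : ℝ} {p : ℕ} {x y : ℝ} (hx : Near q b e p x) (hy : Near q b e (p + 1) y) :
    ℓ - 2 * e ≤ ‖q x - q y‖ := by
  have h1 := hx.norm_sub_le hy
  have h2 := norm_sub_norm_le (q (pt b p) - q (pt b (p + 1))) (q x - q y)
  rw [norm_sub_rev, norm_pt_sub, norm_sub_rev (q (pt b p) - q (pt b (p + 1)))] at h2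
  linarith

lemma exists_distDeriv_le (h : Dom) (hb : Bounce) {η : ℝ}
    (hη : 0 < η) : ∃ e > 0, ∀ p x y, Near q b e p x → Near q b e (p + 1) y →
      |distDeriv q x y| ≤ η := by
  have hD := orbitLength_pos h hb
  set D := ℓ
  obtain ⟨e₁, he₁, h1⟩ := h.exists_near_deriv (η := η / 4) (by positivity)
  refine ⟨min e₁ (min (D / 4) (η * D / 8)), by positivity, fun p x y hx hy => ?_⟩
  have hle := hx.le_norm hy
  have hlt : D / 2 ≤ ‖q x - q y‖ := by
    have : min e₁ (min (D / 4) (η * D / 8)) ≤ D / 4 := (min_le_right _ _).trans (min_le_left _ _)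
    linarith
  have hpos : 0 < ‖q x - q y‖ := by linarith
  have h2 := h1 (pt b p) x (hx.mono (min_le_left _ _))
  have h3 := abs_inner_sub_le (z := q x - q y) (z' := q (pt b p) - q (pt b (p + 1)))
    (w := deriv q x) (w' := deriv q (pt b p)) (A := D) (h.arclength x) (by
      rw [norm_sub_rev, norm_pt_sub])
  rw [inner_pt_sub h hb, sub_zero] at h3
  have h4 := hx.norm_sub_le hy
  have h5 : min e₁ (min (D / 4) (η * D / 8)) ≤ η * D / 8 :=
    (min_le_right _ _).trans (min_le_right _ _)
  rw [distDeriv, abs_div, abs_of_pos hpos, div_le_iff₀ hpos]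
  calc _ ≤ 2 * (η * D / 8) + D * (η / 4) := by
        refine h3.trans (add_le_add (h4.trans (by linarith)) ?_)
        exact mul_le_mul_of_nonneg_left h2 hD.le
    _ = η * (D / 2) := by ring
    _ ≤ _ := by gcongr

lemma exists_transversal (h : Dom) : ∃ c > 0, ∀ y θ : ℝ, ∀ v : ℂ, ∀ s : ℝ,
    ‖q θ - q y‖ ≤ c → q θ - q y = (s : ℂ) * v → |inner ℝ v (deriv q y)| ≤ 1 / 2 * ‖v‖ →
    q θ = q y := by
  have key : ∀ σ : ℝ, |σ| = 1 → ∃ C, 0 ≤ C ∧ ∀ y w, 0 ≤ w →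
      w * (1 - C * w) ≤ |inner ℝ (q (y - σ * w) - q y) (deriv q y)| := by
    intro σ hσ
    obtain ⟨C, h0, hC, -⟩ := UB.norm_sub_le (UB.sideQuot (ι := Unit) h σ)
    refine ⟨C, h0, fun y w hw => ?_⟩
    have h1 := hC y w hw
    rw [← smul_sideQuot h, inner_smul_left, conj_trivial, abs_mul, abs_of_nonneg hw]
    refine mul_le_mul_of_nonneg_left ?_ hw
    have h2 : sideQuot q σ (y, w) = sideQuot q σ (y, 0) +
      (sideQuot q σ (y, w) - sideQuot q σ (y, 0)) := by ring
    have h3 : -(σ : ℂ) * deriv q y = (-σ) • deriv q y := by rw [real_smul]; push_cast; ring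
    have h4 : |inner ℝ (sideQuot q σ (y, 0)) (deriv q y)| = 1 := by
      rw [sideQuot_zero, h3, inner_smul_left, conj_trivial, real_inner_self_eq_norm_sq,
        h.arclength, one_pow, mul_one, abs_neg, hσ]
    have h5 : |inner ℝ (sideQuot q σ (y, w) - sideQuot q σ (y, 0)) (deriv q y)| ≤ C * w := by
      refine (abs_real_inner_le_norm _ _).trans ?_
      rw [h.arclength, mul_one]; exact h1
    have h6 := abs_sub_abs_le_abs_sub (inner ℝ (sideQuot q σ (y, 0)) (deriv q y))
      (-inner ℝ (sideQuot q σ (y, w) - sideQuot q σ (y, 0)) (deriv q y))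
    rw [h2, inner_add_left]
    rw [sub_neg_eq_add, abs_neg, h4] at h6
    linarith
  obtain ⟨C₁, h01, h1⟩ := key 1 (by simp)
  obtain ⟨C₂, h02, h2⟩ := key (-1) (by simp)
  set C := max C₁ C₂
  have hC : 0 ≤ C := h01.trans (le_max_left _ _)
  obtain ⟨c, hc, hcu⟩ := h.exists_chord (u₁ := 1 / (4 * (C + 1))) (by positivity)
  refine ⟨c, hc, fun y θ v s hle heq hv => ?_⟩
  obtain ⟨u, hu, hq, -⟩ := h.exists_rep θ y
  rw [hq] at hle heq ⊢
  have hu1 := hcu y u hu (by rwa [norm_sub_rev])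
  have h3 : |u| * (1 - C * |u|) ≤ |inner ℝ (q (y - u) - q y) (deriv q y)| := by
    have hu0 := abs_nonneg u
    rcases le_total 0 u with h0 | h0
    · have := h1 y |u| hu0
      rw [abs_of_nonneg h0, one_mul] at this
      rw [abs_of_nonneg h0]
      refine le_trans ?_ this
      have : C₁ * u ≤ C * u := mul_le_mul_of_nonneg_right (le_max_left _ _) h0
      exact mul_le_mul_of_nonneg_left (by linarith) h0
    · have := h2 y |u| hu0
      rw [show y - -1 * |u| = y - u by rw [abs_of_nonpos h0]; ring] at this
      refine le_trans ?_ this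
      have : C₂ * |u| ≤ C * |u| := mul_le_mul_of_nonneg_right (le_max_right _ _) hu0
      exact mul_le_mul_of_nonneg_left (by linarith) hu0
  have h4 : |inner ℝ (q (y - u) - q y) (deriv q y)| ≤ 1 / 2 * |u| := by
    have h5 : ‖(s : ℂ) * v‖ ≤ |u| := by rw [← heq, norm_sub_rev]; exact h.norm_chord_le y u
    rw [norm_mul, norm_real, norm_eq_abs] at h5
    rw [heq, ← real_smul, inner_smul_left, conj_trivial, abs_mul]
    calc _ ≤ |s| * (1 / 2 * ‖v‖) := by gcongr
      _ = 1 / 2 * (|s| * ‖v‖) := by ring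
      _ ≤ _ := by gcongr
  rw [le_div_iff₀ (by positivity)] at hu1
  have h5 : |u| = 0 := by
    by_contra hne
    have hpos : 0 < |u| := lt_of_le_of_ne (abs_nonneg _) (Ne.symm hne)
    have h6 : 1 - C * |u| ≤ 1 / 2 := by
      by_contra hcon
      nlinarith
    nlinarith
  rw [abs_eq_zero.1 h5, sub_zero]

/-- The boundary does not meet segments close to the orbit. -/
lemma exists_segment_disjoint (h : Dom) (hb : Bounce) :
    ∃ e > 0, ∀ p x y, Near q b e p x → Near q b e (p + 1) y → ∀ t : ℝ, 0 < t → t < 1 → ∀ θ,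
      q θ ≠ q y + (t : ℂ) * (q x - q y) := by
  have hD := orbitLength_pos h hb
  obtain ⟨c, hc, htr⟩ := exists_transversal h
  obtain ⟨e₁, he₁, hdir⟩ := exists_distDeriv_le h hb (η := 1 / 2) (by norm_num)
  let K : Set ℂ := range q ∩ {z | c / 2 ≤ ‖z - q 0‖ ∧ c / 2 ≤ ‖z - q b‖}
  have hqc : IsCompact (range q) := by
    have := h.periodic.compact_of_continuous two_pi_pos.ne' h.smooth.continuous
    exact this
  have hK : IsCompact K := hqc.inter_right
    ((isClosed_le (f := fun _ : ℂ => c / 2) (g := fun z => ‖z - q 0‖) continuous_const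
      (by fun_prop)).inter (isClosed_le (f := fun _ : ℂ => c / 2) (g := fun z => ‖z - q b‖)
      continuous_const (by fun_prop)))
  have hS : IsCompact ((fun t : ℝ => q 0 + (t : ℂ) * (q b - q 0)) '' Icc 0 1) :=
    isCompact_Icc.image (by fun_prop)
  have hdis : Disjoint K ((fun t : ℝ => q 0 + (t : ℂ) * (q b - q 0)) '' Icc 0 1) := by
    rw [Set.disjoint_left]
    rintro z ⟨hz, hz1, hz2⟩ ⟨t, ht, rfl⟩
    dsimp only at hz1 hz2
    have hz' : q 0 + (t : ℂ) * (q b - q 0) ∈ frontier Ω := h.frontier_eq ▸ hz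
    rcases ht.1.eq_or_lt with h0 | h0
    · rw [← h0] at hz1; simp at hz1; linarith
    rcases ht.2.eq_or_lt with h1 | h1
    · rw [h1] at hz2; simp at hz2; linarith
    have hm := orbit_mem h hb 0 h0 h1
    rw [show pt b (0 + 1) = b by simp [pt], show pt b 0 = 0 by simp [pt]] at hm
    rw [h.isOpen.frontier_eq] at hz'
    exact hz'.2 hm
  obtain ⟨d, hd, hdd⟩ := hdis.exists_thickenings hK hS.isClosed
  set D := ℓ
  refine ⟨min (min e₁ (D / 4)) (min (c / 2) (d / 2)), by positivity,
    fun p x y hx hy t ht0 ht1 θ heq => ?_⟩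
  set e := min (min e₁ (D / 4)) (min (c / 2) (d / 2))
  have hee : e ≤ e₁ := (min_le_left _ _).trans (min_le_left _ _)
  have heD : e ≤ D / 4 := (min_le_left _ _).trans (min_le_right _ _)
  have hec : e ≤ c / 2 := (min_le_right _ _).trans (min_le_left _ _)
  have hed : e ≤ d / 2 := (min_le_right _ _).trans (min_le_right _ _)
  have hpos : 0 < ‖q x - q y‖ := by linarith [hx.le_norm hy]
  have hne : q x - q y ≠ 0 := norm_pos_iff.1 hpos
  have hy1 : c / 2 ≤ ‖q θ - q (pt b (p + 1))‖ := by
    by_contra hcon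
    have h1 : ‖q θ - q y‖ ≤ c := by
      have := norm_sub_le_norm_sub_add_norm_sub (q θ) (q (pt b (p + 1))) (q y)
      rw [norm_sub_rev (q (pt b (p + 1)))] at this
      rw [Near] at hy
      linarith
    have h2 := hdir (p + 1) y x (hy.mono hee) (near_add_two.2 (hx.mono hee))
    rw [distDeriv, abs_div, abs_norm, norm_sub_rev, div_le_iff₀ hpos, ← neg_sub, inner_neg_left,
      abs_neg] at h2
    have h3 := htr y θ _ t h1 (by rw [heq]; ring) h2
    rw [h3, left_eq_add, mul_eq_zero] at heq
    rcases heq with heq | heq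
    · have : t = 0 := by exact_mod_cast heq
      linarith
    · exact hne heq
  have hx1 : c / 2 ≤ ‖q θ - q (pt b p)‖ := by
    by_contra hcon
    have h1 : ‖q θ - q x‖ ≤ c := by
      have := norm_sub_le_norm_sub_add_norm_sub (q θ) (q (pt b p)) (q x)
      rw [norm_sub_rev (q (pt b p))] at this
      rw [Near] at hx
      linarith
    have h2 := hdir p x y (hx.mono hee) (hy.mono hee)
    rw [distDeriv, abs_div, abs_norm, div_le_iff₀ hpos] at h2
    have h3 := htr x θ _ (t - 1) h1 (by rw [heq]; push_cast; ring) h2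
    rw [h3, ← sub_eq_zero] at heq
    have h4 : ((1 - t : ℝ) : ℂ) * (q x - q y) = 0 := by rw [← heq]; push_cast; ring
    rcases mul_eq_zero.1 h4 with h5 | h5
    · have : 1 - t = 0 := by exact_mod_cast h5
      linarith
    · exact hne h5
  have hzK : q θ ∈ K := by
    refine ⟨mem_range_self θ, ?_⟩
    rcases pt_cases b p with ⟨h1, h2⟩ | ⟨h1, h2⟩
    · rw [h1] at hx1; rw [h2] at hy1
      exact ⟨hx1, hy1⟩
    · rw [h1] at hx1; rw [h2] at hy1
      exact ⟨hy1, hx1⟩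
  have hs : q (pt b (p + 1)) + (t : ℂ) * (q (pt b p) - q (pt b (p + 1))) ∈
      ((fun t : ℝ => q 0 + (t : ℂ) * (q b - q 0)) '' Icc 0 1) := by
    rcases pt_cases b p with ⟨h1, h2⟩ | ⟨h1, h2⟩
    · rw [h1, h2]
      exact ⟨1 - t, ⟨by linarith, by linarith⟩, by push_cast; ring⟩
    · rw [h1, h2]
      exact ⟨t, ⟨ht0.le, ht1.le⟩, rfl⟩
  refine Set.disjoint_left.1 hdd (Metric.self_subset_thickening hd K hzK)
    (Metric.mem_thickening_iff.2 ⟨_, hs, ?_⟩)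
  rw [dist_eq_norm, heq]
  have h1 : q y + (t : ℂ) * (q x - q y) -
      (q (pt b (p + 1)) + (t : ℂ) * (q (pt b p) - q (pt b (p + 1)))) =
      ((1 - t : ℝ) : ℂ) * (q y - q (pt b (p + 1))) + (t : ℂ) * (q x - q (pt b p)) := by
    push_cast; ring
  rw [h1]
  refine (norm_add_le _ _).trans_lt ?_
  rw [norm_mul, norm_mul, norm_real, norm_real, Real.norm_of_nonneg (by linarith), Real.norm_of_nonneg ht0.le]
  have h2 : (1 - t) * ‖q y - q (pt b (p + 1))‖ ≤ (1 - t) * e :=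
    mul_le_mul_of_nonneg_left hy (by linarith)
  have h3 : t * ‖q x - q (pt b p)‖ ≤ t * e := mul_le_mul_of_nonneg_left hx ht0.le
  linarith

lemma exists_segment_subset (h : Dom) (hb : Bounce) :
    ∃ e > 0, ∀ p x y, Near q b e p x → Near q b e (p + 1) y → ∀ t : ℝ, 0 < t → t < 1 →
      q y + (t : ℂ) * (q x - q y) ∈ Ω := by
  obtain ⟨e₁, he₁, hdis⟩ := exists_segment_disjoint h hb
  have hmid : ∃ e > 0, ∀ p x y, Near q b e p x → Near q b e (p + 1) y →
      q y + ((1 / 2 : ℝ) : ℂ) * (q x - q y) ∈ Ω := by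
    have hm : ∀ p, q (pt b p) + ((1 / 2 : ℝ) : ℂ) * (q (pt b (p + 1)) - q (pt b p)) ∈ Ω :=
      fun p => orbit_mem h hb p (by norm_num) (by norm_num)
    obtain ⟨r, hr, hball⟩ := Metric.isOpen_iff.1 h.isOpen _ (hm 0)
    refine ⟨r / 2, half_pos hr, fun p x y hx hy => hball ?_⟩
    have h1 : q (pt b 0) + ((1 / 2 : ℝ) : ℂ) * (q (pt b (0 + 1)) - q (pt b 0)) =
        q (pt b (p + 1)) + ((1 / 2 : ℝ) : ℂ) * (q (pt b p) - q (pt b (p + 1))) := by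
      rcases pt_cases b p with ⟨h1, h2⟩ | ⟨h1, h2⟩
      · rw [h1, h2, show pt b (0 + 1) = b by simp [pt], show pt b 0 = 0 by simp [pt]]
        push_cast; ring
      · rw [h1, h2, show pt b (0 + 1) = b by simp [pt], show pt b 0 = 0 by simp [pt]]
    rw [Metric.mem_ball, dist_eq_norm, h1]
    have h2 : q y + ((1 / 2 : ℝ) : ℂ) * (q x - q y) -
        (q (pt b (p + 1)) + ((1 / 2 : ℝ) : ℂ) * (q (pt b p) - q (pt b (p + 1)))) =
        (1 / 2 : ℂ) * ((q y - q (pt b (p + 1))) + (q x - q (pt b p))) := by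
      push_cast; ring
    rw [h2, norm_mul]
    have h3 := norm_add_le (q y - q (pt b (p + 1))) (q x - q (pt b p))
    rw [Near] at hx hy
    have h4 : ‖(1 / 2 : ℂ)‖ = 1 / 2 := by norm_num
    rw [h4]
    linarith
  obtain ⟨e₂, he₂, hmid⟩ := hmid
  refine ⟨min e₁ e₂, lt_min he₁ he₂, fun p x y hx hy t ht0 ht1 => ?_⟩
  have hconn : IsPreconnected ((fun t : ℝ => q y + (t : ℂ) * (q x - q y)) '' Ioo 0 1) :=
    isPreconnected_Ioo.image _ (Continuous.continuousOn (by fun_prop))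
  have hcov : ((fun t : ℝ => q y + (t : ℂ) * (q x - q y)) '' Ioo 0 1) ⊆ Ω ∪ (closure Ω)ᶜ := by
    rintro _ ⟨s, hs, rfl⟩
    by_contra hcon
    rw [mem_union, not_or, notMem_compl_iff] at hcon
    have : q y + (s : ℂ) * (q x - q y) ∈ frontier Ω := by
      rw [h.isOpen.frontier_eq]; exact ⟨hcon.2, hcon.1⟩
    rw [h.frontier_eq] at this
    obtain ⟨θ, hθ⟩ := this
    exact hdis p x y (hx.mono (min_le_left _ _)) (hy.mono (min_le_left _ _)) s hs.1 hs.2 θ hθ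
  have hsub := hconn.subset_left_of_subset_union h.isOpen isClosed_closure.isOpen_compl
    (disjoint_compl_right.mono_left subset_closure) hcov
    ⟨_, ⟨1 / 2, ⟨by norm_num, by norm_num⟩, rfl⟩,
      hmid p x y (hx.mono (min_le_right _ _)) (hy.mono (min_le_right _ _))⟩
  exact hsub ⟨t, ⟨ht0, ht1⟩, rfl⟩

/-- A neighbourhood of the orbit in which the billiard map is given by the length of chords. -/
structure OrbitScale (Ω : Set ℂ) (q : ℝ → ℂ) (b e : ℝ) : Prop where
  pos : 0 < e
  le : e ≤ orbitLength q b / 16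
  deriv_le : ∀ p x y, Near q b e p x → Near q b e (p + 1) y → |distDeriv q x y| ≤ 1 / 2
  inner_le : ∀ p x y, Near q b e p x → Near q b e (p + 1) y →
    |inner ℝ (deriv q x) (deriv q y) + 1| ≤ 1 / 4
  inner_pos : ∀ p x y, Near q b e p x → Near q b e (p + 1) y → 0 ≤ inner ℝ (q x - q y) (normal q y)
  segment : ∀ p x y, Near q b e p x → Near q b e (p + 1) y → ∀ t : ℝ, 0 < t → t < 1 →
    q y + (t : ℂ) * (q x - q y) ∈ Ω

local notation "Scale" => OrbitScale Ω q b

lemma OrbitScale.norm_pos {e : ℝ} (he : Scale e) {p : ℕ} {x y : ℝ}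
    (hx : Near q b e p x) (hy : Near q b e (p + 1) y) : 0 < ‖q x - q y‖ := by
  linarith [hx.le_norm hy, he.pos, he.le]

lemma exists_orbitScale (h : Dom) (hb : Bounce) {A : ℝ} (hA : 0 < A) : ∃ e, e ≤ A ∧ Scale e := by
  have hD := orbitLength_pos h hb
  set D := ℓ with hDdef
  obtain ⟨e₁, he₁, h1⟩ := exists_distDeriv_le h hb (η := 1 / 2) (by norm_num)
  obtain ⟨e₂, he₂, h2⟩ := h.exists_near_deriv (η := 1 / 8) (by norm_num)
  obtain ⟨e₃, he₃, h3⟩ := exists_segment_subset h hb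
  set e := min (min (min e₁ e₂) (min e₃ A)) (D / 16)
  have he1 : e ≤ e₁ := (min_le_left _ _).trans ((min_le_left _ _).trans (min_le_left _ _))
  have he2 : e ≤ e₂ := (min_le_left _ _).trans ((min_le_left _ _).trans (min_le_right _ _))
  have he3 : e ≤ e₃ := (min_le_left _ _).trans ((min_le_right _ _).trans (min_le_left _ _))
  have he4 : e ≤ A := (min_le_left _ _).trans ((min_le_right _ _).trans (min_le_right _ _))
  have he5 : e ≤ D / 16 := min_le_right _ _
  refine ⟨e, he4, by positivity, he5, fun p x y hx hy => h1 p x y (hx.mono he1) (hy.mono he1),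
    fun p x y hx hy => ?_, fun p x y hx hy => ?_,
    fun p x y hx hy => h3 p x y (hx.mono he3) (hy.mono he3)⟩
  · have e1 := h2 _ _ (hx.mono he2)
    have e2 := h2 _ _ (hy.mono he2)
    have e3 := abs_inner_sub_le (z := deriv q x) (w := deriv q y) (z' := deriv q (pt b p))
      (w' := deriv q (pt b (p + 1))) (A := 1) (h.arclength _) (h.arclength _).le
    rw [deriv_pt_succ h hb, inner_neg_right, real_inner_self_eq_norm_sq, h.arclength, one_pow,
      sub_neg_eq_add] at e3
    rw [deriv_pt_succ h hb] at e2
    linarith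
  · have e2 := h2 _ _ (hy.mono he2)
    have e3 : ‖normal q y - normal q (pt b (p + 1))‖ ≤ 1 / 8 := by
      rw [normal, normal, ← mul_sub, norm_mul, norm_I, one_mul]; exact e2
    have e4 := abs_inner_sub_le (z := q x - q y) (w := normal q y)
      (z' := q (pt b p) - q (pt b (p + 1))) (w' := normal q (pt b (p + 1))) (A := D)
      (h.norm_normal _) (by rw [norm_sub_rev, norm_pt_sub])
    have e5 : inner ℝ (q (pt b p) - q (pt b (p + 1))) (normal q (pt b (p + 1))) = D := by
      rw [normal_pt_succ h hb, inner_neg_right, ← neg_sub, inner_neg_left, neg_neg,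
        pt_sub_eq h hb, ← real_smul, inner_smul_left, conj_trivial,
        real_inner_self_eq_norm_sq, h.norm_normal, one_pow, mul_one]
    rw [e5] at e4
    have e6 := hx.norm_sub_le hy
    have e7 := (abs_le.1 e4).1
    have e8 : D * ‖normal q y - normal q (pt b (p + 1))‖ ≤ D * (1 / 8) :=
      mul_le_mul_of_nonneg_left e3 hD.le
    linarith

/-- Nearly normal chords are trajectories of the billiard flow. -/
lemma OrbitScale.billiardMap (h : Dom) {e : ℝ} (he : Scale e) {p : ℕ}
    {x y : ℝ} (hx : Near q b e p x) (hy : Near q b e (p + 1) y) :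
    BilliardMap Ω q (y, -distDeriv q y x) (x, distDeriv q x y) := by
  have hpos := he.norm_pos hx hy
  set r := ‖q x - q y‖ with hr
  have hrc : (r : ℂ) ≠ 0 := by exact_mod_cast hpos.ne'
  set v : ℂ := (r : ℂ)⁻¹ * (q x - q y) with hv
  have hv1 : ‖v‖ = 1 := by
    rw [hv, norm_mul, norm_inv, norm_of_nonneg hpos.le, ← hr, inv_mul_cancel₀ hpos.ne']
  have hvs : v = r⁻¹ • (q x - q y) := by rw [real_smul, hv]; push_cast; rfl
  have hη : -distDeriv q y x = inner ℝ v (deriv q y) := by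
    rw [hvs, inner_smul_left, conj_trivial, distDeriv, norm_sub_rev, ← hr, ← neg_sub (q x),
      inner_neg_left]
    field_simp
  have hη1 : |-distDeriv q y x| ≤ 1 / 2 := by
    rw [abs_neg]
    exact he.deriv_le (p + 1) y x hy (near_add_two.2 hx)
  have hdir : direction q (y, -distDeriv q y x) = v := by
    have hw : (starRingEnd ℂ) (deriv q y) * deriv q y = 1 := by
      rw [mul_comm, mul_conj, Complex.normSq_eq_norm_sq, h.arclength]; norm_num
    set ζ : ℂ := (starRingEnd ℂ) (deriv q y) * v with hζ
    have h1 : ζ.re = -distDeriv q y x := by rw [hη, real_inner_comm, Complex.inner, hζ, mul_comm]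
    have h2 : 0 ≤ ζ.im := by
      have h3 : ζ.im = r⁻¹ * inner ℝ (q x - q y) (normal q y) := by
        rw [← conj_trivial (r⁻¹), ← inner_smul_left, ← hvs, real_inner_comm, Complex.inner, normal,
          hζ]
        simp
        ring
      rw [h3]
      exact mul_nonneg (inv_nonneg.2 hpos.le) (he.inner_pos p x y hx hy)
    have h3 : ζ.re ^ 2 + ζ.im ^ 2 = 1 := by
      have : ‖ζ‖ = 1 := by rw [hζ, norm_mul, RCLike.norm_conj, h.arclength, hv1, one_mul]
      have h4 := Complex.sq_norm ζ
      rw [this, Complex.normSq_apply] at h4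
      linarith
    have h4 : Real.sqrt (1 - (-distDeriv q y x) ^ 2) = ζ.im := by
      rw [← h1, show 1 - ζ.re ^ 2 = ζ.im ^ 2 by linarith, Real.sqrt_sq h2]
    have h5 : v = ζ * deriv q y := by rw [hζ, mul_right_comm, hw, one_mul]
    rw [direction]
    dsimp only
    rw [h4, ← h1, h5, normal]
    nth_rewrite 3 [← Complex.re_add_im ζ]
    ring
  refine ⟨lt_of_le_of_lt hη1 (by norm_num), ⟨r, hpos, ?_, fun s hs0 hs1 => ?_⟩, ?_⟩
  · rw [hdir, hv, mul_inv_cancel_left₀ hrc]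
    ring
  · rw [hdir]
    have := he.segment p x y hx hy (s / r) (by positivity) ((div_lt_one hpos).2 hs1)
    convert this using 2
    rw [hv]; push_cast; field_simp
  · rw [hdir, hvs, inner_smul_left, conj_trivial, distDeriv, ← hr]
    dsimp only
    field_simp

/-! ### The length functional near the bouncing ball orbit -/

lemma pt_of_even {p : ℕ} (hp : Even p) : pt b p = pt b 0 ∧ pt b (p + 1) = pt b 1 := by
  constructor
  · rw [pt, if_pos hp]; simp [pt]
  · rw [pt, if_neg (by simpa [even_add_one] using hp)]; simp [pt]

lemma pt_of_odd {p : ℕ} (hp : Odd p) : pt b p = pt b 1 ∧ pt b (p + 1) = pt b 0 := by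
  obtain ⟨k, rfl⟩ := hp
  constructor
  · rw [pt, if_neg (by simp [even_add_one])]; simp [pt]
  · rw [pt, if_pos (by simp [even_add_one])]; simp [pt]

lemma eq_mul_I_of_inner_eq_zero {z w : ℂ} (hw : ‖w‖ = 1) (h : inner ℝ z w = 0) :
    ∃ s : ℝ, z = (s : ℂ) * (I * w) := by
  have hww : (starRingEnd ℂ) w * w = 1 := by
    rw [mul_comm, mul_conj, Complex.normSq_eq_norm_sq, hw]; norm_num
  set ζ : ℂ := (starRingEnd ℂ) w * z with hζ
  have h1 : ζ.re = 0 := by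
    rw [real_inner_comm, Complex.inner] at h
    rw [hζ, mul_comm]
    exact h
  have h2 : z = ζ * w := by rw [hζ, mul_right_comm, hww, one_mul]
  have h3 : ζ = ζ.im * I := by
    nth_rewrite 1 [← Complex.re_add_im ζ]
    rw [h1, ofReal_zero, zero_add]
  exact ⟨ζ.im, by rw [h2, ← mul_assoc, ← h3]⟩

/-- Away from the other end point, chords from near one end point of the orbit to the boundary
are not normal there. -/
def Admissible (q : ℝ → ℂ) (b e e' r c : ℝ) : Prop :=
  ∀ p φ₀ φ₁, Near q b e (p + 1) φ₁ → r ≤ ‖q φ₀ - q φ₁‖ → ¬Near q b e' p φ₀ →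
    (∀ η, |η| ≤ e → c ≤ |distDeriv q φ₁ φ₀ + η|) ∧
    ∀ φ₂, Near q b e p φ₂ → c ≤ |distDeriv q φ₁ φ₀ + distDeriv q φ₁ φ₂|

lemma NoGhost.exists_le_inner (hN : NoGhost q b) (h : Dom)
    (hb : Bounce) {e' r : ℝ} (he' : 0 < e') (hr : 0 < r) (p : ℕ) :
    ∃ m > 0, ∀ θ, r ≤ ‖q θ - q (pt b (p + 1))‖ → e' ≤ ‖q θ - q (pt b p)‖ →
      m ≤ |inner ℝ (q (pt b (p + 1)) - q θ) (deriv q (pt b (p + 1)))| := by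
  have hqc : IsCompact (range q) :=
    h.periodic.compact_of_continuous two_pi_pos.ne' h.smooth.continuous
  let K : Set ℂ := range q ∩ {z | r ≤ ‖z - q (pt b (p + 1))‖ ∧ e' ≤ ‖z - q (pt b p)‖}
  have hK : IsCompact K := hqc.inter_right
    ((isClosed_le (f := fun _ : ℂ => r) (g := fun z => ‖z - q (pt b (p + 1))‖) continuous_const
      (by fun_prop)).inter (isClosed_le (f := fun _ : ℂ => e') (g := fun z => ‖z - q (pt b p)‖)
      continuous_const (by fun_prop)))
  rcases K.eq_empty_or_nonempty with h0 | hne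
  · refine ⟨1, one_pos, fun θ h1 h2 => ?_⟩
    have : q θ ∈ K := ⟨mem_range_self θ, h1, h2⟩
    rw [h0] at this
    exact absurd this (notMem_empty _)
  obtain ⟨z, hz, hmin⟩ := hK.exists_isMinOn hne
    (f := fun z => |inner ℝ (q (pt b (p + 1)) - z) (deriv q (pt b (p + 1)))|)
    (Continuous.continuousOn (by fun_prop))
  refine ⟨_, ?_, fun θ h1 h2 => hmin ⟨mem_range_self θ, h1, h2⟩⟩
  refine abs_pos.2 fun hin => ?_
  obtain ⟨s, hs⟩ := eq_mul_I_of_inner_eq_zero (h.arclength _) hin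
  obtain ⟨⟨θ, rfl⟩, hz1, hz2⟩ := hz
  have hD := orbitLength_pos h hb
  have hDc : (ℓ : ℂ) ≠ 0 := by exact_mod_cast hD.ne'
  have h1 := pt_sub_eq h hb (p + 1)
  rw [show p + 1 + 1 = p + 2 from rfl, pt_add_two, normal] at h1
  have h2 : q θ = q (pt b (p + 1)) - ((s / ℓ : ℝ) : ℂ) * (q (pt b p) - q (pt b (p + 1))) := by
    rw [h1]; push_cast
    rw [← mul_assoc, div_mul_cancel₀ _ hDc, ← hs]; ring
  have h3 : q θ = q (pt b p) ∨ q θ = q (pt b (p + 1)) := by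
    rcases even_or_odd p with hp | hp
    · obtain ⟨e1, e2⟩ := pt_of_even (b := b) hp
      rw [e1, e2] at h2 ⊢
      simp only [pt, Even.zero, if_true, Nat.not_even_one, if_false] at h2 ⊢
      refine hN θ (1 + s / ℓ) ?_
      rw [h2]; push_cast; ring
    · obtain ⟨e1, e2⟩ := pt_of_odd (b := b) hp
      rw [e1, e2] at h2 ⊢
      simp only [pt, Even.zero, if_true, Nat.not_even_one, if_false] at h2 ⊢
      refine (hN θ (-(s / ℓ)) ?_).symm
      rw [h2]; push_cast; ring
  rcases h3 with h3 | h3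
  · rw [h3, sub_self, norm_zero] at hz2; linarith
  · rw [h3, sub_self, norm_zero] at hz1; linarith

lemma IsSmoothDomain.norm_sub_le_four (h : Dom) (x y : ℝ) : ‖q x - q y‖ ≤ 4 := by
  obtain ⟨u, hu, hq, -⟩ := h.exists_rep y x
  rw [hq]
  linarith [h.norm_chord_le x u, Real.pi_lt_four]

lemma NoGhost.exists_admissible (hN : NoGhost q b) (h : Dom)
    (hb : Bounce) {e' r A : ℝ} (he' : 0 < e') (hr : 0 < r) (hA : 0 < A) :
    ∃ e > 0, e ≤ A ∧ ∃ c > 0, Admissible q b e e' r c := by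
  obtain ⟨m₀, hm₀, h₀⟩ := hN.exists_le_inner h hb he' (half_pos hr) 0
  obtain ⟨m₁, hm₁, h₁⟩ := hN.exists_le_inner h hb he' (half_pos hr) 1
  set m := min m₀ m₁
  have hm : 0 < m := lt_min hm₀ hm₁
  have hkey : ∀ p θ, r / 2 ≤ ‖q θ - q (pt b (p + 1))‖ → e' ≤ ‖q θ - q (pt b p)‖ →
      m ≤ |inner ℝ (q (pt b (p + 1)) - q θ) (deriv q (pt b (p + 1)))| := fun p θ h1 h2 => by
    rcases even_or_odd p with hp | hp
    · obtain ⟨e1, e2⟩ := pt_of_even (b := b) hp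
      rw [e1] at h2; rw [e2] at h1 ⊢
      exact (min_le_left _ _).trans (h₀ θ h1 h2)
    · obtain ⟨e1, e2⟩ := pt_of_odd (b := b) hp
      rw [e1] at h2; rw [e2] at h1 ⊢
      have := h₁ θ
      rw [pt_add_two] at this
      exact (min_le_right _ _).trans (this h1 h2)
  obtain ⟨e₁, he₁, hd⟩ := h.exists_near_deriv (η := m / 16) (by positivity)
  obtain ⟨e₂, he₂, hdist⟩ := exists_distDeriv_le h hb (η := m / 16) (by positivity)
  set e := min (min (min e₁ e₂) (min (r / 2) A)) (m / 16)
  have hee1 : e ≤ e₁ := (min_le_left _ _).trans ((min_le_left _ _).trans (min_le_left _ _))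
  have hee2 : e ≤ e₂ := (min_le_left _ _).trans ((min_le_left _ _).trans (min_le_right _ _))
  have hee3 : e ≤ r / 2 := (min_le_left _ _).trans ((min_le_right _ _).trans (min_le_left _ _))
  have hee4 : e ≤ A := (min_le_left _ _).trans ((min_le_right _ _).trans (min_le_right _ _))
  have hee5 : e ≤ m / 16 := min_le_right _ _
  refine ⟨e, by positivity, hee4, m / 16, by positivity, fun p φ₀ φ₁ hn hle hnn => ?_⟩
  have hn' := hn
  rw [Near] at hn'
  have h1 : r / 2 ≤ ‖q φ₀ - q (pt b (p + 1))‖ := by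
    have := norm_sub_le_norm_sub_add_norm_sub (q φ₀) (q (pt b (p + 1))) (q φ₁)
    rw [norm_sub_rev (q (pt b (p + 1)))] at this
    linarith
  have h2 : e' ≤ ‖q φ₀ - q (pt b p)‖ := (not_le.1 hnn).le
  have h3 := hkey p φ₀ h1 h2
  have h4 := hd _ _ (hn.mono hee1)
  have h5 := abs_inner_sub_le (z := q φ₁ - q φ₀) (w := deriv q φ₁)
    (z' := q (pt b (p + 1)) - q φ₀) (w' := deriv q (pt b (p + 1))) (A := 4) (h.arclength _)
    (h.norm_sub_le_four _ _)
  rw [sub_sub_sub_cancel_right] at h5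
  have h6 : m / 2 ≤ |inner ℝ (q φ₁ - q φ₀) (deriv q φ₁)| := by
    have := abs_sub_abs_le_abs_sub (inner ℝ (q (pt b (p + 1)) - q φ₀) (deriv q (pt b (p + 1))))
      (inner ℝ (q φ₁ - q φ₀) (deriv q φ₁))
    rw [abs_sub_comm] at this
    linarith
  have hpos : 0 < ‖q φ₁ - q φ₀‖ := by rw [norm_sub_rev]; linarith
  have h7 : m / 8 ≤ |distDeriv q φ₁ φ₀| := by
    rw [distDeriv, abs_div, abs_norm, le_div_iff₀ hpos]
    have := h.norm_sub_le_four φ₁ φ₀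
    nlinarith
  have h8 : ∀ η, |η| ≤ m / 16 → m / 16 ≤ |distDeriv q φ₁ φ₀ + η| := fun η hη => by
    have := abs_sub_abs_le_abs_sub (distDeriv q φ₁ φ₀) (-η)
    rw [sub_neg_eq_add, abs_neg] at this
    linarith
  refine ⟨fun η hη => h8 η (hη.trans hee5), fun φ₂ h9 => h8 _ ?_⟩
  exact hdist (p + 1) φ₁ φ₂ (hn.mono hee2) (near_add_two.2 (h9.mono hee2))

/-! #### A smooth version of the distance -/

/-- The distance of boundary points, made smooth at the diagonal. -/
def smoothDist (q : ℝ → ℂ) (c : ℝ) (p : ℝ × ℝ) : ℝ := realSqrt c (‖q p.1 - q p.2‖ ^ 2)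

lemma smoothDist_eq {c x y : ℝ} (hc : 0 < c) (h : c ≤ ‖q x - q y‖) :
    smoothDist q c (x, y) = ‖q x - q y‖ := realSqrt_sq hc h

lemma smoothDist_pos {c : ℝ} (hc : 0 < c) (p : ℝ × ℝ) : 0 < smoothDist q c p :=
  (half_pos hc).trans_le (le_realSqrt hc _)

lemma UB.smoothDist (h : Dom) {c : ℝ} (hc : 0 < c) : UB₀ (fun (_ : ι) => smoothDist q c) := by
  have h1 : UB₀ (fun (_ : ι) (p : ℝ × ℝ) => q p.1 - q p.2) :=
    (h.ub.comp (UB₁.linear (fst ℝ ℝ ℝ))).sub (h.ub.comp (UB₁.linear (snd ℝ ℝ ℝ)))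
  exact h1.comp_smooth ((contDiff_realSqrt hc).comp (contDiff_norm_sq ℝ))

lemma hasDerivAt_dist (h : Dom) {f g : ℝ → ℝ} {f' g' t : ℝ}
    (hf : HasDerivAt f f' t) (hg : HasDerivAt g g' t) (hne : q (f t) ≠ q (g t)) :
    HasDerivAt (fun t => ‖q (f t) - q (g t)‖)
      (distDeriv q (f t) (g t) * f' + distDeriv q (g t) (f t) * g') t := by
  have h1 : HasDerivAt (fun t => q (f t) - q (g t)) (f' • deriv q (f t) - g' • deriv q (g t)) t :=
    ((h.hasDerivAt _).scomp t hf).sub ((h.hasDerivAt _).scomp t hg)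
  refine (hasDerivAt_norm h1 (sub_ne_zero.2 hne)).congr_deriv ?_
  rw [inner_sub_right, inner_smul_right, inner_smul_right, distDeriv, distDeriv,
    norm_sub_rev (q (g t)), ← neg_sub (q (f t)) (q (g t)), inner_neg_left]
  ring

lemma hasDerivAt_smoothDist (h : Dom) {c : ℝ} (hc : 0 < c) {f g : ℝ → ℝ}
    {f' g' t : ℝ} (hf : HasDerivAt f f' t) (hg : HasDerivAt g g' t)
    (hlt : c < ‖q (f t) - q (g t)‖) :
    HasDerivAt (fun t => smoothDist q c (f t, g t))
      (distDeriv q (f t) (g t) * f' + distDeriv q (g t) (f t) * g') t := by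
  have hne : q (f t) ≠ q (g t) := fun h0 => by rw [h0, sub_self, norm_zero] at hlt; linarith
  refine (hasDerivAt_dist h hf hg hne).congr_of_eventuallyEq ?_
  have hcont : ContinuousAt (fun t => ‖q (f t) - q (g t)‖) t :=
    (hasDerivAt_dist h hf hg hne).continuousAt
  filter_upwards [hcont.eventually (lt_mem_nhds hlt)] with s hs
  exact smoothDist_eq hc hs.le

lemma hasDerivAt_distDeriv (h : Dom) {x y : ℝ} (hne : q x ≠ q y) :
    HasDerivAt (fun y => distDeriv q x y)
      (-(inner ℝ (deriv q x) (deriv q y) + distDeriv q x y * distDeriv q y x) / ‖q x - q y‖) y := by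
  have h1 := hasDerivAt_dist h (hasDerivAt_const y x) (hasDerivAt_id y) hne
  have h2 : HasDerivAt (fun y => inner ℝ (q x - q y) (deriv q x))
      (-inner ℝ (deriv q x) (deriv q y)) y := by
    have := ((h.hasDerivAt y).const_sub (q x)).inner ℝ (hasDerivAt_const y (deriv q x))
    refine this.congr_deriv ?_
    rw [inner_zero_right, inner_neg_left, zero_add, real_inner_comm]
  have h0 : ‖q x - q y‖ ≠ 0 := norm_ne_zero_iff.2 (sub_ne_zero.2 hne)
  have h3 : inner ℝ (q x - q y) (deriv q x) = distDeriv q x y * ‖q x - q y‖ := by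
    rw [distDeriv, div_mul_cancel₀ _ h0]
  refine (h2.div h1 h0).congr_deriv ?_
  simp only [id, mul_zero, zero_add, mul_one]
  rw [h3]
  field_simp
  ring

/-! #### Critical points of the length functional -/

lemma pathLength_torusPeriodic (h : Dom) (n : ℕ) : TorusPeriodic (pathLength q n) := fun x i => by
  have : ∀ l, q (Function.update x i (x i + 2 * π) l) = q (x l) := fun l => by
    by_cases hl : l = i
    · subst hl; rw [Function.update_self, h.periodic]
    · rw [Function.update_of_ne hl]
  simp only [pathLength, this]

/-- The configurations whose vertices are alternately close to the two end points. -/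
def orbitConfigs (q : ℝ → ℂ) (b e : ℝ) (n : ℕ) : Set (Fin n → ℝ) :=
  {x | ∃ p, ∀ j : Fin n, Near q b e (p + j) (x j)}

lemma isClosed_orbitConfigs (h : Dom) (e : ℝ) (n : ℕ) : IsClosed (orbitConfigs q b e n) := by
  have hq := h.smooth.continuous
  have hcl : ∀ p, IsClosed {x : Fin n → ℝ | ∀ j : Fin n, Near q b e (p + j) (x j)} := fun p => by
    simp only [ofPred_forall]
    exact isClosed_iInter fun j => isClosed_le (by fun_prop) continuous_const
  have : orbitConfigs q b e n = {x | ∀ j : Fin n, Near q b e (0 + j) (x j)} ∪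
      {x | ∀ j : Fin n, Near q b e (1 + j) (x j)} := by
    ext x
    simp only [orbitConfigs, mem_ofPred_eq, mem_union]
    refine ⟨fun ⟨p, hp⟩ => ?_, fun hx => hx.elim (fun h => ⟨0, h⟩) fun h => ⟨1, h⟩⟩
    have hred : ∀ p', (∃ l, p = p' + 2 * l) → ∀ j : Fin n, Near q b e (p' + j) (x j) := by
      rintro p' ⟨l, rfl⟩ j
      have h1 := hp j
      clear hp
      induction l with
      | zero => exact h1
      | succ l ih =>
        refine ih (near_add_two.1 ?_)
        convert h1 using 1
        ring
    rcases Nat.even_or_odd' p with ⟨l, hl | hl⟩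
    · exact Or.inl (hred 0 ⟨l, by omega⟩)
    · exact Or.inr (hred 1 ⟨l, by omega⟩)
  rw [this]
  exact (hcl 0).union (hcl 1)

lemma hasLineDerivAt_pathLength (h : Dom) {n : ℕ} {x : Fin (n + 2) → ℝ}
    (hx : ∀ j : Fin (n + 1), q (x j.castSucc) ≠ q (x j.succ)) (v : Fin (n + 2) → ℝ) :
    HasLineDerivAt ℝ (pathLength q n)
      (∑ j : Fin (n + 1), (distDeriv q (x j.castSucc) (x j.succ) * v j.castSucc +
        distDeriv q (x j.succ) (x j.castSucc) * v j.succ)) x v := by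
  have hl : ∀ l, HasDerivAt (fun t : ℝ => (x + t • v) l) (v l) 0 := fun l => by
    simpa using ((hasDerivAt_id (0 : ℝ)).mul_const (v l)).const_add (x l)
  unfold HasLineDerivAt pathLength
  refine HasDerivAt.fun_sum fun j _ => ?_
  have := hasDerivAt_dist h (hl j.castSucc) (hl j.succ) (by simpa using hx j)
  simpa using this

lemma contDiffAt_pathLength (h : Dom) {n : ℕ} {x : Fin (n + 2) → ℝ}
    (hx : ∀ j : Fin (n + 1), q (x j.castSucc) ≠ q (x j.succ)) :
    ContDiffAt ℝ ∞ (pathLength q n) x := by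
  unfold pathLength
  refine ContDiffAt.sum fun j _ => ?_
  have hp : ∀ l, ContDiffAt ℝ ∞ (fun x : Fin (n + 2) → ℝ => q (x l)) x := fun l =>
    (h.smooth.comp (contDiff_apply ℝ ℝ l)).contDiffAt
  exact ((hp _).sub (hp _)).norm ℝ (sub_ne_zero.2 (hx j))

lemma partialDeriv_pathLength (h : Dom) {n : ℕ} {x : Fin (n + 2) → ℝ}
    (hx : ∀ j : Fin (n + 1), q (x j.castSucc) ≠ q (x j.succ)) (i : Fin (n + 2)) :
    partialDeriv (pathLength q n) i x = ∑ j : Fin (n + 1), (distDeriv q (x j.castSucc) (x j.succ) *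
        (Pi.single i (1 : ℝ) : Fin (n + 2) → ℝ) j.castSucc +
        distDeriv q (x j.succ) (x j.castSucc) *
        (Pi.single i (1 : ℝ) : Fin (n + 2) → ℝ) j.succ) := by
  rw [partialDeriv, ← ((contDiffAt_pathLength h hx).differentiableAt (by simp)).lineDeriv_eq_fderiv]
  exact (hasLineDerivAt_pathLength h hx _).lineDeriv

lemma phaseDeriv_pathLength (h : Dom) {n : ℕ} {x : Fin (n + 2) → ℝ}
    (hx : ∀ j : Fin (n + 1), q (x j.castSucc) ≠ q (x j.succ)) (i : Fin n) :
    phaseDeriv (pathLength q n) i x = distDeriv q (x i.castSucc.succ) (x i.castSucc.castSucc) +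
      distDeriv q (x i.castSucc.succ) (x i.succ.succ) := by
  rw [phaseDeriv, partialDeriv_pathLength h hx, Finset.sum_add_distrib, add_comm,
    sum_eq_single i.castSucc, sum_eq_single i.succ]
  · simp
  · intro j _ hj
    rw [Pi.single_eq_of_ne, mul_zero]
    rw [Fin.succ_castSucc]
    exact fun h => hj (Fin.castSucc_injective _ h)
  · simp
  · intro j _ hj
    rw [Pi.single_eq_of_ne, mul_zero]
    exact fun h => hj (Fin.succ_injective _ h)
  · simp

lemma partialDeriv_pathLength_zero (h : Dom) {n : ℕ} {x : Fin (n + 2) → ℝ}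
    (hx : ∀ j : Fin (n + 1), q (x j.castSucc) ≠ q (x j.succ)) :
    partialDeriv (pathLength q n) 0 x = distDeriv q (x 0) (x 1) := by
  rw [partialDeriv_pathLength h hx, sum_eq_single 0]
  · simp
  · intro j _ hj
    rw [Pi.single_eq_of_ne, Pi.single_eq_of_ne, mul_zero, mul_zero, add_zero]
    · exact Fin.succ_ne_zero j
    · exact fun h => hj (Fin.castSucc_injective _ h)
  · simp

lemma partialDeriv_pathLength_last (h : Dom) {n : ℕ} {x : Fin (n + 2) → ℝ}
    (hx : ∀ j : Fin (n + 1), q (x j.castSucc) ≠ q (x j.succ)) :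
    partialDeriv (pathLength q n) (Fin.last (n + 1)) x =
      distDeriv q (x (Fin.last (n + 1))) (x (Fin.last n).castSucc) := by
  rw [partialDeriv_pathLength h hx, sum_eq_single (Fin.last n)]
  · simp [(Fin.castSucc_lt_last (Fin.last n)).ne]
  · intro j _ hj
    rw [Pi.single_eq_of_ne, Pi.single_eq_of_ne, mul_zero, mul_zero, add_zero]
    · rw [← Fin.succ_last]
      exact fun h => hj (Fin.succ_injective _ h)
    · exact (Fin.castSucc_lt_last j).ne
  · simp

lemma OrbitScale.ne {e : ℝ} (he : Scale e) {n : ℕ} {x : Fin (n + 2) → ℝ}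
    (hx : x ∈ orbitConfigs q b e (n + 2)) (j : Fin (n + 1)) : q (x j.castSucc) ≠ q (x j.succ) := by
  obtain ⟨p, hp⟩ := hx
  have h1 := hp j.castSucc
  have h2 := hp j.succ
  rw [Fin.val_castSucc] at h1
  rw [Fin.val_succ, ← add_assoc] at h2
  exact sub_ne_zero.1 (norm_pos_iff.1 (he.norm_pos h1 h2))

lemma OrbitScale.linearIndependent (h : Dom) {e : ℝ} (he : Scale e) {n : ℕ}
    {x : Fin (n + 2) → ℝ} (hx : x ∈ orbitConfigs q b e (n + 2)) :
    LinearIndependent ℝ (fun j : Fin n => fderiv ℝ (phaseDeriv (pathLength q n) j) x) := by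
  have hne := he.ne hx
  have hev : ∀ᶠ y in 𝓝 x, ∀ j : Fin (n + 1), q (y j.castSucc) ≠ q (y j.succ) := by
    rw [eventually_all]
    intro j
    have hq := h.smooth.continuous
    have : Continuous fun y : Fin (n + 2) → ℝ => q (y j.castSucc) - q (y j.succ) := by fun_prop
    filter_upwards [this.continuousAt.eventually_ne (sub_ne_zero.2 (hne j))] with y hy
    exact sub_ne_zero.1 hy
  have hdiff : ∀ j : Fin n, DifferentiableAt ℝ (phaseDeriv (pathLength q n) j) x := fun j => by
    have h1 : ContDiffAt ℝ 1 (fderiv ℝ (pathLength q n)) x :=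
      (contDiffAt_pathLength h hne).fderiv_right (m := 1) (by norm_cast)
    exact (h1.differentiableAt (by simp)).clm_apply (differentiableAt_const _)
  have hlow : ∀ i j : Fin n, i ≤ j → fderiv ℝ (phaseDeriv (pathLength q n) j) x
      (Pi.single i.castSucc.castSucc 1) = if i = j then
        -(inner ℝ (deriv q (x j.castSucc.succ)) (deriv q (x j.castSucc.castSucc)) +
        distDeriv q (x j.castSucc.succ) (x j.castSucc.castSucc) *
        distDeriv q (x j.castSucc.castSucc) (x j.castSucc.succ)) /
        ‖q (x j.castSucc.succ) - q (x j.castSucc.castSucc)‖ else 0 := fun i j hij => by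
    rw [← (hdiff j).lineDeriv_eq_fderiv]
    refine HasLineDerivAt.lineDeriv ?_
    have hcurve : Tendsto (fun t : ℝ => x + t • (Pi.single i.castSucc.castSucc 1 :
        Fin (n + 2) → ℝ)) (𝓝 0) (𝓝 x) := by
      have : Continuous (fun t : ℝ => x + t • (Pi.single i.castSucc.castSucc 1 :
        Fin (n + 2) → ℝ)) := by fun_prop
      simpa using this.tendsto 0
    have hs : ∀ l : Fin (n + 2), i.castSucc.castSucc < l → ∀ t : ℝ,
        (x + t • (Pi.single i.castSucc.castSucc 1 : Fin (n + 2) → ℝ)) l = x l := fun l hl t => by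
      simp [Pi.single_eq_of_ne hl.ne']
    have hi' : i.val ≤ j.val := hij
    have h1 := hs j.castSucc.succ (by rw [Fin.lt_def]; simp; omega)
    have h2 := hs j.succ.succ (by rw [Fin.lt_def]; simp; omega)
    have heq : (fun t : ℝ => phaseDeriv (pathLength q n) j
        (x + t • (Pi.single i.castSucc.castSucc 1 : Fin (n + 2) → ℝ))) =ᶠ[𝓝 0] fun t =>
        distDeriv q (x j.castSucc.succ) ((x + t • (Pi.single i.castSucc.castSucc 1 :
          Fin (n + 2) → ℝ)) j.castSucc.castSucc) +
        distDeriv q (x j.castSucc.succ) (x j.succ.succ) := by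
      filter_upwards [hcurve.eventually hev] with t ht
      rw [phaseDeriv_pathLength h ht, h1, h2]
    refine HasDerivAt.congr_of_eventuallyEq ?_ heq
    split_ifs with hij'
    · subst hij'
      have h3 : ∀ t : ℝ, (x + t • (Pi.single i.castSucc.castSucc 1 : Fin (n + 2) → ℝ))
          i.castSucc.castSucc = x i.castSucc.castSucc + t := fun t => by simp
      simp only [h3]
      refine HasDerivAt.add_const _ ?_
      have h4 := hasDerivAt_distDeriv h (hne i.castSucc).symm
      have h5 : HasDerivAt (fun t => x i.castSucc.castSucc + t) 1 (0 : ℝ) :=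
        (hasDerivAt_id (0 : ℝ)).const_add _
      have h6 := HasDerivAt.comp (0 : ℝ) (h₂ := fun y => distDeriv q (x i.castSucc.succ) y)
        (by rw [add_zero]; exact h4) h5
      simpa [comp_def] using h6
    · have h3 := hs j.castSucc.castSucc (by
        rw [Fin.lt_def]; simp
        exact lt_of_le_of_ne hi' fun h => hij' (by simpa [Fin.ext_iff] using h))
      simp only [h3]
      exact hasDerivAt_const _ _
  rw [Fintype.linearIndependent_iff]
  intro g hg
  have hmain : ∀ m : ℕ, ∀ i : Fin n, i.val = m → g i = 0 := by
    intro m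
    induction m using Nat.strong_induction_on with
    | _ m ih =>
      rintro i rfl
      have h1 := congrArg (fun L : (Fin (n + 2) → ℝ) →L[ℝ] ℝ =>
        L (Pi.single i.castSucc.castSucc 1)) hg
      simp only [_root_.sum_apply, _root_.smul_apply, _root_.zero_apply, smul_eq_mul] at h1
      rw [sum_eq_single i] at h1
      · rw [hlow i i le_rfl, if_pos rfl] at h1
        refine (mul_eq_zero.1 h1).resolve_right ?_
        obtain ⟨p, hp⟩ := hx
        have n1 := hp i.castSucc.castSucc
        have n2 := hp i.castSucc.succ
        rw [Fin.val_castSucc, Fin.val_castSucc] at n1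
        rw [Fin.val_succ, Fin.val_castSucc, ← add_assoc] at n2
        have b1 := abs_le.1 (he.inner_le _ _ _ n1 n2)
        have b2 := he.deriv_le _ _ _ n1 n2
        have b3 := he.deriv_le _ _ _ n2 (near_add_two.2 n1)
        have b4 : |distDeriv q (x i.castSucc.succ) (x i.castSucc.castSucc) *
            distDeriv q (x i.castSucc.castSucc) (x i.castSucc.succ)| ≤ 1 / 2 * (1 / 2) := by
          rw [abs_mul]
          exact mul_le_mul b3 b2 (abs_nonneg _) (by norm_num)
        rw [real_inner_comm] at b1
        have b5 := (abs_le.1 b4).2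
        have b6 : 0 < ‖q (x i.castSucc.succ) - q (x i.castSucc.castSucc)‖ := by
          rw [norm_sub_rev]; exact he.norm_pos n1 n2
        refine div_ne_zero ?_ b6.ne'
        rw [neg_ne_zero]
        refine ne_of_lt ?_
        linarith
      · intro j _ hj
        rcases lt_or_gt_of_ne hj with hlt | hgt
        · rw [ih j.val hlt j rfl, zero_mul]
        · rw [hlow i j hgt.le, if_neg hj.symm, mul_zero]
      · simp
  exact fun i => hmain _ i rfl

lemma OrbitScale.billiardIterate (h : Dom) {e : ℝ} (he : Scale e) (n : ℕ) :
    ∀ (p : ℕ) (y : ℕ → ℝ), (∀ j ≤ n + 1, Near q b e (p + j) (y j)) →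
      (∀ j < n, distDeriv q (y (j + 1)) (y j) + distDeriv q (y (j + 1)) (y (j + 2)) = 0) →
      BilliardIterate Ω q (n + 1) (y (n + 1), -distDeriv q (y (n + 1)) (y n))
        (y 0, distDeriv q (y 0) (y 1)) := by
  induction n with
  | zero =>
    intro p y hy _
    exact ⟨_, rfl, he.billiardMap h (hy 0 (by norm_num)) (hy 1 (by norm_num))⟩
  | succ n ih =>
    intro p y hy hc
    refine ⟨_, ih (p + 1) (fun j => y (j + 1)) (fun j hj => ?_) fun j hj => hc (j + 1) (by omega),
      ?_⟩
    · have := hy (j + 1) (by omega)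
      rwa [← add_assoc, add_right_comm] at this
    · have h0 := hc 0 (by omega)
      have : distDeriv q (y 1) (y 2) = -distDeriv q (y 1) (y 0) := by
        simp only [zero_add] at h0
        linarith
      simp only [zero_add, this]
      exact he.billiardMap h (hy 0 (by omega)) (hy 1 (by omega))

lemma OrbitScale.mem_billiardRelation (h : Dom) {e : ℝ} (he : Scale e) {n : ℕ}
    {x : Fin (n + 2) → ℝ} (hx : x ∈ orbitConfigs q b e (n + 2))
    (hc : ∀ j, phaseDeriv (pathLength q n) j x = 0) :
    ((x 0, partialDeriv (pathLength q n) 0 x),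
      (x (Fin.last (n + 1)), -partialDeriv (pathLength q n) (Fin.last (n + 1)) x)) ∈
      billiardRelation Ω q (n + 1) := by
  have hne := he.ne hx
  obtain ⟨p, hp⟩ := hx
  let y : ℕ → ℝ := fun j => if hj : j < n + 2 then x ⟨j, hj⟩ else 0
  have hy : ∀ j (hj : j < n + 2), y j = x ⟨j, hj⟩ := fun j hj => dif_pos hj
  have hmain := he.billiardIterate h n p y (fun j hj => by
    rw [hy j (by omega)]; exact hp ⟨j, by omega⟩) fun j hj => by
      have := hc ⟨j, hj⟩
      rw [phaseDeriv_pathLength h hne] at this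
      rw [hy _ (by omega), hy _ (by omega), hy _ (by omega)]
      exact this
  rw [partialDeriv_pathLength_zero h hne, partialDeriv_pathLength_last h hne]
  rw [hy 0 (by omega), hy 1 (by omega), hy n (by omega), hy (n + 1) (by omega)] at hmain
  exact hmain

/-! ### Fourier integral kernels near the bouncing ball orbit -/

/-- The length of a polygonal path with `n` links and vertices on the boundary. -/
def chainLength (q : ℝ → ℂ) (n : ℕ) (x : Fin (n + 1) → ℝ) : ℝ :=
  ∑ j : Fin n, ‖q (x j.castSucc) - q (x j.succ)‖

lemma pathLength_cons (q : ℝ → ℂ) (n : ℕ) (φ : ℝ) (y : Fin (n + 1) → ℝ) :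
    pathLength q n (vcons φ y) = ‖q φ - q (y 0)‖ + chainLength q n y := by
  rw [pathLength, Fin.sum_univ_succ, chainLength]
  rfl

lemma chainLength_nonneg (q : ℝ → ℂ) (n : ℕ) (y : Fin (n + 1) → ℝ) : 0 ≤ chainLength q n y :=
  sum_nonneg fun _ _ => norm_nonneg _

lemma continuous_chainLength (h : Dom) (n : ℕ) : Continuous (chainLength q n) := by
  have hq := h.smooth.continuous
  unfold chainLength
  fun_prop

lemma pathLength_nonneg (q : ℝ → ℂ) (n : ℕ) (y : Fin (n + 2) → ℝ) : 0 ≤ pathLength q n y :=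
  chainLength_nonneg q (n + 1) y

lemma continuous_pathLength (h : Dom) (n : ℕ) : Continuous (pathLength q n) :=
  continuous_chainLength h (n + 1)

/-- The map `Fin.cons` as a continuous linear map. -/
def consCLM (n : ℕ) : ℝ × (Fin n → ℝ) →L[ℝ] (Fin (n + 1) → ℝ) :=
  ContinuousLinearMap.pi (Fin.cases (fst ℝ ℝ (Fin n → ℝ))
    fun j => (proj j).comp (snd ℝ ℝ (Fin n → ℝ)))

lemma consCLM_apply (n : ℕ) (p : ℝ × (Fin n → ℝ)) : consCLM n p = vcons p.1 p.2 := by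
  ext j
  refine Fin.cases ?_ (fun j => ?_) j <;> simp [consCLM]

/-- The first coordinate and the remaining ones. -/
def unconsCLM (n : ℕ) : (Fin (n + 1) → ℝ) →L[ℝ] ℝ × (Fin n → ℝ) :=
  (proj 0).prod (ContinuousLinearMap.pi fun j => proj j.succ)

lemma unconsCLM_apply (n : ℕ) (x : Fin (n + 1) → ℝ) : unconsCLM n x = (x 0, Fin.tail x) := rfl

lemma continuous_cons (n : ℕ) : Continuous fun p : ℝ × (Fin n → ℝ) => vcons p.1 p.2 := by
  simp only [← consCLM_apply]
  exact (consCLM n).continuous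

lemma continuous_snoc (n : ℕ) : Continuous fun p : (Fin n → ℝ) × ℝ => vsnoc p.1 p.2 := by
  refine continuous_pi fun j => ?_
  refine Fin.lastCases ?_ (fun j => ?_) j
  · simpa using continuous_snd
  · simp only [Fin.snoc_castSucc]
    fun_prop

lemma continuous_joinPoint (n : ℕ) :
    Continuous fun p : ℝ × (Fin n → ℝ) × ℝ => joinPoint p.1 p.2.1 p.2.2 :=
  (continuous_cons (n + 1)).comp (continuous_fst.prodMk ((continuous_snoc n).comp continuous_snd))

/-- The amplitude of a Fourier integral kernel localised to the orbit. -/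
structure FioSymbol (q : ℝ → ℂ) (b e : ℝ) (n : ℕ) (A : ℝ → (Fin (n + 2) → ℝ) → ℂ) : Prop where
  ub : UB₀ (fun (k : ℝ₁) => A k)
  periodic : ∀ k, 1 ≤ k → TorusPeriodic (A k)
  support : ∀ k, 1 ≤ k → ∀ x, A k x ≠ 0 → x ∈ orbitConfigs q b e (n + 2)

/-- The integrand of a Fourier integral kernel. -/
def fioIntegrand (q : ℝ → ℂ) (l : ℂ) (n : ℕ) (A : (Fin (n + 2) → ℝ) → ℂ)
    (x : Fin (n + 2) → ℝ) : ℂ :=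
  exp (I * l * pathLength q n x) * A x

local notation:max "𝓘" k:max => fioIntegrand q (lam k)

/-- The Fourier integral kernel of order `-m` whose phase is the length functional. -/
def fioKernel (q : ℝ → ℂ) (lam : ℝ → ℂ) (n m : ℕ) (A : ℝ → (Fin (n + 2) → ℝ) → ℂ)
    (k φ₁ φ₂ : ℝ) : ℂ :=
  (k ^ (-(m : ℝ) + ((n : ℝ) + 1) / 2) : ℝ) * ∫ θ in 𝕋 n,
      fioIntegrand q (lam k) n (A k) (joinPoint φ₁ θ φ₂)

/-- The kernels that agree with a Fourier integral kernel of order `-m` up to `O(k^{-∞})`. -/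
def FioForm (q : ℝ → ℂ) (lam : ℝ → ℂ) (b e : ℝ) (n m : ℕ) (X : ℝ → ℝ → ℝ → ℂ) : Prop :=
  ∃ A, FioSymbol q b e n A ∧ ∃ k₀ : ℝ, ∀ R : ℕ, ∃ C : ℝ, 0 ≤ C ∧ ∀ k, 1 ≤ k → k₀ ≤ k →
    ∀ φ₁ φ₂, ‖X k φ₁ φ₂ - fioKernel q lam n m A k φ₁ φ₂‖ ≤ C * (k ^ R)⁻¹

lemma Setting.im_nonneg (H : Stg) (hk : 1 ≤ k) : 0 ≤ (lam k).im := by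
  rw [H.lam_eq]
  simpa using (H.tau k hk).1

lemma Setting.norm_exp_le_one (H : Stg) (hk : 1 ≤ k) {r : ℝ}
    (hr : 0 ≤ r) : ‖exp (I * lam k * r)‖ ≤ 1 := by
  rw [norm_exp, Real.exp_le_one_iff]
  have h1 : (I * lam k * r).re = -((lam k).im * r) := by simp [Complex.mul_re]
  rw [h1, neg_nonpos]
  exact mul_nonneg (H.im_nonneg hk) hr

variable {e : ℝ} {n : ℕ} {A : ℝ → (Fin (n + 2) → ℝ) → ℂ}

lemma FioSymbol.continuous (h : FioSymbol q b e n A) {k : ℝ} (hk : 1 ≤ k) : Continuous (A k) :=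
  (h.ub.smooth ⟨k, hk⟩).continuous

lemma FioSymbol.exists_norm_le (h : FioSymbol q b e n A) :
    ∃ C, 0 ≤ C ∧ ∀ k, 1 ≤ k → ∀ x, ‖A k x‖ ≤ C := by
  obtain ⟨C, h0, hC⟩ := h.ub.norm_le
  exact ⟨C, h0, fun k hk x => by simpa using hC ⟨k, hk⟩ x⟩

lemma continuous_fioIntegrand (hΩ : Dom) (l : ℂ) {A : (Fin (n + 2) → ℝ) → ℂ}
    (hA : Continuous A) : Continuous (fioIntegrand q l n A) := by
  have := continuous_pathLength hΩ n
  unfold fioIntegrand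
  fun_prop

lemma Setting.norm_fioIntegrand_le (H : Stg) (hk : 1 ≤ k)
    (A : (Fin (n + 2) → ℝ) → ℂ) (x : Fin (n + 2) → ℝ) :
    ‖𝓘 k n A x‖ ≤ ‖A x‖ := by
  rw [fioIntegrand, norm_mul]
  exact mul_le_of_le_one_left (norm_nonneg _) (H.norm_exp_le_one hk (pathLength_nonneg _ _ _))

lemma torusPeriodic_fioIntegrand (hΩ : Dom) (l : ℂ) {A : (Fin (n + 2) → ℝ) → ℂ}
    (hA : TorusPeriodic A) : TorusPeriodic (fioIntegrand q l n A) := fun x i => by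
  rw [fioIntegrand, fioIntegrand, hA, pathLength_torusPeriodic hΩ]

lemma TorusPeriodic.cons {n : ℕ} {f : (Fin (n + 1) → ℝ) → ℂ} (hf : TorusPeriodic f) (φ : ℝ)
    (y : Fin n → ℝ) : f (vcons (φ + 2 * π) y) = f (vcons φ y) := by
  have := hf (vcons φ y) 0
  rwa [Fin.update_cons_zero, Fin.cons_zero] at this

lemma FioSymbol.leftRegular (h : FioSymbol q b e n A) (hΩ : Dom) (m : ℕ) {k : ℝ}
    (hk : 1 ≤ k) : LeftRegular (fioKernel q lam n m A k) := by
  refine ⟨fun φ₂ => continuous_const.mul ?_, fun φ₂ φ => ?_⟩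
  · refine continuous_parametric_integral_of_continuous ?_ isCompact_Icc
    exact (continuous_fioIntegrand hΩ (lam k) (h.continuous hk)).comp ((continuous_joinPoint n).comp
        (continuous_fst.prodMk (continuous_snd.prodMk continuous_const)))
  · simp only [fioKernel, joinPoint]
    congr 2
    ext θ
    exact (torusPeriodic_fioIntegrand hΩ (lam k) (h.periodic k hk)).cons φ _

lemma rpow_order_le (hk : 1 ≤ k) (m n : ℕ) : k ^ (-(m : ℝ) + ((n : ℝ) + 1) / 2) ≤ k ^ (n + 1) := by
  rw [← rpow_natCast]
  refine rpow_le_rpow_of_exponent_le hk ?_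
  push_cast
  linarith [m.cast_nonneg (α := ℝ), n.cast_nonneg (α := ℝ)]

lemma FioSymbol.exists_norm_fioKernel_le (h : FioSymbol q b e n A) (H : Stg)
    (m : ℕ) : ∃ C, 0 ≤ C ∧ ∀ k, 1 ≤ k → ∀ φ₁ φ₂,
      ‖fioKernel q lam n m A k φ₁ φ₂‖ ≤ C * k ^ (n + 1) := by
  obtain ⟨C, h0, hC⟩ := h.exists_norm_le
  refine ⟨C * volume.real (𝕋 n), by positivity, fun k hk φ₁ φ₂ => ?_⟩
  rw [fioKernel, norm_mul, mul_comm, norm_of_nonneg (by positivity)]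
  refine mul_le_mul ?_ ?_ (by positivity) (by positivity)
  · refine norm_setIntegral_le_of_norm_le_const isCompact_Icc.measure_lt_top fun θ _ => ?_
    exact (H.norm_fioIntegrand_le hk _ _).trans (hC k hk _)
  · exact rpow_order_le hk m n

lemma FioForm.comp_of_symbol (H : Stg) {e' : ℝ} {m n' m' : ℕ} (i : Fin 2)
    {X : ℝ → ℝ → ℝ → ℂ} (hX : ∀ k, 1 ≤ k → LeftRegular (X k))
    (hstep : ∀ A, FioSymbol q b e n A → FioForm q lam b e' n' m'
      fun k => compKernel (𝒩 k i) (fioKernel q lam n m A k))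
    (h : FioForm q lam b e n m X) :
    FioForm q lam b e' n' m' fun k => compKernel (𝒩 k i) (X k) := by
  obtain ⟨A, hA, k₀, hk₀⟩ := h
  obtain ⟨A', hA', k₁, hk₁⟩ := hstep A hA
  obtain ⟨D, hD, hN⟩ := H.exists_norm_compKernel_le
  refine ⟨A', hA', max k₀ k₁, fun R => ?_⟩
  obtain ⟨C₀, h0, hC₀⟩ := hk₀ (R + 1)
  obtain ⟨C₁, h1, hC₁⟩ := hk₁ R
  refine ⟨C₁ + D * C₀, by positivity, fun k hk hkk φ₁ φ₂ => ?_⟩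
  have hkpos : 0 < k := by linarith
  have hF := hA.leftRegular (lam := lam) H.domain m hk
  have hE := (hX k hk).sub hF
  have e1 := H.compKernel_add hk (i := i) hF hE φ₁ φ₂
  have e2 : (fun φ₁ φ₂ => fioKernel q lam n m A k φ₁ φ₂ +
      (X k φ₁ φ₂ - fioKernel q lam n m A k φ₁ φ₂)) = X k := by
    ext; ring
  rw [e2] at e1
  have e3 := hN k hk i _ hE φ₂ _ (fun φ => hC₀ k hk ((le_max_left _ _).trans hkk) φ φ₂) φ₁
  have e4 := hC₁ k hk ((le_max_right _ _).trans hkk) φ₁ φ₂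
  beta_reduce at e4 ⊢
  rw [e1, add_sub_right_comm, add_mul]
  refine (norm_add_le _ _).trans (add_le_add e4 (e3.trans_eq ?_))
  rw [pow_succ]
  field_simp

lemma OrbitScale.norm_near (he : Scale e) {p : ℕ} {x y z : ℝ}
    (hx : Near q b e p x) (hy : Near q b e (p + 1) y)
    (hz : ‖q z - q x‖ ≤ ℓ / 8) : ℓ / 2 < ‖q z - q y‖ := by
  have h1 := hx.le_norm hy
  have h2 := norm_sub_le_norm_sub_add_norm_sub (q x) (q z) (q y)
  rw [norm_sub_rev (q x) (q z)] at h2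
  linarith [he.le, he.pos]

/-- The phase for the composition of `N₀` and a Fourier integral kernel. -/
def zeroPhase (q : ℝ → ℂ) (c a : ℝ) {n : ℕ} (p : (ℝ × (Fin (n + 1) → ℝ)) × ℝ) : ℂ :=
  specParam a * ((diffQuot (smoothDist q c) (-1, 0) ((p.1.1, p.1.2 0), p.2) : ℝ) : ℂ)

/-- The amplitude for the composition of `N₀` and a Fourier integral kernel. -/
def zeroAmp {n : ℕ} (A : (Fin (n + 2) → ℝ) → ℂ) (p : (ℝ × (Fin (n + 1) → ℝ)) × ℝ) : ℂ :=
  A (vcons (p.1.1 - p.2) p.1.2)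

local notation:max "𝒵" k:max => zeroPhase (n := n) q (ℓ / 2) (τ k / k)

lemma mul_zeroPhase (hΩ : Dom) {c : ℝ} (hc : 0 < c) (a φ u : ℝ)
    (y : Fin (n + 1) → ℝ) : u * zeroPhase q c a ((φ, y), u) =
      specParam a * ((smoothDist q c (φ - u, y 0) - smoothDist q c (φ, y 0) : ℝ) : ℂ) := by
  have := smul_diffQuot ((UB.smoothDist (ι := Unit) hΩ hc).smooth ()) (-1, 0) (φ, y 0) u
  have h2 : (φ, y 0) + u • ((-1 : ℝ), (0 : ℝ)) = (φ - u, y 0) := by ext <;> simp [sub_eq_add_neg]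
  rw [h2, smul_eq_mul] at this
  rw [← this, zeroPhase]
  push_cast
  ring

lemma FioSymbol.nearData (H : Stg) (he : Scale e)
    (hA : FioSymbol q b e n A) {u₁ r₁ : ℝ} (hs : NearScale q u₁ r₁)
    (hr : r₁ ≤ ℓ / 16) {R : ℕ}
    {X : ℝ₁ → ℝ → ℂ} (hX : SymbolFamily R fun (k : ℝ₁) x =>
      hankelAmp (specParam (τ k / k)) x * X k x) :
    NearData q u₁ r₁ R (fun k : ℝ₁ => (k : ℝ)) (fun k => τ k / k) X (fun k => 𝒵 k)
      (fun k => zeroAmp (A k)) := by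
  have hc : 0 < ℓ / 2 := by linarith [he.pos, he.le]
  have hG : UB₀ (fun (k : ℝ₁) => 𝒵 k) := by
    have h1 := (UB.smoothDist (ι := ℝ₁) H.domain hc).ub₁.diffQuot (-1, 0)
    have h2 : UB₁ (fun (_ : ℝ₁) (p : (ℝ × (Fin (n + 1) → ℝ)) × ℝ) =>
        ((p.1.1, p.1.2 0), p.2)) := UB₁.linear
      ((((fst ℝ ℝ (Fin (n + 1) → ℝ)).prod ((proj 0).comp (snd ℝ ℝ (Fin (n + 1) → ℝ)))).comp
        (fst ℝ (ℝ × (Fin (n + 1) → ℝ)) ℝ)).prod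
        (snd ℝ (ℝ × (Fin (n + 1) → ℝ)) ℝ))
    exact H.ub_specParam.mul_bdd (h1.comp h2).ofReal
  have hsupp : ∀ (k : ℝ₁) (φ : ℝ) (y : Fin (n + 1) → ℝ) (u : ℝ),
      ‖q φ - q (φ - u)‖ ≤ 2 * r₁ → zeroAmp (A k) ((φ, y), u) ≠ 0 →
      ∃ p, Near q b e p (φ - u) ∧ Near q b e (p + 1) (y 0) ∧
        ℓ / 2 < ‖q φ - q (y 0)‖ ∧ ℓ / 2 < ‖q (φ - u) - q (y 0)‖ := by
    intro k φ y u hle hne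
    obtain ⟨p, hp⟩ := hA.support k k.2 _ hne
    have n1 : Near q b e p (φ - u) := hp 0
    have n2 : Near q b e (p + 1) (y 0) := hp 1
    refine ⟨p, n1, n2, he.norm_near n1 n2 (by linarith), he.norm_near n1 n2 ?_⟩
    rw [sub_self, norm_zero]; linarith
  refine ⟨hs, fun k => k.2, ⟨T, fun k => H.reduced_mem k.2⟩, hX, hG, ?_, ?_, ?_⟩
  · have h1 : UB₁ (fun (_ : ℝ₁) (p : (ℝ × (Fin (n + 1) → ℝ)) × ℝ) =>
        consCLM (n + 1) (p.1.1 - p.2, p.1.2)) := UB₁.linear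
      ((consCLM (n + 1)).comp (((fst ℝ ℝ (Fin (n + 1) → ℝ)).comp (fst ℝ (ℝ × (Fin (n + 1) → ℝ)) ℝ) -
          snd ℝ (ℝ × (Fin (n + 1) → ℝ)) ℝ).prod
        ((snd ℝ ℝ (Fin (n + 1) → ℝ)).comp (fst ℝ (ℝ × (Fin (n + 1) → ℝ)) ℝ))))
    exact (hA.ub.comp h1).congr fun k p => by rw [consCLM_apply]; rfl
  · intro k φ y u hu hle hne
    obtain ⟨p, n1, n2, l1, l2⟩ := hsupp k φ y u hle hne
    have hd : HasDerivAt (fun u : ℝ => u * 𝒵 k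
        ((φ, y), u)) (specParam (τ k / k) * ((-distDeriv q (φ - u) (y 0) : ℝ) : ℂ)) u := by
      simp only [mul_zeroPhase H.domain hc]
      refine HasDerivAt.const_mul _ (HasDerivAt.ofReal_comp ?_)
      have := (hasDerivAt_smoothDist H.domain hc ((hasDerivAt_id u).const_sub φ)
        (hasDerivAt_const u (y 0)) l2).sub_const (smoothDist q (ℓ / 2) (φ, y 0))
      simpa using this
    rw [radialDeriv_eq_of_hasDerivAt (hG.smooth k) hd, Complex.mul_re, Complex.ofReal_im,
      mul_zero, sub_zero, specParam_re, one_mul, Complex.ofReal_re, abs_neg]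
    exact he.deriv_le _ _ _ n1 n2
  · intro k φ y u hu hle hne
    obtain ⟨p, n1, n2, l1, l2⟩ := hsupp k φ y u hle hne
    have h1 : u * (𝒵 k ((φ, y), u)).im = τ k / k * (‖q (φ - u) - q (y 0)‖ - ‖q φ - q (y 0)‖) := by
      have := congrArg Complex.im (mul_zeroPhase (n := n) H.domain hc (τ k / k) φ u y)
      rwa [Complex.im_ofReal_mul, Complex.im_mul_ofReal, specParam_im, smoothDist_eq hc l1.le,
        smoothDist_eq hc l2.le] at this
    rw [h1, ← mul_add]
    refine mul_nonneg (H.reduced_mem k.2).1 ?_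
    have := norm_sub_le_norm_sub_add_norm_sub (q φ) (q (φ - u)) (q (y 0))
    linarith

/-! ### Composition of `N₀` and a Fourier integral kernel -/

lemma OrbitScale.mono {e' : ℝ} (h : Scale e') (he : 0 < e) (hee : e ≤ e') : Scale e :=
  ⟨he, hee.trans h.le, fun p x y hx hy => h.deriv_le p x y (hx.mono hee) (hy.mono hee),
    fun p x y hx hy => h.inner_le p x y (hx.mono hee) (hy.mono hee),
    fun p x y hx hy => h.inner_pos p x y (hx.mono hee) (hy.mono hee),
    fun p x y hx hy => h.segment p x y (hx.mono hee) (hy.mono hee)⟩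

lemma nearIntegrand_fio_eq (H : Stg) (he : Scale e)
    (hA : FioSymbol q b e n A) {r₁ : ℝ} (hr₁ : 0 < r₁) (hr : r₁ ≤ ℓ / 16) {k : ℝ}
    (hk : 1 ≤ k) (X : ℝ → ℂ) (φ : ℝ) (y : Fin (n + 1) → ℝ) (u : ℝ) :
    exp (I * lam k * pathLength q n (vcons φ y)) * nearIntegrand q r₁ k (τ k / k) X
        (𝒵 k) (zeroAmp (A k)) (φ, y) u =
      kernelN q (lam k) φ (φ - u) * X (k * ‖q φ - q (φ - u)‖) * (bump r₁ ‖q φ - q (φ - u)‖ : ℂ) *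
        𝓘 k n (A k) (vcons (φ - u) y) := by
  have hc : 0 < ℓ / 2 := by linarith [he.pos, he.le]
  have h4 : I * k * u * 𝒵 k ((φ, y), u) = I * lam k * ((smoothDist q (ℓ / 2) (φ - u, y 0) -
        smoothDist q (ℓ / 2) (φ, y 0) : ℝ) : ℂ) := by
    rw [mul_assoc, mul_zeroPhase H.domain hc, H.lam_eq_mul hk]; ring
  rw [nearIntegrand, ← H.lam_eq_mul hk, h4, zeroAmp]
  dsimp only
  by_cases hK : bump r₁ ‖q φ - q (φ - u)‖ = 0
  · rw [hK, ofReal_zero]; ring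
  have hle : ‖q φ - q (φ - u)‖ ≤ 2 * r₁ := by
    by_contra hcon
    exact hK (bump_eq_zero hr₁ (by rw [abs_norm]; exact (not_le.1 hcon).le))
  by_cases hA0 : A k (vcons (φ - u) y) = 0
  · rw [fioIntegrand, hA0]; ring
  obtain ⟨p, hp⟩ := hA.support k hk _ hA0
  have n1 : Near q b e p (φ - u) := hp 0
  have n2 : Near q b e (p + 1) (y 0) := hp 1
  have l1 := he.norm_near n1 n2 (z := φ) (by linarith)
  have l2 := he.norm_near n1 n2 (z := φ - u) (by rw [sub_self, norm_zero]; linarith)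
  rw [smoothDist_eq hc l1.le, smoothDist_eq hc l2.le, fioIntegrand, pathLength_cons,
    pathLength_cons]
  have h5 : exp (I * lam k * ((‖q (φ - u) - q (y 0)‖ + chainLength q n y : ℝ) : ℂ))
      = exp (I * lam k * ((‖q φ - q (y 0)‖ + chainLength q n y : ℝ) : ℂ)) * exp (I * lam k *
          ((‖q (φ - u) - q (y 0)‖ - ‖q φ - q (y 0)‖ : ℝ) : ℂ)) := by
    rw [← exp_add]
    congr 1
    push_cast
    ring
  rw [h5]
  ring

lemma nearIntegrand_zero_eq (H : Stg) (he : Scale e)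
    (hA : FioSymbol q b e n A) {r₁ : ℝ} (hr₁ : 0 < r₁) (hr : r₁ ≤ ℓ / 16) {k : ℝ}
    (hk : 1 ≤ k) (hkr : 1 ≤ k ^ (1 - δ) * r₁) (φ : ℝ) (y : Fin (n + 1) → ℝ) (u : ℝ) :
    exp (I * lam k * pathLength q n (vcons φ y)) *
      nearIntegrand q r₁ k (τ k / k) (fun x => (χ (k ^ (-δ) * x) : ℂ))
        (𝒵 k) (zeroAmp (A k)) (φ, y) u =
      𝒩 k 0 φ (φ - u) * 𝓘 k n (A k) (vcons (φ - u) y) := by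
  rw [nearIntegrand_fio_eq H he hA hr₁ hr hk,
    ← (H.kernelSplit_zero_mul_bump hr₁ hkr φ (φ - u)).1, kernelSplit, rpow_mul_chord hk, if_pos rfl]
  ring

lemma FioSymbol.comp_zero (H : Stg) {e' : ℝ} (he' : Scale e')
    (he0 : 0 < e) (hee : e < e') (m : ℕ) (hA : FioSymbol q b e n A) :
    FioForm q lam b e' n (m + 1) fun k => compKernel (𝒩 k 0) (fioKernel q lam n m A k) := by
  classical
  have he := he'.mono he0 hee.le
  obtain ⟨u₁, r, hr, hs⟩ := H.domain.exists_nearScale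
  set r₁ := min r (min (e' - e) (ℓ / 16))
  have hD : 0 < ℓ := by linarith [he.pos, he.le]
  have hr₁ : 0 < r₁ := lt_min hr (lt_min (by linarith) (by linarith))
  have hre : r₁ ≤ e' - e := (min_le_right _ _).trans (min_le_left _ _)
  have hrD : r₁ ≤ ℓ / 16 := (min_le_right _ _).trans (min_le_right _ _)
  have hN := hA.nearData H he (hs _ hr₁ (min_le_left _ _)) hrD H.symbol_zero
  obtain ⟨k₁, hk₁⟩ := exists_one_le_rpow_mul H.lt_one hr₁
  let J : ℝ → ℝ × (Fin (n + 1) → ℝ) → ℝ → ℂ := fun k =>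
    nearIntegrand q r₁ k (τ k / k) (fun x => (χ (k ^ (-δ) * x) : ℂ)) (𝒵 k) (zeroAmp (A k))
  have hI : ∀ k, 1 ≤ k → k₁ ≤ k → ∀ φ (y : Fin (n + 1) → ℝ),
      exp (I * lam k * pathLength q n (vcons φ y)) *
        (∫ u in (-π)..π, J k (φ, y) u) = ∫ u in (-π)..π,
        𝒩 k 0 φ (φ - u) *
        𝓘 k n (A k) (vcons (φ - u) y) :=
    fun k hk hk1 φ y => by
      rw [← int_const_mul]
      congr 1
      ext u
      exact nearIntegrand_zero_eq H he hA hr₁ hrD hk (hk₁ k hk1) φ y u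
  have hI' : ∀ k, 1 ≤ k → k₁ ≤ k → ∀ φ (y : Fin (n + 1) → ℝ), (∫ u in (-π)..π, J k (φ, y) u) =
      (exp (I * lam k * pathLength q n (vcons φ y)))⁻¹ *
      ∫ u in (-π)..π, 𝒩 k 0 φ (φ - u) * 𝓘 k n (A k) (vcons (φ - u) y) :=
    fun k hk hk1 φ y => by rw [← hI k hk hk1, inv_mul_cancel_left₀ (Complex.exp_ne_zero _)]
  let A' : ℝ → (Fin (n + 2) → ℝ) → ℂ := fun k x => if k₁ ≤ k then
    k * ∫ u in (-π)..π, J k (unconsCLM (n + 1) x) u else 0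
  have hA'c : ∀ k, k₁ ≤ k → ∀ φ (y : Fin (n + 1) → ℝ), A' k (vcons φ y) =
      k * ∫ u in (-π)..π, J k (φ, y) u := fun k hk1 φ y => by
    simp only [A', if_pos hk1, unconsCLM_apply, Fin.cons_zero, Fin.tail_cons]
  have hcons : ∀ x : Fin (n + 2) → ℝ, vcons (x 0) (Fin.tail x) = x := fun x => Fin.cons_self_tail x
  have hint : ∀ k, 1 ≤ k → Continuous (𝓘 k n (A k)) := fun k hk =>
    continuous_fioIntegrand H.domain _ (hA.continuous hk)
  refine ⟨A', ⟨?_, ?_, ?_⟩, k₁, fun R => ⟨0, le_rfl, fun k hk hk1 φ₁ φ₂ => ?_⟩⟩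
  · refine UB.ite (fun _ => zero_le_one) (P := fun k : ℝ₁ => k₁ ≤ k)
      (g := fun k x => k * ∫ u in (-π)..π, J k (unconsCLM (n + 1) x) u) ?_
    exact ((hN.ub H.domain).comp (UB₁.linear (unconsCLM (n + 1)))).reindex
      fun k : {k : ℝ₁ // k₁ ≤ k} => (k : ℝ₁)
  · intro k hk x i
    by_cases hk1 : k₁ ≤ k
    swap
    · simp only [A', if_neg hk1]
    rw [← hcons x]
    generalize x 0 = φ
    generalize Fin.tail x = y
    have hp := torusPeriodic_fioIntegrand H.domain (lam k) (hA.periodic k hk)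
    refine Fin.cases ?_ (fun j => ?_) i
    · rw [Fin.update_cons_zero, Fin.cons_zero, hA'c k hk1, hA'c k hk1, hI' k hk hk1, hI' k hk hk1]
      have h1 := pathLength_torusPeriodic H.domain n (vcons φ y) 0
      rw [Fin.update_cons_zero, Fin.cons_zero] at h1
      rw [h1]
      congr 3
      ext u
      rw [kernelSplit_add_two_pi_left H.domain, add_sub_right_comm,
        kernelSplit_add_two_pi H.domain, hp.cons]
    · rw [← Fin.cons_update, Fin.cons_succ, hA'c k hk1, hA'c k hk1, hI' k hk hk1, hI' k hk hk1]
      have h1 := pathLength_torusPeriodic H.domain n (vcons φ y) j.succ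
      rw [← Fin.cons_update, Fin.cons_succ] at h1
      rw [h1]
      congr 3
      ext u
      have h2 := hp (vcons (φ - u) y) j.succ
      rw [← Fin.cons_update, Fin.cons_succ] at h2
      rw [h2]
  · intro k hk x hne
    by_cases hk1 : k₁ ≤ k
    swap
    · exact absurd (by simp only [A', if_neg hk1]) hne
    rw [← hcons x, hA'c k hk1, hI' k hk hk1] at hne
    obtain ⟨u, hu⟩ : ∃ u, 𝒩 k 0 (x 0) (x 0 - u) ≠ 0 ∧ A k (vcons (x 0 - u) (Fin.tail x)) ≠ 0 := by
      by_contra! hcon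
      refine hne ?_
      have : ∀ u, 𝒩 k 0 (x 0) (x 0 - u) * 𝓘 k n (A k)
          (vcons (x 0 - u) (Fin.tail x)) = 0 := fun u => by
        by_cases h0 : 𝒩 k 0 (x 0) (x 0 - u) = 0
        · rw [h0, zero_mul]
        · rw [fioIntegrand, hcon u h0, mul_zero, mul_zero]
      simp only [this, intervalIntegral.integral_zero, mul_zero]
    obtain ⟨p, hp⟩ := hA.support k hk _ hu.2
    refine ⟨p, fun j => ?_⟩
    refine Fin.cases ?_ (fun j => ?_) j
    · have h1 := hp 0
      have h2 := (H.kernelSplit_zero_mul_bump hr₁ (hk₁ k hk1) (x 0) (x 0 - u)).2 hu.1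
      have h3 := norm_sub_le_norm_sub_add_norm_sub (q (x 0)) (q (x 0 - u)) (q (pt b p))
      rw [Near, Fin.cons_zero, Fin.val_zero, add_zero] at h1
      rw [Near, Fin.val_zero, add_zero]
      linarith
    · have h1 := hp j.succ
      rw [Fin.cons_succ] at h1
      exact h1.mono hee.le
  · beta_reduce
    have hkpos : 0 < k := by linarith
    have hkc : (k : ℂ) ≠ 0 := by exact_mod_cast hkpos.ne'
    obtain ⟨B, hB0, hB⟩ := hA.exists_norm_le
    have : IsFiniteMeasure (volume.restrict (𝕋 n)) :=
      ⟨by rw [Measure.restrict_apply_univ]; exact isCompact_Icc.measure_lt_top⟩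
    have hswap := integral_mul_integral_swap (μ := volume.restrict (𝕋 n))
      (H.intervalIntegrable_kernel hk 0 φ₁)
      (F := fun p : ℝ × (Fin n → ℝ) => 𝓘 k n (A k) (joinPoint (φ₁ - p.1) p.2 φ₂))
      ((hint k hk).comp ((continuous_joinPoint n).comp ((continuous_const.sub continuous_fst).prodMk
        (continuous_snd.prodMk continuous_const)))) (B := B) fun p =>
        (H.norm_fioIntegrand_le hk _ _).trans (hB k hk _)
    have e1 : compKernel (𝒩 k 0) (fioKernel q lam n m A k) φ₁ φ₂ =
        fioKernel q lam n (m + 1) A' k φ₁ φ₂ := by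
      rw [compKernel_eq H.domain (hA.leftRegular H.domain m hk)]
      simp only [fioKernel]
      have e2 : ∀ u : ℝ, 𝒩 k 0 φ₁ (φ₁ - u) * ((k ^ (-(m : ℝ) + ((n : ℝ) + 1) / 2) : ℝ) * ∫ θ in 𝕋 n,
            𝓘 k n (A k) (joinPoint (φ₁ - u) θ φ₂)) =
          (k ^ (-(m : ℝ) + ((n : ℝ) + 1) / 2) : ℝ) *
          (𝒩 k 0 φ₁ (φ₁ - u) *
          ∫ θ in 𝕋 n, 𝓘 k n (A k) (joinPoint (φ₁ - u) θ φ₂)) := fun u => by ring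
      simp only [e2]
      rw [int_const_mul, hswap]
      have e3 : (k ^ (-(m : ℝ) + ((n : ℝ) + 1) / 2) : ℝ) =
          k ^ (-((m + 1 : ℕ) : ℝ) + ((n : ℝ) + 1) / 2) * k := by
        rw [← Real.rpow_add_one hkpos.ne']
        congr 1
        push_cast
        ring
      rw [e3, ofReal_mul, mul_assoc, ← integral_const_mul]
      congr 2
      ext θ
      rw [fioIntegrand, joinPoint, hA'c k hk1, mul_left_comm, hI k hk hk1]
      rfl
    rw [e1, sub_self, norm_zero, zero_mul]

/-- Composition with `N₀` lowers the order of a Fourier integral kernel. -/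
theorem FioForm.comp_zero (H : Stg) {e' : ℝ} (he' : Scale e')
    (he0 : 0 < e) (hee : e < e') {m : ℕ} {X : ℝ → ℝ → ℝ → ℂ} (hX : ∀ k, 1 ≤ k → LeftRegular (X k))
    (h : FioForm q lam b e n m X) : FioForm q lam b e' n (m + 1) fun k =>
      compKernel (𝒩 k 0) (X k) :=
  h.comp_of_symbol H 0 hX fun _ hA => hA.comp_zero H he' he0 hee m

/-! ### The kernel away from the diagonal -/

/-- Smooth amplitudes of the kernel away from the diagonal. -/
structure FarAmp (q : ℝ → ℂ) (r₁ : ℝ) (B : ℝ → ℝ × ℝ → ℂ) : Prop where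
  ub : UB₀ (fun (k : ℝ₁) => B k)
  congr : ∀ k φ φ' θ θ', q φ = q φ' → q θ = q θ' → normal q θ = normal q θ' →
    B k (φ, θ) = B k (φ', θ')
  support : ∀ k φ θ, B k (φ, θ) ≠ 0 → r₁ ≤ ‖q φ - q θ‖

lemma Setting.exists_farAmp (H : Stg) {r₁ : ℝ} (hr₁ : 0 < r₁) :
    ∃ B, FarAmp q r₁ B ∧ ∃ k₁ : ℝ, ∀ k, 1 ≤ k → k₁ ≤ k → ∀ φ θ, 𝒩 k 1 φ θ =
        𝒩 k 1 φ θ * (Billiard.bump r₁ ‖q φ - q θ‖ : ℂ) +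
        (k ^ (1 / 2 : ℝ) : ℝ) * (exp (I * lam k * (‖q φ - q θ‖ : ℝ)) * B k (φ, θ)) := by
  obtain ⟨c, hc, hc1⟩ := exists_isPosCutoff hr₁ (show r₁ < r₁ + 4 by linarith)
  let B : ℝ → ℝ × ℝ → ℂ := fun k p =>
    (k ^ (1 / 2 : ℝ) : ℝ) * (hankelAmp (specParam (τ k / k)) (k * smoothDist q r₁ p) *
      c (smoothDist q r₁ p)) * ((I / 2) * (((1 - chordCut r₁ (q p.1 - q p.2)) *
      (inner ℝ (q p.2 - q p.1) (normal q p.2) * realInv (r₁ / 2) (smoothDist q r₁ p)) : ℝ) : ℂ))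
  have hfst : UB₁ (fun (_ : ℝ₁) (p : ℝ × ℝ) => p.1) := UB₁.linear (fst ℝ ℝ ℝ)
  have hsnd : UB₁ (fun (_ : ℝ₁) (p : ℝ × ℝ) => p.2) := UB₁.linear (snd ℝ ℝ ℝ)
  have hD : UB₀ (fun (_ : ℝ₁) => smoothDist q r₁) := UB.smoothDist H.domain hr₁
  have hh : UB₀ (fun (k : ℝ₁) (y : ℝ) => ((k : ℝ) ^ (1 / 2 : ℝ) : ℝ) *
      (hankelAmp (specParam (τ k / k)) (k * y) * c y)) := by
    have h1 := UB.hankelAmp (κ := ℝ₁) (μ := fun k => specParam (τ k / k))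
      (Λ := fun k => (k : ℝ)) (fun k => by
        rw [specParam_im]; exact (H.reduced_mem k.2).1) (fun k => one_le_norm_specParam _) (fun k => norm_specParam_le (H.reduced_mem k.2))
      (fun k => one_pos.trans_le k.2) hc
    refine ((h1.const_mul fun k => (((k : ℝ) ^ (1 / 2 : ℝ) : ℝ) : ℂ))).mono (C := 2) (by norm_num)
      (fun _ => zero_le_one) fun k => ?_
    have hk : (1 : ℝ) ≤ k := k.2
    have hk0 : (0 : ℝ) < k := by linarith
    rw [norm_of_nonneg (by positivity), mul_add, ← rpow_add hk0, ← rpow_add hk0]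
    norm_num
    have : (k : ℝ) ^ (-1 : ℝ) ≤ 1 := Real.rpow_le_one_of_one_le_of_nonpos hk (by norm_num)
    linarith
  have hq1 := H.domain.ub.comp hfst
  have hq2 := H.domain.ub.comp hsnd
  have hcut : UB₀ (fun (_ : ℝ₁) (p : ℝ × ℝ) => 1 - chordCut r₁ (q p.1 - q p.2)) :=
    (UB.const (fun _ => (1 : ℝ)) (C := 1) fun _ => by simp).sub
      ((hq1.sub hq2).comp_smooth (contDiff_chordCut r₁))
  have hin : UB₀ (fun (_ : ℝ₁) (p : ℝ × ℝ) => inner ℝ (q p.2 - q p.1) (normal q p.2)) := by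
    have := (hq2.sub hq1).bilin (innerSL ℝ) ((UB.normal H.domain).comp hsnd)
    simp only [mul_one] at this
    exact this.congr fun _ _ => rfl
  refine ⟨B, ⟨?_, ?_, ?_⟩, ?_⟩
  · have h1 := hh.comp hD.ub₁
    have h2 := (hcut.mul_bdd (hin.mul_bdd (hD.comp_smooth
      (contDiff_realInv (half_pos hr₁))))).ofReal
    have h3 : UB₀ (fun (_ : ℝ₁) (_ : ℝ × ℝ) => I / 2) := UB.const _ (C := 1) fun _ => by norm_num
    exact h1.mul_bdd (h3.mul_bdd h2)
  · intro k φ φ' θ θ' h1 h2 h3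
    simp only [B, smoothDist, h1, h2, h3]
  · intro k φ θ hne
    by_contra hcon
    refine hne ?_
    simp only [B, chordCut]
    rw [bump_eq_one hr₁ (by rw [abs_norm]; exact (not_le.1 hcon).le)]
    simp
  · obtain ⟨k₁, hk₁⟩ := exists_one_le_rpow_mul H.lt_one (half_pos hr₁)
    refine ⟨k₁, fun k hk hkk φ θ => ?_⟩
    have hk0 : 0 < k := by linarith
    rcases lt_or_ge ‖q φ - q θ‖ r₁ with hlt | hge
    · have h0 : B k (φ, θ) = 0 := by
        simp only [B, chordCut]
        rw [bump_eq_one hr₁ (by rw [abs_norm]; exact hlt.le)]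
        simp
      rw [h0, bump_eq_one hr₁ (by rw [abs_norm]; exact hlt.le)]
      simp
    · have hχ : χ (k ^ (1 - δ) * ‖q φ - q θ‖) = 0 := by
        have hp : (0 : ℝ) < k ^ (1 - δ) := rpow_pos_of_pos hk0 _
        refine H.bump.eq_zero _ ?_
        rw [abs_of_nonneg (by positivity)]
        nlinarith [hk₁ k hkk]
      have hne : q φ ≠ q θ := fun h => by rw [h, sub_self, norm_zero] at hge; linarith
      have hsq : (k : ℂ) = (k ^ (1 / 2 : ℝ) : ℝ) * (k ^ (1 / 2 : ℝ) : ℝ) := by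
        rw [← ofReal_mul, ← rpow_add hk0]; norm_num
      rw [kernelSplit, if_neg (by norm_num), hχ, H.kernelN_eq hk hne]
      simp only [B, chordCut]
      rw [smoothDist_eq hr₁ hge, hc1 _ ⟨hge, by linarith [H.domain.norm_sub_le_four φ θ]⟩,
        realInv_of_le (half_pos hr₁) (by linarith)]
      have hexp : I * specParam (τ k / k) * (k * ‖q φ - q θ‖ : ℝ) =
          I * lam k * (‖q φ - q θ‖ : ℝ) := by
        rw [H.lam_eq_mul hk]; push_cast; ring
      rw [hexp]
      nth_rewrite 1 2 [hsq]
      push_cast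
      ring

/-- A boundary point away from the orbit. -/
lemma exists_far_point (h : Dom) (hb : Bounce) : ∃ s, ∀ p, ℓ / 4 < ‖q s - q (pt b p)‖ := by
  have hD := orbitLength_pos h hb
  have hq := h.smooth.continuous
  obtain ⟨s, hs⟩ := intermediate_value_univ (f := fun θ => ‖q θ - q 0‖) 0 b (by fun_prop)
    (show ℓ / 2 ∈ Icc ‖q 0 - q 0‖ ‖q b - q 0‖ by
      rw [sub_self, norm_zero, ← orbitLength]; constructor <;> linarith)
  refine ⟨s, fun p => ?_⟩
  beta_reduce at hs
  rw [pt]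
  split_ifs
  · rw [hs]; linarith
  · have := norm_sub_le_norm_sub_add_norm_sub (q b) (q s) (q 0)
    rw [hs, ← orbitLength, norm_sub_rev] at this
    linarith

lemma fderiv_apply_of_hasDerivAt {F : E × ℝ → ℂ} (hF : Smooth F) {x : E} {v : ℝ} {d : ℂ}
    (h : HasDerivAt (fun v : ℝ => F (x, v)) d v) : fderiv ℝ F (x, v) (0, 1) = d := by
  have h1 : HasDerivAt (fun v : ℝ => (x, v)) ((0 : E), (1 : ℝ)) v :=
    (hasDerivAt_const v x).prodMk (hasDerivAt_id v)
  exact ((hF.differentiable (by simp) (x, v)).hasFDerivAt.comp_hasDerivAt v h1).unique h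

lemma exists_norm_nonstationary_le
    {F B : ι → E × ℝ → ℂ} {Λ : ι → ℝ} (hF : UB₁ F) (hΛ : ∀ i, 1 ≤ Λ i)
    (hB : UB₀ B) {c : ℝ} (hc : 0 < c)
    (hder : ∀ i x v, B i (x, v) ≠ 0 → ∃ d, HasDerivAt (fun v : ℝ => F i (x, v)) d v ∧ c ≤ ‖d‖)
    (him : ∀ i p, B i p ≠ 0 → 0 ≤ (F i p).im) {s s' : ℝ} (hs : s ≤ s')
    (ha : ∀ i x, ∀ᶠ v in 𝓝 s, B i (x, v) = 0) (hb : ∀ i x, ∀ᶠ v in 𝓝 s', B i (x, v) = 0)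
    (N : ℕ) : ∃ C, 0 ≤ C ∧ ∀ i x, ‖∫ v in s..s', exp (Λ i * (I * F i (x, v))) * B i (x, v)‖ ≤
        C * (Λ i ^ N)⁻¹ := by
  have hH : UB₀ (fun i p => complexInv c (fderiv ℝ (F i) p (0, 1))) :=
    (hF.fderiv_apply (0, 1)).comp_smooth (contDiff_complexInv hc)
  obtain ⟨C, h0, hC⟩ := (UB.nonstationary hF hΛ hB hH (fun i p => by
    by_cases h : B i p = 0
    · rw [h, mul_zero]
    obtain ⟨x, v⟩ := p
    obtain ⟨d, hd, hcd⟩ := hder i x v h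
    rw [fderiv_apply_of_hasDerivAt (hF.smooth i) hd, complexInv_mul hc hcd, one_mul]) him hs ha hb
    N).norm_le
  exact ⟨C, h0, fun i x => by simpa [inv_pow] using hC i x⟩

/-! #### Cutoffs near the orbit -/

/-- A cutoff to the boundary points close to the end point with index `p`. -/
def endCut (q : ℝ → ℂ) (b e : ℝ) (p : ℕ) (x : ℝ) : ℝ := chordCut (e / 2) (q x - q (pt b p))

/-- A cutoff to pairs of boundary points close to different end points of the orbit. -/
def pairCut (q : ℝ → ℂ) (b e : ℝ) (z : ℝ × ℝ) : ℝ :=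
  endCut q b e 0 z.1 * endCut q b e 1 z.2 + endCut q b e 1 z.1 * endCut q b e 0 z.2

lemma UB.endCut (h : Dom) (e : ℝ) (p : ℕ) : UB₀ (fun (_ : ι) => endCut q b e p) :=
  (h.ub.sub (UB.const (fun _ => q (pt b p)) (fun _ => le_rfl))).comp_smooth
    (contDiff_chordCut (e / 2))

lemma UB.pairCut (h : Dom) (e : ℝ) : UB₀ (fun (_ : ι) => pairCut q b e) := by
  have h1 : UB₁ (fun (_ : ι) (p : ℝ × ℝ) => p.1) := UB₁.linear (fst ℝ ℝ ℝ)
  have h2 : UB₁ (fun (_ : ι) (p : ℝ × ℝ) => p.2) := UB₁.linear (snd ℝ ℝ ℝ)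
  exact (((UB.endCut h e 0).comp h1).mul_bdd ((UB.endCut h e 1).comp h2)).add
    (((UB.endCut h e 1).comp h1).mul_bdd ((UB.endCut h e 0).comp h2))

lemma endCut_eq_one {e : ℝ} (he : 0 < e) {p : ℕ} {x : ℝ} (h : Near q b (e / 2) p x) :
    endCut q b e p x = 1 := by
  rw [endCut, chordCut]
  exact bump_eq_one (half_pos he) (by rw [abs_norm]; exact h)

lemma endCut_eq_zero {e : ℝ} (he : 0 < e) {p : ℕ} {x : ℝ} (h : e ≤ ‖q x - q (pt b p)‖) :
    endCut q b e p x = 0 := by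
  rw [endCut, chordCut]
  exact bump_eq_zero (half_pos he) (by rw [abs_norm]; linarith)

lemma OrbitScale.pairCut_eq {e : ℝ} (he : Scale e) {p : ℕ} {φ θ : ℝ}
    (h : Near q b (e / 2) (p + 1) θ) : pairCut q b e (φ, θ) = endCut q b e p φ := by
  have h1 := endCut_eq_one he.pos h
  have h2 : endCut q b e p θ = 0 := by
    refine endCut_eq_zero he.pos ?_
    have h3 := norm_sub_le_norm_sub_add_norm_sub (q (pt b (p + 1))) (q θ) (q (pt b p))
    rw [norm_pt_sub, norm_sub_rev] at h3
    rw [Near] at h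
    linarith [he.le, he.pos]
  rw [pairCut]
  rcases even_or_odd p with hp | hp
  · obtain ⟨e1, e2⟩ := pt_of_even (b := b) hp
    simp only [endCut, e1, e2] at h1 h2 ⊢
    rw [h1, h2, mul_one, mul_zero, add_zero]
  · obtain ⟨e1, e2⟩ := pt_of_odd (b := b) hp
    simp only [endCut, e1, e2] at h1 h2 ⊢
    rw [h1, h2, mul_one, mul_zero, zero_add]

lemma pairCut_congr {e : ℝ} {φ φ' θ θ' : ℝ} (h1 : q φ = q φ') (h2 : q θ = q θ') :
    pairCut q b e (φ, θ) = pairCut q b e (φ', θ') := by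
  simp only [pairCut, endCut, h1, h2]

lemma continuous_bump_chord (h : Dom) (r φ : ℝ) :
    Continuous fun u => (bump r ‖q φ - q (φ - u)‖ : ℂ) := by
  have hq := h.smooth.continuous
  exact continuous_ofReal.comp ((contDiff_chordCut r).continuous.comp (by fun_prop))

/-- The composition of `N₁` and a kernel is the sum of the contributions of the points near the
diagonal and of those away from it. -/
lemma Setting.compKernel_one_eq (H : Stg) {r₁ : ℝ} {B : ℝ → ℝ × ℝ → ℂ}
    (hB : FarAmp q r₁ B) {k : ℝ} (hk : 1 ≤ k)
    (hsplit : ∀ φ θ, 𝒩 k 1 φ θ = 𝒩 k 1 φ θ * (Billiard.bump r₁ ‖q φ - q θ‖ : ℂ) +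
        (k ^ (1 / 2 : ℝ) : ℝ) * (exp (I * lam k * (‖q φ - q θ‖ : ℝ)) *
          B k (φ, θ))) {K : ℝ → ℝ → ℂ} (hK : LeftRegular K) (s φ φ₂ : ℝ) :
    compKernel (𝒩 k 1) K φ φ₂ = (∫ u in (-π)..π, 𝒩 k 1 φ (φ - u) *
        ((Billiard.bump r₁ ‖q φ - q (φ - u)‖ : ℂ) * K (φ - u) φ₂)) +
      (k ^ (1 / 2 : ℝ) : ℝ) * ∫ θ in s..(s + 2 * π),
        exp (I * lam k * (‖q φ - q θ‖ : ℝ)) * B k (φ, θ) * K θ φ₂ := by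
  have hq := H.domain.smooth.continuous
  have hBc : Continuous (B k) := (hB.ub.smooth ⟨k, hk⟩).continuous
  have hKc := hK.continuous φ₂
  have hp : Periodic (fun θ => exp (I * lam k * (‖q φ - q θ‖ : ℝ)) *
      B k (φ, θ) * K θ φ₂) (2 * π) := fun θ => by
    beta_reduce
    rw [H.domain.periodic θ, show K (θ + 2 * π) φ₂ = K θ φ₂ from hK.periodic φ₂ θ, hB.congr k φ φ (θ + 2 * π) θ rfl
      (H.domain.periodic θ) (H.domain.normal_periodic θ)]
  rw [hp.intervalIntegral_add_eq s 0, zero_add, integral_period_eq hp φ, compKernel_eq H.domain hK,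
    ← int_const_mul, ← int_add]
  · congr 1
    ext u
    conv_lhs => rw [hsplit]
    ring
  · exact H.intervalIntegrable_mul hk 1 φ ((continuous_bump_chord H.domain r₁ φ).mul (by fun_prop))
  · refine Continuous.intervalIntegrable ?_ _ _
    fun_prop

/-! ### Composition of `N₁` and a Fourier integral kernel -/

lemma isFiniteMeasure_Icc (n : ℕ) (c : Fin n → ℝ) :
    IsFiniteMeasure (volume.restrict (Icc (0 : Fin n → ℝ) c)) :=
  ⟨by rw [Measure.restrict_apply_univ]; exact isCompact_Icc.measure_lt_top⟩

/-- The part near the diagonal of the composition of `N₁` and a Fourier integral kernel is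
negligible. -/
lemma FioSymbol.near_negligible (H : Stg) (he : Scale e)
    (hA : FioSymbol q b e n A) {u₁ r₁ : ℝ} (hs : NearScale q u₁ r₁)
    (hr : r₁ ≤ ℓ / 16) (m R : ℕ) : ∃ C, 0 ≤ C ∧ ∀ k, 1 ≤ k → ∀ φ φ₂,
      ‖∫ u in (-π)..π, 𝒩 k 1 φ (φ - u) *
        ((bump r₁ ‖q φ - q (φ - u)‖ : ℂ) * fioKernel q lam n m A k (φ - u) φ₂)‖ ≤
        C * (k ^ R)⁻¹ := by
  set R' := R + (n + 1)
  have hN := hA.nearData H he hs hr ((symbolFamily_hankel fun k : ℝ₁ =>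
    H.reduced_mem k.2).mul_one_sub_bump H.bump (fun k => k.2) H.half_lt R')
  obtain ⟨C, h0, hC⟩ := (hN.ub H.domain).norm_le
  set V := volume.real (𝕋 n)
  refine ⟨C * V, by positivity, fun k hk φ φ₂ => ?_⟩
  have hkpos : 0 < k := by linarith
  have hkc : (k : ℂ) ≠ 0 := by exact_mod_cast hkpos.ne'
  have hin : ∀ y : Fin (n + 1) → ℝ, ‖∫ u in (-π)..π,
      𝒩 k 1 φ (φ - u) * (bump r₁ ‖q φ - q (φ - u)‖ : ℂ) * 𝓘 k n (A k) (vcons (φ - u) y)‖ ≤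
      C * (k ^ R')⁻¹ := fun y => by
    have h1 : ∀ u, 𝒩 k 1 φ (φ - u) * (bump r₁ ‖q φ - q (φ - u)‖ : ℂ) *
        𝓘 k n (A k) (vcons (φ - u) y) =
        (((k : ℂ) ^ R')⁻¹ * exp (I * lam k * pathLength q n (vcons φ y))) *
          nearIntegrand q r₁ k (τ k / k) (fun x => (k : ℂ) ^ R' * (1 - (χ (k ^ (-δ) * x) : ℂ)))
            (𝒵 k) (zeroAmp (A k)) (φ, y) u := by
      intro u
      rw [mul_assoc ((k : ℂ) ^ R')⁻¹, nearIntegrand_fio_eq H he hA hs.pos hr hk, rpow_mul_chord hk, kernelSplit,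
        if_neg (by norm_num)]
      field_simp
    simp only [h1]
    rw [int_const_mul, norm_mul, norm_mul, norm_inv, norm_pow, norm_of_nonneg hkpos.le]
    have h2 := hC ⟨k, hk⟩ (φ, y)
    rw [norm_mul, norm_of_nonneg hkpos.le, mul_one] at h2
    have h3 := H.norm_exp_le_one hk (pathLength_nonneg q n (vcons φ y))
    have h4 : ‖∫ u in (-π)..π,
        nearIntegrand q r₁ k (τ k / k) (fun x => (k : ℂ) ^ R' * (1 - (χ (k ^ (-δ) * x) : ℂ)))
          (𝒵 k) (zeroAmp (A k)) (φ, y) u‖ ≤ C :=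
      le_trans (le_mul_of_one_le_left (norm_nonneg _) hk) h2
    calc _ ≤ (k ^ R')⁻¹ * 1 * C := by gcongr
      _ = _ := by ring
  have := isFiniteMeasure_Icc n (fun _ => 2 * π)
  obtain ⟨B, hB0, hB⟩ := hA.exists_norm_le
  have hbc := continuous_bump_chord H.domain r₁ φ
  have hswap := integral_mul_integral_swap (μ := volume.restrict (𝕋 n))
    (H.intervalIntegrable_mul hk 1 φ hbc)
    (F := fun p : ℝ × (Fin n → ℝ) => 𝓘 k n (A k) (joinPoint (φ - p.1) p.2 φ₂))
    ((continuous_fioIntegrand H.domain _ (hA.continuous hk)).comp ((continuous_joinPoint n).comp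
      ((continuous_const.sub continuous_fst).prodMk (continuous_snd.prodMk continuous_const))))
    (B := B) fun p => (H.norm_fioIntegrand_le hk _ _).trans (hB k hk _)
  have e2 : ∀ u : ℝ, 𝒩 k 1 φ (φ - u) *
      ((bump r₁ ‖q φ - q (φ - u)‖ : ℂ) * fioKernel q lam n m A k (φ - u) φ₂) =
      (k ^ (-(m : ℝ) + ((n : ℝ) + 1) / 2) : ℝ) *
      (𝒩 k 1 φ (φ - u) * (bump r₁ ‖q φ - q (φ - u)‖ : ℂ) *
      ∫ θ in 𝕋 n, 𝓘 k n (A k) (joinPoint (φ - u) θ φ₂)) := fun u => by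
    rw [fioKernel]; ring
  simp only [e2]
  rw [int_const_mul, hswap, norm_mul, norm_of_nonneg (by positivity)]
  have h5 := rpow_order_le hk m n
  have h6 : ‖∫ θ in 𝕋 n, ∫ u in (-π)..π, 𝒩 k 1 φ (φ - u) * (bump r₁ ‖q φ - q (φ - u)‖ : ℂ) *
        𝓘 k n (A k) (joinPoint (φ - u) θ φ₂)‖ ≤ C * (k ^ R')⁻¹ * V :=
    norm_setIntegral_le_of_norm_le_const isCompact_Icc.measure_lt_top fun θ _ => hin _
  calc _ ≤ k ^ (n + 1) * (C * (k ^ R')⁻¹ * V) := by gcongr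
    _ = C * V * (k ^ R)⁻¹ := by
      rw [show R' = R + (n + 1) from rfl]
      field_simp
      ring

lemma integral_Icc_succ {n : ℕ} {f : (Fin (n + 1) → ℝ) → ℂ} (hf : Continuous f) :
    ∫ x in 𝕋 (n + 1), f x = ∫ θ in (0 : ℝ)..(2 * π), ∫ y in 𝕋 n, f (vcons θ y) := by
  have hmp := (volume_preserving_piFinSuccAbove (fun _ : Fin (n + 1) => ℝ) 0).symm
  have hsymm : ∀ p : ℝ × (Fin n → ℝ),
      (MeasurableEquiv.piFinSuccAbove (fun _ : Fin (n + 1) => ℝ) 0).symm p =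
        vcons p.1 p.2 := fun p => by
    rw [← Fin.insertNth_zero']
    rfl
  have hpre : (MeasurableEquiv.piFinSuccAbove (fun _ : Fin (n + 1) => ℝ) 0).symm ⁻¹' 𝕋 (n + 1) =
      Icc (0 : ℝ) (2 * π) ×ˢ 𝕋 n := by
    ext p
    rw [mem_preimage, hsymm]
    simp only [mem_Icc, Pi.le_def, Fin.forall_fin_succ, Fin.cons_zero, Fin.cons_succ, mem_prod,
      Pi.zero_apply]
    tauto
  have h1 := hmp.setIntegral_preimage_emb (MeasurableEquiv.measurableEmbedding _) f (𝕋 (n + 1))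
  rw [← h1, hpre]
  simp only [hsymm]
  have h2 : IntegrableOn (fun p : ℝ × (Fin n → ℝ) => f (vcons p.1 p.2)) (Icc (0 : ℝ) (2 * π) ×ˢ 𝕋 n)
      ((volume : Measure ℝ).prod (volume : Measure (Fin n → ℝ))) :=
    (hf.comp (continuous_cons n)).continuousOn.integrableOn_compact
      (isCompact_Icc.prod isCompact_Icc)
  rw [integral_of_le two_pi_pos.le, ← integral_Icc_eq_integral_Ioc]
  exact setIntegral_prod _ h2

lemma eventually_far {s : ℝ} (h : Dom) (hs : ∀ p, ℓ / 4 < ‖q s - q (pt b p)‖) :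
    ∀ᶠ θ in 𝓝 s, ∀ p, ℓ / 4 < ‖q θ - q (pt b p)‖ := by
  have hq := h.smooth.continuous
  have hc : ∀ p, ∀ᶠ θ in 𝓝 s, ℓ / 4 < ‖q θ - q (pt b p)‖ := fun p =>
    (Continuous.tendsto (by fun_prop : Continuous fun θ => ‖q θ - q (pt b p)‖) s).eventually
      (lt_mem_nhds (hs p))
  filter_upwards [hc 0, hc 1] with θ h0 h1 p
  rcases even_or_odd p with hp | hp
  · rwa [(pt_of_even hp).1]
  · rwa [(pt_of_odd hp).1]

/-- The amplitude of the composition of `N₁` and a Fourier integral kernel. -/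
def oneAmp (B : ℝ × ℝ → ℂ) (A : (Fin (n + 2) → ℝ) → ℂ) (x : Fin (n + 3) → ℝ) : ℂ :=
  B (x 0, x 1) * A (Fin.tail x)

lemma fioIntegrand_oneAmp (q : ℝ → ℂ) (l : ℂ) (B : ℝ × ℝ → ℂ) (A : (Fin (n + 2) → ℝ) → ℂ) (φ : ℝ)
    (z : Fin (n + 2) → ℝ) :
    fioIntegrand q l (n + 1) (oneAmp B A) (vcons φ z) =
      exp (I * l * (‖q φ - q (z 0)‖ : ℝ)) * B (φ, z 0) * fioIntegrand q l n A z := by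
  rw [fioIntegrand, fioIntegrand, pathLength_cons, oneAmp]
  have h1 : chainLength q (n + 1) z = pathLength q n z := rfl
  have h2 : (Fin.cons φ z : Fin (n + 3) → ℝ) 1 = z 0 := rfl
  rw [h1, h2, Fin.cons_zero, Fin.tail_cons]
  push_cast
  rw [mul_add, exp_add]
  ring

/-- The point `(φ₁, φ₂)` is close to the orbit whenever the tail is. -/
lemma FioSymbol.exists_near_of_cons (hA : FioSymbol q b e n A) {k : ℝ} (hk : 1 ≤ k)
    {z : Fin (n + 2) → ℝ} (hz : A k z ≠ 0) :
    ∃ p, (∀ j : Fin (n + 2), Near q b e (p + 1 + j) (z j)) ∧ Near q b e (p + 1) (z 0) ∧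
      Near q b e p (z 1) := by
  obtain ⟨p, hp⟩ := hA.support k hk _ hz
  have h : ∀ j : Fin (n + 2), Near q b e (p + 1 + 1 + j) (z j) := fun j => by
    have := near_add_two.2 (hp j)
    rwa [show p + j + 2 = p + 1 + 1 + j by ring] at this
  refine ⟨p + 1, h, h 0, ?_⟩
  exact near_add_two.1 (h 1)

lemma FarAmp.oneAmp_symbol (H : Stg) {e' r₁ : ℝ} {B : ℝ → ℝ × ℝ → ℂ}
    (hB : FarAmp q r₁ B) (he' : Scale e') (hee : e ≤ e' / 2)
    (hA : FioSymbol q b e n A) : FioSymbol q b e' (n + 1) fun k =>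
      oneAmp (fun z => (pairCut q b e' z : ℂ) * B k z) (A k) := by
  have hΩ := H.domain
  refine ⟨?_, fun k hk x i => ?_, fun k hk x hne => ?_⟩
  · have h1 : UB₁ (fun (_ : ℝ₁) (x : Fin (n + 3) → ℝ) => (x 0, x 1)) := UB₁.linear
      ((proj (R := ℝ) (φ := fun _ : Fin (n + 3) => ℝ) 0).prod
        (proj (R := ℝ) (φ := fun _ : Fin (n + 3) => ℝ) 1))
    have h2 : UB₁ (fun (_ : ℝ₁) (x : Fin (n + 3) → ℝ) => Fin.tail x) := UB₁.linear
      ((snd ℝ ℝ (Fin (n + 2) → ℝ)).comp (unconsCLM (n + 2)))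
    exact (((UB.pairCut hΩ e').ofReal.mul_bdd hB.ub).comp h1).mul_bdd (hA.ub.comp h2)
  · have hq : ∀ l, q (Function.update x i (x i + 2 * π) l) = q (x l) := fun l => by
      by_cases hl : l = i
      · subst hl; rw [Function.update_self, hΩ.periodic]
      · rw [Function.update_of_ne hl]
    have hn : ∀ l, normal q (Function.update x i (x i + 2 * π) l) = normal q (x l) := fun l => by
        by_cases hl : l = i
        · subst hl; rw [Function.update_self, hΩ.normal_periodic]
        · rw [Function.update_of_ne hl]
    have ht : A k (Fin.tail (Function.update x i (x i + 2 * π))) = A k (Fin.tail x) := by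
      refine Fin.cases ?_ (fun j => ?_) i
      · rw [Fin.tail_update_zero]
      · rw [Fin.tail_update_succ]
        exact hA.periodic k hk (Fin.tail x) j
    simp only [oneAmp]
    rw [ht, pairCut_congr (hq 0) (hq 1), hB.congr k _ _ _ _ (hq 0) (hq 1) (hn 1)]
  · rw [oneAmp] at hne
    have h1 := right_ne_zero_of_mul hne
    have h2 := left_ne_zero_of_mul (left_ne_zero_of_mul hne)
    obtain ⟨p, hp, hp0, -⟩ := hA.exists_near_of_cons hk h1
    refine ⟨p, fun j => Fin.cases ?_ (fun j => ?_) j⟩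
    · have h3 : pairCut q b e' (x 0, x 1) = endCut q b e' p (x 0) := he'.pairCut_eq (hp0.mono hee)
      rw [h3] at h2
      by_contra hcon
      refine h2 ?_
      rw [endCut_eq_zero he'.pos (show e' ≤ ‖q (x 0) - q (pt b p)‖ from (not_le.1 hcon).le),
        ofReal_zero]
    · have h4 := (hp j).mono (hee.trans (by linarith [he'.pos] : e' / 2 ≤ e'))
      rwa [show p + 1 + (j : ℕ) = p + (j.succ : ℕ) by rw [Fin.val_succ]; ring] at h4

lemma FarAmp.remainder (H : Stg) {e' r₁ c : ℝ} {B : ℝ → ℝ × ℝ → ℂ}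
    (hB : FarAmp q r₁ B) (hr₁ : 0 < r₁) (he' : Scale e') (he0 : 0 < e)
    (hee : e ≤ e' / 2) (hA : FioSymbol q b e n A) (hc : 0 < c)
    (hadm : Admissible q b e (e' / 2) r₁ c) {s : ℝ}
    (hs : ∀ p, ℓ / 4 < ‖q s - q (pt b p)‖) (N : ℕ) :
    ∃ C, 0 ≤ C ∧ ∀ k, 1 ≤ k → ∀ φ (z : Fin (n + 1) → ℝ), ‖∫ θ in s..(s + 2 * π), 𝓘 k (n + 1)
        (oneAmp (fun z => (1 - pairCut q b e' z : ℂ) * B k z) (A k))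
        (vcons φ (vcons θ z))‖ ≤ C * (k ^ N)⁻¹ := by
  have hΩ := H.domain
  have he := he'.mono he0 (hee.trans (by linarith [he'.pos]))
  have hD : 0 < ℓ / 2 := by linarith [he.pos, he.le]
  let E := ℝ × (Fin (n + 1) → ℝ)
  let F : ℝ₁ → E × ℝ → ℂ := fun k p => specParam (τ k / k) *
    ((smoothDist q (r₁ / 2) (p.1.1, p.2) + smoothDist q (ℓ / 2) (p.2, p.1.2 0) : ℝ) : ℂ)
  let Q : ℝ₁ → E × ℝ → ℂ := fun k p => ((1 - pairCut q b e' (p.1.1, p.2) : ℂ) * B k (p.1.1, p.2)) *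
      A k (vcons p.2 p.1.2)
  have l1 : UB₁ (fun (_ : ℝ₁) (p : E × ℝ) => (p.1.1, p.2)) := UB₁.linear
    (((fst ℝ ℝ (Fin (n + 1) → ℝ)).comp (fst ℝ E ℝ)).prod (snd ℝ E ℝ))
  have l2 : UB₁ (fun (_ : ℝ₁) (p : E × ℝ) => (p.2, p.1.2 0)) := UB₁.linear
    ((snd ℝ E ℝ).prod ((proj 0).comp ((snd ℝ ℝ (Fin (n + 1) → ℝ)).comp (fst ℝ E ℝ))))
  have l3 : UB₁ (fun (_ : ℝ₁) (p : E × ℝ) => consCLM (n + 1) (p.2, p.1.2)) := UB₁.linear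
    ((consCLM (n + 1)).comp ((snd ℝ E ℝ).prod ((snd ℝ ℝ (Fin (n + 1) → ℝ)).comp (fst ℝ E ℝ))))
  have hF : UB₀ F := H.ub_specParam.mul_bdd (((UB.smoothDist hΩ (half_pos hr₁)).comp l1).add
    ((UB.smoothDist hΩ hD).comp l2)).ofReal
  have hQ : UB₀ Q := by
    have h1 : UB₀ (fun (_ : ℝ₁) (z : ℝ × ℝ) => (1 - pairCut q b e' z : ℂ)) :=
      (UB.const (fun _ => (1 : ℂ)) (C := 1) fun _ => by simp).sub (UB.pairCut hΩ e').ofReal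
    have h2 : UB₀ (fun (k : ℝ₁) (p : E × ℝ) => A k (vcons p.2 p.1.2)) :=
      (hA.ub.comp l3).congr fun k p => by rw [consCLM_apply]
    exact ((h1.mul_bdd hB.ub).comp l1).mul_bdd h2
  have hzero : ∀ s, (∀ p, ℓ / 4 < ‖q s - q (pt b p)‖) → ∀ k x,
      ∀ᶠ v in 𝓝 s, Q k (x, v) = 0 := fun s hs k x => by
    filter_upwards [eventually_far hΩ hs] with θ hθ
    by_contra hne
    obtain ⟨p, -, hp, -⟩ := hA.exists_near_of_cons k.2 (right_ne_zero_of_mul hne)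
    have := hθ (p + 1)
    rw [Near, Fin.cons_zero] at hp
    linarith [he.le]
  have hder : ∀ (k : ℝ₁) x θ, Q k (x, θ) ≠ 0 →
      ∃ d, HasDerivAt (fun θ : ℝ => F k (x, θ)) d θ ∧ c ≤ ‖d‖ := by
    rintro k ⟨φ, z⟩ θ hne
    obtain ⟨p, -, hp, hp'⟩ := hA.exists_near_of_cons k.2 (right_ne_zero_of_mul hne)
    change Near q b e (p + 1) θ at hp
    change Near q b e p (z 0) at hp'
    have h2 := left_ne_zero_of_mul (left_ne_zero_of_mul hne)
    have h3 := hB.support _ _ _ (right_ne_zero_of_mul (left_ne_zero_of_mul hne))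
    have h4 := he.norm_near hp (near_add_two.2 hp') (z := θ) (by rw [sub_self, norm_zero]; linarith)
    have h5 : ¬Near q b (e' / 2) p φ := fun hn => h2 (by
      dsimp only
      rw [he'.pairCut_eq (hp.mono hee), endCut_eq_one he'.pos hn, ofReal_one, sub_self])
    have h6 := (hadm p φ θ hp h3 h5).2 (z 0) hp'
    refine ⟨specParam (τ k / k) * ((distDeriv q θ φ + distDeriv q θ (z 0) : ℝ) : ℂ), ?_, ?_⟩
    · refine HasDerivAt.const_mul _ (HasDerivAt.ofReal_comp ?_)
      have d1 := hasDerivAt_smoothDist hΩ (half_pos hr₁) (hasDerivAt_const θ φ) (hasDerivAt_id θ)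
        (lt_of_lt_of_le (by linarith) h3)
      have d2 := hasDerivAt_smoothDist hΩ hD (hasDerivAt_id θ) (hasDerivAt_const θ (z 0)) h4
      have d := d1.fun_add d2
      simpa only [mul_zero, mul_one, add_zero, zero_add, id] using d
    · rw [norm_mul, norm_real]
      exact h6.trans (le_mul_of_one_le_left (abs_nonneg _) (one_le_norm_specParam _))
  have him : ∀ (k : ℝ₁) p, Q k p ≠ 0 → 0 ≤ (F k p).im := by
    rintro k p -
    simp only [F]
    rw [Complex.im_mul_ofReal, specParam_im]
    exact mul_nonneg (H.reduced_mem k.2).1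
      (add_pos (smoothDist_pos (half_pos hr₁) _) (smoothDist_pos hD _)).le
  obtain ⟨C, h0, hC⟩ := exists_norm_nonstationary_le hF.ub₁ (Λ := fun k : ℝ₁ => (k : ℝ))
    (fun k => k.2) hQ hc hder him (show s ≤ s + 2 * π by linarith [two_pi_pos])
    (hzero s hs) (hzero _ (by simpa only [hΩ.periodic s] using hs)) N
  refine ⟨C, h0, fun k hk φ z => ?_⟩
  have h1 : ∀ θ, 𝓘 k (n + 1) (oneAmp (fun z => (1 - pairCut q b e' z : ℂ) * B k z) (A k))
      (vcons φ (vcons θ z)) =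
      exp (I * lam k * chainLength q n z) *
        (exp (k * (I * F ⟨k, hk⟩ ((φ, z), θ))) * Q ⟨k, hk⟩ ((φ, z), θ)) := by
    intro θ
    have h2 : oneAmp (fun z => (1 - pairCut q b e' z : ℂ) * B k z) (A k) (vcons φ (vcons θ z)) =
        Q ⟨k, hk⟩ ((φ, z), θ) := rfl
    rw [fioIntegrand, h2]
    by_cases hne : Q ⟨k, hk⟩ ((φ, z), θ) = 0
    · rw [hne]; ring
    obtain ⟨p, -, hp, hp'⟩ := hA.exists_near_of_cons hk (right_ne_zero_of_mul hne)
    have h3 := hB.support _ _ _ (right_ne_zero_of_mul (left_ne_zero_of_mul hne))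
    have h4 := (he.norm_near hp (near_add_two.2 hp') (z := θ) (by
      rw [Fin.cons_zero, sub_self, norm_zero]; linarith)).le
    change _ ≤ ‖q θ - q (z 0)‖ at h4
    rw [← mul_assoc (exp _) (exp _) (Q _ _), ← exp_add]
    congr 2
    simp only [F]
    rw [smoothDist_eq (half_pos hr₁) (by linarith : r₁ / 2 ≤ ‖q φ - q θ‖), smoothDist_eq hD h4,
      pathLength_cons, H.lam_eq_mul hk]
    have h5 : chainLength q (n + 1) (vcons θ z) =
        ‖q θ - q (z 0)‖ + chainLength q n z := pathLength_cons q n θ z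
    rw [h5, Fin.cons_zero]
    push_cast
    ring
  simp only [h1]
  rw [int_const_mul, norm_mul]
  exact (mul_le_mul (H.norm_exp_le_one hk (chainLength_nonneg q n z)) (hC ⟨k, hk⟩ (φ, z))
    (norm_nonneg _) zero_le_one).trans_eq (one_mul _)

/-- The integral over all the intermediate vertices but the first. -/
def innerInt (q : ℝ → ℂ) (l : ℂ) (a : (Fin (n + 3) → ℝ) → ℂ) (φ φ₂ θ : ℝ) : ℂ :=
  ∫ y in 𝕋 n, fioIntegrand q l (n + 1) a (vcons φ (joinPoint θ y φ₂))

lemma continuous_fioIntegrand_join (h : Dom) (l : ℂ) {a : (Fin (n + 3) → ℝ) → ℂ}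
    (ha : Continuous a) (φ φ₂ : ℝ) : Continuous fun p : ℝ × (Fin n → ℝ) =>
      fioIntegrand q l (n + 1) a (vcons φ (joinPoint p.1 p.2 φ₂)) :=
  (continuous_fioIntegrand h l ha).comp ((continuous_cons (n + 2)).comp
    (continuous_const.prodMk ((continuous_joinPoint n).comp
      (continuous_fst.prodMk (continuous_snd.prodMk continuous_const)))))

lemma continuous_innerInt (h : Dom) (l : ℂ) {a : (Fin (n + 3) → ℝ) → ℂ} (ha : Continuous a)
    (φ φ₂ : ℝ) : Continuous (innerInt q l a φ φ₂) :=
  continuous_parametric_integral_of_continuous (continuous_fioIntegrand_join h l ha φ φ₂)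
    isCompact_Icc

/-- Composition with `N₁` adds a reflection to a Fourier integral kernel. -/
theorem FioForm.comp_one (H : Stg) (hb : Bounce) {e' u₁ r₁ c : ℝ}
    (he' : Scale e') (he0 : 0 < e) (hee : e ≤ e' / 2) (hs : NearScale q u₁ r₁)
    (hr : r₁ ≤ ℓ / 16) (hc : 0 < c) (hadm : Admissible q b e (e' / 2) r₁ c) {m : ℕ}
    {X : ℝ → ℝ → ℝ → ℂ} (hX : ∀ k, 1 ≤ k → LeftRegular (X k)) (h : FioForm q lam b e n m X) :
    FioForm q lam b e' (n + 1) m fun k => compKernel (𝒩 k 1) (X k) := by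
  refine h.comp_of_symbol H 1 hX fun A hA => ?_
  have hΩ := H.domain
  have he := he'.mono he0 (hee.trans (by linarith [he'.pos]))
  obtain ⟨B, hB, k₁, hk₁⟩ := H.exists_farAmp hs.pos
  obtain ⟨s, hfar⟩ := exists_far_point hΩ hb
  have hA' := hB.oneAmp_symbol H he' hee hA
  refine ⟨_, hA', k₁, fun R => ?_⟩
  obtain ⟨C₁, h1, hC₁⟩ := hA.near_negligible H he hs hr m R
  obtain ⟨C₂, h2, hC₂⟩ := hB.remainder H hs.pos he' he0 hee hA hc hadm hfar (R + (n + 2))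
  set V := volume.real (𝕋 n)
  refine ⟨C₁ + C₂ * V, by positivity, fun k hk hkk φ φ₂ => ?_⟩
  have hkpos : 0 < k := by linarith
  have hlr := hA.leftRegular (lam := lam) hΩ m hk
  beta_reduce
  rw [H.compKernel_one_eq hB hk (hk₁ k hk hkk) hlr s, add_sub_assoc, add_mul]
  refine (norm_add_le _ _).trans (add_le_add (hC₁ k hk φ φ₂) ?_)
  set a' := oneAmp (fun z => (pairCut q b e' z : ℂ) * B k z) (A k) with ha'
  set a'' := oneAmp (fun z => (1 - pairCut q b e' z : ℂ) * B k z) (A k) with ha''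
  have hBc : Continuous (B k) := (hB.ub.smooth ⟨k, hk⟩).continuous
  have hWc : Continuous (pairCut q b e') := ((UB.pairCut (ι := Unit) hΩ e').smooth ()).continuous
  have hAc := hA.continuous hk
  have htail : Continuous fun x : Fin (n + 3) → ℝ => Fin.tail x :=
    continuous_pi fun j => continuous_apply _
  have ha'c : Continuous a' := (hA'.ub.smooth ⟨k, hk⟩).continuous
  have ha''c : Continuous a'' := by
    simp only [ha'']
    unfold oneAmp
    fun_prop
  have hI' := continuous_fioIntegrand_join hΩ (lam k) ha'c φ φ₂
  have hI'' := continuous_fioIntegrand_join hΩ (lam k) ha''c φ φ₂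
  have hsum : ∀ x, 𝓘 k (n + 1) (oneAmp (B k) (A k)) x =
      𝓘 k (n + 1) a' x + 𝓘 k (n + 1) a'' x := fun x => by
    simp only [fioIntegrand, ha', ha'', oneAmp]
    ring
  have e1 : ∀ θ, exp (I * lam k * (‖q φ - q θ‖ : ℝ)) * B k (φ, θ) *
      fioKernel q lam n m A k θ φ₂ = (k ^ (-(m : ℝ) + ((n : ℝ) + 1) / 2) : ℝ) *
        (innerInt q (lam k) a' φ φ₂ θ + innerInt q (lam k) a'' φ φ₂ θ) := fun θ => by
    rw [innerInt, innerInt, ← integral_add, fioKernel, mul_left_comm, ← integral_const_mul]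
    · congr 2
      ext y
      rw [← hsum, fioIntegrand_oneAmp]
      rfl
    · exact (hI'.comp (Continuous.prodMk_right θ)).continuousOn.integrableOn_compact isCompact_Icc
    · exact (hI''.comp (Continuous.prodMk_right θ)).continuousOn.integrableOn_compact isCompact_Icc
  simp only [e1]
  rw [int_const_mul, int_add ((continuous_innerInt hΩ _ ha'c φ φ₂).intervalIntegrable _ _)
    ((continuous_innerInt hΩ _ ha''c φ φ₂).intervalIntegrable _ _), ← mul_assoc,
    ← ofReal_mul, ← rpow_add hkpos, mul_add]
  have hexp : (1 / 2 : ℝ) + (-(m : ℝ) + ((n : ℝ) + 1) / 2) =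
      -(m : ℝ) + (((n + 1 : ℕ) : ℝ) + 1) / 2 := by push_cast; ring
  rw [hexp]
  have hmain : ∫ θ in s..(s + 2 * π), innerInt q (lam k) a' φ φ₂ θ =
      ∫ x in 𝕋 (n + 1), 𝓘 k (n + 1) a' (joinPoint φ x φ₂) := by
    have hper : Periodic (innerInt q (lam k) a' φ φ₂) (2 * π) := fun θ => by
      rw [innerInt, innerInt]
      congr 1
      ext y
      have := torusPeriodic_fioIntegrand hΩ (lam k) (hA'.periodic k hk)
        (vcons φ (joinPoint θ y φ₂)) (Fin.succ 0)
      rw [← Fin.cons_update, Fin.cons_succ] at this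
      simp only [joinPoint] at this ⊢
      rwa [Fin.update_cons_zero, Fin.cons_zero] at this
    rw [hper.intervalIntegral_add_eq s 0, zero_add, integral_Icc_succ (f := fun x =>
      𝓘 k (n + 1) a' (joinPoint φ x φ₂))
      ((continuous_fioIntegrand hΩ (lam k) ha'c).comp ((continuous_joinPoint (n + 1)).comp
        (continuous_const.prodMk (continuous_id.prodMk continuous_const))))]
    simp only [innerInt, joinPoint]
    congr 1
    ext θ
    congr 1
    ext y
    rw [Fin.cons_snoc_eq_snoc_cons]
  rw [hmain]
  have hrem : ‖∫ θ in s..(s + 2 * π), innerInt q (lam k) a'' φ φ₂ θ‖ ≤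
      C₂ * (k ^ (R + (n + 2)))⁻¹ * V := by
    have := isFiniteMeasure_Icc n (fun _ => 2 * π)
    have h3 : Integrable (fun p : ℝ × (Fin n → ℝ) => 𝓘 k (n + 1) a''
        (vcons φ (joinPoint p.1 p.2 φ₂)))
        ((volume.restrict (Ioc s (s + 2 * π))).prod (volume.restrict (𝕋 n))) := by
      rw [Measure.prod_restrict]
      exact (hI''.continuousOn.integrableOn_compact
        (isCompact_Icc.prod isCompact_Icc)).mono_set (prod_mono Ioc_subset_Icc_self le_rfl)
    simp only [innerInt]
    rw [integral_of_le (by linarith [two_pi_pos]), integral_integral_swap h3]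
    refine norm_setIntegral_le_of_norm_le_const isCompact_Icc.measure_lt_top fun y _ => ?_
    have := hC₂ k hk φ (vsnoc y φ₂)
    rwa [integral_of_le (by linarith [two_pi_pos])] at this
  have hfio : fioKernel q lam (n + 1) m
      (fun k => oneAmp (fun z => (pairCut q b e' z : ℂ) * B k z) (A k)) k φ φ₂ =
      (k ^ (-(m : ℝ) + (((n + 1 : ℕ) : ℝ) + 1) / 2) : ℝ) * ∫ x in 𝕋 (n + 1),
          𝓘 k (n + 1) a' (joinPoint φ x φ₂) := rfl
  rw [hfio, add_sub_cancel_left, norm_mul, norm_of_nonneg (by positivity)]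
  have h5 := rpow_order_le hk m (n + 1)
  calc _ ≤ k ^ (n + 2) * (C₂ * (k ^ (R + (n + 2)))⁻¹ * V) := by gcongr
    _ = C₂ * V * (k ^ R)⁻¹ := by
      field_simp
      ring

/-! ### Composition of `N₁` and a pseudodifferential operator: negligible parts -/

lemma norm_integral_mul_quantize_le {k ρ B s t : ℝ} (hk : 1 ≤ k) (hρ : 0 ≤ ρ) {a : ℝ × ℝ → ℂ}
    (ha : ∀ φ η, a (φ, η) ≠ 0 → |η| ≤ ρ) (hac : Continuous a) {f : ℝ → ℂ} {g : ℝ → ℝ}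
    (hg : Continuous g)
    (hf : ∀ h : ℝ → ℂ, Continuous h → IntervalIntegrable (fun u => f u * h u) volume s t)
    (hB : ∀ η, |η| ≤ ρ → ‖∫ u in s..t, f u * (a (g u, η) * exp (I * (k * η : ℝ) * g u))‖ ≤ B)
    (hB0 : 0 ≤ B) (θ : ℝ) : ‖∫ u in s..t, f u * quantize k a (g u) θ‖ ≤ (2 * ρ + 3) * k * B := by
  have hk0 : 0 < k := by linarith
  have hz : ∀ η, ¬|η| ≤ ρ → ∀ φ, a (φ, η) = 0 := fun η h φ => by
    by_contra h0
    exact h (ha φ η h0)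
  let J : ℝ × ℝ → ℂ := fun z => ∫ u in s..t, f u * (a (g u, z.2) * exp (I * (k * z.2 : ℝ) * g u))
  have hJ : ∀ φ η, J (φ, η) ≠ 0 → |η| ≤ ρ := fun φ η h => by
    by_contra hcon
    exact h (by simp [J, hz η hcon])
  have e : ∫ u in s..t, f u * quantize k a (g u) θ = quantize k J 0 θ := by
    rw [quantize_eq_sum hk0 hJ]
    simp only [quantize_eq_sum hk0 ha]
    have e1 : ∀ u, f u * ((1 / (2 * π) : ℂ) * ∑ n ∈ Finset.Icc (-⌈ρ * k⌉) ⌈ρ * k⌉,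
        a (g u, n / k) * exp (I * n * (g u - θ))) =
        ∑ n ∈ Finset.Icc (-⌈ρ * k⌉) ⌈ρ * k⌉, f u * (a (g u, n / k) *
          exp (I * (k * (n / k) : ℝ) * g u)) *
          ((1 / (2 * π) : ℂ) * exp (I * n * ((0 : ℝ) - θ))) := fun u => by
      rw [mul_sum, mul_sum]
      refine sum_congr rfl fun n _ => ?_
      rw [mul_div_cancel₀ _ hk0.ne', show I * n * (g u - θ) =
        I * (n : ℝ) * g u + I * n * ((0 : ℝ) - θ) by push_cast; ring,
        exp_add]
      ring
    simp only [e1]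
    rw [int_sum fun n _ => (hf _ (by fun_prop)).mul_const _, mul_sum]
    refine sum_congr rfl fun n _ => ?_
    rw [int_mul_const]
    ring
  rw [e]
  refine norm_quantize_le hk hρ hJ (fun η => ?_) θ
  by_cases h : |η| ≤ ρ
  · exact hB η h
  · simpa [J, hz η h] using hB0

/-- The part near the diagonal of the composition of `N₁` and a pseudodifferential operator is
negligible. -/
lemma PsiSymbol.near_negligible (H : Stg) {ρ : ℝ} (hρ0 : 0 ≤ ρ)
    (hρ : ρ ≤ 1 / 2) {V : Set ℂ} {a : ℝ → ℝ × ℝ → ℂ} (ha : PsiSymbol q ρ V a) {u₁ r₁ : ℝ}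
    (hs : NearScale q u₁ r₁) (R : ℕ) : ∃ C, 0 ≤ C ∧ ∀ k, 1 ≤ k → ∀ φ φ₂,
      ‖∫ u in (-π)..π, 𝒩 k 1 φ (φ - u) *
        ((bump r₁ ‖q φ - q (φ - u)‖ : ℂ) * quantize k (a k) (φ - u) φ₂)‖ ≤ C * (k ^ R)⁻¹ := by
  have hN := ha.nearData H hρ hs ((symbolFamily_hankel fun k : ℝ₁ =>
    H.reduced_mem k.2).mul_one_sub_bump H.bump (fun k => k.2) H.half_lt R)
  obtain ⟨C, h0, hC⟩ := (hN.ub H.domain).norm_le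
  refine ⟨(2 * ρ + 3) * C, by positivity, fun k hk φ φ₂ => ?_⟩
  have hkpos : 0 < k := by linarith
  have hkc : (k : ℂ) ≠ 0 := by exact_mod_cast hkpos.ne'
  have hbc := continuous_bump_chord H.domain r₁ φ
  have := norm_integral_mul_quantize_le (B := C * (k ^ R)⁻¹ * k⁻¹) (s := -π) (t := π)
    (g := fun u => φ - u) (f := fun u => 𝒩 k 1 φ (φ - u) *
      (bump r₁ ‖q φ - q (φ - u)‖ : ℂ)) hk hρ0 (fun φ η h => (ha.support k hk φ η h).1)
    (ha.continuous hk) (by fun_prop) (fun h hh => by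
      simpa only [mul_assoc, Pi.mul_apply] using H.intervalIntegrable_mul hk 1 φ (hbc.mul hh))
    (fun η hη => ?_) (by positivity) φ₂
  · simp only [mul_assoc] at this ⊢
    refine this.trans_eq ?_
    field_simp
  have e : ∀ u, 𝒩 k 1 φ (φ - u) * (bump r₁ ‖q φ - q (φ - u)‖ : ℂ) *
      (a k (φ - u, η) * exp (I * (k * η : ℝ) * (φ - u : ℝ))) =
      (((k : ℂ) ^ R)⁻¹ * exp (I * (k * η : ℝ) * φ)) *
      nearIntegrand q r₁ k (τ k / k) (fun x => (k : ℂ) ^ R * (1 - (χ (k ^ (-δ) * x) : ℂ)))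
        (fun p => ((-truncId p.1.2 : ℝ) : ℂ)) (fun p : (ℝ × ℝ) × ℝ => a k (p.1.1 - p.2, p.1.2))
        (φ, η) u := fun u => by
    rw [nearIntegrand, rpow_mul_chord hk, kernelSplit, if_neg (by norm_num), H.lam_eq_mul hk]
    dsimp only
    rw [truncId_eq (hη.trans (hρ.trans (by norm_num))), show I * (k * η : ℝ) *
      (φ - u : ℝ) = I * (k * η : ℝ) * φ + I * k * u * ((-η : ℝ) : ℂ) by push_cast; ring, exp_add]
    field_simp
  simp only [e]
  have h2 := hC ⟨k, hk⟩ (φ, η)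
  rw [norm_mul, norm_of_nonneg hkpos.le, mul_one] at h2
  have h3 : ‖exp (I * (k * η : ℝ) * φ)‖ = 1 := by rw [norm_exp]; simp
  rw [int_const_mul, norm_mul, norm_mul, norm_inv, norm_pow,
    norm_of_nonneg hkpos.le, h3, mul_one, mul_comm C, mul_assoc,
    ← div_eq_mul_inv]
  gcongr
  rwa [le_div_iff₀' hkpos]

/-- The discs of radius `e` about the end points of the orbit. -/
def orbitEnds (q : ℝ → ℂ) (b e : ℝ) : Set ℂ := {z | ∃ p, ‖z - q (pt b p)‖ ≤ e}

lemma exists_near_of_mem_orbitEnds {e θ : ℝ} (h : q θ ∈ orbitEnds q b e) :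
    ∃ p, Near q b e (p + 1) θ :=
  h.imp' (· + 1) fun _ hp => near_add_two.2 hp

lemma FarAmp.psi_remainder (H : Stg) {e e' r₁ c : ℝ}
    {B : ℝ → ℝ × ℝ → ℂ} (hB : FarAmp q r₁ B) (hr₁ : 0 < r₁) (he' : Scale e')
    (he0 : 0 < e) (hee : e ≤ e' / 2) {a : ℝ → ℝ × ℝ → ℂ}
    (ha : PsiSymbol q e (orbitEnds q b e) a) (hc : 0 < c)
    (hadm : Admissible q b e (e' / 2) r₁ c) {s : ℝ}
    (hs : ∀ p, ℓ / 4 < ‖q s - q (pt b p)‖) (N : ℕ) :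
    ∃ C, 0 ≤ C ∧ ∀ k, 1 ≤ k → ∀ φ φ₂, ‖∫ θ in s..(s + 2 * π), exp (I * lam k * (‖q φ - q θ‖ : ℝ)) *
        ((1 - pairCut q b e' (φ, θ) : ℂ) * B k (φ, θ)) * quantize k (a k) θ φ₂‖ ≤
      C * (k ^ N)⁻¹ := by
  have hΩ := H.domain
  let J := ℝ₁ × Icc (-e) e
  let F : J → ℝ × ℝ → ℂ := fun i p => specParam (τ i.1 / i.1) * (smoothDist q (r₁ / 2) p : ℂ) +
    ((i.2 : ℝ) • ofRealCLM.comp (snd ℝ ℝ ℝ)) p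
  let Q : J → ℝ × ℝ → ℂ := fun i p => ((1 - pairCut q b e' p : ℂ) * B i.1 p) * a i.1 (p.2, i.2)
  have hF : UB₁ F := by
    have h1 := ((H.ub_specParam (E := ℝ × ℝ)).mul_bdd
      (UB.smoothDist hΩ (half_pos hr₁)).ofReal).reindex (Prod.fst : J → ℝ₁)
    have h2 := UB₁.affine (fun i : J => (i.2 : ℝ) • ofRealCLM.comp (snd ℝ ℝ ℝ)) 0
      (C := e * ‖ofRealCLM.comp (snd ℝ ℝ ℝ)‖) fun i => by
        rw [norm_smul]
        exact mul_le_mul_of_nonneg_right (abs_le.2 i.2.2) (norm_nonneg _)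
    simpa only [Pi.zero_apply, add_zero] using h1.ub₁.add h2
  have hQ : UB₀ Q := by
    have h1 : UB₀ (fun (_ : J) (p : ℝ × ℝ) => (1 - pairCut q b e' p : ℂ)) := by
      have := ((UB.const (ι := J) (E := ℝ × ℝ) (fun _ => (1 : ℝ)) (fun _ => le_rfl)).sub
        (UB.pairCut hΩ e' (b := b))).ofReal
      exact this.congr fun _ p => by push_cast; rfl
    exact (h1.mul_bdd (hB.ub.reindex (Prod.fst : J → ℝ₁))).mul_bdd
      ((ha.ub.reindex (Prod.fst : J → ℝ₁)).comp ((UB₁.prodMk_const fun i : J =>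
        (i.2 : ℝ)).comp (UB₁.linear (snd ℝ ℝ ℝ))))
  have hzero : ∀ s, (∀ p, ℓ / 4 < ‖q s - q (pt b p)‖) → ∀ i x,
      ∀ᶠ v in 𝓝 s, Q i (x, v) = 0 := fun s hs i x => by
    filter_upwards [eventually_far hΩ hs] with θ hθ
    by_contra hne
    obtain ⟨p, hp⟩ := (ha.support i.1 i.1.2 θ i.2 (right_ne_zero_of_mul hne)).2
    have := hθ p
    linarith [he'.le, he'.pos]
  have hder : ∀ (i : J) x θ, Q i (x, θ) ≠ 0 →
      ∃ d, HasDerivAt (fun θ : ℝ => F i (x, θ)) d θ ∧ c ≤ ‖d‖ := by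
    intro i φ θ hne
    obtain ⟨p, hp⟩ := exists_near_of_mem_orbitEnds
      (ha.support i.1 i.1.2 θ i.2 (right_ne_zero_of_mul hne)).2
    have h3 := hB.support _ _ _ (right_ne_zero_of_mul (left_ne_zero_of_mul hne))
    have h5 : ¬Near q b (e' / 2) p φ := fun hn => left_ne_zero_of_mul (left_ne_zero_of_mul hne) (by
        rw [he'.pairCut_eq (hp.mono hee), endCut_eq_one he'.pos hn, ofReal_one, sub_self])
    have h6 := (hadm p φ θ hp h3 h5).1 i.2 (abs_le.2 i.2.2)
    refine ⟨specParam (τ i.1 / i.1) * (distDeriv q θ φ : ℂ) + (i.2 : ℝ), ?_, ?_⟩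
    · have d1 := hasDerivAt_smoothDist hΩ (half_pos hr₁) (hasDerivAt_const θ φ) (hasDerivAt_id θ)
        (lt_of_lt_of_le (by linarith) h3)
      have d2 := (d1.ofReal_comp.const_mul (specParam (τ i.1 / i.1))).fun_add
        ((hasDerivAt_id θ).ofReal_comp.const_mul ((i.2 : ℝ) : ℂ))
      simpa [F] using d2
    · refine h6.trans (le_trans ?_ (Complex.abs_re_le_norm _))
      simp
  have him : ∀ (i : J) p, Q i p ≠ 0 → 0 ≤ (F i p).im := by
    rintro i p -
    simpa [F] using mul_nonneg (H.reduced_mem i.1.2).1 (smoothDist_pos (half_pos hr₁) p).le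
  obtain ⟨C, h0, hC⟩ := exists_norm_nonstationary_le hF (Λ := fun i : J => (i.1 : ℝ))
    (fun i => i.1.2) hQ hc hder him (show s ≤ s + 2 * π by linarith [two_pi_pos])
    (hzero s hs) (hzero _ (by simpa only [hΩ.periodic s] using hs)) (N + 1)
  refine ⟨(2 * e + 3) * C, by positivity, fun k hk φ φ₂ => ?_⟩
  have hkpos : 0 < k := by linarith
  have hq := hΩ.smooth.continuous
  have hBc : Continuous (B k) := (hB.ub.smooth ⟨k, hk⟩).continuous
  have hWc : Continuous (pairCut q b e') := ((UB.pairCut (ι := Unit) hΩ e').smooth ()).continuous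
  refine (norm_integral_mul_quantize_le (g := id) (B := C * (k ^ (N + 1))⁻¹) hk he0.le
    (fun φ η h => (ha.support k hk φ η h).1) (ha.continuous hk) continuous_id (fun h hh =>
      Continuous.intervalIntegrable (by fun_prop) _ _) (fun η hη => ?_) (by positivity)
      φ₂).trans_eq ?_
  · refine le_of_eq_of_le (congrArg norm (int_congr fun θ _ => ?_))
      (hC (⟨k, hk⟩, ⟨η, abs_le.1 hη⟩) φ)
    by_cases hne : Q (⟨k, hk⟩, ⟨η, abs_le.1 hη⟩) (φ, θ) = 0
    · have h1 : ((1 - pairCut q b e' (φ, θ) : ℂ) * B k (φ, θ)) * a k (θ, η) = 0 := hne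
      rw [hne, mul_zero, mul_assoc, id, ← mul_assoc (_ * _) (a k _), h1, zero_mul, mul_zero]
    have h3 := hB.support _ _ _ (right_ne_zero_of_mul (left_ne_zero_of_mul hne))
    have h4 : (k : ℂ) * (I * F (⟨k, hk⟩, ⟨η, abs_le.1 hη⟩) (φ, θ)) =
        I * lam k * (‖q φ - q θ‖ : ℝ) + I * (k * η : ℝ) * θ := by
      simp only [F]
      rw [smoothDist_eq (half_pos hr₁) (by linarith), H.lam_eq_mul hk]
      simp
      ring
    rw [h4, exp_add, id]
    simp only [Q]
    ring
  · rw [pow_succ]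
    field_simp

/-! ### Composition of `N₁` and a pseudodifferential operator: the main part -/

variable {k u : ι → ℝ}

lemma mul_quantize_eq {k : ℝ} (hk : 0 < k) {ρ : ℝ} {a : ℝ × ℝ → ℂ}
    (ha : ∀ φ η, a (φ, η) ≠ 0 → |η| ≤ ρ) (φ u : ℝ) :
    (k * (exp (I * (-u : ℝ)) - 1)) * quantize k (fun z => a (φ, z.2)) u 0 =
      quantize k (fun z => k * (a (φ, z.2 + 1 / k) - a (φ, z.2))) u 0 := by
  let f : ℤ → ℂ := fun n => a (φ, n / k) * exp (I * n * (u - (0 : ℝ)))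
  have hf : Summable f := by
    refine summable_of_ne_finset_zero (s := Finset.Icc (-⌈ρ * k⌉) ⌈ρ * k⌉) fun n hn => ?_
    have : a (φ, n / k) = 0 := by
      by_contra hcon
      have h1 := ha _ _ hcon
      rw [abs_div, abs_of_pos hk, div_le_iff₀ hk] at h1
      rw [Finset.mem_Icc, ← abs_le] at hn
      exact hn (by exact_mod_cast h1.trans (Int.le_ceil _))
    simp only [f, this, zero_mul]
  have hf1 : Summable fun n => f (n + 1) := (Equiv.addRight (1 : ℤ)).summable_iff.2 hf
  have h1 : ∑' n, f (n + 1) = ∑' n, f n := (Equiv.addRight (1 : ℤ)).tsum_eq f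
  have h2 : ∀ n : ℤ, (k : ℂ) * (a (φ, n / k + 1 / k) - a (φ, n / k)) * exp (I * n * (u - (0 : ℝ))) =
      k * exp (I * (-u : ℝ)) * f (n + 1) - k * f n := fun n => by
    have : exp (I * n * (u - (0 : ℝ))) = exp (I * (-u : ℝ)) *
        exp (I * (n + 1 : ℤ) * (u - (0 : ℝ))) := by
      rw [← exp_add]
      congr 1
      push_cast
      ring
    simp only [f]
    rw [mul_sub, sub_mul, ← add_div, show (n : ℝ) + 1 = (n + 1 : ℤ) by push_cast; rfl, ← mul_assoc]
    nth_rewrite 1 [this]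
    ring
  simp only [quantize, h2]
  rw [(hf1.mul_left _).tsum_sub (hf.mul_left _), tsum_mul_left, tsum_mul_left, h1]
  ring

lemma abs_le_norm_exp_sub_one {u : ℝ} (hu : |u| ≤ π) :
    |u| ≤ 2 * ‖exp (I * (-u : ℝ)) - 1‖ := by
  have h1 := Real.mul_le_sin (x := |u / 2|) (abs_nonneg _) (by rw [abs_div, abs_two]; linarith)
  rw [Complex.norm_exp_I_mul_ofReal_sub_one, neg_div, Real.sin_neg, mul_neg, norm_neg, norm_mul,
    Real.norm_two, norm_eq_abs, Real.abs_sin_eq_sin_abs_of_abs_le_pi (by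
      rw [abs_div, abs_two]; linarith [abs_nonneg u])]
  have h2 : 1 / 2 * |u / 2| ≤ 2 / π * |u / 2| := by
    gcongr ?_ * _
    rw [div_le_div_iff₀ two_pos pi_pos]
    linarith [Real.pi_le_four]
  rw [abs_div, abs_two] at h1 h2
  rw [abs_div, abs_two]
  linarith

/-- The kernel of a pseudodifferential operator decays away from the diagonal. -/
lemma UB.quantize (hk : ∀ i, 1 ≤ k i) (hu : ∀ i, |u i| ≤ π) (N : ℕ) :
    ∀ {ρ : ℝ}, 0 ≤ ρ → ∀ {a : ι → ℝ × ℝ → ℂ}, UB₀ a → (∀ i φ η, a i (φ, η) ≠ 0 → |η| ≤ ρ) →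
      UB (fun i => k i * ((1 + k i * |u i|) ^ N)⁻¹)
        (fun i φ => Billiard.quantize (k i) (fun z => a i (φ, z.2)) (u i) 0) := by
  have hk0 : ∀ i, 0 < k i := fun i => one_pos.trans_le (hk i)
  have hL : ∀ i, 0 < 1 + k i * |u i| := fun i => by
    have := mul_nonneg (hk0 i).le (abs_nonneg (u i)); linarith
  induction N with
  | zero =>
    intro ρ hρ a ha hs
    have h1 : UB₀ (fun (p : ι × ℤ) (φ : ℝ) => a p.1 (φ, p.2 / k p.1) *
        ((1 / (2 * π) : ℂ) * exp (I * p.2 * (u p.1 - (0 : ℝ))))) :=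
      ((ha.reindex Prod.fst).comp (UB₁.prodMk_const fun p : ι × ℤ => p.2 / k p.1)).mul_bdd
        (UB.const _ (C := 1) fun p => by
          have h2 : 1 ≤ ‖(2 * π : ℂ)‖ := by
            rw [norm_mul, norm_ofNat, norm_of_nonneg pi_pos.le]
            linarith [pi_gt_three]
          rw [norm_mul, norm_div, norm_one, norm_exp]
          simpa using inv_le_one_of_one_le₀ h2)
    have e : ∀ i, (fun φ => Billiard.quantize (k i) (fun z => a i (φ, z.2)) (u i) 0) =
        fun φ => ∑ n ∈ Finset.Icc (-⌈ρ * k i⌉) ⌈ρ * k i⌉, a i (φ, n / k i) *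
          ((1 / (2 * π) : ℂ) * exp (I * n * (u i - (0 : ℝ)))) := fun i =>
      funext fun φ => by
        rw [quantize_eq_sum (hk0 i) fun _ η h => hs i φ η h, mul_sum]
        exact sum_congr rfl fun n _ => mul_left_comm _ _ _
    refine .of_bound (fun i => mul_nonneg (hk0 i).le (by have := hL i; positivity))
      (fun i => by rw [e]; exact ContDiff.sum fun n _ => h1.smooth (i, n)) fun j => ?_
    obtain ⟨C, h0, hC⟩ := h1.bound j
    refine ⟨(2 * ρ + 3) * C, fun i φ => ?_⟩
    rw [e, iteratedFDeriv_fun_sum_apply fun n _ =>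
      (h1.smooth (i, n)).contDiffAt.of_le (by exact_mod_cast le_top)]
    refine (norm_sum_le_of_le _ fun n _ => hC (i, n) φ).trans ?_
    rw [Finset.sum_const, nsmul_eq_mul, pow_zero, inv_one, mul_one, mul_one, mul_right_comm]
    exact mul_le_mul_of_nonneg_right (card_Icc_ceil_le (hk i) hρ) h0
  | succ N ih =>
    intro ρ hρ a ha hs
    let a' : ι → ℝ × ℝ → ℂ := fun i z => diffQuot (a i) (0, 1) (z, 1 / k i)
    have e1 : ∀ i φ η, a' i (φ, η) = k i * (a i (φ, η + 1 / k i) - a i (φ, η)) := fun i φ η => by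
      have := smul_diffQuot (ha.smooth i) (0, 1) (φ, η) (1 / k i)
      rw [show ((φ, η) : ℝ × ℝ) + (1 / k i) • ((0, 1) : ℝ × ℝ) = (φ, η + 1 / k i) by
        ext <;> simp] at this
      rw [← this, real_smul, ← mul_assoc, ← ofReal_mul,
        mul_one_div_cancel (hk0 i).ne', ofReal_one, one_mul]
    have ha' : UB₀ a' := (ha.ub₁.diffQuot (0, 1)).comp (UB₁.prodMk_const fun i => 1 / k i)
    obtain h1 := ih hρ ha hs
    have h2 := ih (by linarith : 0 ≤ ρ + 1) ha' fun i φ η hne => by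
      have hki : |1 / k i| ≤ 1 := by
        rw [abs_of_pos (by have := hk0 i; positivity)]
        exact (div_le_one (hk0 i)).2 (hk i)
      by_contra! hcon
      refine hne ?_
      have h3 : a i (φ, η) = 0 := by by_contra h; linarith [hs i φ η h]
      have h4 : a i (φ, η + 1 / k i) = 0 := by
        by_contra h
        have := abs_sub_abs_le_abs_sub η (-(1 / k i))
        rw [sub_neg_eq_add, abs_neg] at this
        linarith [hs i φ _ h]
      rw [e1, h3, h4, sub_zero, mul_zero]
    refine .of_bound (fun i => mul_nonneg (hk0 i).le (by have := hL i; positivity)) h1.smooth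
      fun j => ?_
    obtain ⟨C₁, h01, hC₁⟩ := h1.bound j
    obtain ⟨C₂, h02, hC₂⟩ := h2.bound j
    refine ⟨C₁ + 2 * C₂, fun i φ => ?_⟩
    set x := ‖𝐃 j (fun φ => Billiard.quantize (k i) (fun z => a i (φ, z.2)) (u i) 0) φ‖ with hx
    have h5 : k i * ‖exp (I * (-u i : ℝ)) - 1‖ * x ≤ C₂ * (k i * ((1 + k i * |u i|) ^ N)⁻¹) := by
      refine le_of_eq_of_le ?_ (hC₂ i φ)
      have e2 : (fun φ => Billiard.quantize (k i) (fun z => a' i (φ, z.2)) (u i) 0) =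
          fun φ => (k i * (exp (I * (-u i : ℝ)) - 1)) •
            Billiard.quantize (k i) (fun z => a i (φ, z.2)) (u i) 0 := funext fun φ => by
        rw [smul_eq_mul, mul_quantize_eq (hk0 i) (hs i)]
        simp only [e1]
      rw [e2, iteratedFDeriv_const_smul_apply'
        ((h1.smooth i).contDiffAt.of_le (by exact_mod_cast le_top)), norm_smul, norm_mul,
        norm_of_nonneg (hk0 i).le]
    have h6 := hC₁ i φ
    have h7 := mul_le_mul_of_nonneg_right (mul_le_mul_of_nonneg_left
      (abs_le_norm_exp_sub_one (hu i)) (hk0 i).le) (norm_nonneg _ : 0 ≤ x)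
    have h8 : (1 + k i * |u i|) * x ≤ (C₁ + 2 * C₂) * (k i * ((1 + k i * |u i|) ^ N)⁻¹) := by
      linarith
    rw [pow_succ, mul_inv, ← mul_assoc (k i), ← mul_assoc, ← div_eq_mul_inv, le_div_iff₀ (hL i)]
    linarith

variable {ρ : ℝ} {V : Set ℂ} {a : ℝ → ℝ × ℝ → ℂ}

lemma PsiSymbol.ub_quantize (ha : PsiSymbol q ρ V a) (hρ : 0 ≤ ρ) (N : ℕ) :
    UB (fun i : ℝ₁ × Icc (-π) π => (i.1 : ℝ) * ((1 + (i.1 : ℝ) * |(i.2 : ℝ)|) ^ N)⁻¹)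
      (fun i φ => quantize i.1 (a i.1) (φ - i.2) φ) := by
  have h1 := (ha.ub.reindex (Prod.fst : ℝ₁ × Icc (-π) π → _)).comp
    (UB₁.affine (fun _ => ContinuousLinearMap.id ℝ (ℝ × ℝ)) (fun i => (-(i.2 : ℝ), (0 : ℝ)))
      fun _ => le_rfl)
  have h2 := UB.quantize (k := fun i : ℝ₁ × Icc (-π) π => (i.1 : ℝ))
    (u := fun i => -(i.2 : ℝ)) (fun i => i.1.2) (fun i => by rw [abs_neg]; exact abs_le.2 i.2.2) N
    hρ h1 fun i φ η h => (ha.support i.1 i.1.2 _ _ h).1.trans' (by simp)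
  simp only [abs_neg] at h2
  refine h2.congr fun i φ => ?_
  simp only [quantize]
  congr 2
  ext n
  simp only [ContinuousLinearMap.id_apply, Prod.mk_add_mk, add_zero, ← sub_eq_add_neg]
  congr 3
  push_cast
  ring

lemma exp_mul_log_le {k u : ℝ} (hk : 1 ≤ k) (hu : |u| ≤ π) :
    Real.exp (|u| / π * Real.log k) ≤ 1 + k * |u| := by
  have hp := pi_gt_three
  have h1 := rpow_one_add_le_one_add_mul_self (s := k - 1) (p := |u| / π) (by linarith)
    (by positivity) ((div_le_one (by linarith)).2 hu)
  rw [add_sub_cancel, Real.rpow_def_of_pos (by linarith), mul_comm (Real.log k)] at h1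
  have h2 : |u| / π ≤ |u| := div_le_self (abs_nonneg u) (by linarith)
  nlinarith [abs_nonneg u, mul_le_mul_of_nonneg_right h2 (sub_nonneg.2 hk)]

lemma integral_scaled_le {k : ℝ} (hk : 0 < k) (s : Set ℝ) :
    Integrable (fun u => k * (1 + (k * u) ^ 2)⁻¹) (volume.restrict s) ∧
      ∫ u in s, k * (1 + (k * u) ^ 2)⁻¹ ≤ π := by
  have h1 : Integrable fun u => k * (1 + (k * u) ^ 2)⁻¹ :=
    (integrable_inv_one_add_sq.comp_mul_left' hk.ne').const_mul k
  refine ⟨h1.restrict, (setIntegral_le_integral h1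
    (Eventually.of_forall fun u => by positivity)).trans_eq ?_⟩
  rw [integral_const_mul, Measure.integral_comp_mul_left (fun u : ℝ => (1 + u ^ 2)⁻¹),
    integral_univ_inv_one_add_sq, abs_of_pos (inv_pos.2 hk), smul_eq_mul,
    mul_inv_cancel_left₀ hk.ne']

/-- The amplitude of the composition of the kernel away from the diagonal and a
pseudodifferential operator. -/
def psiAmp (q : ℝ → ℂ) (l : ℂ) (r k : ℝ) (W a : ℝ × ℝ → ℂ) : ℝ × ℝ → ℂ := fun x => ∫ u in (-π)..π,
    exp (I * l * ((smoothDist q r (x.1, x.2 - u) - smoothDist q r x : ℝ) : ℂ)) *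
      (quantize k a (x.2 - u) x.2 * W (x.1, x.2 - u))

lemma ub_psiAmp (H : Stg) {r : ℝ} (hr : 0 < r) (hρ : 0 ≤ ρ)
    (ha : PsiSymbol q ρ V a) {W : ℝ → ℝ × ℝ → ℂ} (hW : UB₀ fun (k : ℝ₁) => W k) :
    UB₀ (fun (k : ℝ₁) => psiAmp q (lam k) r k (W k) (a k)) := by
  have hR : UB₀ (fun (_ : ℝ₁) => smoothDist q r) := UB.smoothDist H.domain hr
  have hD := hR.ub₁.diffQuot (0, -1)
  obtain ⟨C, h0, hC⟩ := hD.norm_le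
  have hDR : ∀ (k : ℝ₁) (x : ℝ × ℝ) (u : ℝ), smoothDist q r (x.1, x.2 - u) - smoothDist q r x =
        u * diffQuot (smoothDist q r) (0, -1) (x, u) := fun k x u => by
    have := smul_diffQuot (hR.smooth k) (0, -1) x u
    rw [smul_eq_mul] at this
    rw [this]
    congr 2
    ext <;> simp [sub_eq_add_neg]
  have hpi := pi_pos
  suffices h : UB (fun _ : ℝ₁ => π) (fun k => psiAmp q (lam k) r k (W k) (a k)) from
    h.mono hpi.le (fun _ => zero_le_one) fun _ => (mul_one _).ge
  unfold psiAmp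
  simp only [integral_of_le (by linarith : -π ≤ π)]
  refine UB.integral (f := fun (k : ℝ₁) (p : (ℝ × ℝ) × ℝ) => exp (I *
    lam k * ((smoothDist q r (p.1.1, p.1.2 - p.2) - smoothDist q r p.1 : ℝ) : ℂ)) *
      (quantize k (a k) (p.1.2 - p.2) p.1.2 * W k (p.1.1, p.1.2 - p.2)))
    isOpen_univ (fun k => ContDiff.contDiffOn ?_) (fun _ => Eventually.of_forall fun _ => mem_univ _)
    (m := fun k u => (k : ℝ) * (1 + (k * u) ^ 2)⁻¹)
    (fun k => (integral_scaled_le (one_pos.trans_le k.2) _).1)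
    (fun k => (integral_scaled_le (one_pos.trans_le k.2) _).2) (fun _ => hpi.le) fun j => ?_
  · have h1 := hR.smooth k
    have h2 := hW.smooth k
    have h3 := ha.ub.smooth k
    have h4 : Smooth Complex.ofReal := ofRealCLM.contDiff
    simp only [quantize_eq_sum (one_pos.trans_le k.2) fun φ η h => (ha.support k k.2 φ η h).1]
    fun_prop
  set P := ⌈C * T * π⌉₊
  let J := ℝ₁ × Icc (-π) π
  have hk : ∀ i : J, (1 : ℝ) ≤ i.1 := fun i => i.1.2
  have hL : ∀ i : J, 1 ≤ 1 + (i.1 : ℝ) * |(i.2 : ℝ)| := fun i =>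
    le_add_of_nonneg_right (mul_nonneg (zero_le_one.trans (hk i)) (abs_nonneg _))
  let g : J → ℝ × ℝ → ℂ := fun i x => (((i.1 : ℝ) * i.2 / (1 + (i.1 : ℝ) * |(i.2 : ℝ)|) : ℝ) : ℂ) *
    (I * (specParam (τ i.1 / i.1) * (diffQuot (smoothDist q r) (0, -1) (x, i.2) : ℝ)))
  have hg : UB₀ g := by
    refine (UB.const _ (C := 1) fun i => ?_).mul_bdd ((UB.const (fun _ => I) (C := 1)
      fun _ => by simp).mul_bdd ((H.ub_specParam.reindex Prod.fst).mul_bdd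
      ((hD.reindex Prod.fst).comp (UB₁.prodMk_const fun i : J => (i.2 : ℝ))).ofReal))
    have := hL i
    rw [norm_real, norm_div, norm_mul, Real.norm_of_nonneg (zero_le_one.trans (hk i)),
      Real.norm_of_nonneg (zero_le_one.trans this), norm_eq_abs]
    exact (div_le_one (by linarith)).2 (by linarith)
  have hB := ((ha.ub_quantize hρ (j + P + 2)).comp (UB₁.linear (snd ℝ ℝ ℝ))
    ).mul_bdd ((hW.reindex (Prod.fst : J → _)).comp (UB₁.affine
      (fun _ => ContinuousLinearMap.id ℝ (ℝ × ℝ)) (fun i => ((0 : ℝ), -(i.2 : ℝ))) fun _ => le_rfl))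
  have hLg : ∀ (i : J) x, (1 + (i.1 : ℝ) * |(i.2 : ℝ)| : ℝ) * g i x = I * lam i.1 *
      ((smoothDist q r (x.1, x.2 - i.2) - smoothDist q r x : ℝ) : ℂ) := fun i x => by
    have : ((1 + (i.1 : ℝ) * |(i.2 : ℝ)| : ℝ) : ℂ) ≠ 0 := by
      exact_mod_cast (one_pos.trans_le (hL i)).ne'
    simp only [g]
    rw [hDR i.1, H.lam_eq_mul i.1.2]
    push_cast at this ⊢
    field_simp
  obtain ⟨C', h0', hC'⟩ := UB.cexp_mul hg.ub₁ hL hB (κ := fun i : J => τ i.1 * (|(i.2 : ℝ)| * C))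
    (fun i x _ => by
      have h1 : (1 + (i.1 : ℝ) * |(i.2 : ℝ)|) * (g i x).re =
          τ i.1 * -((i.2 : ℝ) * diffQuot (smoothDist q r) (0, -1) (x, (i.2 : ℝ))) := by
        rw [← Complex.re_ofReal_mul, hLg, hDR i.1, H.lam_eq]
        simp
      rw [h1]
      refine mul_le_mul_of_nonneg_left ((neg_le_abs _).trans ?_) (H.tau _ (hk i)).1
      rw [abs_mul]
      have := hC i.1 (x, (i.2 : ℝ))
      rw [mul_one] at this
      gcongr
      exact this) j
  refine ⟨C' * Real.exp P, by positivity, fun k => ?_⟩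
  filter_upwards [ae_restrict_mem measurableSet_Ioc] with u hu x
  have hk1 : (1 : ℝ) ≤ k := k.2
  have hu' : |u| ≤ π := abs_le.2 ⟨hu.1.le, hu.2⟩
  let i : J := (k, ⟨u, hu.1.le, hu.2⟩)
  have h1 := hC' i x
  simp only [hLg i] at h1
  have hfun : (fun x : ℝ × ℝ => exp (I * lam k *
      ((smoothDist q r (x.1, x.2 - u) - smoothDist q r x : ℝ) : ℂ)) *
      (quantize k (a k) (x.2 - u) x.2 * W k (x.1, x.2 - u))) =
      fun x => exp (I * lam k *
      ((smoothDist q r (x.1, x.2 - u) - smoothDist q r x : ℝ) : ℂ)) *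
      (quantize k (a k) (snd ℝ ℝ ℝ x - u) (snd ℝ ℝ ℝ x) *
        W k (ContinuousLinearMap.id ℝ (ℝ × ℝ) x + ((0 : ℝ), -u))) := funext fun x => by
    congr 3
    ext <;> simp [sub_eq_add_neg]
  rw [hfun]
  refine h1.trans ?_
  simp only [i]
  rw [mul_assoc C']
  refine mul_le_mul_of_nonneg_left ?_ h0'
  set L := 1 + (k : ℝ) * |u| with hLdef
  have hL0 : 1 ≤ L := hL i
  have hP : C * T * π ≤ P := Nat.le_ceil _
  have hlog := Real.log_nonneg hk1
  have h2 : Real.exp (τ k * (|u| * C)) ≤ Real.exp P * L ^ P := by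
    refine le_trans ?_ (mul_le_mul_of_nonneg_left (pow_le_pow_left₀ (Real.exp_pos _).le
      (exp_mul_log_le hk1 hu') P) (Real.exp_pos _).le)
    rw [← Real.exp_nat_mul, ← Real.exp_add]
    refine Real.exp_le_exp.2 ?_
    have h3 : τ k * (|u| * C) ≤ T * (1 + Real.log k) * (|u| * C) := by
      have := (H.tau k hk1).2
      gcongr
    have h4 : T * (1 + Real.log k) * (|u| * C) =
        C * T * π * (|u| / π) + C * T * π * (|u| / π * Real.log k) := by
      field_simp
    have h5 : |u| / π ≤ 1 := (div_le_one hpi).2 hu'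
    have h6 : 0 ≤ C * T * π := mul_nonneg (mul_nonneg h0 H.T_nonneg) hpi.le
    have h7 := mul_le_of_le_one_right h6 h5
    have h8 := mul_le_mul_of_nonneg_right hP (by positivity : 0 ≤ |u| / π * Real.log k)
    linarith
  have h9 : (L ^ 2)⁻¹ ≤ (1 + (k * u) ^ 2)⁻¹ := by
    refine inv_anti₀ (by positivity) ?_
    have : (k * u) ^ 2 = ((k : ℝ) * |u|) ^ 2 := by rw [mul_pow, mul_pow, sq_abs]
    rw [this, hLdef]
    nlinarith [mul_nonneg (zero_le_one.trans hk1) (abs_nonneg u)]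
  calc _ ≤ L ^ j * (Real.exp P * L ^ P * (k * (L ^ (j + P + 2))⁻¹)) := by gcongr
    _ = Real.exp P * (k * (L ^ 2)⁻¹) := by
      rw [pow_add, pow_add]
      field_simp
    _ ≤ _ := by gcongr

variable {a : ℝ → ℝ × ℝ → ℂ} {e e' r : ℝ}

lemma pairCut_comm (x y : ℝ) : pairCut q b e (x, y) = pairCut q b e (y, x) := by
  simp only [pairCut]
  ring

lemma exists_near_of_pairCut (he : 0 < e) {z : ℝ × ℝ} (h : pairCut q b e z ≠ 0) :
    ∃ p, Near q b e p z.1 ∧ Near q b e (p + 1) z.2 := by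
  have h1 : ∀ p x, endCut q b e p x ≠ 0 → Near q b e p x := fun p x hne => by
    by_contra hcon
    exact hne (endCut_eq_zero he (not_le.1 hcon).le)
  by_cases h0 : endCut q b e 0 z.1 * endCut q b e 1 z.2 = 0
  · rw [pairCut, h0, zero_add] at h
    exact ⟨1, h1 _ _ (left_ne_zero_of_mul h), near_add_two.2 (h1 _ _ (right_ne_zero_of_mul h))⟩
  · exact ⟨0, h1 _ _ (left_ne_zero_of_mul h0), h1 _ _ (right_ne_zero_of_mul h0)⟩

lemma exists_ne_of_quantize {k : ℝ} {a : ℝ × ℝ → ℂ} {φ θ : ℝ} (h : quantize k a φ θ ≠ 0) :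
    ∃ η, a (φ, η) ≠ 0 := by
  by_contra! hcon
  exact h (by simp [quantize, hcon])

/-- The amplitude of the Fourier integral kernel obtained by composing `N₁` and a
pseudodifferential operator. -/
lemma FarAmp.psi_symbol (H : Stg) {B : ℝ → ℝ × ℝ → ℂ} (hB : FarAmp q r B)
    (hr : 0 < r) (he0 : 0 < e) (he' : 0 < e') (ha : PsiSymbol q e (orbitEnds q b e) a) :
    FioSymbol q b e' 0 fun k x => psiAmp q (lam k) (r / 2) k
      (fun z => (pairCut q b (e' / 2) z : ℂ) * B k z) (a k) (x 0, x 1) *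
        (pairCut q b e' (x 0, x 1) : ℂ) := by
  have hΩ := H.domain
  have hq : ∀ {φ}, q (φ + 2 * π) = q φ := hΩ.periodic _
  refine ⟨?_, fun k hk x i => ?_, fun k hk x hne => ?_⟩
  · have h1 : UB₁ (fun (_ : ℝ₁) (x : Fin 2 → ℝ) => (x 0, x 1)) := UB₁.linear
      ((proj (R := ℝ) (φ := fun _ : Fin 2 => ℝ) 0).prod (proj (R := ℝ) (φ := fun _ : Fin 2 => ℝ) 1))
    have h2 := (UB.pairCut hΩ (e' / 2) (b := b)).ofReal.mul_bdd hB.ub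
    have h3 := ub_psiAmp H (half_pos hr) he0.le ha
      (W := fun k z => (pairCut q b (e' / 2) z : ℂ) * B k z) h2
    exact (h3.mul_bdd (UB.pairCut hΩ e').ofReal).comp h1
  · have h1 : ∀ φ θ u, B k (φ + 2 * π, θ - u) = B k (φ, θ - u) := fun φ θ u =>
      hB.congr _ _ _ _ _ hq rfl rfl
    have hsub : ∀ θ u : ℝ, θ + 2 * π - u = θ - u + 2 * π := fun θ u => by ring
    have h2 : ∀ φ θ u, B k (φ, θ + 2 * π - u) = B k (φ, θ - u) := fun φ θ u => by
      rw [hsub]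
      exact hB.congr _ _ _ _ _ rfl hq (hΩ.normal_periodic _)
    have h3 : ∀ θ u, quantize k (a k) (θ + 2 * π - u) (θ + 2 * π) =
        quantize k (a k) (θ - u) θ := fun θ u => by
      rw [hsub]
      simp only [quantize, ha.periodic k hk]
      congr 2
      ext n
      congr 3
      push_cast
      ring
    have h4 : ∀ θ u, q (θ + 2 * π - u) = q (θ - u) := fun θ u => by rw [hsub, hq]
    fin_cases i
    · simp [psiAmp, pairCut, endCut, smoothDist, h1, hq]
    · simp [psiAmp, pairCut, endCut, smoothDist, h2, h3, h4, hq]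
  · obtain ⟨p, h1, h2⟩ := exists_near_of_pairCut he' (by
      exact_mod_cast right_ne_zero_of_mul hne : pairCut q b e' (x 0, x 1) ≠ 0)
    exact ⟨p, fun j => by fin_cases j; exacts [h1, h2]⟩

lemma fioKernel_zero (m : ℕ) (A : ℝ → (Fin 2 → ℝ) → ℂ) (k φ φ₂ : ℝ) :
    fioKernel q lam 0 m A k φ φ₂ = (k ^ (-(m : ℝ) + 1 / 2) : ℝ) *
      (exp (I * lam k * (‖q φ - q φ₂‖ : ℝ)) * A k ![φ, φ₂]) := by
  have hj : ∀ θ : Fin 0 → ℝ, joinPoint φ θ φ₂ = ![φ, φ₂] := fun θ => by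
    ext j
    fin_cases j <;> rfl
  have hI : 𝕋 0 = univ :=
    eq_univ_of_forall fun x => by rw [Subsingleton.elim x 0]; exact ⟨le_rfl, fun i => i.elim0⟩
  have hp : pathLength q 0 ![φ, φ₂] = ‖q φ - q φ₂‖ := by simp [pathLength]
  rw [fioKernel, hI, setIntegral_univ, volume_pi, Measure.pi_of_empty, integral_dirac, hj,
    fioIntegrand, hp]
  simp

/-- Composition with `N₁` turns a pseudodifferential operator into a Fourier integral kernel. -/
theorem PsiForm.comp_one (H : Stg) (hb : Bounce) {u₁ c : ℝ}
    (he' : Scale e') (he0 : 0 < e) (hee : e ≤ e' / 4) (he1 : e ≤ 1 / 2)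
    (hs : NearScale q u₁ r) (hr : r ≤ ℓ / 16) (hc : 0 < c)
    (hadm : Admissible q b e (e' / 4) r c) {m : ℕ} {X : ℝ → ℝ → ℝ → ℂ}
    (h : PsiForm q e (orbitEnds q b e) m X) :
    FioForm q lam b e' 0 m fun k => compKernel (𝒩 k 1) (X k) := by
  obtain ⟨a, ha, k₀, hX⟩ := h
  have hΩ := H.domain
  have hr0 := hs.pos
  have he0' := he'.pos
  have he2 := he'.mono (half_pos he0') (half_le_self he0'.le)
  obtain ⟨B, hB, k₁, hk₁⟩ := H.exists_farAmp hr0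
  obtain ⟨s, hfar⟩ := exists_far_point hΩ hb
  refine ⟨_, hB.psi_symbol H hr0 he0 he0' ha, max k₀ k₁, fun R => ?_⟩
  obtain ⟨C₁, h1, hC₁⟩ := ha.near_negligible H he0.le he1 hs R
  obtain ⟨C₂, h2, hC₂⟩ := hB.psi_remainder H hr0 he2 he0 (by linarith) ha hc
    (by rwa [show e' / 2 / 2 = e' / 4 by ring]) hfar (R + 1)
  obtain ⟨C₃, h3, hC₃⟩ := (ha.ub_quantize he0.le (R + 2)).norm_le
  obtain ⟨C₄, h4, hC₄⟩ := ((UB.pairCut (b := b) hΩ (e' / 2)).ofReal.mul_bdd hB.ub).norm_le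
  obtain ⟨C₅, h5, hC₅⟩ := ((UB.const (ι := Unit) (E := ℝ × ℝ) (fun _ => (1 : ℝ))
    (fun _ => le_rfl)).sub (UB.pairCut (b := b) hΩ e')).norm_le
  set D := C₅ * (C₃ * ((e' / 4) ^ (R + 2))⁻¹ * C₄) * (2 * π) with hD
  have hpi := pi_pos
  refine ⟨C₁ + (C₂ + D), by positivity, fun k hk hkk φ φ₂ => ?_⟩
  have hkpos : 0 < k := by linarith
  set W : ℝ × ℝ → ℂ := fun z => (pairCut q b (e' / 2) z : ℂ) * B k z with hW
  set P := ∫ u in (-π)..π, exp (I * lam k * (‖q φ - q (φ₂ - u)‖ : ℝ)) *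
    (quantize k (a k) (φ₂ - u) φ₂ * W (φ, φ₂ - u)) with hP
  have hq := hΩ.smooth.continuous
  have hBc : Continuous (B k) := (hB.ub.smooth ⟨k, hk⟩).continuous
  have hWc : Continuous (pairCut q b (e' / 2)) :=
    ((UB.pairCut (ι := Unit) hΩ (e' / 2)).smooth ()).continuous
  have hlr := ha.leftRegular hk
  have hK : Continuous fun θ => quantize k (a k) θ φ₂ := hlr.continuous φ₂
  have hX' : X k = fun φ₁ φ₂ => ((k : ℂ) ^ m)⁻¹ * quantize k (a k) φ₁ φ₂ :=
    funext fun φ₁ => funext fun φ₂ => hX k hk ((le_max_left _ _).trans hkk) φ₁ φ₂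
  have e1 : compKernel (𝒩 k 1) (X k) φ φ₂ =
      ((k : ℂ) ^ m)⁻¹ * compKernel (𝒩 k 1) (quantize k (a k)) φ φ₂ := by
    rw [hX', compKernel, compKernel, ← int_const_mul]
    simp only [mul_left_comm]
  have e2 : ∫ θ in s..(s + 2 * π), exp (I * lam k * (‖q φ - q θ‖ : ℝ)) *
      B k (φ, θ) * quantize k (a k) θ φ₂ = (∫ θ in s..(s + 2 * π),
        exp (I * lam k * (‖q φ - q θ‖ : ℝ)) *
          ((1 - pairCut q b (e' / 2) (φ, θ) : ℂ) * B k (φ, θ)) * quantize k (a k) θ φ₂) + P := by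
    have hper : Periodic (fun θ => exp (I * lam k * (‖q φ - q θ‖ : ℝ)) *
        (quantize k (a k) θ φ₂ * W (φ, θ))) (2 * π) := fun θ => by
      have : quantize k (a k) (θ + 2 * π) φ₂ = quantize k (a k) θ φ₂ := hlr.periodic φ₂ θ
      simp only [hW]
      rw [hΩ.periodic, this, pairCut_congr rfl (hΩ.periodic θ),
        hB.congr k φ φ _ _ rfl (hΩ.periodic θ) (hΩ.normal_periodic θ)]
    have e0 := hper.intervalIntegral_add_eq s 0
    rw [zero_add] at e0
    rw [hP, ← integral_period_eq hper φ₂, ← e0, ← int_add]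
    · congr 1
      ext θ
      simp only [hW]
      ring
    · exact Continuous.intervalIntegrable (by fun_prop) _ _
    · exact Continuous.intervalIntegrable (by fun_prop) _ _
  have e3 : exp (I * lam k * (‖q φ - q φ₂‖ : ℝ)) *
      (psiAmp q (lam k) (r / 2) k W (a k) (φ, φ₂) * (pairCut q b e' (φ, φ₂) : ℂ)) =
      (pairCut q b e' (φ, φ₂) : ℂ) * P := by
    by_cases h0 : pairCut q b e' (φ, φ₂) = 0
    · simp [h0]
    obtain ⟨p, hp, hp'⟩ := exists_near_of_pairCut he0' h0
    have h6 := hp.le_norm hp'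
    rw [psiAmp, hP, ← mul_assoc, mul_comm _ (pairCut q b e' (φ, φ₂) : ℂ), ← int_const_mul]
    congr 2
    ext u
    by_cases hB0 : B k (φ, φ₂ - u) = 0
    · simp [hW, hB0]
    have h7 := hB.support _ _ _ hB0
    rw [smoothDist_eq (half_pos hr0) (by linarith : r / 2 ≤ ‖q φ - q (φ₂ - u)‖),
      smoothDist_eq (half_pos hr0) (by linarith [he'.le] : r / 2 ≤ ‖q φ - q φ₂‖), ← mul_assoc,
      ← exp_add]
    congr 2
    push_cast
    ring
  have hPb : ‖((1 - pairCut q b e' (φ, φ₂) : ℝ) : ℂ) * P‖ ≤ D * (k ^ (R + 1))⁻¹ := by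
    rw [hP, ← int_const_mul]
    refine (intervalIntegral.norm_integral_le_of_norm_le_const (C := C₅ *
      (C₃ * ((e' / 4) ^ (R + 2))⁻¹ * C₄) * (k ^ (R + 1))⁻¹) fun u hu => ?_).trans_eq ?_
    · rw [uIoc_of_le (by linarith)] at hu
      by_cases h0 : ((1 - pairCut q b e' (φ, φ₂) : ℝ) : ℂ) = 0 ∨
        quantize k (a k) (φ₂ - u) φ₂ * W (φ, φ₂ - u) = 0
      · rcases h0 with h0 | h0 <;> (rw [h0]; simp; positivity)
      push Not at h0
      obtain ⟨η, hη⟩ := exists_ne_of_quantize (left_ne_zero_of_mul h0.2)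
      obtain ⟨p, hp⟩ := exists_near_of_mem_orbitEnds (ha.support k hk _ _ hη).2
      have h6 : ‖q (φ₂ - u) - q (pt b (p + 1))‖ ≤ e := hp
      have h7 : Near q b (e' / 2) p φ := by
        by_contra hcon
        refine left_ne_zero_of_mul (right_ne_zero_of_mul h0.2) ?_
        rw [he2.pairCut_eq (hp.mono (by linarith)), endCut_eq_zero he2.pos (not_le.1 hcon).le,
          ofReal_zero]
      have h8 : ¬Near q b (e' / 2) (p + 1) φ₂ := fun hn => h0.1 (by
        rw [pairCut_comm, he'.pairCut_eq (p := p + 1) (near_add_two.2 h7), endCut_eq_one he0' hn,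
          sub_self, ofReal_zero])
      rw [Near, not_le] at h8
      have h9 : e' / 4 ≤ |u| := by
        linarith [hΩ.norm_chord_le φ₂ u, norm_sub_le_norm_sub_add_norm_sub (q φ₂) (q (φ₂ - u))
          (q (pt b (p + 1)))]
      have h10 := hC₃ (⟨k, hk⟩, ⟨u, hu.1.le, hu.2⟩) φ₂
      have h11 : k * ((1 + k * |u|) ^ (R + 2))⁻¹ ≤ ((e' / 4) ^ (R + 2))⁻¹ * (k ^ (R + 1))⁻¹ := by
        have : ((1 + k * |u|) ^ (R + 2))⁻¹ ≤ ((k * (e' / 4)) ^ (R + 2))⁻¹ :=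
          inv_anti₀ (by positivity) (pow_le_pow_left₀ (by positivity) (by nlinarith) _)
        refine (mul_le_mul_of_nonneg_left this hkpos.le).trans_eq ?_
        rw [mul_pow, pow_succ k (R + 1)]
        field_simp
      have h12 := hC₄ ⟨k, hk⟩ (φ, φ₂ - u)
      have h13 := hC₅ () (φ, φ₂)
      rw [mul_one] at h12 h13
      rw [norm_mul, norm_mul, norm_mul, norm_real]
      calc _ ≤ C₅ * (1 * (C₃ * (((e' / 4) ^ (R + 2))⁻¹ * (k ^ (R + 1))⁻¹) * C₄)) :=
            mul_le_mul h13 (mul_le_mul (H.norm_exp_le_one hk (norm_nonneg _))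
              (mul_le_mul (h10.trans (mul_le_mul_of_nonneg_left h11 h3)) h12 (norm_nonneg _)
                (by positivity)) (by positivity) zero_le_one) (by positivity) h5
        _ = _ := by ring
    · rw [hD, sub_neg_eq_add, abs_of_pos (by linarith)]
      ring
  have hm : (k ^ (-(m : ℝ) + 1 / 2) : ℝ) = (k ^ m)⁻¹ * k ^ (1 / 2 : ℝ) := by
    rw [rpow_add hkpos, rpow_neg hkpos.le, rpow_natCast]
  have hsum : compKernel (𝒩 k 1) (X k) φ φ₂ -
      fioKernel q lam 0 m (fun k x => psiAmp q (lam k) (r / 2) k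
        (fun z => (pairCut q b (e' / 2) z : ℂ) * B k z) (a k) (x 0, x 1) *
        (pairCut q b e' (x 0, x 1) : ℂ)) k φ φ₂ = ((k : ℂ) ^ m)⁻¹ *
      ((∫ u in (-π)..π, 𝒩 k 1 φ (φ - u) *
        ((bump r ‖q φ - q (φ - u)‖ : ℂ) * quantize k (a k) (φ - u) φ₂)) +
      (k ^ (1 / 2 : ℝ) : ℝ) * ((∫ θ in s..(s + 2 * π), exp (I * lam k * (‖q φ - q θ‖ : ℝ)) *
          ((1 - pairCut q b (e' / 2) (φ, θ) : ℂ) * B k (φ, θ)) * quantize k (a k) θ φ₂) +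
        ((1 - pairCut q b e' (φ, φ₂) : ℝ) : ℂ) * P)) := by
    rw [e1, H.compKernel_one_eq hB hk (hk₁ k hk ((le_max_right _ _).trans hkk)) hlr s, e2,
      fioKernel_zero, hm]
    simp only [Matrix.cons_val_zero, Matrix.cons_val_one]
    rw [e3]
    push_cast
    ring
  rw [hsum, norm_mul, norm_inv, norm_pow, norm_of_nonneg hkpos.le]
  have hk2 : k ^ (1 / 2 : ℝ) ≤ k := by
    conv_rhs => rw [← rpow_one k]
    exact rpow_le_rpow_of_exponent_le hk (by norm_num)
  refine (mul_le_of_le_one_left (norm_nonneg _) (inv_le_one_of_one_le₀ (one_le_pow₀ hk))).trans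
    ((norm_add_le _ _).trans ?_)
  rw [norm_mul, norm_of_nonneg (by positivity)]
  have h6 := (norm_add_le _ _).trans (add_le_add (hC₂ k hk φ φ₂) hPb)
  calc _ ≤ C₁ * (k ^ R)⁻¹ + k * (C₂ * (k ^ (R + 1))⁻¹ + D * (k ^ (R + 1))⁻¹) :=
        add_le_add (hC₁ k hk φ φ₂) (mul_le_mul hk2 h6 (norm_nonneg _) hkpos.le)
    _ = _ := by
      rw [pow_succ]
      field_simp

/-! ### Words in `N₀` and `N₁` -/

lemma zeroCount_succ {M : ℕ} (σ : Fin (M + 1) → Fin 2) :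
    zeroCount σ = (if σ 0 = 0 then 1 else 0) + zeroCount fun j => σ j.succ :=
  Fin.card_filter_univ_succ' _

lemma orbitEnds_thickens {e e' : ℝ} (h : e < e') : Thickens (orbitEnds q b e) (orbitEnds q b e') :=
  ⟨e' - e, sub_pos.2 h, fun z ⟨p, hp⟩ w hw => ⟨p, by
    linarith [norm_sub_le_norm_sub_add_norm_sub w z (q (pt b p))]⟩⟩

lemma PsiForm.mono {ρ ρ' : ℝ} {V : Set ℂ} {m : ℕ} {X : ℝ → ℝ → ℝ → ℂ} (h : PsiForm q ρ V m X)
    (hρ : ρ ≤ ρ') : PsiForm q ρ' V m X :=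
  let ⟨a, ha, hX⟩ := h
  ⟨a, ⟨ha.ub, ha.periodic, fun k hk φ η hne => (ha.support k hk φ η hne).imp_left hρ.trans'⟩, hX⟩

/-- On a small neighbourhood of the orbit a word in `N₀` and `N₁` is a pseudodifferential operator
or a Fourier integral operator. -/
theorem NoGhost.exists_scale (hN : NoGhost q b) (hΩ : Dom)
    (hb : Bounce) (M : ℕ) : ∀ e', Scale e' → e' ≤ 1 / 8 →
    ∃ e > 0, e ≤ e' ∧ ∀ (χ : ℝ → ℝ) (δ : ℝ) (τ : ℝ → ℝ) (T : ℝ) (lam : ℝ → ℂ),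
      Setting Ω q χ δ τ T lam → ∀ c, PsiSymbol q e (orbitEnds q b e) (fun _ => c) →
      ∀ σ : Fin M → Fin 2, ((∀ j, σ j = 0) ∧ PsiForm q e' (orbitEnds q b e') M fun k =>
          kernelWord q χ δ k (lam k) σ (quantize k c)) ∨
        ∃ n, M = zeroCount σ + (n + 1) ∧ FioForm q lam b e' n (zeroCount σ) fun k =>
          kernelWord q χ δ k (lam k) σ (quantize k c) := by
  induction M with
  | zero =>
    refine fun e' he' _ => ⟨e', he'.pos, le_rfl, fun χ δ τ T lam _ c hc σ =>
      Or.inl ⟨fun j => j.elim0, ?_⟩⟩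
    simp only [kernelWord_nil]
    exact hc.psiForm
  | succ M ih =>
    intro e' he' h8
    have h0 := he'.pos
    obtain ⟨u₁, r, hr, hs⟩ := hΩ.exists_nearScale
    have hr₁ : 0 < min r (ℓ / 16) := lt_min hr (by linarith [orbitLength_pos hΩ hb])
    have hs₁ := hs _ hr₁ (min_le_left _ _)
    obtain ⟨e₁, h01, h1, c₁, hc₁, hadm⟩ :=
      hN.exists_admissible hΩ hb (e' := e' / 4) (by linarith) hr₁ (A := e' / 4) (by linarith)
    have hadm' : Admissible q b e₁ (e' / 2) (min r (ℓ / 16)) c₁ :=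
      fun p φ₀ φ₁ h2 h3 h4 => hadm p φ₀ φ₁ h2 h3 fun hn => h4 (hn.mono (by linarith))
    obtain ⟨e, h02, h2, hword⟩ := ih e₁ (he'.mono h01 (by linarith)) (by linarith)
    refine ⟨e, h02, by linarith, fun χ δ τ T lam H c hc σ => ?_⟩
    have hX : ∀ k, 1 ≤ k → LeftRegular
        (kernelWord q χ δ k (lam k) (fun j => σ j.succ) (quantize k c)) := fun k hk =>
      H.leftRegular_word hk _ (hc.leftRegular hk)
    simp only [kernelWord_succ]
    rw [zeroCount_succ]
    rcases hword χ δ τ T lam H c hc fun j => σ j.succ with ⟨hz, h⟩ | ⟨n, hn, h⟩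
    · have hz' : zeroCount (fun j => σ j.succ) = M := by simp [zeroCount, hz]
      by_cases h3 : σ 0 = 0
      · refine Or.inl ⟨Fin.cases h3 hz, ?_⟩
        rw [h3]
        exact (h.comp_zero H (by linarith) (orbitEnds_thickens (by linarith))).mono (by linarith)
      · refine Or.inr ⟨0, by rw [if_neg h3, hz', zero_add], ?_⟩
        rw [if_neg h3, hz', zero_add, Fin.eq_one_of_ne_zero _ h3]
        exact h.comp_one H hb he' h01 h1 (by linarith) hs₁ (min_le_right _ _) hc₁ hadm
    · by_cases h3 : σ 0 = 0
      · refine Or.inr ⟨n, by rw [if_pos h3]; omega, ?_⟩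
        rw [if_pos h3, h3, add_comm 1]
        exact h.comp_zero H he' h01 (by linarith) hX
      · refine Or.inr ⟨n + 1, by rw [if_neg h3]; omega, ?_⟩
        rw [if_neg h3, zero_add, Fin.eq_one_of_ne_zero _ h3]
        exact h.comp_one H hb he' h01 (by linarith) hs₁ (min_le_right _ _) hc₁ hadm' hX

lemma FioSymbol.isFourierIntegralKernel (H : Stg) {e : ℝ}
    (he : Scale e) {n : ℕ} {A : ℝ → (Fin (n + 2) → ℝ) → ℂ} (hA : FioSymbol q b e n A)
    (m : ℕ) : IsFourierIntegralKernel δ lam (pathLength q n) (billiardRelation Ω q (n + 1))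
      (-(m : ℝ)) (fioKernel q lam n m A) := by
  have hΩ := H.domain
  refine ⟨pathLength_torusPeriodic hΩ n, orbitConfigs q b e (n + 2), A,
    isClosed_orbitConfigs hΩ e _, fun x hx => contDiffAt_pathLength hΩ (he.ne hx),
    fun x hx hc => ⟨he.linearIndependent hΩ hx, he.mem_billiardRelation hΩ hx hc⟩,
    ⟨fun k hk => ⟨hA.ub.smooth ⟨k, hk⟩, hA.periodic k hk⟩, fun j => ?_⟩,
    fun k hk x hx => by_contra fun hne => hx (hA.support k hk x hne), fun k hk φ₁ φ₂ => rfl⟩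
  obtain ⟨C, h0, hC⟩ := hA.ub.bound j
  refine ⟨C, fun k hk x => ?_⟩
  rw [mul_comm C]
  refine mul_le_mul (rpow_le_rpow_of_exponent_le hk ?_) ((hC ⟨k, hk⟩ x).trans_eq (mul_one C))
    (norm_nonneg _) (by positivity)
  have := mul_le_mul_of_nonneg_right H.lt_one.le (j.cast_nonneg (α := ℝ))
  linarith

lemma FioForm.exists_kernel (H : Stg) {e ρ : ℝ} (he : Scale e)
    (hρ : 0 ≤ ρ) {V : Set ℂ} {c : ℝ × ℝ → ℂ} (hc : PsiSymbol q ρ V fun _ => c) {M n m : ℕ}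
    (hn : n + 1 ≤ M) (σ : Fin M → Fin 2)
    (h : FioForm q lam b e n m fun k => 𝒲 k σ (quantize k c)) :
    ∃ F, IsFourierIntegralKernel δ lam (pathLength q n) (billiardRelation Ω q (n + 1))
      (-(m : ℝ)) F ∧ ∀ R : ℕ, ∃ K, IsBigOKernel R K ∧ ∀ k, 1 ≤ k → ∀ φ₁ φ₂,
        𝒲 k σ (quantize k c) φ₁ φ₂ = F k φ₁ φ₂ + K k φ₁ φ₂ := by
  obtain ⟨A, hA, k₀, hX⟩ := h
  refine ⟨_, hA.isFourierIntegralKernel H he m, fun R => ⟨fun k φ₁ φ₂ =>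
    𝒲 k σ (quantize k c) φ₁ φ₂ - fioKernel q lam n m A k φ₁ φ₂, ?_,
    fun k hk φ₁ φ₂ => (add_sub_cancel _ _).symm⟩⟩
  obtain ⟨C, h0, hC⟩ := hX R
  obtain ⟨C₁, h1, hC₁⟩ := H.exists_norm_kernelWord_le M
  obtain ⟨C₂, h2, hC₂⟩ := hc.exists_norm_le hρ
  obtain ⟨C₃, h3, hC₃⟩ := hA.exists_norm_fioKernel_le H m
  refine isBigOKernel_of_large (C := C₁ * C₂ + C₃) (p := M + 1) (fun k hk φ₁ φ₂ => ?_) hC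
  have h4 := hC₁ k hk σ _ (hc.leftRegular hk) φ₂ _ (fun φ => hC₂ k hk φ φ₂) φ₁
  have h5 : k ^ (n + 1) ≤ k ^ (M + 1) := pow_le_pow_right₀ hk (by omega)
  refine (norm_sub_le _ _).trans ((add_le_add h4 ((hC₃ k hk φ₁ φ₂).trans
    (mul_le_mul_of_nonneg_left h5 h3))).trans_eq ?_)
  ring

lemma IsOrbitCutoff.psiSymbol (hΩ : Dom) {ε : ℝ} {c : ℝ × ℝ → ℂ}
    (hc : IsOrbitCutoff b ε c) : PsiSymbol q ε (orbitEnds q b ε) fun _ => c := by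
  have hper : ∀ (n : ℤ) z, c (z + ((n : ℝ) * (2 * π), 0)) = c z := fun n z => by
    have h1 : Periodic (fun φ => c (φ, z.2)) (2 * π) := fun φ => hc.periodic φ z.2
    simpa [Prod.add_def] using h1.int_mul n z.1
  refine ⟨.of_bound (fun _ => zero_le_one) (fun _ => hc.smooth) fun j => ?_,
    fun k _ => hc.periodic, fun k _ φ η hne => ?_⟩
  · have hcont := hc.smooth.continuous_iteratedFDeriv (m := j) (by exact_mod_cast le_top)
    obtain ⟨C, hC⟩ := (isCompact_Icc.prod isCompact_Icc :
      IsCompact (Icc (0 : ℝ) (2 * π) ×ˢ Icc (-ε) ε)).exists_bound_of_continuousOn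
      hcont.continuousOn
    refine ⟨max C 0, fun _ z => ?_⟩
    rw [mul_one]
    by_cases hz : 𝐃 j c z = 0
    · rw [hz, norm_zero]
      exact le_max_right _ _
    have h1 : z ∈ {z : ℝ × ℝ | |z.2| ≤ ε} := closure_minimal
      (fun z hz => (hc.support z hz).1) (isClosed_le (continuous_abs.comp continuous_snd) continuous_const)
      (support_iteratedFDeriv_subset j hz)
    obtain ⟨n, hn⟩ := (existsUnique_add_zsmul_mem_Ico two_pi_pos z.1 0).exists
    have h2 : 𝐃 j c z = 𝐃 j c (z + ((n : ℝ) * (2 * π), 0)) := by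
      rw [← iteratedFDeriv_comp_add_right]
      simp only [hper]
    rw [h2]
    rw [zsmul_eq_mul, zero_add] at hn
    exact (hC _ ⟨Ico_subset_Icc_self hn, by simpa [← abs_le] using h1⟩).trans (le_max_left _ _)
  · obtain ⟨h1, n, h2⟩ := hc.support _ hne
    have h3 : ∀ x, |φ - x - 2 * π * n| ≤ ε → ‖q φ - q x‖ ≤ ε := fun x hx => by
      have h4 := hΩ.norm_chord_le (φ - n * (2 * π)) (φ - x - 2 * π * n)
      rw [hΩ.periodic.sub_int_mul_eq n, show φ - n * (2 * π) - (φ - x - 2 * π * n) = x by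
        ring] at h4
      exact h4.trans hx
    rcases h2 with h2 | h2
    · exact ⟨h1, 0, h3 0 (by simpa using h2)⟩
    · exact ⟨h1, 1, h3 b h2⟩

end Billiard

end

theorem mainTheorem3 (Ω : Set ℂ) (q : ℝ → ℂ) (hΩ : Billiard.IsSmoothDomain Ω q)
    (b : ℝ) (hb : Billiard.IsBouncingBall Ω q b) (M : ℕ) :
    ∃ ε₀ : ℝ, 0 < ε₀ ∧
      ∀ (c : ℝ × ℝ → ℂ), Billiard.IsOrbitCutoff b ε₀ c →
      ∀ (χ : ℝ → ℝ), Billiard.IsBump χ →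
      ∀ (δ : ℝ), 1 / 2 < δ → δ < 1 →
      ∀ (τ : ℝ → ℝ) (T : ℝ), (∀ k, 1 ≤ k → 0 ≤ τ k ∧ τ k ≤ T * (1 + Real.log k)) →
      ∀ (lam : ℝ → ℂ), (∀ k, lam k = (k : ℂ) + Complex.I * (τ k : ℂ)) →
      -- (A)
      (Billiard.NoGhost q b →
        ∀ σ : Fin M → Fin 2, σ ≠ (fun _ => 0) →
          ∃ (n : ℕ) (F : ℝ → ℝ → ℝ → ℂ), M = Billiard.zeroCount σ + (n + 1) ∧
            Billiard.IsFourierIntegralKernel δ lam (Billiard.pathLength q n)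
              (Billiard.billiardRelation Ω q (n + 1)) (-(Billiard.zeroCount σ : ℝ)) F ∧
            ∀ R : ℕ, ∃ K : ℝ → ℝ → ℝ → ℂ, Billiard.IsBigOKernel R K ∧
              ∀ k, 1 ≤ k → ∀ φ₁ φ₂,
                Billiard.kernelWord q χ δ k (lam k) σ (Billiard.quantize k c) φ₁ φ₂ =
                  F k φ₁ φ₂ + K k φ₁ φ₂) ∧
      -- (B)
      (∃ P : ℝ → ℝ → ℝ → ℂ, Billiard.IsPseudodifferential (-(M : ℝ)) P ∧
        Billiard.KernelEquiv
          (fun k => Billiard.kernelWord q χ δ k (lam k) (fun _ : Fin M => 0)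
            (Billiard.quantize k c))
          (fun k => Billiard.compKernel (P k) (Billiard.quantize k c))) ∧
      (∃ P : ℝ → ℝ → ℝ → ℂ, Billiard.IsPseudodifferential (-(M : ℝ)) P ∧
        Billiard.KernelEquiv
          (fun k => Billiard.kernelWord q χ δ k (lam k) (fun _ : Fin M => 0)
            (Billiard.quantize k c)) P) := by
  obtain ⟨e, h0, h8, he⟩ : ∃ e > 0, e ≤ 1 / 8 ∧ (Billiard.NoGhost q b →
      ∃ e', Billiard.OrbitScale Ω q b e' ∧ ∀ (χ : ℝ → ℝ) (δ : ℝ) (τ : ℝ → ℝ) (T : ℝ) (lam : ℝ → ℂ),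
        Billiard.Setting Ω q χ δ τ T lam →
        ∀ c, Billiard.PsiSymbol q e (Billiard.orbitEnds q b e) (fun _ => c) →
        ∀ σ : Fin M → Fin 2, ((∀ j, σ j = 0) ∧
          Billiard.PsiForm q e' (Billiard.orbitEnds q b e') M fun k =>
            Billiard.kernelWord q χ δ k (lam k) σ (Billiard.quantize k c)) ∨
          ∃ n, M = Billiard.zeroCount σ + (n + 1) ∧
            Billiard.FioForm q lam b e' n (Billiard.zeroCount σ) fun k =>
              Billiard.kernelWord q χ δ k (lam k) σ (Billiard.quantize k c)) := by
    by_cases hN : Billiard.NoGhost q b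
    · obtain ⟨e', h8, he'⟩ := Billiard.exists_orbitScale hΩ hb (A := 1 / 8) (by norm_num)
      obtain ⟨e, h0, h1, he⟩ := hN.exists_scale hΩ hb M e' he' h8
      exact ⟨e, h0, h1.trans h8, fun _ => ⟨e', he', he⟩⟩
    · exact ⟨1 / 8, by norm_num, le_rfl, fun h => absurd h hN⟩
  refine ⟨e, h0, fun c hc χ hχ δ hδ hδ1 τ T hτ lam hlam => ?_⟩
  have H : Billiard.Setting Ω q χ δ τ T lam := ⟨hΩ, hχ, hδ, hδ1, hτ, hlam⟩
  have hP := hc.psiSymbol hΩ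
  refine ⟨fun hN σ hσ => ?_, H.powers_of_zero h0.le h8 hP M⟩
  obtain ⟨e', he', hword⟩ := he hN
  obtain ⟨hz, -⟩ | ⟨n, hn, h⟩ := hword χ δ τ T lam H c hP σ
  · exact absurd (funext hz) hσ
  · obtain ⟨F, hF, hK⟩ := h.exists_kernel H he' h0.le hP (by omega) σ
    exact ⟨n, F, hn, hF, hK⟩
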